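/- Let $r_0,R>0$ and $0<\alpha_s<2^{-8}(r_0/R)^4$. Put $W_{\rm rel}(\eta)=\eta^2$ if $\eta\ge-2\alpha_s^{1/2}$ and $W_{\rm rel}(\eta)=-4\alpha_s^{1/2}(\alpha_s^{1/2}+\eta)$ otherwise. Let $\mathcal V$ be the set of $\bar v\in W^{1,1}_{\rm loc}(0,r_0)$ with $\bar v(0)=0$ (that is, $\bar v(r)\to0$ as $r\to0^+$) and $\mathcal W=W^{2,1}_{\rm loc}(0,r_0)$; all functions are identified with their continuous representatives. For $\bar v\in\mathcal V$, $\bar w\in\mathcal W$, $h>0$ and measurable $B$ define, with values in $[0,\infty]$, $$F_0(\bar v)=\int_0^{r_0}\Big[\Big(\bar v'+\frac{r^2}{2R^2}\Big)^2+W_{\rm rel}(\bar v/r)\Big]r\,dr,$$ $$F_h^B(\bar v,\bar w)=\int_0^{r_0}\Big[\Big(\bar v'+\tfrac12\big(\tfrac rR-\bar w'\big)^2+B\Big)^2+\alpha_sh^{-2}\bar w^2+h^2\Big(\bar w''-\tfrac1R\Big)^2+W_{\rm rel}(\bar v/r)\Big]r\,dr,$$ and $F_h=F_h^0$. Let $r_w=(16\alpha_s^{1/2}r_0R^2)^{1/3}$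 and $$\bar v_0(r)=\begin{cases}-\frac{3}{16}\frac{r^3}{R^2}+\Big(2\alpha_s^{1/2}\big(\tfrac{r_0}{r_w}-1\big)+\frac1{16}\frac{r_w^2}{R^2}\Big)r,&0<r\le r_w,\\-2\alpha_s^{1/2}r-\frac16\frac{r^3-r_w^3}{R^2}+2\alpha_s^{1/2}r_0\log\frac r{r_w},&r_w<r<r_0.\end{cases}$$ Then $\bar v_0$ is the unique minimizer of $F_0$ on $\mathcal V$, and $F_0(\bar v_0)<\infty$. Moreover there are constants $C>0$ and $\bar h>0$, depending only on $\alpha_s,r_0,R$, such that the following holds for every $h>0$. The functional $F_h$ has a unique minimizer $(\bar v_h,\bar w_h)$ on $\mathcal V\times\mathcal W$, its minimum is finite, and with $\sigma_h:=\bar v_h'+\frac12(\frac rR-\bar w_h')^2$: 1. $|F_0(\bar v_0)-F_h(\bar v_h,\bar w_h)|\le Ch^2$. 2. $\int_0^{r_0}\bar w_h^2\,r\,dr\le Ch^4$, $\int_0^{r_0}(\bar w_h')^2\,r\,dr\le Ch^2$ and $\int_0^{r_0}|\bar v_h-\bar v_0|^2\,r\,dr\le Ch^2$. 3. If $h<\bar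 h$, then $\sigma_h(r)=2\alpha_s^{1/2}(r_0/r-1)$ for all $r\in((2r_w+r_0)/3,\,r_0)$. 4. For every nonnegative $B\in L^1(0,r_0)$ and every $(\bar v,\bar w)\in\mathcal V\times\mathcal W$ such that $F_h^B(\bar v,\bar w)<\infty$ and $e:=F_h^B(\bar v,\bar w)-F_h(\bar v_h,\bar w_h)\le1$, the integrand below is integrable and $$\int_0^{r_0}\big(2\sigma_hB+(\bar v-\bar v_h)_+^2\big)\,r\,dr\le Ce,$$ where $x_+=\max(x,0)$. -/

import Mathlib

open Set Filter Topology MeasureTheory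
open scoped ENNReal

namespace WrinkledSheet

/-- The relaxed energy density of a circle with azimuthal strain `η`. -/
noncomputable def Wrel (αs η : ℝ) : ℝ :=
  if -2 * √αs ≤ η then η ^ 2 else -4 * √αs * (√αs + η)

/-- `f` belongs to `W^{1,1}_loc(0, r₀)` (precise representative): it is absolutely continuous on
every compact subinterval of `(0, r₀)`. Its weak derivative is then `deriv f`, almost everywhere. -/
def LocallyAC (r₀ : ℝ) (f : ℝ → ℝ) : Prop :=
  ∀ a b : ℝ, 0 < a → a ≤ b → b < r₀ → AbsolutelyContinuousOnInterval f a b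

/-- Admissible radial displacements: one weak derivative on `(0, r₀)` and `v(0) = 0`. -/
structure AdmissibleV (r₀ : ℝ) (v : ℝ → ℝ) : Prop where
  locallyAC : LocallyAC r₀ v
  zero_at_zero : Tendsto v (𝓝[>] 0) (𝓝 0)

/-- Admissible normal displacements: two weak derivatives on `(0, r₀)`, no boundary condition. -/
structure AdmissibleW (r₀ : ℝ) (w : ℝ → ℝ) : Prop where
  differentiableOn : DifferentiableOn ℝ w (Ioo 0 r₀)
  locallyAC_deriv : LocallyAC r₀ (deriv w)

/-- The effective functional
`F₀(v) = ∫₀^{r₀} [(v' + r²/(2R²))² + W_rel(v/r)] r dr`, with values in `[0, ∞]`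
(the integrand is nonnegative). -/
noncomputable def F₀ (αs r₀ R : ℝ) (v : ℝ → ℝ) : ℝ≥0∞ :=
  ∫⁻ r in Ioo 0 r₀, ENNReal.ofReal
    (((deriv v r + r ^ 2 / (2 * R ^ 2)) ^ 2 + Wrel αs (v r / r)) * r)

/-- The functional
`∫₀^{r₀} [(v' + (r/R - w')²/2 + B)² + αs h⁻² w² + h² (w'' - 1/R)² + W_rel(v/r)] r dr`,
with values in `[0, ∞]` (the integrand is nonnegative). -/
noncomputable def FB (αs r₀ R h : ℝ) (B v w : ℝ → ℝ) : ℝ≥0∞ :=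
  ∫⁻ r in Ioo 0 r₀, ENNReal.ofReal
    (((deriv v r + (1 / 2) * (r / R - deriv w r) ^ 2 + B r) ^ 2
      + αs * (h ^ 2)⁻¹ * w r ^ 2
      + h ^ 2 * (deriv (deriv w) r - 1 / R) ^ 2
      + Wrel αs (v r / r)) * r)

/-- The functional `F_h`, i.e. the previous one with `B = 0`. -/
noncomputable def F (αs r₀ R h : ℝ) (v w : ℝ → ℝ) : ℝ≥0∞ :=
  FB αs r₀ R h (fun _ => 0) v w

/-- `v` minimizes `F₀` among the admissible functions. -/
structure IsMinimizerF₀ (αs r₀ R : ℝ) (v : ℝ → ℝ) : Prop where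
  admissible : AdmissibleV r₀ v
  le : ∀ v', AdmissibleV r₀ v' → F₀ αs r₀ R v ≤ F₀ αs r₀ R v'

/-- `(v, w)` minimizes `F_h` among the admissible pairs. -/
structure IsMinimizerF (αs r₀ R h : ℝ) (v w : ℝ → ℝ) : Prop where
  admissibleV : AdmissibleV r₀ v
  admissibleW : AdmissibleW r₀ w
  le : ∀ v' w', AdmissibleV r₀ v' → AdmissibleW r₀ w' → F αs r₀ R h v w ≤ F αs r₀ R h v' w'

/-- The inner radius `r_w = (16 αs^{1/2} r₀ R²)^{1/3}` of the wrinkled region. -/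
noncomputable def rw (αs r₀ R : ℝ) : ℝ := (16 * √αs * r₀ * R ^ 2) ^ (1 / 3 : ℝ)

/-- The explicit minimizer of `F₀`. -/
noncomputable def v₀ (αs r₀ R r : ℝ) : ℝ :=
  if r ≤ rw αs r₀ R then
    -3 / 16 * (r ^ 3 / R ^ 2)
      + (2 * √αs * (r₀ / rw αs r₀ R - 1) + 1 / 16 * (rw αs r₀ R ^ 2 / R ^ 2)) * r
  else
    -2 * √αs * r - 1 / 6 * ((r ^ 3 - rw αs r₀ R ^ 3) / R ^ 2)
      + 2 * √αs * r₀ * Real.log (r / rw αs r₀ R)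

/-- The radial stress `σ = v' + (r/R - w')²/2`. -/
noncomputable def stress (R : ℝ) (v w : ℝ → ℝ) (r : ℝ) : ℝ :=
  deriv v r + (1 / 2) * (r / R - deriv w r) ^ 2

end WrinkledSheet

/-!
For a fixed normal displacement `w` the energy is convex in the radial displacement `v`. Its
minimizers satisfy an equilibrium system (`IsEquilibrium`) for `v` and the weighted stress
`s = r σ`, namely `v' = s / r - g` with the strain `g = (r / R - w')² / 2` and
`s' = max (v / r) (-2 √αs)`. The maximum principle gives `0 ≤ s`: the sheet is everywhere under
radial tension. This sign makes the whole problem, which is not convex in `w`, behave like a convex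
one. The energy of a competitor `(v₁, w₁)` with excess strain `B` exceeds that of an equilibrium
`(v, w)` by exactly
`2 ∫ s B + ∫ s (w₁ - w)'² + 2 firstVar (w₁ - w)` plus the squares of the differences in stress, `w`
and `w''`, plus the convexity gap of `Wrel` (`IsEquilibrium.energy_identity`).

Existence and uniqueness. Equilibria exist for each `w` by the direct method
(`exists_isEquilibrium`). The identity at the equilibrium over the midpoint of `w₁` and `w₂` bounds
`w₁ - w₂` in norm by energy differences, so that minimizing sequences converge
(`exists_reduced_minimizer`). At the limit the first variation vanishes (`exists_isCritical`), and
then the identity shows that it is the unique minimizer. The explicit function `v₀` is the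
equilibrium for `w = 0`, hence the minimizer of the effective functional (`isMinimizerF₀_v₀`).

Convergence rates. Apply the identity at `(v₀, 0)` to the minimizer `(v, w)` of the full energy.
There the first variation is `-∫ (s₀ r w' + h² r w'') / R`. After an integration by parts in the
first term it is absorbed, up to `C h²`, by the quadratic terms `αs h⁻² ∫ w² r` and `h² ∫ w''² r`
(`IsEquilibrium.exists_firstVar_ge`). This bounds the energy difference, `w`, `w''` and the stress
difference (`exists_comparison`), and interpolation bounds `w'`. The displacement `v` is compared
with `v₀` by integrating `v' - v₀'` from a point below `rw`, where the convexity gap controls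
`v - v₀`. This gives a pointwise rate (`exists_displacement_bound`). Beyond `rw` the strain `v₀ / r`
is strictly below the threshold, hence so is `v / r` for small `h`, and `s' = -2 √αs` with `s → 0`
at `r₀` yields the stress formula.

Stability. The identity at the minimizer, where the first variation vanishes, bounds `2 ∫ s B` and
all quadratic terms by the energy gap `e`. To bound `(v₁ - v)₊`, integrate
`(v₁ - v)' ≤ ρ + (w₁ - w)' (r / R - w')`, where `ρ` is the stress difference including `B`; the
dropped terms `-B` and `-(w₁ - w)'² / 2` have a sign. The starting point comes from `exists_start`:
if `v / r` were below the threshold on most of an interval reaching far towards the origin, then `s`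
would become negative. Constants independent of `h` need a separate argument for large `h`, where
the bending term flattens the sheet and wrinkling disappears away from the origin
(`exists_unwrinkled`).
-/

namespace WrinkledSheet

/-! ### Locally absolutely continuous functions -/

section LocallyAC

variable {r₀ : ℝ} {f g : ℝ → ℝ}

lemma LocallyAC.add (hf : LocallyAC r₀ f) (hg : LocallyAC r₀ g) :
    LocallyAC r₀ (fun r => f r + g r) :=
  fun a b ha hab hb => (hf a b ha hab hb).fun_add (hg a b ha hab hb)

lemma LocallyAC.sub (hf : LocallyAC r₀ f) (hg : LocallyAC r₀ g) :
    LocallyAC r₀ (fun r => f r - g r) :=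
  fun a b ha hab hb => (hf a b ha hab hb).fun_sub (hg a b ha hab hb)

lemma LocallyAC.mul (hf : LocallyAC r₀ f) (hg : LocallyAC r₀ g) :
    LocallyAC r₀ (fun r => f r * g r) :=
  fun a b ha hab hb => (hf a b ha hab hb).fun_mul (hg a b ha hab hb)

lemma LocallyAC.const_mul (c : ℝ) (hf : LocallyAC r₀ f) :
    LocallyAC r₀ (fun r => c * f r) :=
  fun a b ha hab hb => (hf a b ha hab hb).const_mul c

lemma LocallyAC.continuousOn (hf : LocallyAC r₀ f) : ContinuousOn f (Ioo 0 r₀) := by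
  intro x hx
  have h := (hf (x / 2) ((x + r₀) / 2) (by linarith [hx.1]) (by linarith [hx.1, hx.2])
    (by linarith [hx.2])).continuousOn
  rw [uIcc_of_le (by linarith [hx.1, hx.2])] at h
  exact (h.continuousAt (Icc_mem_nhds (by linarith [hx.1]) (by linarith [hx.2]))).continuousWithinAt

lemma ae_Ioo_of_forall_Icc {P : ℝ → Prop}
    (h : ∀ a b, 0 < a → a ≤ b → b < r₀ → ∀ᵐ x : ℝ, x ∈ Icc a b → P x) :
    ∀ᵐ x ∂(volume.restrict (Ioo 0 r₀)), P x := by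
  rw [ae_restrict_iff' measurableSet_Ioo]
  have h' : ∀ n : ℕ, ∀ᵐ x : ℝ, x ∈ Icc (1 / ((n : ℝ) + 1)) (r₀ - 1 / ((n : ℝ) + 1)) → P x := by
    intro n
    have hn : 0 < 1 / ((n : ℝ) + 1) := by positivity
    by_cases hc : 1 / ((n : ℝ) + 1) ≤ r₀ - 1 / ((n : ℝ) + 1)
    · exact h _ _ hn hc (by linarith)
    · rw [Icc_eq_empty hc]; simp
  filter_upwards [ae_all_iff.2 h'] with x hx hxI
  obtain ⟨n, hn⟩ := exists_nat_one_div_lt (lt_min hxI.1 (sub_pos.2 hxI.2))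
  refine hx n ⟨(hn.trans_le (min_le_left _ _)).le, ?_⟩
  have := hn.trans_le (min_le_right _ _)
  linarith

lemma LocallyAC.ae_differentiableAt (hf : LocallyAC r₀ f) :
    ∀ᵐ r ∂(volume.restrict (Ioo 0 r₀)), DifferentiableAt ℝ f r := by
  refine ae_Ioo_of_forall_Icc fun a b ha hab hb => ?_
  have := (hf a b ha hab hb).ae_differentiableAt
  rwa [uIcc_of_le hab] at this

lemma uIcc_subset_Ioo' {a b : ℝ} (ha : a ∈ Ioo 0 r₀) (hb : b ∈ Ioo 0 r₀) :
    uIcc a b ⊆ Ioo 0 r₀ := fun _ hx =>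
  ⟨lt_of_lt_of_le (lt_min ha.1 hb.1) hx.1, lt_of_le_of_lt hx.2 (max_lt ha.2 hb.2)⟩

lemma LocallyAC.ac (hf : LocallyAC r₀ f) {a b : ℝ} (ha : a ∈ Ioo 0 r₀) (hb : b ∈ Ioo 0 r₀) :
    AbsolutelyContinuousOnInterval f a b := by
  rcases le_total a b with h | h
  · exact hf a b ha.1 h hb.2
  · exact (hf b a hb.1 h ha.2).symm

lemma LocallyAC.intervalIntegrable_deriv (hf : LocallyAC r₀ f) {a b : ℝ} (ha : a ∈ Ioo 0 r₀)
    (hb : b ∈ Ioo 0 r₀) : IntervalIntegrable (deriv f) volume a b :=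
  (hf.ac ha hb).intervalIntegrable_deriv

lemma LocallyAC.integral_deriv (hf : LocallyAC r₀ f) {a b : ℝ} (ha : a ∈ Ioo 0 r₀)
    (hb : b ∈ Ioo 0 r₀) : ∫ r in a..b, deriv f r = f b - f a :=
  (hf.ac ha hb).integral_deriv_eq_sub

lemma locallyAC_of_hasDerivAt {f' : ℝ → ℝ} (hf : ∀ r ∈ Ioo 0 r₀, HasDerivAt f (f' r) r)
    (hf' : ContinuousOn f' (Ioo 0 r₀)) : LocallyAC r₀ f := by
  intro a b ha hab hb
  have hsub : Icc a b ⊆ Ioo 0 r₀ := fun x hx => ⟨ha.trans_le hx.1, hx.2.trans_lt hb⟩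
  obtain ⟨C, hC⟩ := isCompact_Icc.exists_bound_of_continuousOn (hf'.mono hsub)
  have hC0 : 0 ≤ C := (norm_nonneg _).trans (hC a ⟨le_rfl, hab⟩)
  have : LipschitzOnWith ⟨C, hC0⟩ f (Icc a b) :=
    (convex_Icc a b).lipschitzOnWith_of_nnnorm_hasDerivWithin_le
      (fun x hx => (hf x (hsub hx)).hasDerivWithinAt) (fun x hx => hC x hx)
  rw [← uIcc_of_le hab] at this
  exact this.absolutelyContinuousOnInterval

lemma intervalIntegrable_of_integrableOn_Ioo (hf : IntegrableOn f (Ioo 0 r₀)) {a b : ℝ}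
    (ha : a ∈ Icc 0 r₀) (hb : b ∈ Icc 0 r₀) : IntervalIntegrable f volume a b := by
  have h : IntegrableOn f (Icc 0 r₀) := (integrableOn_Icc_iff_integrableOn_Ioo).2 hf
  refine IntegrableOn.intervalIntegrable (h.mono_set ?_)
  exact fun x hx => ⟨(le_min ha.1 hb.1).trans hx.1, hx.2.trans (max_le ha.2 hb.2)⟩

/-- Primitives of functions that are integrable on compact subintervals of `(0, r₀)`. -/
lemma locallyAC_primitive {p c : ℝ} (hp : p ∈ Ioo 0 r₀)
    (hf : ∀ a b, 0 < a → a ≤ b → b < r₀ → IntervalIntegrable f volume a b) :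
    LocallyAC r₀ (fun r => c + ∫ t in p..r, f t) := by
  intro a b ha hab hb
  have h := hf (min a p) (max b p) (lt_min ha hp.1)
    ((min_le_left _ _).trans (hab.trans (le_max_left _ _))) (max_lt hb hp.2)
  have hle : min a p ≤ max b p := (min_le_left _ _).trans (hab.trans (le_max_left _ _))
  have h1 := h.absolutelyContinuousOnInterval_intervalIntegral (c := p)
    (by rw [uIcc_of_le hle]; exact ⟨min_le_right _ _, le_max_right _ _⟩)
  have h2 : AbsolutelyContinuousOnInterval (fun _ : ℝ => c) a b :=
    ((LipschitzWith.const c).lipschitzOnWith (s := uIcc a b)).absolutelyContinuousOnInterval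
  refine h2.fun_add (h1.mono ?_)
  rw [uIcc_of_le hab, uIcc_of_le hle]
  exact Icc_subset_Icc (min_le_left _ _) (le_max_left _ _)

lemma ae_deriv_primitive {p c : ℝ} (hp : p ∈ Ioo 0 r₀)
    (hf : ∀ a b, 0 < a → a ≤ b → b < r₀ → IntervalIntegrable f volume a b) :
    ∀ᵐ r ∂(volume.restrict (Ioo 0 r₀)), HasDerivAt (fun r => c + ∫ t in p..r, f t) (f r) r := by
  refine ae_Ioo_of_forall_Icc fun a b ha hab hb => ?_
  have hle : min a p ≤ max b p := (min_le_left _ _).trans (hab.trans (le_max_left _ _))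
  have h := hf (min a p) (max b p) (lt_min ha hp.1) hle (max_lt hb hp.2)
  have := h.ae_hasDerivAt_integral
  filter_upwards [this] with x hx hxI
  refine (hx ?_ p ?_).const_add c
  · rw [uIcc_of_le hle]; exact ⟨(min_le_left _ _).trans hxI.1, hxI.2.trans (le_max_left _ _)⟩
  · rw [uIcc_of_le hle]; exact ⟨min_le_right _ _, le_max_right _ _⟩

lemma LocallyAC.of_eqOn (hf : LocallyAC r₀ f) (h : EqOn f g (Ioo 0 r₀)) : LocallyAC r₀ g := by
  intro a b ha hab hb
  have hf' := hf a b ha hab hb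
  rw [absolutelyContinuousOnInterval_iff] at hf' ⊢
  intro ε hε
  obtain ⟨δ, hδ, H⟩ := hf' ε hε
  refine ⟨δ, hδ, fun E hE hE' => ?_⟩
  convert H E hE hE' using 1
  refine Finset.sum_congr rfl fun i hi => ?_
  have hsub : uIcc a b ⊆ Ioo 0 r₀ := by
    rw [uIcc_of_le hab]; exact fun x hx => ⟨ha.trans_le hx.1, hx.2.trans_lt hb⟩
  rw [h (hsub (hE.1 i hi).1), h (hsub (hE.1 i hi).2)]

/-- The fundamental theorem of calculus up to the ends of `(0, r₀)`. -/
lemma LocallyAC.setIntegral_deriv (hr₀ : 0 < r₀) {A B : ℝ} (hf : LocallyAC r₀ f)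
    (hint : IntegrableOn (deriv f) (Ioo 0 r₀)) (h0 : Tendsto f (𝓝[>] 0) (𝓝 A))
    (h1 : Tendsto f (𝓝[<] r₀) (𝓝 B)) : ∫ r in Ioo 0 r₀, deriv f r = B - A := by
  obtain ⟨a, -, ha, hat⟩ := exists_seq_strictAnti_tendsto' hr₀
  obtain ⟨b, -, hb, hbt⟩ := exists_seq_strictMono_tendsto' hr₀
  have hcov : AECover (volume.restrict (Ioo 0 r₀)) atTop fun i => Ioc (a i) (b i) :=
    aecover_Ioo_of_Ioc hat hbt
  have key := hcov.integral_tendsto_of_countably_generated hint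
  have h2 : Tendsto (fun i => f (b i) - f (a i)) atTop (𝓝 (B - A)) := by
    refine (h1.comp ?_).sub (h0.comp ?_)
    · exact tendsto_nhdsWithin_iff.2 ⟨hbt, Eventually.of_forall fun i => (hb i).2⟩
    · exact tendsto_nhdsWithin_iff.2 ⟨hat, Eventually.of_forall fun i => (ha i).1⟩
  refine tendsto_nhds_unique key (h2.congr' ?_)
  have hev : ∀ᶠ i in atTop, a i ≤ b i := by
    have e1 := hat.eventually (gt_mem_nhds (show (0:ℝ) < r₀ / 2 by linarith))
    have e2 := hbt.eventually (lt_mem_nhds (show r₀ / 2 < r₀ by linarith))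
    filter_upwards [e1, e2] with i h1 h2
    exact (h1.trans h2).le
  filter_upwards [hev] with i hi
  rw [← hf.integral_deriv (ha i) (hb i), intervalIntegral.integral_of_le hi,
    Measure.restrict_restrict measurableSet_Ioc,
    inter_eq_left.2 (show Ioc (a i) (b i) ⊆ Ioo 0 r₀ from
      fun x hx => ⟨(ha i).1.trans hx.1, hx.2.trans_lt (hb i).2⟩)]

/-- A locally absolutely continuous function whose derivative is integrable up to the right end
is bounded near the right end. -/
lemma LocallyAC.exists_bound_right {p : ℝ} (hp : p ∈ Ioo 0 r₀) (hf : LocallyAC r₀ f)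
    (hint : IntegrableOn (deriv f) (Ioo p r₀)) : ∃ M, ∀ r ∈ Ico p r₀, |f r| ≤ M := by
  refine ⟨|f p| + ∫ t in Ioo p r₀, |deriv f t|, fun r hr => ?_⟩
  have h1 := hf.integral_deriv hp ⟨hp.1.trans_le hr.1, hr.2⟩
  have h2 : |∫ t in p..r, deriv f t| ≤ ∫ t in Ioo p r₀, |deriv f t| := by
    refine (intervalIntegral.abs_integral_le_integral_abs hr.1).trans ?_
    rw [intervalIntegral.integral_of_le hr.1]
    refine setIntegral_mono_set hint.abs (Eventually.of_forall fun x => abs_nonneg _) ?_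
    exact (show Ioc p r ⊆ Ioo p r₀ from fun x hx => ⟨hx.1, hx.2.trans_lt hr.2⟩).eventuallyLE
  have h3 : f r = f p + ∫ t in p..r, deriv f t := by rw [h1]; ring
  rw [h3]
  exact (abs_add_le _ _).trans (by linarith)

/-- If the almost everywhere derivative agrees with a continuous function, then the function is
continuously differentiable. -/
lemma LocallyAC.hasDerivAt_of_ae_eq (hf : LocallyAC r₀ f) (hg : ContinuousOn g (Ioo 0 r₀))
    (h : ∀ᵐ r ∂(volume.restrict (Ioo 0 r₀)), deriv f r = g r) :
    ∀ r ∈ Ioo 0 r₀, HasDerivAt f (g r) r := by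
  intro r hr
  have hae : ∀ x ∈ Ioo 0 r₀, f x = f r + ∫ t in r..x, g t := by
    intro x hx
    rw [← intervalIntegral.integral_congr_ae (f := deriv f), hf.integral_deriv hr hx]
    · ring
    rw [ae_restrict_iff' measurableSet_Ioo] at h
    filter_upwards [h] with t ht htx
    exact ht (uIcc_subset_Ioo' hr hx (uIoc_subset_uIcc htx))
  have hnhds : Ioo 0 r₀ ∈ 𝓝 r := Ioo_mem_nhds hr.1 hr.2
  have hd : HasDerivAt (fun x => f r + ∫ t in r..x, g t) (g r) r := by
    refine HasDerivAt.const_add _ ?_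
    refine intervalIntegral.integral_hasDerivAt_right (by simp) ?_ (hg.continuousAt hnhds)
    exact hg.stronglyMeasurableAtFilter isOpen_Ioo r hr
  exact hd.congr_of_eventuallyEq (eventually_of_mem hnhds hae)

end LocallyAC

/-! ### Integration tools on `(0, r₀)` with weight `r` -/

lemma integrable_mul_of_sq {α : Type*} [MeasurableSpace α] {μ : Measure α} {f g : α → ℝ}
    (hf : AEStronglyMeasurable f μ) (hg : AEStronglyMeasurable g μ)
    (hf2 : Integrable (fun x => f x ^ 2) μ) (hg2 : Integrable (fun x => g x ^ 2) μ) :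
    Integrable (fun x => f x * g x) μ :=
  ((memLp_two_iff_integrable_sq hf).2 hf2).integrable_mul
    ((memLp_two_iff_integrable_sq hg).2 hg2)

lemma sq_integral_mul_le {α : Type*} [MeasurableSpace α] {μ : Measure α} {f g : α → ℝ}
    (hf : AEStronglyMeasurable f μ) (hg : AEStronglyMeasurable g μ)
    (hf2 : Integrable (fun x => f x ^ 2) μ) (hg2 : Integrable (fun x => g x ^ 2) μ) :
    (∫ x, f x * g x ∂μ) ^ 2 ≤ (∫ x, f x ^ 2 ∂μ) * ∫ x, g x ^ 2 ∂μ := by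
  have hfg := integrable_mul_of_sq hf hg hf2 hg2
  have h : ∀ t : ℝ, 0 ≤ (∫ x, f x ^ 2 ∂μ) * (t * t) + (2 * ∫ x, f x * g x ∂μ) * t
      + ∫ x, g x ^ 2 ∂μ := by
    intro t
    have e : (∫ x, f x ^ 2 ∂μ) * (t * t) + (2 * ∫ x, f x * g x ∂μ) * t + ∫ x, g x ^ 2 ∂μ
        = ∫ x, (f x * t + g x) ^ 2 ∂μ := by
      have : ∀ x, (f x * t + g x) ^ 2 = f x ^ 2 * (t * t) + (f x * g x) * (2 * t) + g x ^ 2 :=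
        fun x => by ring
      simp_rw [this]
      have i1 := hf2.mul_const (t * t)
      have i2 := hfg.mul_const (2 * t)
      have i3 : Integrable (fun x => f x ^ 2 * (t * t) + f x * g x * (2 * t)) μ := i1.add i2
      rw [integral_add i3 hg2, integral_add i1 i2, integral_mul_const, integral_mul_const]
      ring
    rw [e]
    exact integral_nonneg fun x => sq_nonneg _
  have := discrim_le_zero h
  unfold discrim at this
  nlinarith

section

variable {r₀ : ℝ} {f g : ℝ → ℝ}

lemma integrableOn_of_abs_le {s : Set ℝ} (hs : MeasurableSet s)
    (hm : AEStronglyMeasurable f (volume.restrict s))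
    (hg : IntegrableOn g s) (h : ∀ r ∈ s, |f r| ≤ g r) : IntegrableOn f s :=
  Integrable.mono' hg hm ((ae_restrict_iff' hs).2 (Eventually.of_forall h))

lemma integrableOn_inv_sqrt (r₀ : ℝ) : IntegrableOn (fun r : ℝ => 1 / √r) (Ioo 0 r₀) := by
  rcases le_or_gt r₀ 0 with h | h
  · rw [Ioo_eq_empty (by linarith)]; simp
  have := (intervalIntegral.integrableOn_Ioo_rpow_iff (s := -(1/2)) h).2 (by norm_num)
  refine this.congr_fun (fun x hx => ?_) measurableSet_Ioo
  simp only [Real.sqrt_eq_rpow, Real.rpow_neg hx.1.le, one_div]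

lemma aesm_of_continuousOn (hf : ContinuousOn f (Ioo 0 r₀)) :
    AEStronglyMeasurable f (volume.restrict (Ioo 0 r₀)) :=
  hf.aestronglyMeasurable measurableSet_Ioo

lemma integral_inv_mul_sqrt_le {p q : ℝ} (hp : 0 < p) (hpq : p ≤ q) :
    IntervalIntegrable (fun t => 1 / (t * √t)) volume p q ∧
      ∫ t in p..q, 1 / (t * √t) ≤ 2 / √p := by
  have hpos : ∀ t ∈ uIcc p q, 0 < t := fun t ht => by
    rw [uIcc_of_le hpq] at ht; exact hp.trans_le ht.1
  have hc : ContinuousOn (fun t => 1 / (t * √t)) (uIcc p q) := by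
    refine ContinuousOn.div continuousOn_const (by fun_prop) fun t ht => ?_
    have := hpos t ht
    have := Real.sqrt_pos.2 this
    positivity
  refine ⟨hc.intervalIntegrable, ?_⟩
  rw [intervalIntegral.integral_eq_sub_of_hasDerivAt (f := fun t => -2 / √t) ?_
    hc.intervalIntegrable]
  · have : 0 ≤ 2 / √q := by positivity
    have e : -2 / √q - -2 / √p = 2 / √p - 2 / √q := by ring
    rw [e]; linarith
  · intro t ht
    have h0 := hpos t ht
    have hs := Real.sqrt_pos.2 h0
    have h1 := (Real.hasDerivAt_sqrt h0.ne')
    refine ((hasDerivAt_const t (-2 : ℝ)).div h1 hs.ne').congr_deriv ?_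
    rw [Real.sq_sqrt h0.le]
    field_simp
    ring

lemma sqrt_mul_sq {r : ℝ} (hr : 0 ≤ r) (a : ℝ) : (√r * a) ^ 2 = a ^ 2 * r := by
  rw [mul_pow, Real.sq_sqrt hr]; ring

/-- Weighted Cauchy–Schwarz inequality, integrating from `p > 0`; the weight costs a factor
`p^(-1/2)` and so does the singularity allowed for the second factor. -/
lemma sq_integral_abs_mul_le {p q K : ℝ} (hp : 0 < p) (hpq : p ≤ q) (hq : q < r₀)
    (hf : AEStronglyMeasurable f (volume.restrict (Ioo 0 r₀)))
    (hf2 : IntegrableOn (fun r => f r ^ 2 * r) (Ioo 0 r₀))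
    (hg : AEStronglyMeasurable g (volume.restrict (Ioo 0 r₀)))
    (hgK : ∀ r ∈ Ioo 0 r₀, g r ^ 2 ≤ K / √r) :
    IntervalIntegrable (fun t => f t * g t) volume p q ∧
    (∫ t in p..q, |f t * g t|) ^ 2 ≤ (∫ r in Ioo 0 r₀, f r ^ 2 * r) * (2 * K / √p) := by
  have hsub : Ioc p q ⊆ Ioo 0 r₀ := fun t ht => ⟨hp.trans ht.1, ht.2.trans_lt hq⟩
  have hf' := hf.mono_measure (Measure.restrict_mono hsub le_rfl)
  have hg' := hg.mono_measure (Measure.restrict_mono hsub le_rfl)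
  have hf2' := hf2.mono_set hsub
  have m1 : AEStronglyMeasurable (fun t => √t * |f t|) (volume.restrict (Ioc p q)) :=
    (Real.continuous_sqrt.aestronglyMeasurable).mul hf'.norm
  have m2 : AEStronglyMeasurable (fun t => (√t)⁻¹ * |g t|) (volume.restrict (Ioc p q)) :=
    (Real.continuous_sqrt.measurable.inv.aestronglyMeasurable).mul hg'.norm
  have i1 : IntegrableOn (fun t => (√t * |f t|) ^ 2) (Ioc p q) := by
    refine hf2'.congr_fun (fun t ht => ?_) measurableSet_Ioc
    simp only [sqrt_mul_sq (hp.trans ht.1).le, sq_abs]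
  obtain ⟨j1, j2⟩ := integral_inv_mul_sqrt_le hp hpq
  have b2 : ∀ t ∈ Ioc p q, ((√t)⁻¹ * |g t|) ^ 2 ≤ K * (1 / (t * √t)) := fun t ht => by
    have h0 := hp.trans ht.1
    rw [mul_pow, sq_abs, inv_pow, Real.sq_sqrt h0.le]
    have := hgK t (hsub ht)
    calc t⁻¹ * g t ^ 2 ≤ t⁻¹ * (K / √t) := by gcongr
      _ = K * (1 / (t * √t)) := by field_simp
  have j1' : IntegrableOn (fun t => K * (1 / (t * √t))) (Ioc p q) :=
    ((intervalIntegrable_iff_integrableOn_Ioc_of_le hpq).1 j1).const_mul K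
  have i2 : IntegrableOn (fun t => ((√t)⁻¹ * |g t|) ^ 2) (Ioc p q) := by
    refine integrableOn_of_abs_le measurableSet_Ioc (m2.pow 2) j1' fun t ht => ?_
    rw [abs_of_nonneg (sq_nonneg _)]
    exact b2 t ht
  have e : ∀ t ∈ Ioc p q, √t * |f t| * ((√t)⁻¹ * |g t|) = |f t * g t| := fun t ht => by
    have := Real.sqrt_pos.2 (hp.trans ht.1)
    rw [abs_mul]; field_simp
  have hfg := integrable_mul_of_sq m1 m2 i1 i2
  have hcs := sq_integral_mul_le m1 m2 i1 i2
  have hK : 0 ≤ K := by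
    have h := hgK q ⟨hp.trans_le hpq, hq⟩
    have h1 := Real.sqrt_pos.2 (hp.trans_le hpq)
    have h2 : 0 ≤ K / √q := (sq_nonneg _).trans h
    by_contra hneg
    exact absurd h2 (not_le.2 (div_neg_of_neg_of_pos (not_le.1 hneg) h1))
  constructor
  · rw [intervalIntegrable_iff_integrableOn_Ioc_of_le hpq]
    have : IntegrableOn (fun t => |f t * g t|) (Ioc p q) := hfg.congr
      ((ae_restrict_iff' measurableSet_Ioc).2 (Eventually.of_forall e))
    exact (integrable_norm_iff (hf'.mul hg')).1 this
  · rw [intervalIntegral.integral_of_le hpq, ← setIntegral_congr_fun measurableSet_Ioc e]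
    refine hcs.trans ?_
    have k1 : ∫ t in Ioc p q, (√t * |f t|) ^ 2 ≤ ∫ r in Ioo 0 r₀, f r ^ 2 * r := by
      rw [setIntegral_congr_fun measurableSet_Ioc (g := fun t => f t ^ 2 * t) (fun t ht => by
        simp only [sqrt_mul_sq (hp.trans ht.1).le, sq_abs])]
      refine setIntegral_mono_set hf2 ?_ hsub.eventuallyLE
      exact (ae_restrict_iff' measurableSet_Ioo).2 (Eventually.of_forall fun t ht =>
        mul_nonneg (sq_nonneg _) ht.1.le)
    have k2 : ∫ t in Ioc p q, ((√t)⁻¹ * |g t|) ^ 2 ≤ 2 * K / √p := by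
      calc _ ≤ ∫ t in Ioc p q, K * (1 / (t * √t)) :=
            setIntegral_mono_on i2 j1' measurableSet_Ioc b2
        _ = K * ∫ t in p..q, 1 / (t * √t) := by
            rw [integral_const_mul, intervalIntegral.integral_of_le hpq]
        _ ≤ K * (2 / √p) := by gcongr
        _ = _ := by ring
    have k0 : 0 ≤ ∫ t in Ioc p q, ((√t)⁻¹ * |g t|) ^ 2 := integral_nonneg fun t => sq_nonneg _
    have k3 : 0 ≤ ∫ r in Ioo 0 r₀, f r ^ 2 * r :=
      setIntegral_nonneg measurableSet_Ioo fun t ht => mul_nonneg (sq_nonneg _) ht.1.le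
    exact mul_le_mul k1 k2 k0 k3

lemma one_le_sqrt_div {r : ℝ} (hr : r ∈ Ioo 0 r₀) : (1 : ℝ) ≤ √r₀ / √r := by
  rw [one_le_div (Real.sqrt_pos.2 hr.1)]
  exact Real.sqrt_le_sqrt hr.2.le

lemma sq_integral_abs_le {p q : ℝ} (hp : 0 < p) (hpq : p ≤ q) (hq : q < r₀)
    (hf : AEStronglyMeasurable f (volume.restrict (Ioo 0 r₀)))
    (hf2 : IntegrableOn (fun r => f r ^ 2 * r) (Ioo 0 r₀)) :
    IntervalIntegrable f volume p q ∧
    (∫ t in p..q, |f t|) ^ 2 ≤ (∫ r in Ioo 0 r₀, f r ^ 2 * r) * (2 * √r₀ / √p) := by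
  have := sq_integral_abs_mul_le (g := fun _ => 1) hp hpq hq hf hf2
    aestronglyMeasurable_const (K := √r₀) (fun r hr => by simpa using one_le_sqrt_div hr)
  simpa using this

lemma exists_mul_le_integral {a b : ℝ} (hab : a < b) (hf : IntervalIntegrable f volume a b) :
    ∃ c ∈ Ioo a b, f c * (b - a) ≤ ∫ t in a..b, f t := by
  by_contra! H
  have h : 0 < ∫ t in a..b, (f t - (∫ t in a..b, f t) / (b - a)) := by
    refine intervalIntegral.intervalIntegral_pos_of_pos_on (hf.sub (by simp)) ?_ hab
    intro x hx
    have := H x hx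
    rw [← div_lt_iff₀ (by linarith)] at this
    linarith
  rw [intervalIntegral.integral_sub hf (by simp)] at h
  simp only [intervalIntegral.integral_const, smul_eq_mul] at h
  have : b - a ≠ 0 := by linarith
  field_simp at h
  linarith

lemma weighted_nonneg (f : ℝ → ℝ) : 0 ≤ ∫ r in Ioo 0 r₀, f r ^ 2 * r :=
  setIntegral_nonneg measurableSet_Ioo fun _ ht => mul_nonneg (sq_nonneg _) ht.1.le

lemma LocallyAC.sq_sub_le (hf : LocallyAC r₀ f) {a b : ℝ} (ha : a ∈ Ioo 0 r₀) (hb : b ∈ Ioo 0 r₀)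
    (hf2 : IntegrableOn (fun r => deriv f r ^ 2 * r) (Ioo 0 r₀)) :
    (f b - f a) ^ 2 ≤ (∫ r in Ioo 0 r₀, deriv f r ^ 2 * r) * (2 * √r₀ / √(min a b)) := by
  wlog hab : a ≤ b generalizing a b
  · have := this hb ha (le_of_not_ge hab)
    rw [min_comm a b]
    calc (f b - f a) ^ 2 = (f a - f b) ^ 2 := by ring
      _ ≤ _ := this
  rw [min_eq_left hab]
  obtain ⟨-, h2⟩ := sq_integral_abs_le ha.1 hab hb.2
    (measurable_deriv f).aestronglyMeasurable hf2
  refine le_trans ?_ h2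
  rw [← hf.integral_deriv ha hb]
  rw [← sq_abs]
  exact pow_le_pow_left₀ (abs_nonneg _) (intervalIntegral.abs_integral_le_integral_abs hab) 2

/-- Pointwise bound for radial functions with one square integrable derivative in the plane; the
true growth at the origin is logarithmic. -/
lemma LocallyAC.sq_le (hr₀ : 0 < r₀) : ∃ C > 0, ∀ f : ℝ → ℝ, LocallyAC r₀ f →
    IntegrableOn (fun r => f r ^ 2 * r) (Ioo 0 r₀) →
    IntegrableOn (fun r => deriv f r ^ 2 * r) (Ioo 0 r₀) →
    ∀ r ∈ Ioo 0 r₀, f r ^ 2 ≤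
      C * ((∫ r in Ioo 0 r₀, f r ^ 2 * r) + ∫ r in Ioo 0 r₀, deriv f r ^ 2 * r) / √r := by
  have hs := Real.sqrt_pos.2 hr₀
  refine ⟨16 / r₀ ^ 2 * √r₀ + 8 * √r₀, by positivity, fun f hf i1 i2 r hr => ?_⟩
  set A := ∫ r in Ioo 0 r₀, f r ^ 2 * r
  set B := ∫ r in Ioo 0 r₀, deriv f r ^ 2 * r
  have hA : 0 ≤ A := weighted_nonneg f
  have hB : 0 ≤ B := weighted_nonneg _
  have ii : IntervalIntegrable (fun r => f r ^ 2 * r) volume (r₀ / 2) r₀ :=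
    intervalIntegrable_of_integrableOn_Ioo i1 ⟨by linarith, by linarith⟩ ⟨hr₀.le, le_rfl⟩
  obtain ⟨p, hp, hpA⟩ := exists_mul_le_integral (by linarith) ii
  have hA' : ∫ t in (r₀ / 2)..r₀, f t ^ 2 * t ≤ A := by
    rw [intervalIntegral.integral_of_le (by linarith), integral_Ioc_eq_integral_Ioo]
    refine setIntegral_mono_set i1 ?_ (Ioo_subset_Ioo_left (by linarith)).eventuallyLE
    exact (ae_restrict_iff' measurableSet_Ioo).2 (Eventually.of_forall fun t ht =>
        mul_nonneg (sq_nonneg _) ht.1.le)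
  have hfp : f p ^ 2 ≤ 4 / r₀ ^ 2 * A := by
    have h1 : f p ^ 2 * (r₀ / 2) * (r₀ / 2) ≤ A := by
      calc f p ^ 2 * (r₀ / 2) * (r₀ / 2) ≤ f p ^ 2 * p * (r₀ - r₀ / 2) := by
            have : r₀ - r₀ / 2 = r₀ / 2 := by ring
            rw [this]; gcongr; exact hp.1.le
        _ ≤ _ := hpA.trans hA'
    rw [div_mul_eq_mul_div, le_div_iff₀ (by positivity)]
    linarith
  have hpI : p ∈ Ioo 0 r₀ := ⟨by linarith [hp.1], hp.2⟩
  have h2 := hf.sq_sub_le hpI hr i2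
  have hsr := Real.sqrt_pos.2 hr.1
  have h3 : 2 * √r₀ / √(min p r) ≤ 4 * √r₀ / √r := by
    have : √r / 2 ≤ √(min p r) := by
      apply Real.le_sqrt_of_sq_le
      rw [div_pow, Real.sq_sqrt hr.1.le]
      exact le_min (by linarith [hp.1, hr.2]) (by linarith [hr.1])
    calc 2 * √r₀ / √(min p r) ≤ 2 * √r₀ / (√r / 2) := by gcongr
      _ = 4 * √r₀ / √r := by field_simp; ring
  have h4 := one_le_sqrt_div hr
  calc f r ^ 2 ≤ 2 * f p ^ 2 + 2 * (f r - f p) ^ 2 := by nlinarith [sq_nonneg (f r - 2 * f p)]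
    _ ≤ 2 * (4 / r₀ ^ 2 * A) * (√r₀ / √r) + 2 * (B * (4 * √r₀ / √r)) := by
        have : 2 * f p ^ 2 ≤ 2 * (4 / r₀ ^ 2 * A) * (√r₀ / √r) := by
          calc 2 * f p ^ 2 ≤ 2 * (4 / r₀ ^ 2 * A) * 1 := by linarith
            _ ≤ _ := by gcongr
        have h5 : B * (2 * √r₀ / √(min p r)) ≤ B * (4 * √r₀ / √r) := by gcongr
        linarith
    _ = (8 / r₀ ^ 2 * √r₀ * A + 8 * √r₀ * B) / √r := by field_simp; ring
    _ ≤ (16 / r₀ ^ 2 * √r₀ + 8 * √r₀) * (A + B) / √r := by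
        gcongr
        have e1 : 0 ≤ 8 / r₀ ^ 2 * √r₀ * A := by positivity
        have e2 : 0 ≤ 16 / r₀ ^ 2 * √r₀ * B := by positivity
        have e3 : 0 ≤ 8 * √r₀ * A := by positivity
        have e4 : (16 / r₀ ^ 2 * √r₀ + 8 * √r₀) * (A + B) = 2 * (8 / r₀ ^ 2 * √r₀ * A)
          + 16 / r₀ ^ 2 * √r₀ * B + 8 * √r₀ * A + 8 * √r₀ * B := by ring
        rw [e4]; linarith

/-- Completeness of the weighted space `L²(r dr)`. -/
lemma exists_weighted_limit {f : ℕ → ℝ → ℝ}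
    (hm : ∀ n, AEStronglyMeasurable (f n) (volume.restrict (Ioo 0 r₀)))
    (hi : ∀ n, IntegrableOn (fun r => f n r ^ 2 * r) (Ioo 0 r₀))
    (hC : ∀ ε > 0, ∃ N, ∀ m ≥ N, ∀ n ≥ N, ∫ r in Ioo 0 r₀, (f m r - f n r) ^ 2 * r ≤ ε) :
    ∃ g : ℝ → ℝ, AEStronglyMeasurable g (volume.restrict (Ioo 0 r₀)) ∧
      IntegrableOn (fun r => g r ^ 2 * r) (Ioo 0 r₀) ∧
      Tendsto (fun n => ∫ r in Ioo 0 r₀, (f n r - g r) ^ 2 * r) atTop (𝓝 0) := by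
  set μ := volume.restrict (Ioo (0:ℝ) r₀)
  have hms : AEStronglyMeasurable (fun r : ℝ => √r) μ := Real.continuous_sqrt.aestronglyMeasurable
  have hLp : ∀ n, MemLp (fun r => √r * f n r) 2 μ := fun n => by
    refine (memLp_two_iff_integrable_sq (hms.mul (hm n))).2 ?_
    exact (hi n).congr_fun (fun r hr => (sqrt_mul_sq hr.1.le _).symm) measurableSet_Ioo
  let U : ℕ → Lp ℝ 2 μ := fun n => (hLp n).toLp _
  have hnorm : ∀ F : Lp ℝ 2 μ, ‖F‖ ^ 2 = ∫ r, (F r) ^ 2 ∂μ := by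
    intro F
    rw [← real_inner_self_eq_norm_sq, L2.inner_def]
    refine integral_congr_ae (Eventually.of_forall fun r => ?_)
    simp [sq]
  have hcau : CauchySeq U := by
    rw [Metric.cauchySeq_iff]
    intro ε hε
    obtain ⟨N, hN⟩ := hC (ε ^ 2 / 2) (by positivity)
    refine ⟨N, fun m hm' n hn => ?_⟩
    have h1 : ‖U m - U n‖ ^ 2 ≤ ε ^ 2 / 2 := by
      rw [hnorm]
      refine le_trans (le_of_eq ?_) (hN m hm' n hn)
      refine integral_congr_ae ?_
      filter_upwards [Lp.coeFn_sub (U m) (U n), (hLp m).coeFn_toLp, (hLp n).coeFn_toLp,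
        ae_restrict_mem measurableSet_Ioo] with r h1 h2 h3 h4
      rw [h1, Pi.sub_apply, h2, h3, ← mul_sub, sqrt_mul_sq h4.1.le]
    rw [dist_eq_norm]
    exact lt_of_pow_lt_pow_left₀ 2 hε.le (by nlinarith)
  obtain ⟨G, hG⟩ := cauchySeq_tendsto_of_complete hcau
  have hGm : AEStronglyMeasurable G μ := Lp.aestronglyMeasurable G
  have hG2 : Integrable (fun r => G r ^ 2) μ := (memLp_two_iff_integrable_sq hGm).1 (Lp.memLp G)
  have hgG : ∀ r ∈ Ioo 0 r₀, √r * ((√r)⁻¹ * G r) = G r := fun r hr => by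
    have := Real.sqrt_pos.2 hr.1
    field_simp
  refine ⟨fun r => (√r)⁻¹ * G r,
    (Real.continuous_sqrt.measurable.inv.aestronglyMeasurable).mul hGm, ?_, ?_⟩
  · refine IntegrableOn.congr_fun hG2 (fun r hr => ?_) measurableSet_Ioo
    simp only
    rw [← sqrt_mul_sq hr.1.le, hgG r hr]
  · have h1 : Tendsto (fun n => ‖U n - G‖ ^ 2) atTop (𝓝 0) := by
      have := (tendsto_iff_norm_sub_tendsto_zero.1 hG).pow 2
      simpa using this
    refine h1.congr fun n => ?_
    rw [hnorm]
    refine integral_congr_ae ?_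
    filter_upwards [Lp.coeFn_sub (U n) G, (hLp n).coeFn_toLp,
        ae_restrict_mem measurableSet_Ioo] with r h1 h2 h4
    rw [h1, Pi.sub_apply, h2, ← sqrt_mul_sq h4.1.le, mul_sub, hgG r h4]

end

/-! ### Interpolation between a function and its second derivative -/

section

variable {r₀ : ℝ} {w : ℝ → ℝ}

lemma AdmissibleW.hasDerivAt (hw : AdmissibleW r₀ w) {r : ℝ} (hr : r ∈ Ioo 0 r₀) :
    HasDerivAt w (deriv w r) r :=
  ((hw.differentiableOn r hr).differentiableAt (Ioo_mem_nhds hr.1 hr.2)).hasDerivAt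

lemma AdmissibleW.continuousOn_deriv (hw : AdmissibleW r₀ w) :
    ContinuousOn (deriv w) (Ioo 0 r₀) := hw.locallyAC_deriv.continuousOn

lemma AdmissibleW.locallyAC (hw : AdmissibleW r₀ w) : LocallyAC r₀ w :=
  locallyAC_of_hasDerivAt (fun _ hr => hw.hasDerivAt hr) hw.continuousOn_deriv

/-- Interpolation on a single interval `[a, a + ℓ]`: between two points where `w` is controlled by
its mean square, the mean value theorem yields a point where `w'` is controlled. -/
lemma AdmissibleW.sq_deriv_le (hw : AdmissibleW r₀ w)
    (h2 : IntegrableOn (fun r => deriv (deriv w) r ^ 2 * r) (Ioo 0 r₀))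
    {a l r : ℝ} (ha : 0 < a) (hl : 0 < l) (hal : a + l < r₀) (hr : r ∈ Icc a (a + l)) :
    deriv w r ^ 2 ≤ ∫ t in a..(a + l),
      (216 / l ^ 3 * w t ^ 2 + 2 * l * deriv (deriv w) t ^ 2) := by
  have hsub : ∀ {p q}, a ≤ p → q ≤ a + l → Icc p q ⊆ Ioo 0 r₀ := fun hp hq x hx =>
    ⟨ha.trans_le (hp.trans hx.1), (hx.2.trans hq).trans_lt hal⟩
  have cw2 : ContinuousOn (fun t => w t ^ 2) (Icc a (a + l)) :=
    (hw.locallyAC.continuousOn.mono (hsub le_rfl le_rfl)).pow 2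
  have iw : IntervalIntegrable (fun t => w t ^ 2) volume a (a + l) :=
    ContinuousOn.intervalIntegrable (by rwa [uIcc_of_le (by linarith)])
  have key : ∀ p q, a ≤ p → q ≤ a + l → p ≤ q →
      IntervalIntegrable (fun t => w t ^ 2) volume p q ∧
      ∫ t in p..q, w t ^ 2 ≤ ∫ t in a..(a + l), w t ^ 2 := fun p q hp hq hpq => by
    refine ⟨iw.mono_set ?_, ?_⟩
    · rw [uIcc_of_le hpq, uIcc_of_le (by linarith)]; exact Icc_subset_Icc hp hq
    · exact intervalIntegral.integral_mono_interval hp hpq hq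
        (Eventually.of_forall fun t => sq_nonneg _) iw
  obtain ⟨k1, k2⟩ := key a (a + l / 3) le_rfl (by linarith) (by linarith)
  obtain ⟨k3, k4⟩ := key (a + 2 * l / 3) (a + l) (by linarith) le_rfl (by linarith)
  obtain ⟨p, hp, hp'⟩ := exists_mul_le_integral (by linarith) k1
  obtain ⟨q, hq, hq'⟩ := exists_mul_le_integral (by linarith) k3
  set A := ∫ t in a..(a + l), w t ^ 2
  have hwp : w p ^ 2 ≤ 3 / l * A := by
    rw [div_mul_eq_mul_div, le_div_iff₀ hl]; nlinarith
  have hwq : w q ^ 2 ≤ 3 / l * A := by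
    rw [div_mul_eq_mul_div, le_div_iff₀ hl]; nlinarith
  have hpq : l / 3 ≤ q - p := by linarith [hp.2, hq.1]
  have hpq0 : 0 < q - p := by linarith
  obtain ⟨ξ, hξ, hξ'⟩ := exists_deriv_eq_slope w (show p < q by linarith)
    (hw.locallyAC.continuousOn.mono (hsub hp.1.le hq.2.le))
    (hw.differentiableOn.mono (Ioo_subset_Icc_self.trans (hsub hp.1.le hq.2.le)))
  have hξ2 : deriv w ξ ^ 2 ≤ 108 / l ^ 3 * A := by
    have h5 : deriv w ξ * (q - p) = w q - w p := by rw [hξ']; field_simp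
    have h6 : deriv w ξ ^ 2 * (l / 3) ^ 2 ≤ 12 / l * A := by
      calc deriv w ξ ^ 2 * (l / 3) ^ 2 ≤ deriv w ξ ^ 2 * (q - p) ^ 2 := by gcongr
        _ = (w q - w p) ^ 2 := by rw [← mul_pow, h5]
        _ ≤ 2 * w q ^ 2 + 2 * w p ^ 2 := by nlinarith [sq_nonneg (w q + w p)]
        _ ≤ 2 * (3 / l * A) + 2 * (3 / l * A) := by gcongr
        _ = _ := by ring
    have e : 108 / l ^ 3 * A = 12 / l * A / (l / 3) ^ 2 := by field_simp; ring
    rw [e, le_div_iff₀ (by positivity)]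
    exact h6
  have hξI : ξ ∈ Icc a (a + l) := ⟨hp.1.le.trans hξ.1.le, hξ.2.le.trans hq.2.le⟩
  have haI : a ∈ Ioo 0 r₀ := ⟨ha, by linarith⟩
  have hbI : a + l ∈ Ioo 0 r₀ := ⟨by linarith, hal⟩
  have hsubc : Ioc a (a + l) ⊆ Ioo 0 r₀ := fun x hx => ⟨ha.trans hx.1, hx.2.trans_lt hal⟩
  have m2 : AEStronglyMeasurable (deriv (deriv w)) (volume.restrict (Ioc a (a + l))) :=
    (measurable_deriv _).aestronglyMeasurable
  have i2 : IntegrableOn (fun t => deriv (deriv w) t ^ 2) (Ioc a (a + l)) := by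
    refine integrableOn_of_abs_le measurableSet_Ioc (m2.pow 2)
      ((h2.mono_set hsubc).mul_const (1 / a)) fun t ht => ?_
    rw [abs_of_nonneg (sq_nonneg _), mul_assoc]
    refine le_mul_of_one_le_right (sq_nonneg _) ?_
    rw [mul_one_div, one_le_div ha]
    exact ht.1.le
  set B := ∫ t in a..(a + l), deriv (deriv w) t ^ 2 with hB
  have hdiff : (deriv w r - deriv w ξ) ^ 2 ≤ l * B := by
    have e1 : |deriv w r - deriv w ξ| ≤ ∫ t in a..(a + l), |deriv (deriv w) t| := by
      rw [← hw.locallyAC_deriv.integral_deriv (hsub le_rfl le_rfl hξI) (hsub le_rfl le_rfl hr)]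
      rw [intervalIntegral.integral_of_le (show a ≤ a + l by linarith),
        intervalIntegral.abs_integral_eq_abs_integral_uIoc]
      refine (abs_integral_le_integral_abs).trans ?_
      refine setIntegral_mono_set ?_ (Eventually.of_forall fun x => abs_nonneg _) ?_
      · exact ((intervalIntegrable_iff_integrableOn_Ioc_of_le (by linarith)).1
          (hw.locallyAC_deriv.intervalIntegrable_deriv haI hbI)).abs
      · exact (Ioc_subset_Ioc (le_min hξI.1 hr.1) (max_le hξI.2 hr.2)).eventuallyLE
    have e2 := sq_integral_mul_le (μ := volume.restrict (Ioc a (a + l)))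
      (f := fun _ => (1 : ℝ)) (g := fun t => |deriv (deriv w) t|) aestronglyMeasurable_const
      m2.norm (by simp) (by simpa [IntegrableOn] using i2)
    have e3 : (∫ t in a..(a + l), |deriv (deriv w) t|) ^ 2 ≤ l * B := by
      rw [intervalIntegral.integral_of_le (show a ≤ a + l by linarith), hB,
        intervalIntegral.integral_of_le (show a ≤ a + l by linarith)]
      have ev : ∫ _ in Ioc a (a + l), (1 : ℝ) ^ 2 = l := by
        simp [hl.le]
      rw [ev] at e2
      simpa using e2
    calc _ = |deriv w r - deriv w ξ| ^ 2 := (sq_abs _).symm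
      _ ≤ _ := pow_le_pow_left₀ (abs_nonneg _) e1 2
      _ ≤ _ := e3
  have ii2 : IntervalIntegrable (fun t => deriv (deriv w) t ^ 2) volume a (a + l) :=
    (intervalIntegrable_iff_integrableOn_Ioc_of_le (by linarith)).2 i2
  rw [intervalIntegral.integral_add (iw.const_mul _) (ii2.const_mul _),
    intervalIntegral.integral_const_mul, intervalIntegral.integral_const_mul]
  calc deriv w r ^ 2 ≤ 2 * deriv w ξ ^ 2 + 2 * (deriv w r - deriv w ξ) ^ 2 := by
        nlinarith [sq_nonneg (deriv w r - 2 * deriv w ξ)]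
    _ ≤ 2 * (108 / l ^ 3 * A) + 2 * (l * B) := by gcongr
    _ = _ := by ring

/-- Interpolation inequality at length scale `l`. -/
lemma AdmissibleW.interpolation (hw : AdmissibleW r₀ w)
    (h0 : IntegrableOn (fun r => w r ^ 2 * r) (Ioo 0 r₀))
    (h2 : IntegrableOn (fun r => deriv (deriv w) r ^ 2 * r) (Ioo 0 r₀))
    {l : ℝ} (hl : 0 < l) (hl4 : l ≤ r₀ / 4) :
    IntegrableOn (fun r => deriv w r ^ 2 * r) (Ioo 0 r₀) ∧
    ∫ r in Ioo 0 r₀, deriv w r ^ 2 * r ≤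
      1728 / l ^ 2 * (∫ r in Ioo 0 r₀, w r ^ 2 * r)
        + 16 * l ^ 2 * ∫ r in Ioo 0 r₀, deriv (deriv w) r ^ 2 * r := by
  set G : ℝ → ℝ := fun t => 216 / l ^ 3 * w t ^ 2 + 2 * l * deriv (deriv w) t ^ 2 with hG
  have hG0 : ∀ t, 0 ≤ G t := fun t => by positivity
  set A := ∫ r in Ioo 0 r₀, w r ^ 2 * r
  set B := ∫ r in Ioo 0 r₀, deriv (deriv w) r ^ 2 * r
  have iG : IntegrableOn (fun t => 4 * (G t * t)) (Ioo 0 r₀) := by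
    have := ((h0.const_mul (216 / l ^ 3)).add (h2.const_mul (2 * l))).const_mul 4
    refine this.congr (Eventually.of_forall fun t => ?_)
    simp only [Pi.add_apply, hG]; ring
  have vG : ∫ t in Ioo 0 r₀, 4 * (G t * t) = 4 * (216 / l ^ 3 * A + 2 * l * B) := by
    rw [integral_const_mul, ← integral_const_mul (216 / l ^ 3), ← integral_const_mul (2 * l),
      ← integral_add (h0.const_mul (216 / l ^ 3)) (h2.const_mul (2 * l))]
    congr 1
    refine integral_congr_ae (Eventually.of_forall fun t => ?_)
    simp only [hG]; ring
  have nn : 0 ≤ᵐ[volume.restrict (Ioo 0 r₀)] fun t => 4 * (G t * t) :=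
    (ae_restrict_iff' measurableSet_Ioo).2 (Eventually.of_forall fun t ht =>
      mul_nonneg (by norm_num) (mul_nonneg (hG0 t) ht.1.le))
  -- the pointwise bound, on the half of `[r - l, r + l]` that stays in `(0, r₀)`
  have hpt : ∀ r ∈ Ioo 0 r₀, deriv w r ^ 2 * r ≤
      ∫ t in Ioo 0 r₀ ∩ Icc (r - l) (r + l), 4 * (G t * t) := by
    intro r hr
    obtain ⟨a, ha, hal, hra, hsub, hle⟩ : ∃ a, 0 < a ∧ a + l < r₀ ∧ r ∈ Icc a (a + l) ∧
        Ioc a (a + l) ⊆ Ioo 0 r₀ ∩ Icc (r - l) (r + l) ∧ r ≤ 4 * a := by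
      by_cases h : r < r₀ / 2
      · exact ⟨r, hr.1, by linarith, ⟨le_rfl, by linarith⟩, fun t ht =>
          ⟨⟨by linarith [ht.1, hr.1], by linarith [ht.2]⟩, ⟨by linarith [ht.1], by linarith [ht.2]⟩⟩,
          by linarith [hr.1]⟩
      · exact ⟨r - l, by linarith, by linarith [hr.2], ⟨by linarith, by linarith⟩, fun t ht =>
          ⟨⟨by linarith [ht.1, hr.1], by linarith [ht.2, hr.2]⟩,
            ⟨by linarith [ht.1], by linarith [ht.2]⟩⟩, by linarith [hr.2]⟩
    have h1 := hw.sq_deriv_le h2 ha hl hal hra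
    rw [intervalIntegral.integral_of_le (by linarith)] at h1
    have hs1 : Ioc a (a + l) ⊆ Ioo 0 r₀ := hsub.trans inter_subset_left
    have iGr : IntegrableOn (fun t => G t * r) (Ioc a (a + l)) := by
      refine integrableOn_of_abs_le measurableSet_Ioc ?_ (iG.mono_set hs1) fun t ht => ?_
      · have : AEStronglyMeasurable G (volume.restrict (Ioo 0 r₀)) :=
          (((aesm_of_continuousOn hw.locallyAC.continuousOn).pow 2).const_mul _).add
            (((measurable_deriv _).aestronglyMeasurable.pow 2).const_mul _)
        exact (this.mono_measure (Measure.restrict_mono hs1 le_rfl)).mul_const r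
      · rw [abs_of_nonneg (mul_nonneg (hG0 t) hr.1.le)]
        nlinarith [hG0 t, ht.1]
    calc deriv w r ^ 2 * r ≤ (∫ t in Ioc a (a + l), G t) * r :=
          mul_le_mul_of_nonneg_right h1 hr.1.le
      _ = ∫ t in Ioc a (a + l), G t * r := (integral_mul_const _ _).symm
      _ ≤ ∫ t in Ioc a (a + l), 4 * (G t * t) := by
          refine setIntegral_mono_on iGr (iG.mono_set hs1) measurableSet_Ioc fun t ht => ?_
          nlinarith [hG0 t, ht.1]
      _ ≤ _ := by
          refine setIntegral_mono_set (iG.mono_set inter_subset_left) ?_ hsub.eventuallyLE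
          exact ae_restrict_of_ae_restrict_of_subset inter_subset_left nn
  have hlin : ∫⁻ r in Ioo 0 r₀, ENNReal.ofReal (deriv w r ^ 2 * r) ≤
      ENNReal.ofReal (2 * l) * ENNReal.ofReal (4 * (216 / l ^ 3 * A + 2 * l * B)) := by
    have mG : AEMeasurable (fun t => ENNReal.ofReal (4 * (G t * t))) (volume.restrict (Ioo 0 r₀)) :=
      iG.aestronglyMeasurable.aemeasurable.ennreal_ofReal
    have mS : MeasurableSet {q : ℝ × ℝ | q.2 ∈ Icc (q.1 - l) (q.1 + l)} :=
      (measurableSet_le (f := fun q : ℝ × ℝ => q.1 - l) (g := fun q : ℝ × ℝ => q.2)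
        (by fun_prop) (by fun_prop)).inter
        (measurableSet_le (f := fun q : ℝ × ℝ => q.2) (g := fun q : ℝ × ℝ => q.1 + l)
          (by fun_prop) (by fun_prop))
    calc ∫⁻ r in Ioo 0 r₀, ENNReal.ofReal (deriv w r ^ 2 * r)
        ≤ ∫⁻ r in Ioo 0 r₀, ∫⁻ t in Ioo 0 r₀,
            {q : ℝ × ℝ | q.2 ∈ Icc (q.1 - l) (q.1 + l)}.indicator
              (fun q => ENNReal.ofReal (4 * (G q.2 * q.2))) (r, t) := by
          refine setLIntegral_mono' measurableSet_Ioo fun r hr => ?_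
          refine (ENNReal.ofReal_le_ofReal (hpt r hr)).trans ?_
          rw [ofReal_integral_eq_lintegral_ofReal (iG.mono_set inter_subset_left)
            (ae_restrict_of_ae_restrict_of_subset inter_subset_left nn), inter_comm,
            ← Measure.restrict_restrict measurableSet_Icc, ← lintegral_indicator measurableSet_Icc]
          exact le_of_eq (lintegral_congr fun t => by simp [indicator])
      _ = ∫⁻ t in Ioo 0 r₀, ∫⁻ r in Ioo 0 r₀,
            {q : ℝ × ℝ | q.2 ∈ Icc (q.1 - l) (q.1 + l)}.indicator
              (fun q => ENNReal.ofReal (4 * (G q.2 * q.2))) (r, t) := by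
          refine lintegral_lintegral_swap ?_
          exact (mG.comp_snd (μ := volume.restrict (Ioo 0 r₀))).indicator mS
      _ ≤ ∫⁻ t in Ioo 0 r₀, ENNReal.ofReal (2 * l) * ENNReal.ofReal (4 * (G t * t)) := by
          refine lintegral_mono fun t => ?_
          calc _ ≤ ∫⁻ r, (Icc (t - l) (t + l)).indicator
                (fun _ => ENNReal.ofReal (4 * (G t * t))) r := by
                refine (setLIntegral_le_lintegral _ _).trans (lintegral_mono fun r => ?_)
                simp only [indicator, mem_ofPred_eq, mem_Icc]
                split_ifs with h1 h2 h2
                · exact le_rfl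
                · exact absurd ⟨by linarith [h1.2], by linarith [h1.1]⟩ h2
                · exact zero_le
                · exact le_rfl
            _ = _ := by
                rw [lintegral_indicator measurableSet_Icc, lintegral_const,
                  Measure.restrict_apply_univ, Real.volume_Icc, mul_comm]
                congr 2; ring
      _ = _ := by
          rw [lintegral_const_mul' _ _ ENNReal.ofReal_ne_top,
            ← ofReal_integral_eq_lintegral_ofReal iG nn, vG]
  have mm : AEStronglyMeasurable (fun r => deriv w r ^ 2 * r) (volume.restrict (Ioo 0 r₀)) :=
    (((measurable_deriv w).pow_const 2).mul measurable_id).aestronglyMeasurable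
  have nn' : 0 ≤ᵐ[volume.restrict (Ioo 0 r₀)] fun r => deriv w r ^ 2 * r :=
    (ae_restrict_iff' measurableSet_Ioo).2 (Eventually.of_forall fun t ht =>
      mul_nonneg (sq_nonneg _) ht.1.le)
  have hA : 0 ≤ A := weighted_nonneg w
  have hB : 0 ≤ B := weighted_nonneg _
  rw [← ENNReal.ofReal_mul (by positivity)] at hlin
  have hI : IntegrableOn (fun r => deriv w r ^ 2 * r) (Ioo 0 r₀) := by
    refine ⟨mm, ?_⟩
    rw [hasFiniteIntegral_iff_ofReal nn']
    exact hlin.trans_lt ENNReal.ofReal_lt_top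
  refine ⟨hI, ?_⟩
  rw [← ofReal_integral_eq_lintegral_ofReal hI nn',
    ENNReal.ofReal_le_ofReal_iff (by positivity)] at hlin
  refine hlin.trans (le_of_eq ?_)
  field_simp
  ring

end

/-! ### The relaxed energy density -/

section Wrel

variable {αs : ℝ}

/-- The gap in the tangent line inequality for the convex function `Wrel αs`; its derivative at `b`
is `2 * max b (-2 * √αs)`. -/
noncomputable def excess (αs a b : ℝ) : ℝ :=
  Wrel αs a - Wrel αs b - 2 * max b (-2 * √αs) * (a - b)

lemma Wrel_eq_max_sq (hα : 0 < αs) (η : ℝ) :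
    Wrel αs η = max η (-2 * √αs) ^ 2 - 4 * √αs * (η - max η (-2 * √αs)) := by
  unfold Wrel
  have hs : √αs ^ 2 = αs := Real.sq_sqrt hα.le
  split_ifs with h
  · rw [max_eq_left h]; ring
  · rw [max_eq_right (not_le.1 h).le]; ring

lemma Wrel_nonneg (hα : 0 < αs) (η : ℝ) : 0 ≤ Wrel αs η := by
  rw [Wrel_eq_max_sq hα]
  have h1 := Real.sqrt_pos.2 hα
  rcases le_total η (-2 * √αs) with h | h
  · rw [max_eq_right h]; nlinarith
  · rw [max_eq_left h]; nlinarith [sq_nonneg η]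

lemma continuous_Wrel (hα : 0 < αs) : Continuous (Wrel αs) := by
  have : Wrel αs = fun η => max η (-2 * √αs) ^ 2 - 4 * √αs * (η - max η (-2 * √αs)) :=
    funext (Wrel_eq_max_sq hα)
  rw [this]
  fun_prop

lemma excess_nonneg (hα : 0 < αs) (a b : ℝ) : 0 ≤ excess αs a b := by
  have h1 := Real.sqrt_pos.2 hα
  unfold excess
  rw [Wrel_eq_max_sq hα, Wrel_eq_max_sq hα]
  rcases le_total a (-2 * √αs) with h | h <;> rcases le_total b (-2 * √αs) with h' | h' <;>
  simp only [max_eq_left, max_eq_right, h, h'] <;>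
  nlinarith [sq_nonneg (a - b), sq_nonneg (a + 2 * √αs), sq_nonneg (b + 2 * √αs)]

lemma excess_le_sq (hα : 0 < αs) (a b : ℝ) : excess αs a b ≤ (a - b) ^ 2 := by
  have h1 := Real.sqrt_pos.2 hα
  unfold excess
  rw [Wrel_eq_max_sq hα, Wrel_eq_max_sq hα]
  rcases le_total a (-2 * √αs) with h | h <;> rcases le_total b (-2 * √αs) with h' | h' <;>
  simp only [max_eq_left, max_eq_right, h, h'] <;>
  nlinarith [sq_nonneg (a - b), sq_nonneg (a + 2 * √αs), sq_nonneg (b + 2 * √αs)]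

lemma excess_eq_sq {a b : ℝ} (hα : 0 < αs) (hb : -2 * √αs ≤ b) (hab : b ≤ a) :
    excess αs a b = (a - b) ^ 2 := by
  unfold excess
  rw [Wrel_eq_max_sq hα, Wrel_eq_max_sq hα, max_eq_left hb, max_eq_left (hb.trans hab)]
  ring

lemma Wrel_le_sq (hα : 0 < αs) (η : ℝ) : Wrel αs η ≤ η ^ 2 := by
  rw [Wrel_eq_max_sq hα]
  rcases le_total η (-2 * √αs) with h | h
  · rw [max_eq_right h]; nlinarith [sq_nonneg (η + 2 * √αs)]
  · rw [max_eq_left h]; nlinarith [sq_nonneg η]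

lemma abs_le_Wrel (hα : 0 < αs) (η : ℝ) : 4 * √αs * |η| ≤ Wrel αs η + 4 * αs := by
  have h1 := Real.sqrt_pos.2 hα
  have hs : √αs ^ 2 = αs := Real.sq_sqrt hα.le
  rw [Wrel_eq_max_sq hα]
  rcases le_total η (-2 * √αs) with h | h
  · rw [max_eq_right h, abs_of_nonpos (by linarith)]; nlinarith
  · rw [max_eq_left h]; nlinarith [sq_nonneg (|η| - 2 * √αs), sq_abs η]

lemma sq_max_le_Wrel (hα : 0 < αs) (η : ℝ) : max η (-2 * √αs) ^ 2 ≤ Wrel αs η + 4 * αs := by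
  have h1 := Real.sqrt_pos.2 hα
  have hs : √αs ^ 2 = αs := Real.sq_sqrt hα.le
  rw [Wrel_eq_max_sq hα]
  rcases le_total η (-2 * √αs) with h | h
  · rw [max_eq_right h]; nlinarith
  · rw [max_eq_left h]; nlinarith

lemma Wrel_midpoint_le (hα : 0 < αs) (a b : ℝ) :
    2 * Wrel αs ((a + b) / 2) ≤ Wrel αs a + Wrel αs b := by
  have h1 := excess_nonneg hα a ((a + b) / 2)
  have h2 := excess_nonneg hα b ((a + b) / 2)
  unfold excess at h1 h2
  nlinarith

lemma abs_max_le (η : ℝ) : |max η (-2 * √αs)| ≤ |η| + 2 * √αs := by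
  have h1 := Real.sqrt_nonneg αs
  rcases le_total η (-2 * √αs) with h | h
  · rw [max_eq_right h, abs_of_nonpos (by linarith)]
    linarith [abs_nonneg η]
  · rw [max_eq_left h]; linarith

end Wrel

/-! ### Equilibria of the convexified problem for a fixed vertical profile -/

/-- The equilibrium system for the radial displacement `v` and the weighted stress `s r = r σ r`,
when the vertical displacement contributes the radial strain `g`. The condition `0 ≤ s` says that
the sheet is everywhere under radial tension, and `s → 0` at `r₀` is the natural boundary
condition. -/
structure IsEquilibrium (αs r₀ : ℝ) (g v s : ℝ → ℝ) : Prop where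
  hasDerivAt_v : ∀ r ∈ Ioo 0 r₀, HasDerivAt v (s r / r - g r) r
  hasDerivAt_s : ∀ r ∈ Ioo 0 r₀, HasDerivAt s (max (v r / r) (-2 * √αs)) r
  s_nonneg : ∀ r ∈ Ioo 0 r₀, 0 ≤ s r
  v_zero : Tendsto v (𝓝[>] 0) (𝓝 0)
  s_zero : Tendsto s (𝓝[>] 0) (𝓝 0)
  s_end : Tendsto s (𝓝[<] r₀) (𝓝 0)

section mono

variable {r₀ : ℝ} {f f' : ℝ → ℝ}

lemma monotoneOn_Ioo_of_hasDerivAt (h : ∀ r ∈ Ioo 0 r₀, HasDerivAt f (f' r) r)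
    (h' : ∀ r ∈ Ioo 0 r₀, 0 ≤ f' r) : MonotoneOn f (Ioo 0 r₀) := by
  refine monotoneOn_of_deriv_nonneg (convex_Ioo _ _)
    (fun r hr => (h r hr).continuousAt.continuousWithinAt) ?_ ?_
  · rw [interior_Ioo]; exact fun r hr => (h r hr).differentiableAt.differentiableWithinAt
  · rw [interior_Ioo]; exact fun r hr => by rw [(h r hr).deriv]; exact h' r hr

lemma MonotoneOn.ge_of_tendsto_zero {A : ℝ} (h : MonotoneOn f (Ioo 0 r₀))
    (hA : Tendsto f (𝓝[>] 0) (𝓝 A)) {r : ℝ} (hr : r ∈ Ioo 0 r₀) : A ≤ f r := by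
  refine le_of_tendsto hA ?_
  filter_upwards [Ioo_mem_nhdsGT hr.1] with t ht
  exact h ⟨ht.1, ht.2.trans hr.2⟩ hr ht.2.le

lemma MonotoneOn.le_of_tendsto_end {A : ℝ} (h : MonotoneOn f (Ioo 0 r₀))
    (hA : Tendsto f (𝓝[<] r₀) (𝓝 A)) {r : ℝ} (hr : r ∈ Ioo 0 r₀) : f r ≤ A := by
  refine ge_of_tendsto hA ?_
  filter_upwards [Ioo_mem_nhdsLT hr.2] with t ht
  exact h hr ⟨hr.1.trans ht.1, ht.2⟩ ht.1.le

end mono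

namespace IsEquilibrium

variable {αs r₀ K : ℝ} {g v s : ℝ → ℝ}

lemma continuousOn_v (he : IsEquilibrium αs r₀ g v s) : ContinuousOn v (Ioo 0 r₀) :=
  fun r hr => (he.hasDerivAt_v r hr).continuousAt.continuousWithinAt

lemma continuousOn_s (he : IsEquilibrium αs r₀ g v s) : ContinuousOn s (Ioo 0 r₀) :=
  fun r hr => (he.hasDerivAt_s r hr).continuousAt.continuousWithinAt

lemma continuousOn_div (he : IsEquilibrium αs r₀ g v s) :
    ContinuousOn (fun r => v r / r) (Ioo 0 r₀) :=
  he.continuousOn_v.div continuousOn_id fun _ hr => hr.1.ne'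

lemma continuousOn_max (he : IsEquilibrium αs r₀ g v s) :
    ContinuousOn (fun r => max (v r / r) (-2 * √αs)) (Ioo 0 r₀) :=
  ContinuousOn.sup he.continuousOn_div continuousOn_const

lemma locallyAC_s (he : IsEquilibrium αs r₀ g v s) : LocallyAC r₀ s :=
  locallyAC_of_hasDerivAt he.hasDerivAt_s he.continuousOn_max

lemma admissible (he : IsEquilibrium αs r₀ g v s) (hg : ContinuousOn g (Ioo 0 r₀)) :
    AdmissibleV r₀ v where
  locallyAC := locallyAC_of_hasDerivAt he.hasDerivAt_v
    ((he.continuousOn_s.div continuousOn_id fun _ hr => hr.1.ne').sub hg)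
  zero_at_zero := he.v_zero

/-- The stress decays linearly at the outer boundary, since `s' ≥ -2 √αs`. -/
lemma s_le (he : IsEquilibrium αs r₀ g v s) {r : ℝ} (hr : r ∈ Ioo 0 r₀) :
    s r ≤ 2 * √αs * (r₀ - r) := by
  have hd : ∀ r ∈ Ioo 0 r₀, HasDerivAt (fun r => s r + 2 * √αs * r)
      (max (v r / r) (-2 * √αs) + 2 * √αs) r := fun r hr =>
    ((he.hasDerivAt_s r hr).add ((hasDerivAt_id r).const_mul (2 * √αs))).congr_deriv (by ring)
  have hm := monotoneOn_Ioo_of_hasDerivAt hd fun r _ => by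
    have := le_max_right (v r / r) (-2 * √αs)
    linarith
  have ht : Tendsto (fun r => s r + 2 * √αs * r) (𝓝[<] r₀) (𝓝 (0 + 2 * √αs * r₀)) :=
    he.s_end.add ((tendsto_nhdsWithin_of_tendsto_nhds tendsto_id).const_mul _)
  have := MonotoneOn.le_of_tendsto_end hm ht hr
  linarith

/-- The function `r (s - v)` is nondecreasing. -/
lemma v_le_s (he : IsEquilibrium αs r₀ g v s) (hg : ∀ r ∈ Ioo 0 r₀, 0 ≤ g r) {r : ℝ}
    (hr : r ∈ Ioo 0 r₀) : v r ≤ s r := by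
  have hd : ∀ r ∈ Ioo 0 r₀, HasDerivAt (fun r => r * (s r - v r))
      (1 * (s r - v r) + r * (max (v r / r) (-2 * √αs) - (s r / r - g r))) r := fun r hr =>
    (hasDerivAt_id r).mul ((he.hasDerivAt_s r hr).sub (he.hasDerivAt_v r hr))
  have hm := monotoneOn_Ioo_of_hasDerivAt hd fun r hr => by
    have h1 := le_max_left (v r / r) (-2 * √αs)
    have h2 : v r ≤ r * max (v r / r) (-2 * √αs) := by
      calc v r = r * (v r / r) := by field_simp [hr.1.ne']
        _ ≤ _ := mul_le_mul_of_nonneg_left h1 hr.1.le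
    have h3 : r * (s r / r) = s r := by field_simp [hr.1.ne']
    have h4 := mul_nonneg hr.1.le (hg r hr)
    nlinarith
  have ht : Tendsto (fun r => r * (s r - v r)) (𝓝[>] 0) (𝓝 (0 * (0 - 0))) :=
    (tendsto_nhdsWithin_of_tendsto_nhds tendsto_id).mul (he.s_zero.sub he.v_zero)
  have := MonotoneOn.ge_of_tendsto_zero hm ht hr
  simp only [sub_zero, mul_zero] at this
  have h5 : 0 ≤ s r - v r := by
    by_contra hneg
    nlinarith [hr.1]
  linarith

lemma neg_le_v (he : IsEquilibrium αs r₀ g v s) (hg : ∀ r ∈ Ioo 0 r₀, g r ≤ K / √r) {r : ℝ}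
    (hr : r ∈ Ioo 0 r₀) : -(2 * K * √r) ≤ v r := by
  have hd : ∀ r ∈ Ioo 0 r₀, HasDerivAt (fun r => v r + 2 * K * √r)
      ((s r / r - g r) + 2 * K * (1 / (2 * √r))) r := fun r hr =>
    (he.hasDerivAt_v r hr).add ((Real.hasDerivAt_sqrt hr.1.ne').const_mul (2 * K))
  have hm := monotoneOn_Ioo_of_hasDerivAt hd fun r hr => by
    have h1 := div_nonneg (he.s_nonneg r hr) hr.1.le
    have h2 := hg r hr
    have h3 : 2 * K * (1 / (2 * √r)) = K / √r := by
      have := Real.sqrt_pos.2 hr.1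
      field_simp
    linarith
  have ht : Tendsto (fun r => v r + 2 * K * √r) (𝓝[>] 0) (𝓝 (0 + 2 * K * √0)) :=
    he.v_zero.add ((tendsto_nhdsWithin_of_tendsto_nhds Real.continuous_sqrt.continuousAt).const_mul
      (2 * K))
  have := MonotoneOn.ge_of_tendsto_zero hm ht hr
  simp only [Real.sqrt_zero, mul_zero, add_zero] at this
  linarith

/-- A bound on the stress that is uniform up to the origin: `(s + v) / r - 2 K / √r` is
nondecreasing. -/
lemma s_le_sqrt (he : IsEquilibrium αs r₀ g v s) (hg0 : ∀ r ∈ Ioo 0 r₀, 0 ≤ g r)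
    (hg : ∀ r ∈ Ioo 0 r₀, g r ≤ K / √r) {r : ℝ} (hr : r ∈ Ioo 0 r₀) :
    s r ≤ (4 * K + 8 * √αs * √r₀) * √r := by
  have hr₀ : 0 < r₀ := hr.1.trans hr.2
  have hK : 0 ≤ K := by
    have h := (hg0 r hr).trans (hg r hr)
    by_contra hneg
    exact absurd h (not_le.2 (div_neg_of_neg_of_pos (not_le.1 hneg) (Real.sqrt_pos.2 hr.1)))
  have hsr := Real.sqrt_pos.2 hr.1
  have ha := Real.sqrt_nonneg αs
  have hrr : r ≤ √r₀ * √r := by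
    calc r = √r * √r := (Real.mul_self_sqrt hr.1.le).symm
      _ ≤ √r₀ * √r := by gcongr; exact hr.2.le
  rcases lt_or_ge r (r₀ / 2) with h | h
  · have hd : ∀ r ∈ Ioo 0 r₀, HasDerivAt (fun r => (s r + v r) / r - 2 * K / √r)
        (((max (v r / r) (-2 * √αs) + (s r / r - g r)) * r - (s r + v r) * 1) / r ^ 2
          - (0 * √r - 2 * K * (1 / (2 * √r))) / √r ^ 2) r := fun r hr =>
      (((he.hasDerivAt_s r hr).add (he.hasDerivAt_v r hr)).div (hasDerivAt_id r) hr.1.ne').sub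
        ((hasDerivAt_const r (2 * K)).div (Real.hasDerivAt_sqrt hr.1.ne')
          (Real.sqrt_pos.2 hr.1).ne')
    have hm := monotoneOn_Ioo_of_hasDerivAt hd fun r hr => by
      have h1 := Real.sqrt_pos.2 hr.1
      have h2 := hr.1
      have e : ((max (v r / r) (-2 * √αs) + (s r / r - g r)) * r - (s r + v r) * 1) / r ^ 2
          - (0 * √r - 2 * K * (1 / (2 * √r))) / √r ^ 2
          = (max (v r / r) (-2 * √αs) - v r / r) / r + (K / √r - g r) / r := by
        rw [Real.sq_sqrt h2.le]
        field_simp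
        ring
      rw [e]
      have h3 := le_max_left (v r / r) (-2 * √αs)
      have h4 := hg r hr
      have := div_nonneg (sub_nonneg.2 h3) h2.le
      have := div_nonneg (sub_nonneg.2 h4) h2.le
      linarith
    have hq : r₀ / 2 ∈ Ioo 0 r₀ := ⟨by linarith, by linarith⟩
    have h1 := hm hr hq h.le
    simp only at h1
    have h2 : (s (r₀ / 2) + v (r₀ / 2)) / (r₀ / 2) ≤ 4 * √αs := by
      rw [div_le_iff₀ (by linarith)]
      have := he.v_le_s hg0 hq
      have := he.s_le hq
      nlinarith
    have h3 : 0 ≤ 2 * K / √(r₀ / 2) := by positivity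
    have h4 : (s r + v r) / r ≤ 4 * √αs + 2 * K / √r := by linarith
    rw [div_le_iff₀ hr.1] at h4
    have h5 := he.neg_le_v hg hr
    have h6 : (4 * √αs + 2 * K / √r) * r = 4 * √αs * r + 2 * K * √r := by
      have : r = √r * √r := (Real.mul_self_sqrt hr.1.le).symm
      rw [add_mul]
      congr 1
      rw [div_mul_eq_mul_div, div_eq_iff hsr.ne']
      nlinarith
    have h7 : 4 * √αs * r ≤ 8 * √αs * (√r₀ * √r) := by
      have := mul_le_mul_of_nonneg_left hrr ha
      have : 0 ≤ √αs * (√r₀ * √r) := by positivity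
      linarith
    nlinarith
  · have h1 := he.s_le hr
    have h2 : 0 ≤ K * √r := by positivity
    nlinarith

lemma abs_v_le (he : IsEquilibrium αs r₀ g v s) (hg0 : ∀ r ∈ Ioo 0 r₀, 0 ≤ g r)
    (hg : ∀ r ∈ Ioo 0 r₀, g r ≤ K / √r) {r : ℝ} (hr : r ∈ Ioo 0 r₀) :
    |v r| ≤ (4 * K + 8 * √αs * √r₀) * √r := by
  have h1 := he.s_le_sqrt hg0 hg hr
  have h2 := he.v_le_s hg0 hr
  have h3 := he.neg_le_v hg hr
  have hsr := Real.sqrt_pos.2 hr.1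
  have hK : 0 ≤ K := by
    have h := (hg0 r hr).trans (hg r hr)
    by_contra hneg
    exact absurd h (not_le.2 (div_neg_of_neg_of_pos (not_le.1 hneg) hsr))
  have h4 : 0 ≤ 8 * √αs * √r₀ * √r := by positivity
  have h5 : 0 ≤ K * √r := by positivity
  rw [abs_le]
  constructor <;> nlinarith

lemma abs_max_le (he : IsEquilibrium αs r₀ g v s) (hg0 : ∀ r ∈ Ioo 0 r₀, 0 ≤ g r)
    (hg : ∀ r ∈ Ioo 0 r₀, g r ≤ K / √r) {r : ℝ} (hr : r ∈ Ioo 0 r₀) :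
    |max (v r / r) (-2 * √αs)| ≤ (4 * K + 10 * √αs * √r₀) / √r := by
  have h1 := he.abs_v_le hg0 hg hr
  have hsr := Real.sqrt_pos.2 hr.1
  have h2 : |v r / r| ≤ (4 * K + 8 * √αs * √r₀) / √r := by
    rw [abs_div, abs_of_pos hr.1, div_le_div_iff₀ hr.1 hsr]
    calc |v r| * √r ≤ (4 * K + 8 * √αs * √r₀) * √r * √r := by gcongr
      _ = (4 * K + 8 * √αs * √r₀) * r := by rw [mul_assoc, Real.mul_self_sqrt hr.1.le]
  have h3 : 2 * √αs ≤ 2 * √αs * √r₀ / √r := by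
    rw [mul_div_assoc]
    exact le_mul_of_one_le_right (by positivity) (one_le_sqrt_div hr)
  calc _ ≤ |v r / r| + 2 * √αs := WrinkledSheet.abs_max_le _
    _ ≤ (4 * K + 8 * √αs * √r₀) / √r + 2 * √αs * √r₀ / √r := add_le_add h2 h3
    _ = _ := by ring

end IsEquilibrium

/-! ### Configurations of finite energy -/

section

variable {r₀ : ℝ}

/-- Normal displacements for which the quadratic part of the energy is finite. -/
structure WSpace (r₀ : ℝ) (w : ℝ → ℝ) : Prop where
  admissible : AdmissibleW r₀ w
  integrable_sq : IntegrableOn (fun r => w r ^ 2 * r) (Ioo 0 r₀)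
  integrable_sq_deriv2 : IntegrableOn (fun r => deriv (deriv w) r ^ 2 * r) (Ioo 0 r₀)

section lin

variable {w₁ w₂ : ℝ → ℝ}

lemma AdmissibleW.deriv_lin (h₁ : AdmissibleW r₀ w₁) (h₂ : AdmissibleW r₀ w₂) (a b : ℝ) {r : ℝ}
    (hr : r ∈ Ioo 0 r₀) :
    HasDerivAt (fun r => a * w₁ r + b * w₂ r) (a * deriv w₁ r + b * deriv w₂ r) r :=
  ((h₁.hasDerivAt hr).const_mul a).add ((h₂.hasDerivAt hr).const_mul b)

lemma AdmissibleW.lin (h₁ : AdmissibleW r₀ w₁) (h₂ : AdmissibleW r₀ w₂) (a b : ℝ) :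
    AdmissibleW r₀ (fun r => a * w₁ r + b * w₂ r) where
  differentiableOn := fun _ hr =>
    (h₁.deriv_lin h₂ a b hr).differentiableAt.differentiableWithinAt
  locallyAC_deriv :=
    ((h₁.locallyAC_deriv.const_mul a).add (h₂.locallyAC_deriv.const_mul b)).of_eqOn
      fun _ hr => (h₁.deriv_lin h₂ a b hr).deriv.symm

lemma AdmissibleW.ae_deriv2_lin (h₁ : AdmissibleW r₀ w₁) (h₂ : AdmissibleW r₀ w₂) (a b : ℝ) :
    ∀ᵐ r ∂(volume.restrict (Ioo 0 r₀)), deriv (deriv fun r => a * w₁ r + b * w₂ r) r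
      = a * deriv (deriv w₁) r + b * deriv (deriv w₂) r := by
  filter_upwards [h₁.locallyAC_deriv.ae_differentiableAt, h₂.locallyAC_deriv.ae_differentiableAt,
    ae_restrict_mem measurableSet_Ioo] with r d₁ d₂ hr
  have hev : (deriv fun r => a * w₁ r + b * w₂ r) =ᶠ[𝓝 r]
      fun r => a * deriv w₁ r + b * deriv w₂ r :=
    eventually_of_mem (Ioo_mem_nhds hr.1 hr.2) fun t ht => (h₁.deriv_lin h₂ a b ht).deriv
  rw [hev.deriv_eq]
  exact ((d₁.hasDerivAt.const_mul a).add (d₂.hasDerivAt.const_mul b)).deriv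

lemma integrableOn_sq_lin {f₁ f₂ : ℝ → ℝ}
    (m₁ : AEStronglyMeasurable f₁ (volume.restrict (Ioo 0 r₀)))
    (m₂ : AEStronglyMeasurable f₂ (volume.restrict (Ioo 0 r₀)))
    (i₁ : IntegrableOn (fun r => f₁ r ^ 2 * r) (Ioo 0 r₀))
    (i₂ : IntegrableOn (fun r => f₂ r ^ 2 * r) (Ioo 0 r₀)) (a b : ℝ) :
    IntegrableOn (fun r => (a * f₁ r + b * f₂ r) ^ 2 * r) (Ioo 0 r₀) := by
  refine integrableOn_of_abs_le measurableSet_Ioo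
    ((((m₁.const_mul a).add (m₂.const_mul b)).pow 2).mul measurable_id.aestronglyMeasurable)
    ((i₁.const_mul (2 * a ^ 2)).add (i₂.const_mul (2 * b ^ 2))) fun r hr => ?_
  rw [abs_of_nonneg (mul_nonneg (sq_nonneg _) hr.1.le)]
  simp only [Pi.add_apply]
  have : (a * f₁ r + b * f₂ r) ^ 2 ≤ 2 * (a ^ 2 * f₁ r ^ 2) + 2 * (b ^ 2 * f₂ r ^ 2) := by
    nlinarith [sq_nonneg (a * f₁ r - b * f₂ r)]
  nlinarith [mul_le_mul_of_nonneg_right this hr.1.le]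

lemma aesm_deriv (f : ℝ → ℝ) (s : Set ℝ) : AEStronglyMeasurable (deriv f) (volume.restrict s) :=
  (measurable_deriv f).aestronglyMeasurable

lemma WSpace.lin (h₁ : WSpace r₀ w₁) (h₂ : WSpace r₀ w₂) (a b : ℝ) :
    WSpace r₀ (fun r => a * w₁ r + b * w₂ r) where
  admissible := h₁.admissible.lin h₂.admissible a b
  integrable_sq := integrableOn_sq_lin
    (aesm_of_continuousOn h₁.admissible.locallyAC.continuousOn)
    (aesm_of_continuousOn h₂.admissible.locallyAC.continuousOn)
    h₁.integrable_sq h₂.integrable_sq a b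
  integrable_sq_deriv2 := by
    refine (integrableOn_sq_lin (aesm_deriv _ _) (aesm_deriv _ _) h₁.integrable_sq_deriv2
      h₂.integrable_sq_deriv2 a b).congr ?_
    filter_upwards [h₁.admissible.ae_deriv2_lin h₂.admissible a b] with r hr
    rw [hr]

lemma AdmissibleW.deriv_sub (h₁ : AdmissibleW r₀ w₁) (h₂ : AdmissibleW r₀ w₂) {r : ℝ}
    (hr : r ∈ Ioo 0 r₀) :
    deriv (fun r => w₁ r - w₂ r) r = deriv w₁ r - deriv w₂ r :=
  ((h₁.hasDerivAt hr).sub (h₂.hasDerivAt hr)).deriv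

lemma AdmissibleW.ae_deriv2_sub (h₁ : AdmissibleW r₀ w₁) (h₂ : AdmissibleW r₀ w₂) :
    ∀ᵐ r ∂(volume.restrict (Ioo 0 r₀)), deriv (deriv fun r => w₁ r - w₂ r) r
      = deriv (deriv w₁) r - deriv (deriv w₂) r := by
  have := h₁.ae_deriv2_lin h₂ 1 (-1)
  have e : (fun r => 1 * w₁ r + -1 * w₂ r) = fun r => w₁ r - w₂ r := by ext; ring
  rw [e] at this
  filter_upwards [this] with r hr
  rw [hr]; ring

lemma WSpace.sub (h₁ : WSpace r₀ w₁) (h₂ : WSpace r₀ w₂) : WSpace r₀ (fun r => w₁ r - w₂ r) := by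
  have e : (fun r => w₁ r - w₂ r) = fun r => 1 * w₁ r + -1 * w₂ r := by ext; ring
  rw [e]; exact h₁.lin h₂ 1 (-1)

end lin

/-- The parabola with curvature `c`; for `c = 1 / R` it is the flat state of the sheet. -/
lemma wSpace_parabola (r₀ c : ℝ) : WSpace r₀ (fun r => c / 2 * r ^ 2) ∧
    (∀ r, deriv (fun r => c / 2 * r ^ 2) r = c * r) ∧
    (∀ r, deriv (deriv fun r => c / 2 * r ^ 2) r = c) := by
  have hd : ∀ r : ℝ, HasDerivAt (fun r => c / 2 * r ^ 2) (c * r) r := fun r =>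
    ((hasDerivAt_pow 2 r).const_mul (c / 2)).congr_deriv (by norm_num; ring)
  have e1 : (deriv fun r => c / 2 * r ^ 2) = fun r => c * r := funext fun r => (hd r).deriv
  have hd2 : ∀ r : ℝ, HasDerivAt (fun r => c * r) c r := fun r => by
    simpa using (hasDerivAt_id r).const_mul c
  have e2 : ∀ r, deriv (deriv fun r => c / 2 * r ^ 2) r = c := fun r => by
    rw [e1]; exact (hd2 r).deriv
  refine ⟨⟨⟨fun r _ => (hd r).differentiableAt.differentiableWithinAt, ?_⟩, ?_, ?_⟩,
    fun r => (hd r).deriv, e2⟩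
  · rw [e1]
    exact locallyAC_of_hasDerivAt (fun r _ => hd2 r) continuousOn_const
  · exact (Continuous.integrableOn_Icc (a := 0) (b := r₀) (by fun_prop)).mono_set
      Ioo_subset_Icc_self
  · simp_rw [e2]
    exact (Continuous.integrableOn_Icc (a := 0) (b := r₀) (by fun_prop)).mono_set
      Ioo_subset_Icc_self

lemma wSpace_zero (r₀ : ℝ) : WSpace r₀ (fun _ => 0) := by
  simpa using (wSpace_parabola r₀ 0).1

/-- A uniform pointwise bound of the slope by the quadratic energy. -/
lemma WSpace.exists_slope_bound (hr₀ : 0 < r₀) : ∃ C > 0, ∀ w, WSpace r₀ w →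
    (∀ r ∈ Ioo 0 r₀, deriv w r ^ 2 ≤ C * ((∫ r in Ioo 0 r₀, w r ^ 2 * r)
      + ∫ r in Ioo 0 r₀, deriv (deriv w) r ^ 2 * r) / √r) := by
  obtain ⟨C, hC, H⟩ := LocallyAC.sq_le hr₀
  refine ⟨C * (1728 / (r₀ / 4) ^ 2 + 16 * (r₀ / 4) ^ 2 + 1), by positivity, fun w hw r hr => ?_⟩
  obtain ⟨i1, i2⟩ := hw.admissible.interpolation hw.integrable_sq hw.integrable_sq_deriv2
    (l := r₀ / 4) (by positivity) le_rfl
  have h1 := H _ hw.admissible.locallyAC_deriv i1 hw.integrable_sq_deriv2 r hr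
  have hA : 0 ≤ ∫ r in Ioo 0 r₀, w r ^ 2 * r := weighted_nonneg w
  have hB : 0 ≤ ∫ r in Ioo 0 r₀, deriv (deriv w) r ^ 2 * r := weighted_nonneg _
  refine h1.trans ?_
  gcongr ?_ / _
  rw [mul_assoc]
  gcongr
  set A := ∫ r in Ioo 0 r₀, w r ^ 2 * r
  set B := ∫ r in Ioo 0 r₀, deriv (deriv w) r ^ 2 * r
  have e1 : 0 ≤ 1728 / (r₀ / 4) ^ 2 * B := by positivity
  have e2 : 0 ≤ 16 * (r₀ / 4) ^ 2 * A := by positivity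
  calc _ ≤ 1728 / (r₀ / 4) ^ 2 * A + 16 * (r₀ / 4) ^ 2 * B + B := by linarith
    _ ≤ _ := by
      have : (1728 / (r₀ / 4) ^ 2 + 16 * (r₀ / 4) ^ 2 + 1) * (A + B)
        = 1728 / (r₀ / 4) ^ 2 * A + 16 * (r₀ / 4) ^ 2 * B + B + 1728 / (r₀ / 4) ^ 2 * B
          + 16 * (r₀ / 4) ^ 2 * A + A := by ring
      rw [this]; linarith

lemma WSpace.exists_deriv_bound (hr₀ : 0 < r₀) {w : ℝ → ℝ} (hw : WSpace r₀ w) :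
    ∃ K > 0, ∀ r ∈ Ioo 0 r₀, deriv w r ^ 2 ≤ K / √r := by
  obtain ⟨C, hC, H⟩ := WSpace.exists_slope_bound hr₀
  have hA : 0 ≤ ∫ r in Ioo 0 r₀, w r ^ 2 * r := weighted_nonneg w
  have hB : 0 ≤ ∫ r in Ioo 0 r₀, deriv (deriv w) r ^ 2 * r := weighted_nonneg _
  refine ⟨C * ((∫ r in Ioo 0 r₀, w r ^ 2 * r)
      + ∫ r in Ioo 0 r₀, deriv (deriv w) r ^ 2 * r) + 1, by positivity, fun r hr => ?_⟩
  refine (H w hw r hr).trans ?_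
  gcongr
  linarith

/-- The singularity `r ^ (-1/2)` is not optimal, but it makes the strain integrable. -/
lemma WSpace.exists_strain_bound (hr₀ : 0 < r₀) (R : ℝ) {w : ℝ → ℝ} (hw : WSpace r₀ w) :
    ∃ K > 0, ∀ r ∈ Ioo 0 r₀, (r / R - deriv w r) ^ 2 ≤ K / √r := by
  obtain ⟨hp, hp1, -⟩ := wSpace_parabola r₀ (1 / R)
  obtain ⟨K, hK, H⟩ := (hp.sub hw).exists_deriv_bound hr₀
  refine ⟨K, hK, fun r hr => ?_⟩
  have := H r hr
  rw [hp.admissible.deriv_sub hw.admissible hr, hp1] at this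
  convert this using 3
  ring

lemma integrableOn_id_Ioo (r₀ : ℝ) : IntegrableOn (fun r : ℝ => r) (Ioo 0 r₀) :=
  (Continuous.integrableOn_Icc (a := 0) (b := r₀) continuous_id).mono_set Ioo_subset_Icc_self

/-! ### The energy density -/

/-- The integrand of `FB`. -/
noncomputable def density (αs R h : ℝ) (B v w : ℝ → ℝ) (r : ℝ) : ℝ :=
  ((deriv v r + (1 / 2) * (r / R - deriv w r) ^ 2 + B r) ^ 2
      + αs * (h ^ 2)⁻¹ * w r ^ 2
      + h ^ 2 * (deriv (deriv w) r - 1 / R) ^ 2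
      + Wrel αs (v r / r)) * r

variable {αs R h : ℝ} {B v w : ℝ → ℝ}

lemma density_nonneg (hα : 0 < αs) {r : ℝ} (hr : r ∈ Ioo 0 r₀) : 0 ≤ density αs R h B v w r := by
  have := Wrel_nonneg hα (v r / r)
  have := hr.1
  unfold density
  positivity

lemma aesm_Wrel_div (hα : 0 < αs) (hv : LocallyAC r₀ v) :
    AEStronglyMeasurable (fun r => Wrel αs (v r / r)) (volume.restrict (Ioo 0 r₀)) :=
  aesm_of_continuousOn ((continuous_Wrel hα).comp_continuousOn
    (hv.continuousOn.div continuousOn_id fun _ hr => hr.1.ne'))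

lemma aesm_strain (R : ℝ) (v w : ℝ → ℝ)
    (hB : AEStronglyMeasurable B (volume.restrict (Ioo 0 r₀))) :
    AEStronglyMeasurable (fun r => deriv v r + (1 / 2) * (r / R - deriv w r) ^ 2 + B r)
      (volume.restrict (Ioo 0 r₀)) := by
  refine AEStronglyMeasurable.add ?_ hB
  have m1 := measurable_deriv v
  have m2 := measurable_deriv w
  exact (by fun_prop : Measurable
    fun r => deriv v r + (1 / 2) * (r / R - deriv w r) ^ 2).aestronglyMeasurable

lemma aesm_density (hα : 0 < αs) (hv : LocallyAC r₀ v) (hw : AdmissibleW r₀ w)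
    (hB : AEStronglyMeasurable B (volume.restrict (Ioo 0 r₀))) :
    AEStronglyMeasurable (density αs R h B v w) (volume.restrict (Ioo 0 r₀)) := by
  have m0 := aesm_strain R v w hB
  have m1 := aesm_of_continuousOn hw.locallyAC.continuousOn
  have m2 := aesm_Wrel_div hα hv
  have m3 : AEStronglyMeasurable (fun r => h ^ 2 * (deriv (deriv w) r - 1 / R) ^ 2)
      (volume.restrict (Ioo 0 r₀)) := by
    have := measurable_deriv (deriv w)
    exact (by fun_prop : Measurable
      fun r => h ^ 2 * (deriv (deriv w) r - 1 / R) ^ 2).aestronglyMeasurable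
  exact ((((m0.pow 2).add ((m1.pow 2).const_mul _)).add m3).add m2).mul
    measurable_id.aestronglyMeasurable

lemma integrableOn_density_of_ne_top (hα : 0 < αs) (hv : LocallyAC r₀ v) (hw : AdmissibleW r₀ w)
    (hB : AEStronglyMeasurable B (volume.restrict (Ioo 0 r₀))) (hfin : FB αs r₀ R h B v w ≠ ∞) :
    IntegrableOn (density αs R h B v w) (Ioo 0 r₀) := by
  refine ⟨aesm_density hα hv hw hB, ?_⟩
  rw [hasFiniteIntegral_iff_ofReal ((ae_restrict_iff' measurableSet_Ioo).2
    (Eventually.of_forall fun r hr => density_nonneg hα hr))]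
  exact lt_top_iff_ne_top.2 hfin

lemma FB_eq_ofReal (hα : 0 < αs) (hi : IntegrableOn (density αs R h B v w) (Ioo 0 r₀)) :
    FB αs r₀ R h B v w = ENNReal.ofReal (∫ r in Ioo 0 r₀, density αs R h B v w r) := by
  rw [ofReal_integral_eq_lintegral_ofReal hi ((ae_restrict_iff' measurableSet_Ioo).2
    (Eventually.of_forall fun r hr => density_nonneg hα hr))]
  rfl

lemma integral_density_nonneg (hα : 0 < αs) :
    0 ≤ ∫ r in Ioo 0 r₀, density αs R h B v w r :=
  setIntegral_nonneg measurableSet_Ioo fun _ hr => density_nonneg hα hr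

lemma FB_toReal (hα : 0 < αs) (hi : IntegrableOn (density αs R h B v w) (Ioo 0 r₀)) :
    (FB αs r₀ R h B v w).toReal = ∫ r in Ioo 0 r₀, density αs R h B v w r := by
  rw [FB_eq_ofReal hα hi, ENNReal.toReal_ofReal (integral_density_nonneg hα)]

/-- The individual terms of an integrable energy density are integrable. -/
lemma integrableOn_terms (hα : 0 < αs) (hh : 0 < h) (hv : LocallyAC r₀ v) (hw : AdmissibleW r₀ w)
    (hB : AEStronglyMeasurable B (volume.restrict (Ioo 0 r₀)))
    (hi : IntegrableOn (density αs R h B v w) (Ioo 0 r₀)) :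
    IntegrableOn (fun r => (deriv v r + (1 / 2) * (r / R - deriv w r) ^ 2 + B r) ^ 2 * r)
      (Ioo 0 r₀) ∧ WSpace r₀ w ∧ IntegrableOn (fun r => Wrel αs (v r / r) * r) (Ioo 0 r₀) := by
  have mid : AEStronglyMeasurable (fun r : ℝ => r) (volume.restrict (Ioo 0 r₀)) :=
    measurable_id.aestronglyMeasurable
  have i3 : IntegrableOn (fun r => (deriv (deriv w) r - 1 / R) ^ 2 * r) (Ioo 0 r₀) := by
    refine integrableOn_of_abs_le measurableSet_Ioo
      ((((aesm_deriv _ _).sub aestronglyMeasurable_const).pow 2).mul mid)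
      (hi.const_mul (h ^ 2)⁻¹) fun r hr => ?_
    have h1 := hr.1
    have := Wrel_nonneg hα (v r / r)
    simp only [density]
    rw [abs_of_nonneg (by positivity), ← div_eq_inv_mul, le_div_iff₀ (by positivity)]
    have : 0 ≤ ((deriv v r + (1 / 2) * (r / R - deriv w r) ^ 2 + B r) ^ 2
      + αs * (h ^ 2)⁻¹ * w r ^ 2 + Wrel αs (v r / r)) * r := by positivity
    linarith
  refine ⟨?_, ⟨hw, ?_, ?_⟩, ?_⟩
  · refine integrableOn_of_abs_le measurableSet_Ioo (((aesm_strain R v w hB).pow 2).mul mid)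
      hi fun r hr => ?_
    have h1 := hr.1
    have := Wrel_nonneg hα (v r / r)
    simp only [density]
    rw [abs_of_nonneg (by positivity)]
    gcongr
    have : 0 ≤ αs * (h ^ 2)⁻¹ * w r ^ 2 + h ^ 2 * (deriv (deriv w) r - 1 / R) ^ 2
      + Wrel αs (v r / r) := by positivity
    linarith
  · refine integrableOn_of_abs_le measurableSet_Ioo
      (((aesm_of_continuousOn hw.locallyAC.continuousOn).pow 2).mul mid)
      (hi.const_mul (αs * (h ^ 2)⁻¹)⁻¹) fun r hr => ?_
    have h1 := hr.1
    have := Wrel_nonneg hα (v r / r)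
    simp only [density]
    rw [abs_of_nonneg (by positivity), ← div_eq_inv_mul, le_div_iff₀ (by positivity)]
    have : 0 ≤ ((deriv v r + (1 / 2) * (r / R - deriv w r) ^ 2 + B r) ^ 2
      + h ^ 2 * (deriv (deriv w) r - 1 / R) ^ 2 + Wrel αs (v r / r)) * r := by positivity
    linarith
  · refine integrableOn_of_abs_le measurableSet_Ioo (((aesm_deriv _ _).pow 2).mul mid)
      ((i3.const_mul 2).add ((integrableOn_id_Ioo r₀).const_mul (2 * (1 / R) ^ 2)))
      fun r hr => ?_
    have h1 := hr.1
    simp only [Pi.add_apply]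
    rw [abs_of_nonneg (by positivity)]
    have : deriv (deriv w) r ^ 2 ≤ 2 * (deriv (deriv w) r - 1 / R) ^ 2 + 2 * (1 / R) ^ 2 := by
      nlinarith [sq_nonneg (deriv (deriv w) r - 2 * (1 / R))]
    nlinarith [mul_le_mul_of_nonneg_right this h1.le]
  · refine integrableOn_of_abs_le measurableSet_Ioo ((aesm_Wrel_div hα hv).mul mid) hi
      fun r hr => ?_
    have h1 := hr.1
    have := Wrel_nonneg hα (v r / r)
    simp only [density]
    rw [abs_of_nonneg (by positivity)]
    gcongr
    have : 0 ≤ (deriv v r + (1 / 2) * (r / R - deriv w r) ^ 2 + B r) ^ 2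
      + αs * (h ^ 2)⁻¹ * w r ^ 2 + h ^ 2 * (deriv (deriv w) r - 1 / R) ^ 2 := by positivity
    linarith

lemma integrableOn_density (hw : WSpace r₀ w)
    (i1 : IntegrableOn (fun r => (deriv v r + (1 / 2) * (r / R - deriv w r) ^ 2 + B r) ^ 2 * r)
      (Ioo 0 r₀)) (i4 : IntegrableOn (fun r => Wrel αs (v r / r) * r) (Ioo 0 r₀)) :
    IntegrableOn (density αs R h B v w) (Ioo 0 r₀) := by
  have hp := wSpace_parabola r₀ (1 / R)
  have i3 : IntegrableOn (fun r => (deriv (deriv w) r - 1 / R) ^ 2 * r) (Ioo 0 r₀) := by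
    refine (hw.sub hp.1).integrable_sq_deriv2.congr ?_
    filter_upwards [hw.admissible.ae_deriv2_sub hp.1.admissible] with r hr
    rw [hr, hp.2.2]
  have := ((i1.add (hw.integrable_sq.const_mul (αs * (h ^ 2)⁻¹))).add (i3.const_mul (h ^ 2))).add i4
  refine this.congr (Eventually.of_forall fun r => ?_)
  simp only [Pi.add_apply, density]
  ring

end

/-! ### The second variation identity -/

section

variable {αs r₀ R h : ℝ}

/-- The radial strain produced by the vertical displacement `w`. -/
noncomputable def strain (R : ℝ) (w : ℝ → ℝ) (r : ℝ) : ℝ := (1 / 2) * (r / R - deriv w r) ^ 2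

lemma strain_nonneg (R : ℝ) (w : ℝ → ℝ) (r : ℝ) : 0 ≤ strain R w r := by
  unfold strain; positivity

lemma AdmissibleW.continuousOn_strain {w : ℝ → ℝ} (hw : AdmissibleW r₀ w) (R : ℝ) :
    ContinuousOn (strain R w) (Ioo 0 r₀) := by
  unfold strain
  exact (((continuousOn_id.div_const R).sub hw.continuousOn_deriv).pow 2).const_smul (1 / 2 : ℝ)

lemma WSpace.exists_strain_le (hr₀ : 0 < r₀) (R : ℝ) {w : ℝ → ℝ} (hw : WSpace r₀ w) :
    ∃ K > 0, ∀ r ∈ Ioo 0 r₀, strain R w r ≤ K / √r := by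
  obtain ⟨K, hK, H⟩ := hw.exists_strain_bound hr₀ R
  refine ⟨K, hK, fun r hr => ?_⟩
  have := H r hr
  unfold strain
  nlinarith [sq_nonneg (r / R - deriv w r)]

/-- Half of the first variation of the energy with respect to the normal displacement, in the
direction `y`. -/
noncomputable def firstVar (αs r₀ R h : ℝ) (w s y : ℝ → ℝ) : ℝ :=
  ∫ r in Ioo 0 r₀, (-(s r * (r / R - deriv w r) * deriv y r)
    + αs * (h ^ 2)⁻¹ * (w r * y r * r)
    + h ^ 2 * ((deriv (deriv w) r - 1 / R) * deriv (deriv y) r * r))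

lemma integrableOn_weighted_mul {f g : ℝ → ℝ}
    (mf : AEStronglyMeasurable f (volume.restrict (Ioo 0 r₀)))
    (mg : AEStronglyMeasurable g (volume.restrict (Ioo 0 r₀)))
    (hf : IntegrableOn (fun r => f r ^ 2 * r) (Ioo 0 r₀))
    (hg : IntegrableOn (fun r => g r ^ 2 * r) (Ioo 0 r₀)) :
    IntegrableOn (fun r => f r * g r * r) (Ioo 0 r₀) ∧
    (∫ r in Ioo 0 r₀, f r * g r * r) ^ 2
      ≤ (∫ r in Ioo 0 r₀, f r ^ 2 * r) * ∫ r in Ioo 0 r₀, g r ^ 2 * r := by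
  have ms : AEStronglyMeasurable (fun r : ℝ => √r) (volume.restrict (Ioo 0 r₀)) :=
    Real.continuous_sqrt.aestronglyMeasurable
  have e : ∀ k : ℝ → ℝ, ∀ r ∈ Ioo 0 r₀, k r ^ 2 * r = (√r * k r) ^ 2 := fun k r hr =>
    (sqrt_mul_sq hr.1.le _).symm
  have e' : ∀ r ∈ Ioo 0 r₀, √r * f r * (√r * g r) = f r * g r * r := fun r hr => by
    calc _ = f r * g r * (√r * √r) := by ring
      _ = _ := by rw [Real.mul_self_sqrt hr.1.le]
  have hf' := hf.congr_fun (e f) measurableSet_Ioo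
  have hg' := hg.congr_fun (e g) measurableSet_Ioo
  have h1 := integrable_mul_of_sq (ms.mul mf) (ms.mul mg) hf' hg'
  have h2 := sq_integral_mul_le (ms.mul mf) (ms.mul mg) hf' hg'
  refine ⟨IntegrableOn.congr_fun h1 e' measurableSet_Ioo, ?_⟩
  rw [setIntegral_congr_fun measurableSet_Ioo (e f), setIntegral_congr_fun measurableSet_Ioo (e g),
    ← setIntegral_congr_fun measurableSet_Ioo e']
  exact h2

lemma WSpace.integrable_curvature {w : ℝ → ℝ} (hw : WSpace r₀ w) (c : ℝ) :
    IntegrableOn (fun r => (deriv (deriv w) r - c) ^ 2 * r) (Ioo 0 r₀) := by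
  have hp := wSpace_parabola r₀ c
  refine (hw.sub hp.1).integrable_sq_deriv2.congr ?_
  filter_upwards [hw.admissible.ae_deriv2_sub hp.1.admissible] with r hr
  rw [hr, hp.2.2]

namespace IsEquilibrium

variable {w v s : ℝ → ℝ}

lemma stress_eq (he : IsEquilibrium αs r₀ (strain R w) v s) {r : ℝ} (hr : r ∈ Ioo 0 r₀) :
    stress R v w r = s r / r := by
  unfold stress
  rw [(he.hasDerivAt_v r hr).deriv]
  unfold strain
  ring

lemma exists_bounds (hr₀ : 0 < r₀) (hw : WSpace r₀ w)
    (he : IsEquilibrium αs r₀ (strain R w) v s) :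
    ∃ C > 0, ∀ r ∈ Ioo 0 r₀, s r ≤ C * √r ∧ |v r| ≤ C * √r ∧
      |max (v r / r) (-2 * √αs)| ≤ C / √r ∧ (r / R - deriv w r) ^ 2 ≤ C / √r := by
  obtain ⟨K, hK, H⟩ := hw.exists_strain_bound hr₀ R
  have H' : ∀ r ∈ Ioo 0 r₀, strain R w r ≤ K / √r := fun r hr => by
    have := H r hr
    unfold strain
    nlinarith [sq_nonneg (r / R - deriv w r)]
  have hα := Real.sqrt_nonneg αs
  refine ⟨4 * K + 10 * √αs * √r₀, by positivity, fun r hr => ⟨?_, ?_, ?_, ?_⟩⟩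
  · refine (he.s_le_sqrt (fun r _ => strain_nonneg R w r) H' hr).trans ?_
    gcongr; norm_num
  · refine (he.abs_v_le (fun r _ => strain_nonneg R w r) H' hr).trans ?_
    gcongr; norm_num
  · exact he.abs_max_le (fun r _ => strain_nonneg R w r) H' hr
  · refine (H r hr).trans ?_
    gcongr
    have : 0 ≤ √αs * √r₀ := by positivity
    nlinarith

/-- Changing the normal displacement of an equilibrium keeps the energy finite. -/
lemma integrableOn_density (hr₀ : 0 < r₀) (hα : 0 < αs) (h : ℝ) (hw : WSpace r₀ w)
    (he : IsEquilibrium αs r₀ (strain R w) v s) {w₁ : ℝ → ℝ} (hw₁ : WSpace r₀ w₁) :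
    IntegrableOn (density αs R h (fun _ => 0) v w₁) (Ioo 0 r₀) := by
  obtain ⟨C, hC, H⟩ := he.exists_bounds hr₀ hw
  obtain ⟨K, hK, HK⟩ := hw₁.exists_strain_bound hr₀ R
  have hadm := he.admissible (hw.admissible.continuousOn_strain R)
  have mid : AEStronglyMeasurable (fun r : ℝ => r) (volume.restrict (Ioo 0 r₀)) :=
    measurable_id.aestronglyMeasurable
  refine WrinkledSheet.integrableOn_density hw₁ ?_ ?_
  · refine integrableOn_of_abs_le (g := fun _ => 3 * (C ^ 2 + C ^ 2 + K ^ 2)) measurableSet_Ioo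
      (((aesm_strain R v w₁ aestronglyMeasurable_const).pow 2).mul mid) (integrable_const _) fun r hr => ?_
    have hsr := Real.sqrt_pos.2 hr.1
    have hr1 := hr.1
    have hrs : √r * √r = r := Real.mul_self_sqrt hr.1.le
    obtain ⟨h1, -, -, h2⟩ := H r hr
    have h3 := HK r hr
    have h4 := he.s_nonneg r hr
    rw [abs_of_nonneg (by positivity), (he.hasDerivAt_v r hr).deriv, strain]
    set x := (r / R - deriv w r) ^ 2
    set x₁ := (r / R - deriv w₁ r) ^ 2
    have hx : 0 ≤ x := sq_nonneg _
    have hx₁ : 0 ≤ x₁ := sq_nonneg _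
    have e1 : (s r / r) ^ 2 * r ≤ C ^ 2 := by
      have : s r / r * √r ≤ C := by
        rw [div_mul_eq_mul_div, div_le_iff₀ hr1]; nlinarith
      calc (s r / r) ^ 2 * r = (s r / r * √r) ^ 2 := by rw [mul_pow, Real.sq_sqrt hr1.le]
        _ ≤ C ^ 2 := pow_le_pow_left₀ (by positivity) this 2
    have e2 : x ^ 2 * r ≤ C ^ 2 := by
      have : x * √r ≤ C := by rwa [le_div_iff₀ hsr] at h2
      calc x ^ 2 * r = (x * √r) ^ 2 := by rw [mul_pow, Real.sq_sqrt hr1.le]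
        _ ≤ C ^ 2 := pow_le_pow_left₀ (by positivity) this 2
    have e3 : x₁ ^ 2 * r ≤ K ^ 2 := by
      have : x₁ * √r ≤ K := by rwa [le_div_iff₀ hsr] at h3
      calc x₁ ^ 2 * r = (x₁ * √r) ^ 2 := by rw [mul_pow, Real.sq_sqrt hr1.le]
        _ ≤ K ^ 2 := pow_le_pow_left₀ (by positivity) this 2
    have e4 : (s r / r - 1 / 2 * x + 1 / 2 * x₁ + 0) ^ 2
        ≤ 3 * ((s r / r) ^ 2 + x ^ 2 + x₁ ^ 2) := by
      nlinarith [sq_nonneg (s r / r + x), sq_nonneg (s r / r - x₁), sq_nonneg (x + x₁),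
        sq_nonneg (s r / r + 1 / 2 * x), sq_nonneg (s r / r - 1 / 2 * x₁)]
    calc _ ≤ 3 * ((s r / r) ^ 2 + x ^ 2 + x₁ ^ 2) * r := by gcongr
      _ = 3 * ((s r / r) ^ 2 * r + x ^ 2 * r + x₁ ^ 2 * r) := by ring
      _ ≤ _ := by gcongr
  · refine integrableOn_of_abs_le (g := fun _ => C ^ 2) measurableSet_Ioo
      ((aesm_Wrel_div hα hadm.locallyAC).mul mid) (integrable_const _) fun r hr => ?_
    have hr1 := hr.1
    have hW := Wrel_nonneg hα (v r / r)
    rw [abs_of_nonneg (by positivity)]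
    have h1 := (H r hr).2.1
    calc Wrel αs (v r / r) * r ≤ (v r / r) ^ 2 * r := by
          gcongr; exact Wrel_le_sq hα _
      _ = |v r| ^ 2 / r := by rw [sq_abs]; field_simp
      _ ≤ (C * √r) ^ 2 / r := by gcongr
      _ = C ^ 2 := by rw [mul_pow, Real.sq_sqrt hr1.le]; field_simp

/-- The second variation identity. The energy of a competitor with excess strain `B` exceeds the
energy of an equilibrium by the first variation in the normal displacement, a term linear in `B`
with the stress as coefficient, and nonnegative terms. It is exact, since the energy is quadratic
apart from `Wrel` (whose remainder is `excess`) and the square of the slope inside the strain; the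
latter produces the term `s (w₁ - w)'²`, which has a sign because `0 ≤ s`. -/
theorem energy_identity (hr₀ : 0 < r₀) (hα : 0 < αs) (hh : 0 < h) (hw : WSpace r₀ w)
    (he : IsEquilibrium αs r₀ (strain R w) v s) {B v₁ w₁ : ℝ → ℝ}
    (hv₁ : AdmissibleV r₀ v₁) (hw₁ : AdmissibleW r₀ w₁) (hB : IntegrableOn B (Ioo 0 r₀))
    (hfin : IntegrableOn (density αs R h B v₁ w₁) (Ioo 0 r₀)) :
    IntegrableOn (fun r => s r * B r) (Ioo 0 r₀) ∧
    IntegrableOn (fun r => s r * deriv (fun r => w₁ r - w r) r ^ 2) (Ioo 0 r₀) ∧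
    IntegrableOn (fun r => (deriv v₁ r + (1 / 2) * (r / R - deriv w₁ r) ^ 2 + B r - s r / r) ^ 2
      * r) (Ioo 0 r₀) ∧
    IntegrableOn (fun r => excess αs (v₁ r / r) (v r / r) * r) (Ioo 0 r₀) ∧
    ∫ r in Ioo 0 r₀, density αs R h B v₁ w₁ r =
      (∫ r in Ioo 0 r₀, density αs R h (fun _ => 0) v w r)
      + 2 * (∫ r in Ioo 0 r₀, s r * B r)
      + (∫ r in Ioo 0 r₀, s r * deriv (fun r => w₁ r - w r) r ^ 2)
      + 2 * firstVar αs r₀ R h w s (fun r => w₁ r - w r)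
      + (∫ r in Ioo 0 r₀, (deriv v₁ r + (1 / 2) * (r / R - deriv w₁ r) ^ 2 + B r - s r / r) ^ 2
          * r)
      + (∫ r in Ioo 0 r₀, excess αs (v₁ r / r) (v r / r) * r)
      + αs * (h ^ 2)⁻¹ * (∫ r in Ioo 0 r₀, (w₁ r - w r) ^ 2 * r)
      + h ^ 2 * (∫ r in Ioo 0 r₀, deriv (deriv fun r => w₁ r - w r) r ^ 2 * r) := by
  obtain ⟨C, hC, H⟩ := he.exists_bounds hr₀ hw
  have hadm := he.admissible (hw.admissible.continuousOn_strain R)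
  have hB' := hB.aestronglyMeasurable
  obtain ⟨t1, hw₁', t4⟩ := integrableOn_terms hα hh hv₁.locallyAC hw₁ hB' hfin
  have hy := hw₁'.sub hw
  set y : ℝ → ℝ := fun r => w₁ r - w r with hyd
  obtain ⟨K, hK, HK⟩ := hy.exists_deriv_bound hr₀
  have i0 := he.integrableOn_density hr₀ hα h hw hw
  have mid : AEStronglyMeasurable (fun r : ℝ => r) (volume.restrict (Ioo 0 r₀)) :=
    measurable_id.aestronglyMeasurable
  have ms : AEStronglyMeasurable s (volume.restrict (Ioo 0 r₀)) :=
    aesm_of_continuousOn he.continuousOn_s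
  have hs_le : ∀ r ∈ Ioo 0 r₀, s r ≤ C * √r₀ := fun r hr =>
    (H r hr).1.trans (by gcongr; exact hr.2.le)
  have isv : IntegrableOn (fun r => C / √r) (Ioo 0 r₀) := by
    have := (integrableOn_inv_sqrt r₀).const_mul C
    exact this.congr (Eventually.of_forall fun r => by simp only; ring)
  have iKv : IntegrableOn (fun r => K / √r) (Ioo 0 r₀) := by
    have := (integrableOn_inv_sqrt r₀).const_mul K
    exact this.congr (Eventually.of_forall fun r => by simp only; ring)
  -- the individual terms
  have iB : IntegrableOn (fun r => s r * B r) (Ioo 0 r₀) := by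
    refine integrableOn_of_abs_le measurableSet_Ioo (ms.mul hB') (hB.abs.const_mul (C * √r₀))
      fun r hr => ?_
    rw [abs_mul, abs_of_nonneg (he.s_nonneg r hr)]
    gcongr
    exact hs_le r hr
  have iz : IntegrableOn (fun r => s r * deriv y r ^ 2) (Ioo 0 r₀) := by
    refine integrableOn_of_abs_le measurableSet_Ioo (ms.mul ((aesm_deriv y _).pow 2))
      (iKv.const_mul (C * √r₀)) fun r hr => ?_
    rw [abs_of_nonneg (mul_nonneg (he.s_nonneg r hr) (sq_nonneg _))]
    have := he.s_nonneg r hr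
    gcongr
    · exact hs_le r hr
    · exact HK r hr
  set ρ : ℝ → ℝ := fun r => deriv v₁ r + (1 / 2) * (r / R - deriv w₁ r) ^ 2 + B r - s r / r with hρ
  have mρ : AEStronglyMeasurable ρ (volume.restrict (Ioo 0 r₀)) :=
    (aesm_strain R v₁ w₁ hB').sub
      (aesm_of_continuousOn (he.continuousOn_s.div continuousOn_id fun _ hr => hr.1.ne'))
  have iρ : IntegrableOn (fun r => ρ r ^ 2 * r) (Ioo 0 r₀) := by
    refine integrableOn_of_abs_le measurableSet_Ioo ((mρ.pow 2).mul mid)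
      ((t1.const_mul 2).add (integrable_const (2 * C ^ 2))) fun r hr => ?_
    have hr1 := hr.1
    simp only [Pi.add_apply, hρ]
    rw [abs_of_nonneg (by positivity)]
    set a := deriv v₁ r + (1 / 2) * (r / R - deriv w₁ r) ^ 2 + B r
    have e1 : (s r / r) ^ 2 * r ≤ C ^ 2 := by
      have h4 := he.s_nonneg r hr
      have hrs : √r * √r = r := Real.mul_self_sqrt hr.1.le
      have : s r / r * √r ≤ C := by
        have := Real.sqrt_pos.2 hr1
        rw [div_mul_eq_mul_div, div_le_iff₀ hr1]; nlinarith [(H r hr).1]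
      calc (s r / r) ^ 2 * r = (s r / r * √r) ^ 2 := by rw [mul_pow, Real.sq_sqrt hr1.le]
        _ ≤ C ^ 2 := pow_le_pow_left₀ (by positivity) this 2
    have e2 : (a - s r / r) ^ 2 ≤ 2 * a ^ 2 + 2 * (s r / r) ^ 2 := by
      nlinarith [sq_nonneg (a + s r / r)]
    nlinarith [mul_le_mul_of_nonneg_right e2 hr1.le]
  have my := aesm_of_continuousOn hy.admissible.locallyAC.continuousOn
  have mw := aesm_of_continuousOn hw.admissible.locallyAC.continuousOn
  have ifv : IntegrableOn (fun r => -(s r * (r / R - deriv w r) * deriv y r)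
      + αs * (h ^ 2)⁻¹ * (w r * y r * r)
      + h ^ 2 * ((deriv (deriv w) r - 1 / R) * deriv (deriv y) r * r)) (Ioo 0 r₀) := by
    refine (Integrable.add (Integrable.neg ?_) (Integrable.const_mul ?_ _)).add
      (Integrable.const_mul ?_ _)
    · refine integrableOn_of_abs_le measurableSet_Ioo ?_
        ((isv.add iKv).const_mul (C * √r₀)) fun r hr => ?_
      · have := measurable_deriv w
        exact (ms.mul (by fun_prop : Measurable
          fun r => r / R - deriv w r).aestronglyMeasurable).mul (aesm_deriv y _)
      · have h1 := (H r hr).2.2.2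
        have h2 := HK r hr
        have h3 := he.s_nonneg r hr
        rw [mul_assoc, abs_mul, abs_of_nonneg h3]
        simp only [Pi.add_apply]
        gcongr
        · exact hs_le r hr
        · rw [abs_le]
          constructor
          · nlinarith [sq_nonneg (r / R - deriv w r + deriv y r)]
          · nlinarith [sq_nonneg (r / R - deriv w r - deriv y r)]
    · exact (integrableOn_weighted_mul mw my hw.integrable_sq hy.integrable_sq).1
    · exact (integrableOn_weighted_mul ((aesm_deriv _ _).sub aestronglyMeasurable_const)
        (aesm_deriv _ _) (hw.integrable_curvature (1 / R)) hy.integrable_sq_deriv2).1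
  -- the term `(s d)'` with `d = v₁ - v`, which integrates to zero
  set d : ℝ → ℝ := fun r => v₁ r - v r with hd
  have hdAC : LocallyAC r₀ d := hv₁.locallyAC.sub hadm.locallyAC
  have hderiv_d : ∀ᵐ r ∂(volume.restrict (Ioo 0 r₀)), DifferentiableAt ℝ d r ∧
      deriv d r = ρ r - B r + (r / R - deriv w r) * deriv y r - (1 / 2) * deriv y r ^ 2 := by
    filter_upwards [hv₁.locallyAC.ae_differentiableAt, ae_restrict_mem measurableSet_Ioo]
      with r h1 hr
    have h2 := h1.hasDerivAt.sub (he.hasDerivAt_v r hr)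
    refine ⟨h2.differentiableAt, ?_⟩
    have h3 : deriv d r = deriv v₁ r - (s r / r - strain R w r) := h2.deriv
    rw [h3, hyd, hw₁.deriv_sub hw.admissible hr, hρ, strain]
    ring
  have hbound_d : ∀ᵐ r ∂(volume.restrict (Ioo 0 r₀)),
      |deriv d r| ≤ |ρ r| + |B r| + (C / √r + K / √r + K / √r) := by
    filter_upwards [hderiv_d, ae_restrict_mem measurableSet_Ioo] with r h0 hr
    have h1 := (H r hr).2.2.2
    have h2 := HK r hr
    rw [h0.2, abs_le]
    have b1 := abs_le.1 (le_refl |ρ r|)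
    have b2 := abs_le.1 (le_refl |B r|)
    constructor
    · nlinarith [sq_nonneg (r / R - deriv w r + deriv y r), sq_nonneg (deriv y r),
        sq_nonneg (r / R - deriv w r)]
    · nlinarith [sq_nonneg (r / R - deriv w r - deriv y r), sq_nonneg (deriv y r),
        sq_nonneg (r / R - deriv w r)]
  have idp : ∀ p ∈ Ioo 0 r₀, IntegrableOn (deriv d) (Ioo p r₀) := by
    intro p hp
    have hsub : Ioo p r₀ ⊆ Ioo 0 r₀ := Ioo_subset_Ioo_left hp.1.le
    have ib : IntegrableOn (fun r => (1 + ρ r ^ 2 * r * (1 / p)) + |B r|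
        + (C / √r + K / √r + K / √r)) (Ioo p r₀) :=
      ((((integrable_const (1 : ℝ)).add ((iρ.mono_set hsub).mul_const (1 / p)))).add
        (hB.mono_set hsub).abs).add
        (((isv.mono_set hsub).add (iKv.mono_set hsub)).add (iKv.mono_set hsub))
    refine Integrable.mono' ib (aesm_deriv _ _) ?_
    filter_upwards [ae_restrict_of_ae_restrict_of_subset hsub hbound_d,
      ae_restrict_mem measurableSet_Ioo] with r h1 hr
    rw [Real.norm_eq_abs]
    refine h1.trans ?_
    gcongr
    have : 1 ≤ r * (1 / p) := by
      rw [mul_one_div, one_le_div hp.1]; exact hr.1.le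
    have h2 : ρ r ^ 2 ≤ ρ r ^ 2 * r * (1 / p) := by
      rw [mul_assoc]; exact le_mul_of_one_le_right (sq_nonneg _) this
    nlinarith [sq_nonneg (|ρ r| - 1), sq_abs (ρ r), abs_nonneg (ρ r)]
  have hd0 : Tendsto d (𝓝[>] 0) (𝓝 0) := by simpa using hv₁.zero_at_zero.sub he.v_zero
  obtain ⟨M, hM⟩ : ∃ M, ∀ r ∈ Ioo 0 r₀, |d r| ≤ M := by
    have hev : ∀ᶠ r in 𝓝[>] (0 : ℝ), |d r| < 1 := by
      have := hd0.abs
      rw [abs_zero] at this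
      exact this.eventually (gt_mem_nhds one_pos)
    obtain ⟨q, hq, hq'⟩ := mem_nhdsGT_iff_exists_Ioo_subset.1 hev
    have hq0 : (0 : ℝ) < q := hq
    have hp : min (q / 2) (r₀ / 2) ∈ Ioo 0 r₀ :=
      ⟨lt_min (by linarith) (by linarith), (min_le_right _ _).trans_lt (by linarith)⟩
    obtain ⟨M, hM⟩ := hdAC.exists_bound_right hp (idp _ hp)
    refine ⟨max M 1, fun r hr => ?_⟩
    rcases lt_or_ge r (min (q / 2) (r₀ / 2)) with h | h
    · have : |d r| < 1 := hq' ⟨hr.1, by linarith [min_le_left (q / 2) (r₀ / 2)]⟩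
      exact this.le.trans (le_max_right _ _)
    · exact (hM r ⟨h, hr.2⟩).trans (le_max_left _ _)
  have hM0 : 0 ≤ M := (abs_nonneg _).trans (hM (r₀ / 2) ⟨by linarith, by linarith⟩)
  have hsd : LocallyAC r₀ (fun r => s r * d r) := he.locallyAC_s.mul hdAC
  have hderiv_sd : ∀ᵐ r ∂(volume.restrict (Ioo 0 r₀)), deriv (fun r => s r * d r) r
      = max (v r / r) (-2 * √αs) * d r + s r * deriv d r := by
    filter_upwards [hderiv_d, ae_restrict_mem measurableSet_Ioo] with r h0 hr
    exact ((he.hasDerivAt_s r hr).mul h0.1.hasDerivAt).deriv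
  have isd : IntegrableOn (deriv fun r => s r * d r) (Ioo 0 r₀) := by
    have ib : IntegrableOn (fun r => C / √r * M + (C * (1 + ρ r ^ 2 * r) + C * √r₀ * |B r|
        + C * √r₀ * (C / √r + K / √r + K / √r))) (Ioo 0 r₀) :=
      (isv.mul_const M).add (((((integrable_const (1 : ℝ)).add iρ).const_mul C).add
        (hB.abs.const_mul _)).add (((isv.add iKv).add iKv).const_mul _))
    refine Integrable.mono' ib (aesm_deriv _ _) ?_
    filter_upwards [hderiv_sd, hbound_d, ae_restrict_mem measurableSet_Ioo] with r h1 h2 hr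
    have hr1 := hr.1
    have hsr := Real.sqrt_pos.2 hr1
    have h3 := he.s_nonneg r hr
    rw [Real.norm_eq_abs, h1]
    refine (abs_add_le _ _).trans (add_le_add ?_ ?_)
    · rw [abs_mul]
      have := (H r hr).2.2.1
      have := hM r hr
      gcongr
    · rw [abs_mul, abs_of_nonneg h3]
      have e1 : s r * |ρ r| ≤ C * (1 + ρ r ^ 2 * r) := by
        calc s r * |ρ r| ≤ C * √r * |ρ r| := by gcongr; exact (H r hr).1
          _ = C * (√r * |ρ r|) := by ring
          _ ≤ C * (1 + ρ r ^ 2 * r) := by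
            gcongr
            have : (√r * |ρ r|) ^ 2 = ρ r ^ 2 * r := by rw [sqrt_mul_sq hr1.le, sq_abs]
            rw [← this]
            nlinarith [sq_nonneg (√r * |ρ r| - 1)]
      have e2 : s r * |B r| ≤ C * √r₀ * |B r| := by gcongr; exact hs_le r hr
      have e3 : s r * (C / √r + K / √r + K / √r) ≤ C * √r₀ * (C / √r + K / √r + K / √r) := by
        gcongr; exact hs_le r hr
      calc s r * |deriv d r| ≤ s r * (|ρ r| + |B r| + (C / √r + K / √r + K / √r)) := by gcongr
        _ = s r * |ρ r| + s r * |B r| + s r * (C / √r + K / √r + K / √r) := by ring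
        _ ≤ _ := by linarith
  have vsd : ∫ r in Ioo 0 r₀, deriv (fun r => s r * d r) r = 0 := by
    have := hsd.setIntegral_deriv hr₀ (A := 0) (B := 0) isd
      (by simpa using he.s_zero.mul hd0) ?_
    · simpa using this
    · refine squeeze_zero_norm' (a := fun r => |s r| * M) ?_ ?_
      · filter_upwards [Ioo_mem_nhdsLT hr₀] with r hr
        rw [Real.norm_eq_abs, abs_mul]
        exact mul_le_mul_of_nonneg_left (hM r hr) (abs_nonneg _)
      · simpa using he.s_end.abs.mul_const M
  -- the pointwise identity
  have hpt : ∀ᵐ r ∂(volume.restrict (Ioo 0 r₀)), density αs R h B v₁ w₁ r =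
      (density αs R h (fun _ => 0) v w r + 2 * (s r * B r) + s r * deriv y r ^ 2
      + 2 * (-(s r * (r / R - deriv w r) * deriv y r) + αs * (h ^ 2)⁻¹ * (w r * y r * r)
        + h ^ 2 * ((deriv (deriv w) r - 1 / R) * deriv (deriv y) r * r))
      + ρ r ^ 2 * r + αs * (h ^ 2)⁻¹ * (y r ^ 2 * r) + h ^ 2 * (deriv (deriv y) r ^ 2 * r)
      + 2 * deriv (fun r => s r * d r) r) + excess αs (v₁ r / r) (v r / r) * r := by
    filter_upwards [hderiv_d, hderiv_sd, hw₁.ae_deriv2_sub hw.admissible,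
      ae_restrict_mem measurableSet_Ioo] with r h1 h2 h3 hr
    have hr0 := hr.1.ne'
    have e1 : deriv (fun r => w₁ r - w r) r = deriv w₁ r - deriv w r :=
      hw₁.deriv_sub hw.admissible hr
    have e2 : deriv v r = s r / r - (1 / 2) * (r / R - deriv w r) ^ 2 :=
      (he.hasDerivAt_v r hr).deriv
    have e3 : deriv v₁ r = ρ r + s r / r - (1 / 2) * (r / R - deriv w₁ r) ^ 2 - B r := by
      simp only [hρ]; ring
    rw [h2, h1.2, hyd, h3, e1]
    unfold density excess
    rw [e2, e3]
    simp only [hd]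
    field_simp
    ring
  have i1 := i0.add (iB.const_mul 2)
  have i2 := i1.add iz
  have i3 := i2.add (ifv.const_mul 2)
  have i4 := i3.add iρ
  have i5 := i4.add (hy.integrable_sq.const_mul (αs * (h ^ 2)⁻¹))
  have i6 := i5.add (hy.integrable_sq_deriv2.const_mul (h ^ 2))
  have i7 := i6.add (isd.const_mul 2)
  have iexc : IntegrableOn (fun r => excess αs (v₁ r / r) (v r / r) * r) (Ioo 0 r₀) := by
    refine (hfin.sub i7).congr ?_
    filter_upwards [hpt] with r hr
    simp only [Pi.sub_apply, hr, Pi.add_apply]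
    ring
  refine ⟨iB, iz, iρ, iexc, ?_⟩
  rw [integral_congr_ae hpt, firstVar]
  have v1 := integral_add' i7 iexc
  rw [integral_add' i6 (isd.const_mul 2), integral_add' i5 (hy.integrable_sq_deriv2.const_mul _),
    integral_add' i4 (hy.integrable_sq.const_mul _), integral_add' i3 iρ,
    integral_add' i2 (ifv.const_mul 2), integral_add' i1 iz, integral_add' i0 (iB.const_mul 2),
    integral_const_mul, integral_const_mul, integral_const_mul, integral_const_mul,
    integral_const_mul, vsd] at v1
  refine Eq.trans (integral_congr_ae (Eventually.of_forall fun r => ?_)) (v1.trans ?_)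
  · simp only [Pi.add_apply]
  · ring

end IsEquilibrium

end

/-! ### Existence of equilibria for a given strain -/

section

variable {αs r₀ K : ℝ} {g : ℝ → ℝ}

/-- Radial displacements of finite energy for the given strain `g`; no condition is imposed at the
origin. -/
structure RadialSpace (αs r₀ : ℝ) (g v : ℝ → ℝ) : Prop where
  locallyAC : LocallyAC r₀ v
  integrable_stress : IntegrableOn (fun r => (deriv v r + g r) ^ 2 * r) (Ioo 0 r₀)
  integrable_Wrel : IntegrableOn (fun r => Wrel αs (v r / r) * r) (Ioo 0 r₀)

/-- The energy of a radial displacement for the given strain `g`. -/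
noncomputable def radialEnergy (αs r₀ : ℝ) (g v : ℝ → ℝ) : ℝ :=
  (∫ r in Ioo 0 r₀, (deriv v r + g r) ^ 2 * r) + ∫ r in Ioo 0 r₀, Wrel αs (v r / r) * r

lemma integral_Wrel_nonneg (hα : 0 < αs) (v : ℝ → ℝ) :
    0 ≤ ∫ r in Ioo 0 r₀, Wrel αs (v r / r) * r :=
  setIntegral_nonneg measurableSet_Ioo fun _ hr => mul_nonneg (Wrel_nonneg hα _) hr.1.le

lemma radialEnergy_nonneg (hα : 0 < αs) (v : ℝ → ℝ) : 0 ≤ radialEnergy αs r₀ g v :=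
  add_nonneg (weighted_nonneg fun r => deriv v r + g r) (integral_Wrel_nonneg hα v)

lemma aesm_of_strain (hg : ContinuousOn g (Ioo 0 r₀)) (v : ℝ → ℝ) :
    AEStronglyMeasurable (fun r => deriv v r + g r) (volume.restrict (Ioo 0 r₀)) :=
  (aesm_deriv v _).add (aesm_of_continuousOn hg)

lemma radialSpace_zero (hα : 0 < αs) (hg0 : ∀ r ∈ Ioo 0 r₀, 0 ≤ g r)
    (hgK : ∀ r ∈ Ioo 0 r₀, g r ≤ K / √r) (hgc : ContinuousOn g (Ioo 0 r₀)) :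
    RadialSpace αs r₀ g (fun _ => 0) := by
  refine ⟨locallyAC_of_hasDerivAt (fun r _ => hasDerivAt_const r 0) continuousOn_const, ?_, ?_⟩
  · refine integrableOn_of_abs_le (g := fun _ => K ^ 2) measurableSet_Ioo
      (((aesm_of_strain hgc _).pow 2).mul measurable_id.aestronglyMeasurable)
      (integrable_const _) fun r hr => ?_
    have hr1 := hr.1
    have hsr := Real.sqrt_pos.2 hr1
    have h1 := hgK r hr
    have h2 := hg0 r hr
    rw [le_div_iff₀ hsr] at h1
    simp only [deriv_const, zero_add]
    rw [abs_of_nonneg (by positivity)]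
    calc g r ^ 2 * r = (g r * √r) ^ 2 := by rw [mul_pow, Real.sq_sqrt hr1.le]
      _ ≤ K ^ 2 := pow_le_pow_left₀ (by positivity) h1 2
  · have : ∀ r : ℝ, Wrel αs (0 / r) * r = 0 := fun r => by
      have h1 := Wrel_nonneg hα 0
      have h2 := Wrel_le_sq hα 0
      rw [zero_div, show Wrel αs 0 = 0 by nlinarith, zero_mul]
    simp_rw [this]
    exact integrableOn_zero

/-- The midpoint form of convexity, with the uniformly convex part of the energy kept; it makes
minimizing sequences Cauchy in strain. -/
lemma RadialSpace.midpoint (hα : 0 < αs) (hgc : ContinuousOn g (Ioo 0 r₀)) {v₁ v₂ : ℝ → ℝ}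
    (h₁ : RadialSpace αs r₀ g v₁) (h₂ : RadialSpace αs r₀ g v₂) :
    RadialSpace αs r₀ g (fun r => (1 / 2) * v₁ r + (1 / 2) * v₂ r) ∧
    2 * radialEnergy αs r₀ g (fun r => (1 / 2) * v₁ r + (1 / 2) * v₂ r)
      + (1 / 2) * (∫ r in Ioo 0 r₀, ((deriv v₁ r + g r) - (deriv v₂ r + g r)) ^ 2 * r)
      ≤ radialEnergy αs r₀ g v₁ + radialEnergy αs r₀ g v₂ := by
  set v : ℝ → ℝ := fun r => (1 / 2) * v₁ r + (1 / 2) * v₂ r with hv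
  have hAC : LocallyAC r₀ v := (h₁.locallyAC.const_mul _).add (h₂.locallyAC.const_mul _)
  have hd : ∀ᵐ r ∂(volume.restrict (Ioo 0 r₀)), deriv v r + g r
      = (1 / 2) * (deriv v₁ r + g r) + (1 / 2) * (deriv v₂ r + g r) := by
    filter_upwards [h₁.locallyAC.ae_differentiableAt, h₂.locallyAC.ae_differentiableAt]
      with r d₁ d₂
    have e : deriv v r = (1 / 2) * deriv v₁ r + (1 / 2) * deriv v₂ r :=
      ((d₁.hasDerivAt.const_mul (1 / 2)).add (d₂.hasDerivAt.const_mul (1 / 2))).deriv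
    rw [e]
    ring
  have m₁ := aesm_of_strain hgc v₁
  have m₂ := aesm_of_strain hgc v₂
  have i1 : IntegrableOn (fun r => (deriv v r + g r) ^ 2 * r) (Ioo 0 r₀) := by
    refine (integrableOn_sq_lin m₁ m₂ h₁.integrable_stress h₂.integrable_stress
      (1 / 2) (1 / 2)).congr ?_
    filter_upwards [hd] with r hr
    rw [hr]
  have hWle : ∀ r ∈ Ioo 0 r₀, 2 * (Wrel αs (v r / r) * r)
      ≤ Wrel αs (v₁ r / r) * r + Wrel αs (v₂ r / r) * r := fun r hr => by
    have := Wrel_midpoint_le hα (v₁ r / r) (v₂ r / r)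
    have e : v r / r = (v₁ r / r + v₂ r / r) / 2 := by simp only [hv]; ring
    rw [e]
    nlinarith [mul_le_mul_of_nonneg_right this hr.1.le]
  have i2 : IntegrableOn (fun r => Wrel αs (v r / r) * r) (Ioo 0 r₀) := by
    refine integrableOn_of_abs_le measurableSet_Ioo
      ((aesm_Wrel_div hα hAC).mul measurable_id.aestronglyMeasurable)
      (h₁.integrable_Wrel.add h₂.integrable_Wrel) fun r hr => ?_
    have h0 := mul_nonneg (Wrel_nonneg hα (v r / r)) hr.1.le
    rw [abs_of_nonneg h0]
    have := hWle r hr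
    simp only [Pi.add_apply]
    linarith
  refine ⟨⟨hAC, i1, i2⟩, ?_⟩
  have i3 : IntegrableOn (fun r => ((deriv v₁ r + g r) - (deriv v₂ r + g r)) ^ 2 * r)
      (Ioo 0 r₀) := by
    refine (integrableOn_sq_lin m₁ m₂ h₁.integrable_stress h₂.integrable_stress
      1 (-1)).congr (Eventually.of_forall fun r => ?_)
    simp only
    ring
  have e1 : 2 * (∫ r in Ioo 0 r₀, (deriv v r + g r) ^ 2 * r)
      + (1 / 2) * (∫ r in Ioo 0 r₀, ((deriv v₁ r + g r) - (deriv v₂ r + g r)) ^ 2 * r)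
      = (∫ r in Ioo 0 r₀, (deriv v₁ r + g r) ^ 2 * r)
        + ∫ r in Ioo 0 r₀, (deriv v₂ r + g r) ^ 2 * r := by
    rw [← integral_const_mul, ← integral_const_mul,
      ← integral_add (i1.const_mul 2) (i3.const_mul (1 / 2)),
      ← integral_add h₁.integrable_stress h₂.integrable_stress]
    refine integral_congr_ae ?_
    filter_upwards [hd] with r hr
    simp only [hr]
    ring
  have e2 : 2 * (∫ r in Ioo 0 r₀, Wrel αs (v r / r) * r)
      ≤ (∫ r in Ioo 0 r₀, Wrel αs (v₁ r / r) * r) + ∫ r in Ioo 0 r₀, Wrel αs (v₂ r / r) * r := by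
    rw [← integral_const_mul, ← integral_add h₁.integrable_Wrel h₂.integrable_Wrel]
    exact setIntegral_mono_on (i2.const_mul 2) (h₁.integrable_Wrel.add h₂.integrable_Wrel)
      measurableSet_Ioo hWle
  unfold radialEnergy
  linarith

lemma integrableOn_of_Wrel (hα : 0 < αs) {v : ℝ → ℝ} (hv : LocallyAC r₀ v)
    (hW : IntegrableOn (fun r => Wrel αs (v r / r) * r) (Ioo 0 r₀)) :
    IntegrableOn v (Ioo 0 r₀) ∧
    4 * √αs * (∫ r in Ioo 0 r₀, |v r|)
      ≤ (∫ r in Ioo 0 r₀, Wrel αs (v r / r) * r) + 4 * αs * ∫ r in Ioo 0 r₀, r := by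
  have ha := Real.sqrt_pos.2 hα
  have hpt : ∀ r ∈ Ioo 0 r₀, 4 * √αs * |v r| ≤ Wrel αs (v r / r) * r + 4 * αs * r := fun r hr => by
    have h1 := abs_le_Wrel hα (v r / r)
    have h2 := mul_le_mul_of_nonneg_right h1 hr.1.le
    have h3 : |v r / r| * r = |v r| := by
      rw [abs_div, abs_of_pos hr.1]; field_simp [hr.1.ne']
    nlinarith
  have i2 := hW.add ((integrableOn_id_Ioo r₀).const_mul (4 * αs))
  have i1 : IntegrableOn v (Ioo 0 r₀) := by
    refine integrableOn_of_abs_le measurableSet_Ioo (aesm_of_continuousOn hv.continuousOn)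
      (i2.const_mul (4 * √αs)⁻¹) fun r hr => ?_
    rw [← div_eq_inv_mul, le_div_iff₀ (by positivity)]
    have := hpt r hr
    simp only [Pi.add_apply]
    linarith
  refine ⟨i1, ?_⟩
  rw [← integral_const_mul, ← integral_const_mul, ← integral_add hW
    ((integrableOn_id_Ioo r₀).const_mul (4 * αs))]
  exact setIntegral_mono_on (i1.abs.const_mul _) i2 measurableSet_Ioo hpt

/-- A displacement of bounded energy is bounded at the middle of the interval. -/
lemma RadialSpace.exists_mid_bound (hr₀ : 0 < r₀) (hα : 0 < αs) (hgc : ContinuousOn g (Ioo 0 r₀))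
    (E : ℝ) : ∃ M, ∀ v, RadialSpace αs r₀ g v → radialEnergy αs r₀ g v ≤ E →
      |v (r₀ / 2)| ≤ M := by
  have ha := Real.sqrt_pos.2 hα
  have hsub : Icc (r₀ / 2) (3 * r₀ / 4) ⊆ Ioo 0 r₀ := fun x hx =>
    ⟨by linarith [hx.1], by linarith [hx.2]⟩
  have hle : r₀ / 2 ≤ 3 * r₀ / 4 := by linarith
  have hgi : IntervalIntegrable g volume (r₀ / 2) (3 * r₀ / 4) :=
    (hgc.mono (by rwa [uIcc_of_le hle])).intervalIntegrable
  set G := ∫ t in (r₀ / 2)..(3 * r₀ / 4), |g t| with hG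
  set D := 4 * αs * ∫ r in Ioo 0 r₀, r with hD
  refine ⟨(E + D) / (4 * √αs) / (r₀ / 4) + √(E * (2 * √r₀ / √(r₀ / 2))) + G, fun v hv hE => ?_⟩
  have hA := weighted_nonneg (r₀ := r₀) fun r => deriv v r + g r
  have hW := integral_Wrel_nonneg (r₀ := r₀) hα v
  unfold radialEnergy at hE
  obtain ⟨iv, hv1⟩ := integrableOn_of_Wrel hα hv.locallyAC hv.integrable_Wrel
  have iabs : IntervalIntegrable (fun r => |v r|) volume (r₀ / 2) (3 * r₀ / 4) :=
    intervalIntegrable_of_integrableOn_Ioo iv.abs ⟨by linarith, by linarith⟩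
      ⟨by linarith, by linarith⟩
  obtain ⟨c, hc, hc'⟩ := exists_mul_le_integral (by linarith) iabs
  have h1 : ∫ t in (r₀ / 2)..(3 * r₀ / 4), |v t| ≤ ∫ r in Ioo 0 r₀, |v r| := by
    rw [intervalIntegral.integral_of_le hle]
    refine setIntegral_mono_set iv.abs (Eventually.of_forall fun _ => abs_nonneg _) ?_
    exact (Ioc_subset_Icc_self.trans hsub).eventuallyLE
  have hvc : |v c| ≤ (E + D) / (4 * √αs) / (r₀ / 4) := by
    rw [le_div_iff₀ (by positivity), le_div_iff₀ (by positivity)]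
    have : 3 * r₀ / 4 - r₀ / 2 = r₀ / 4 := by ring
    rw [this] at hc'
    nlinarith
  have hcI : c ∈ Ioo 0 r₀ := hsub (Ioo_subset_Icc_self hc)
  have hpI : r₀ / 2 ∈ Ioo 0 r₀ := hsub ⟨le_rfl, hle⟩
  obtain ⟨j1, j2⟩ := sq_integral_abs_le hpI.1 hc.1.le hcI.2 (aesm_of_strain hgc v)
    hv.integrable_stress
  have hsq : ∫ t in (r₀ / 2)..c, |deriv v t + g t| ≤ √(E * (2 * √r₀ / √(r₀ / 2))) := by
    apply Real.le_sqrt_of_sq_le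
    refine j2.trans ?_
    gcongr
    linarith
  have hgi' : IntervalIntegrable g volume (r₀ / 2) c := hgi.mono_set (by
    rw [uIcc_of_le hc.1.le, uIcc_of_le hle]; exact Icc_subset_Icc le_rfl hc.2.le)
  have hdiff : |v c - v (r₀ / 2)| ≤ √(E * (2 * √r₀ / √(r₀ / 2))) + G := by
    rw [← hv.locallyAC.integral_deriv hpI hcI]
    calc |∫ t in (r₀ / 2)..c, deriv v t|
        ≤ ∫ t in (r₀ / 2)..c, |deriv v t| := intervalIntegral.abs_integral_le_integral_abs hc.1.le
      _ ≤ ∫ t in (r₀ / 2)..c, (|deriv v t + g t| + |g t|) := by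
          refine intervalIntegral.integral_mono hc.1.le
            (hv.locallyAC.intervalIntegrable_deriv hpI hcI).abs (j1.abs.add hgi'.abs) fun t => ?_
          have := abs_sub (deriv v t + g t) (g t)
          simpa using this
      _ = (∫ t in (r₀ / 2)..c, |deriv v t + g t|) + ∫ t in (r₀ / 2)..c, |g t| :=
          intervalIntegral.integral_add j1.abs hgi'.abs
      _ ≤ _ := by
          gcongr
          exact intervalIntegral.integral_mono_interval le_rfl hc.1.le hc.2.le
            (Eventually.of_forall fun _ => abs_nonneg _) hgi.abs
  have : |v (r₀ / 2)| ≤ |v c| + |v c - v (r₀ / 2)| := by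
    have := abs_sub (v c) (v c - v (r₀ / 2))
    simpa using this
  linarith

/-- The direct method for the radial energy. -/
lemma exists_radial_minimizer (hr₀ : 0 < r₀) (hα : 0 < αs) (hg0 : ∀ r ∈ Ioo 0 r₀, 0 ≤ g r)
    (hgK : ∀ r ∈ Ioo 0 r₀, g r ≤ K / √r) (hgc : ContinuousOn g (Ioo 0 r₀)) :
    ∃ v, RadialSpace αs r₀ g v ∧
      ∀ v', RadialSpace αs r₀ g v' → radialEnergy αs r₀ g v ≤ radialEnergy αs r₀ g v' := by
  set S : Set ℝ := radialEnergy αs r₀ g '' {v | RadialSpace αs r₀ g v}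
  have hSne : S.Nonempty := ⟨_, _, radialSpace_zero hα hg0 hgK hgc, rfl⟩
  have hSbdd : BddBelow S := ⟨0, by rintro _ ⟨v, -, rfl⟩; exact radialEnergy_nonneg hα v⟩
  set m := sInf S
  have hmle : ∀ v, RadialSpace αs r₀ g v → m ≤ radialEnergy αs r₀ g v := fun v hv =>
    csInf_le hSbdd ⟨v, hv, rfl⟩
  have hex : ∀ n : ℕ, ∃ v, RadialSpace αs r₀ g v ∧
      radialEnergy αs r₀ g v < m + 1 / ((n : ℝ) + 1) := fun n => by
    obtain ⟨_, ⟨v, hv, rfl⟩, h⟩ := exists_lt_of_csInf_lt hSne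
      (show sInf S < m + 1 / ((n : ℝ) + 1) by
        have : (0 : ℝ) < 1 / ((n : ℝ) + 1) := by positivity
        linarith)
    exact ⟨v, hv, h⟩
  choose V hV hVE using hex
  have hone : ∀ {N n : ℕ}, N ≤ n → 1 / ((n : ℝ) + 1) ≤ 1 / ((N : ℝ) + 1) := fun h => by
    gcongr
  obtain ⟨σ, hσm, hσi, hσt⟩ := exists_weighted_limit (r₀ := r₀)
    (f := fun n r => deriv (V n) r + g r)
    (fun n => aesm_of_strain hgc (V n)) (fun n => (hV n).integrable_stress) (by
      intro ε hε
      obtain ⟨N, hN⟩ := exists_nat_one_div_lt (show (0 : ℝ) < ε / 4 by positivity)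
      refine ⟨N, fun a ha b hb => ?_⟩
      obtain ⟨h1, h2⟩ := (hV a).midpoint hα hgc (hV b)
      have h3 := hmle _ h1
      have h4 := hVE a
      have h5 := hVE b
      have h6 := hone ha
      have h7 := hone hb
      linarith)
  obtain ⟨M, hM⟩ := RadialSpace.exists_mid_bound hr₀ hα hgc (m + 1)
  have hVM : ∀ n, V n (r₀ / 2) ∈ Icc (-M) M := fun n => by
    refine abs_le.1 (hM _ (hV n) ((hVE n).le.trans ?_))
    have := hone (Nat.zero_le n)
    norm_num at this ⊢
    linarith
  obtain ⟨c, -, φ, hφ, hc⟩ := isCompact_Icc.tendsto_subseq hVM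
  have hpI : r₀ / 2 ∈ Ioo 0 r₀ := ⟨by linarith, by linarith⟩
  have hloc : ∀ a b, 0 < a → a ≤ b → b < r₀ →
      IntervalIntegrable (fun r => σ r - g r) volume a b := fun a b ha hab hb => by
    refine (sq_integral_abs_le ha hab hb hσm hσi).1.sub (ContinuousOn.intervalIntegrable ?_)
    refine hgc.mono ?_
    rw [uIcc_of_le hab]
    exact fun x hx => ⟨ha.trans_le hx.1, hx.2.trans_lt hb⟩
  set v : ℝ → ℝ := fun r => c + ∫ t in (r₀ / 2)..r, (σ t - g t) with hv
  have hvAC : LocallyAC r₀ v := locallyAC_primitive hpI hloc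
  have hvd : ∀ᵐ r ∂(volume.restrict (Ioo 0 r₀)), deriv v r + g r = σ r := by
    filter_upwards [ae_deriv_primitive (c := c) hpI hloc] with r hr
    rw [hr.deriv]; ring
  have i1 : IntegrableOn (fun r => (deriv v r + g r) ^ 2 * r) (Ioo 0 r₀) := by
    refine hσi.congr ?_
    filter_upwards [hvd] with r hr
    rw [hr]
  -- pointwise convergence along the subsequence
  have hptw : ∀ r ∈ Ioo 0 r₀, Tendsto (fun n => V (φ n) r) atTop (𝓝 (v r)) := by
    intro r hr
    have hb : ∀ n, (V (φ n) r - v r - (V (φ n) (r₀ / 2) - c)) ^ 2 ≤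
        (∫ t in Ioo 0 r₀, ((deriv (V (φ n)) t + g t) - σ t) ^ 2 * t)
          * (2 * √r₀ / √(min (r₀ / 2) r)) := by
      intro n
      have hAC := (hV (φ n)).locallyAC.sub hvAC
      have hae : ∀ᵐ t ∂(volume.restrict (Ioo 0 r₀)), deriv (fun t => V (φ n) t - v t) t
          = (deriv (V (φ n)) t + g t) - σ t := by
        filter_upwards [hvd, hvAC.ae_differentiableAt, (hV (φ n)).locallyAC.ae_differentiableAt]
          with t h1 h2 h3
        have e : deriv (fun t => V (φ n) t - v t) t = deriv (V (φ n)) t - deriv v t :=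
          (h3.hasDerivAt.sub h2.hasDerivAt).deriv
        rw [e, ← h1]
        ring
      have hi : IntegrableOn (fun t => deriv (fun t => V (φ n) t - v t) t ^ 2 * t) (Ioo 0 r₀) := by
        refine (integrableOn_sq_lin (aesm_of_strain hgc (V (φ n))) hσm
          (hV (φ n)).integrable_stress hσi 1 (-1)).congr ?_
        filter_upwards [hae] with t ht
        rw [ht]; ring
      have h1 := hAC.sq_sub_le hpI hr hi
      have h2 : v (r₀ / 2) = c := by simp [hv]
      have h3 : ∫ t in Ioo 0 r₀, deriv (fun t => V (φ n) t - v t) t ^ 2 * t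
          = ∫ t in Ioo 0 r₀, ((deriv (V (φ n)) t + g t) - σ t) ^ 2 * t :=
        integral_congr_ae (by filter_upwards [hae] with t ht; rw [ht])
      rw [h3, h2] at h1
      exact h1
    have h0 : Tendsto (fun n => (V (φ n) r - v r - (V (φ n) (r₀ / 2) - c)) ^ 2) atTop (𝓝 0) := by
      refine squeeze_zero (fun n => sq_nonneg _) hb ?_
      have := (hσt.comp hφ.tendsto_atTop).mul_const (2 * √r₀ / √(min (r₀ / 2) r))
      simpa using this
    have h1 : Tendsto (fun n => V (φ n) r - v r - (V (φ n) (r₀ / 2) - c)) atTop (𝓝 0) := by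
      have := h0.sqrt
      simp only [Real.sqrt_sq_eq_abs, Real.sqrt_zero] at this
      exact tendsto_zero_iff_abs_tendsto_zero _ |>.2 this
    have h2 : Tendsto (fun n => V (φ n) (r₀ / 2) - c) atTop (𝓝 0) := by
      have := hc.sub_const c
      simpa using this
    have h3 := (h1.add h2).add_const (v r)
    simpa using h3
  -- lower semicontinuity
  set b := ∫ r in Ioo 0 r₀, σ r ^ 2 * r with hb
  set δ : ℕ → ℝ := fun n => ∫ r in Ioo 0 r₀, ((deriv (V (φ n)) r + g r) - σ r) ^ 2 * r with hδ
  have hδt : Tendsto δ atTop (𝓝 0) := hσt.comp hφ.tendsto_atTop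
  have hbn : ∀ n, b - 2 * √(b * δ n) ≤ ∫ r in Ioo 0 r₀, (deriv (V (φ n)) r + g r) ^ 2 * r := by
    intro n
    have mm : AEStronglyMeasurable (fun r => (deriv (V (φ n)) r + g r) - σ r)
        (volume.restrict (Ioo 0 r₀)) := (aesm_of_strain hgc (V (φ n))).sub hσm
    have ii : IntegrableOn (fun r => ((deriv (V (φ n)) r + g r) - σ r) ^ 2 * r) (Ioo 0 r₀) := by
      refine (integrableOn_sq_lin (aesm_of_strain hgc (V (φ n))) hσm
          (hV (φ n)).integrable_stress hσi 1 (-1)).congr (Eventually.of_forall fun t => ?_)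
      simp only; ring
    obtain ⟨k1, k2⟩ := integrableOn_weighted_mul hσm mm hσi ii
    have k3 : -√(b * δ n) ≤
        ∫ r in Ioo 0 r₀, σ r * ((deriv (V (φ n)) r + g r) - σ r) * r :=
      (abs_le.1 (Real.abs_le_sqrt k2)).1
    have k4 : b + 2 * (∫ r in Ioo 0 r₀, σ r * ((deriv (V (φ n)) r + g r) - σ r) * r)
        ≤ ∫ r in Ioo 0 r₀, (deriv (V (φ n)) r + g r) ^ 2 * r := by
      rw [hb, ← integral_const_mul, ← integral_add hσi (k1.const_mul 2)]
      refine setIntegral_mono_on (hσi.add (k1.const_mul 2)) (hV (φ n)).integrable_stress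
        measurableSet_Ioo fun r hr => ?_
      have : 0 ≤ ((deriv (V (φ n)) r + g r) - σ r) ^ 2 * r := mul_nonneg (sq_nonneg _) hr.1.le
      nlinarith
    linarith
  set ub : ℕ → ℝ := fun n => m + 1 / ((φ n : ℝ) + 1) - b + 2 * √(b * δ n) with hub
  have hubt : Tendsto ub atTop (𝓝 (m - b)) := by
    have h1 : Tendsto (fun n => 1 / ((φ n : ℝ) + 1)) atTop (𝓝 0) :=
      tendsto_one_div_add_atTop_nhds_zero_nat.comp hφ.tendsto_atTop
    have h2 : Tendsto (fun n => √(b * δ n)) atTop (𝓝 0) := by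
      have := (hδt.const_mul b).sqrt
      simpa using this
    have := ((h1.const_add m).sub_const b).add (h2.const_mul 2)
    simpa [hub] using this
  have hWub : ∀ n, ∫ r in Ioo 0 r₀, Wrel αs (V (φ n) r / r) * r ≤ ub n := by
    intro n
    have h1 := hVE (φ n)
    have h2 := hbn n
    unfold radialEnergy at h1
    simp only [hub]
    linarith
  have hmb : 0 ≤ m - b := ge_of_tendsto hubt
    (Eventually.of_forall fun n => (integral_Wrel_nonneg hα _).trans (hWub n))
  have hnn : ∀ u : ℝ → ℝ, 0 ≤ᵐ[volume.restrict (Ioo 0 r₀)] fun r => Wrel αs (u r / r) * r :=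
    fun u => (ae_restrict_iff' measurableSet_Ioo).2 (Eventually.of_forall fun t ht =>
      mul_nonneg (Wrel_nonneg hα _) ht.1.le)
  have hfatou : ∫⁻ r in Ioo 0 r₀, ENNReal.ofReal (Wrel αs (v r / r) * r)
      ≤ ENNReal.ofReal (m - b) := by
    calc ∫⁻ r in Ioo 0 r₀, ENNReal.ofReal (Wrel αs (v r / r) * r)
        ≤ ∫⁻ r in Ioo 0 r₀, liminf (fun n => ENNReal.ofReal (Wrel αs (V (φ n) r / r) * r))
            atTop := by
          refine setLIntegral_mono' measurableSet_Ioo fun r hr => ?_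
          have h1 : Tendsto (fun n => ENNReal.ofReal (Wrel αs (V (φ n) r / r) * r)) atTop
              (𝓝 (ENNReal.ofReal (Wrel αs (v r / r) * r))) :=
            ENNReal.tendsto_ofReal ((((continuous_Wrel hα).tendsto _).comp
              ((hptw r hr).div_const r)).mul_const r)
          exact h1.liminf_eq.ge
      _ ≤ liminf (fun n => ∫⁻ r in Ioo 0 r₀, ENNReal.ofReal (Wrel αs (V (φ n) r / r) * r))
            atTop :=
          lintegral_liminf_le' fun n =>
            (hV (φ n)).integrable_Wrel.aestronglyMeasurable.aemeasurable.ennreal_ofReal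
      _ ≤ liminf (fun n => ENNReal.ofReal (ub n)) atTop := by
          refine liminf_le_liminf (Eventually.of_forall fun n => ?_)
          rw [← ofReal_integral_eq_lintegral_ofReal (hV (φ n)).integrable_Wrel (hnn _)]
          exact ENNReal.ofReal_le_ofReal (hWub n)
      _ = ENNReal.ofReal (m - b) := (ENNReal.tendsto_ofReal hubt).liminf_eq
  have i2 : IntegrableOn (fun r => Wrel αs (v r / r) * r) (Ioo 0 r₀) := by
    refine ⟨(aesm_Wrel_div hα hvAC).mul measurable_id.aestronglyMeasurable, ?_⟩
    rw [hasFiniteIntegral_iff_ofReal (hnn v)]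
    exact hfatou.trans_lt ENNReal.ofReal_lt_top
  refine ⟨v, ⟨hvAC, i1, i2⟩, fun v' hv' => le_trans ?_ (hmle v' hv')⟩
  rw [← ofReal_integral_eq_lintegral_ofReal i2 (hnn v), ENNReal.ofReal_le_ofReal_iff hmb] at hfatou
  have e : ∫ r in Ioo 0 r₀, (deriv v r + g r) ^ 2 * r = b :=
    integral_congr_ae (by filter_upwards [hvd] with r hr; rw [hr])
  unfold radialEnergy
  rw [e]
  linarith

end

/-! ### The Euler–Lagrange equations of a radial minimizer -/

section

variable {αs r₀ K : ℝ} {g v : ℝ → ℝ}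

lemma eq_zero_of_forall_quadratic {a b : ℝ} (h : ∀ t : ℝ, 0 ≤ t * a + t ^ 2 * b) : a = 0 := by
  by_contra ha
  have hb : 0 < |b| + 1 := by positivity
  have h1 := h (-a / (2 * (|b| + 1)))
  have h2 : -a / (2 * (|b| + 1)) * a + (-a / (2 * (|b| + 1))) ^ 2 * b
      = a ^ 2 / (4 * (|b| + 1) ^ 2) * (b - 2 * (|b| + 1)) := by field_simp; ring
  rw [h2] at h1
  have h3 : 0 < a ^ 2 / (4 * (|b| + 1) ^ 2) := by positivity
  have h4 : b - 2 * (|b| + 1) < 0 := by linarith [le_abs_self b, abs_nonneg b]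
  nlinarith

lemma continuousOn_max_div (hv : LocallyAC r₀ v) :
    ContinuousOn (fun r => max (v r / r) (-2 * √αs)) (Ioo 0 r₀) :=
  ContinuousOn.sup (hv.continuousOn.div continuousOn_id fun _ hr => hr.1.ne') continuousOn_const

lemma RadialSpace.integrable_max_sq (hα : 0 < αs) (hv : RadialSpace αs r₀ g v) :
    IntegrableOn (fun r => max (v r / r) (-2 * √αs) ^ 2 * r) (Ioo 0 r₀) := by
  refine integrableOn_of_abs_le measurableSet_Ioo
    (((aesm_of_continuousOn (continuousOn_max_div hv.locallyAC)).pow 2).mul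
      measurable_id.aestronglyMeasurable)
    (hv.integrable_Wrel.add ((integrableOn_id_Ioo r₀).const_mul (4 * αs))) fun r hr => ?_
  rw [abs_of_nonneg (mul_nonneg (sq_nonneg _) hr.1.le)]
  have := mul_le_mul_of_nonneg_right (sq_max_le_Wrel hα (v r / r)) hr.1.le
  simp only [Pi.add_apply]
  linarith

/-- The Euler–Lagrange equation of a radial minimizer in weak form. -/
lemma radial_weak_equation (hα : 0 < αs) (hgc : ContinuousOn g (Ioo 0 r₀))
    (hv : RadialSpace αs r₀ g v)
    (hmin : ∀ v', RadialSpace αs r₀ g v' → radialEnergy αs r₀ g v ≤ radialEnergy αs r₀ g v')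
    {φ : ℝ → ℝ} (hφ : LocallyAC r₀ φ)
    (hφ1 : IntegrableOn (fun r => deriv φ r ^ 2 * r) (Ioo 0 r₀))
    (hφ0 : IntegrableOn (fun r => (φ r / r) ^ 2 * r) (Ioo 0 r₀)) :
    IntegrableOn (fun r => (deriv v r + g r) * deriv φ r * r) (Ioo 0 r₀) ∧
    IntegrableOn (fun r => max (v r / r) (-2 * √αs) * (φ r / r) * r) (Ioo 0 r₀) ∧
    (∫ r in Ioo 0 r₀, (deriv v r + g r) * deriv φ r * r)
      + ∫ r in Ioo 0 r₀, max (v r / r) (-2 * √αs) * (φ r / r) * r = 0 := by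
  have mφ : AEStronglyMeasurable (fun r => φ r / r) (volume.restrict (Ioo 0 r₀)) :=
    aesm_of_continuousOn (hφ.continuousOn.div continuousOn_id fun _ hr => hr.1.ne')
  have mm := aesm_of_continuousOn (continuousOn_max_div (αs := αs) hv.locallyAC)
  have mσ := aesm_of_strain hgc v
  obtain ⟨i1, -⟩ := integrableOn_weighted_mul mσ (aesm_deriv φ _) hv.integrable_stress hφ1
  obtain ⟨i2, -⟩ := integrableOn_weighted_mul mm mφ (hv.integrable_max_sq hα) hφ0
  refine ⟨i1, i2, ?_⟩
  set a := (∫ r in Ioo 0 r₀, (deriv v r + g r) * deriv φ r * r)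
      + ∫ r in Ioo 0 r₀, max (v r / r) (-2 * √αs) * (φ r / r) * r
  set b := (∫ r in Ioo 0 r₀, deriv φ r ^ 2 * r) + ∫ r in Ioo 0 r₀, (φ r / r) ^ 2 * r
  suffices h : ∀ t : ℝ, 0 ≤ t * (2 * a) + t ^ 2 * b by
    have := eq_zero_of_forall_quadratic h
    linarith
  intro t
  set u : ℝ → ℝ := fun r => v r + t * φ r with hu
  have huAC : LocallyAC r₀ u := hv.locallyAC.add (hφ.const_mul t)
  have hd : ∀ᵐ r ∂(volume.restrict (Ioo 0 r₀)),
      deriv u r + g r = 1 * (deriv v r + g r) + t * deriv φ r := by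
    filter_upwards [hv.locallyAC.ae_differentiableAt, hφ.ae_differentiableAt] with r d₁ d₂
    have e : deriv u r = deriv v r + t * deriv φ r :=
      (d₁.hasDerivAt.add (d₂.hasDerivAt.const_mul t)).deriv
    rw [e]; ring
  have j1 : IntegrableOn (fun r => (deriv u r + g r) ^ 2 * r) (Ioo 0 r₀) := by
    refine (integrableOn_sq_lin mσ (aesm_deriv φ _) hv.integrable_stress hφ1 1 t).congr ?_
    filter_upwards [hd] with r hr
    rw [hr]
  have hWle : ∀ r ∈ Ioo 0 r₀, Wrel αs (u r / r) * r ≤ Wrel αs (v r / r) * r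
      + 2 * t * (max (v r / r) (-2 * √αs) * (φ r / r) * r) + t ^ 2 * ((φ r / r) ^ 2 * r) := by
    intro r hr
    have h1 := excess_le_sq hα (u r / r) (v r / r)
    have e : u r / r - v r / r = t * (φ r / r) := by simp only [hu]; ring
    unfold excess at h1
    rw [e] at h1
    nlinarith [mul_le_mul_of_nonneg_right h1 hr.1.le]
  have jb := (hv.integrable_Wrel.add (i2.const_mul (2 * t))).add (hφ0.const_mul (t ^ 2))
  have j2 : IntegrableOn (fun r => Wrel αs (u r / r) * r) (Ioo 0 r₀) := by
    refine integrableOn_of_abs_le measurableSet_Ioo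
      ((aesm_Wrel_div hα huAC).mul measurable_id.aestronglyMeasurable) jb fun r hr => ?_
    rw [abs_of_nonneg (mul_nonneg (Wrel_nonneg hα _) hr.1.le)]
    exact hWle r hr
  have h1 := hmin u ⟨huAC, j1, j2⟩
  have e1 : ∫ r in Ioo 0 r₀, (deriv u r + g r) ^ 2 * r
      = (∫ r in Ioo 0 r₀, (deriv v r + g r) ^ 2 * r)
        + 2 * t * (∫ r in Ioo 0 r₀, (deriv v r + g r) * deriv φ r * r)
        + t ^ 2 * ∫ r in Ioo 0 r₀, deriv φ r ^ 2 * r := by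
    have jc : IntegrableOn (fun r => (deriv v r + g r) ^ 2 * r
        + 2 * t * ((deriv v r + g r) * deriv φ r * r)) (Ioo 0 r₀) :=
      hv.integrable_stress.add (i1.const_mul (2 * t))
    rw [← integral_const_mul, ← integral_const_mul,
      ← integral_add hv.integrable_stress (i1.const_mul (2 * t)),
      ← integral_add jc (hφ1.const_mul (t ^ 2))]
    refine integral_congr_ae ?_
    filter_upwards [hd] with r hr
    rw [hr]
    ring
  have e2 : ∫ r in Ioo 0 r₀, Wrel αs (u r / r) * r
      ≤ (∫ r in Ioo 0 r₀, Wrel αs (v r / r) * r)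
        + 2 * t * (∫ r in Ioo 0 r₀, max (v r / r) (-2 * √αs) * (φ r / r) * r)
        + t ^ 2 * ∫ r in Ioo 0 r₀, (φ r / r) ^ 2 * r := by
    have jc : IntegrableOn (fun r => Wrel αs (v r / r) * r
        + 2 * t * (max (v r / r) (-2 * √αs) * (φ r / r) * r)) (Ioo 0 r₀) :=
      hv.integrable_Wrel.add (i2.const_mul (2 * t))
    rw [← integral_const_mul, ← integral_const_mul,
      ← integral_add hv.integrable_Wrel (i2.const_mul (2 * t)),
      ← integral_add jc (hφ0.const_mul (t ^ 2))]
    exact setIntegral_mono_on j2 jb measurableSet_Ioo hWle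
  unfold radialEnergy at h1
  rw [e1] at h1
  simp only [a, b]
  nlinarith

/-- The weighted stress of a radial minimizer is the primitive, vanishing at the outer boundary,
of the reaction of the azimuthal energy. -/
lemma radial_strong_equation (hr₀ : 0 < r₀) (hα : 0 < αs) (hgc : ContinuousOn g (Ioo 0 r₀))
    (hv : RadialSpace αs r₀ g v)
    (hmin : ∀ v', RadialSpace αs r₀ g v' → radialEnergy αs r₀ g v ≤ radialEnergy αs r₀ g v') :
    ∃ s : ℝ → ℝ, (∀ r ∈ Ioo 0 r₀, HasDerivAt s (max (v r / r) (-2 * √αs)) r) ∧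
      (∀ r ∈ Ioo 0 r₀, HasDerivAt v (s r / r - g r) r) ∧ Tendsto s (𝓝[<] r₀) (𝓝 0) := by
  set m : ℝ → ℝ := fun r => max (v r / r) (-2 * √αs) with hm
  have hmc : ContinuousOn m (Ioo 0 r₀) := continuousOn_max_div hv.locallyAC
  have hm2 := hv.integrable_max_sq hα
  -- `m` is integrable away from the origin
  have hmi : ∀ p ∈ Ioo 0 r₀, IntervalIntegrable m volume p r₀ := by
    intro p hp
    rw [intervalIntegrable_iff_integrableOn_Ioo_of_le hp.2.le]
    have hsub : Ioo p r₀ ⊆ Ioo 0 r₀ := Ioo_subset_Ioo_left hp.1.le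
    refine integrableOn_of_abs_le measurableSet_Ioo
      ((hmc.mono hsub).aestronglyMeasurable measurableSet_Ioo)
      ((integrable_const (1 : ℝ)).add ((hm2.mono_set hsub).mul_const (1 / p))) fun r hr => ?_
    have : 1 ≤ r * (1 / p) := by
      rw [mul_one_div, one_le_div hp.1]; exact hr.1.le
    have h2 : m r ^ 2 ≤ m r ^ 2 * r * (1 / p) := by
      rw [mul_assoc]; exact le_mul_of_one_le_right (sq_nonneg _) this
    simp only [Pi.add_apply]
    nlinarith [sq_nonneg (|m r| - 1), sq_abs (m r), abs_nonneg (m r)]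
  set s : ℝ → ℝ := fun r => ∫ t in r₀..r, m t with hs
  have hsd : ∀ r ∈ Ioo 0 r₀, HasDerivAt s (m r) r := fun r hr =>
    intervalIntegral.integral_hasDerivAt_right (hmi r hr).symm
      (hmc.stronglyMeasurableAtFilter isOpen_Ioo r hr)
      (hmc.continuousAt (Ioo_mem_nhds hr.1 hr.2))
  have hsAC : LocallyAC r₀ s := locallyAC_of_hasDerivAt hsd hmc
  have hsend : Tendsto s (𝓝[<] r₀) (𝓝 0) := by
    have hp : r₀ / 2 ∈ Ioo 0 r₀ := ⟨by linarith, by linarith⟩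
    have h1 := intervalIntegral.continuousOn_primitive_interval' (hmi _ hp) right_mem_uIcc
    have h2 := h1 r₀ right_mem_uIcc
    rw [uIcc_of_le hp.2.le] at h2
    have h3 : Tendsto s (𝓝[Icc (r₀ / 2) r₀] r₀) (𝓝 (s r₀)) := h2
    have h4 : s r₀ = 0 := by simp [hs]
    rw [h4] at h3
    refine h3.mono_left ?_
    rw [← nhdsWithin_Ioo_eq_nhdsLT hp.2]
    exact nhdsWithin_mono _ Ioo_subset_Icc_self
  have hsbound : ∀ p ∈ Ioo 0 r₀, ∃ M, ∀ r ∈ Ico p r₀, |s r| ≤ M := fun p hp => by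
    refine hsAC.exists_bound_right hp ?_
    refine IntegrableOn.congr_fun ((intervalIntegrable_iff_integrableOn_Ioo_of_le hp.2.le).1
      (hmi p hp)) (fun r hr => ?_) measurableSet_Ioo
    exact (hsd r ⟨hp.1.trans hr.1, hr.2⟩).deriv.symm
  have mid : AEStronglyMeasurable (fun r : ℝ => r) (volume.restrict (Ioo 0 r₀)) :=
    measurable_id.aestronglyMeasurable
  have mσ := aesm_of_strain hgc v
  have msn := aesm_of_continuousOn hsAC.continuousOn
  -- test the weak equation with the primitive of `r σ - s`, cut off near the origin
  have hkey : ∀ p ∈ Ioo 0 r₀, ∀ᵐ r ∂(volume.restrict (Ioo p r₀)),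
      r * (deriv v r + g r) = s r := by
    intro p hp
    obtain ⟨M, hM⟩ := hsbound p hp
    have hsub : Ioo p r₀ ⊆ Ioo 0 r₀ := Ioo_subset_Ioo_left hp.1.le
    set ψ₀ : ℝ → ℝ := fun r => r * (deriv v r + g r) - s r with hψ₀
    set ψ : ℝ → ℝ := (Ioi p).indicator ψ₀ with hψ
    have mψ : AEStronglyMeasurable ψ (volume.restrict (Ioo 0 r₀)) :=
      ((mid.mul mσ).sub msn).indicator measurableSet_Ioi
    have iψ2 : IntegrableOn (fun r => ψ r ^ 2 * r) (Ioo 0 r₀) := by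
      refine integrableOn_of_abs_le measurableSet_Ioo ((mψ.pow 2).mul mid)
        ((hv.integrable_stress.const_mul (2 * r₀ ^ 2)).add (integrable_const (2 * M ^ 2 * r₀)))
        fun r hr => ?_
      rw [abs_of_nonneg (mul_nonneg (sq_nonneg _) hr.1.le)]
      simp only [Pi.add_apply]
      have hr1 := hr.1
      by_cases hrp : p < r
      · have e : ψ r = ψ₀ r := indicator_of_mem hrp _
        rw [e]
        have h1 := hM r ⟨hrp.le, hr.2⟩
        have h2 : s r ^ 2 ≤ M ^ 2 := by rw [← sq_abs]; exact pow_le_pow_left₀ (abs_nonneg _) h1 2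
        have h3 : ψ₀ r ^ 2 ≤ 2 * (r ^ 2 * (deriv v r + g r) ^ 2) + 2 * s r ^ 2 := by
          simp only [hψ₀]
          nlinarith [sq_nonneg (r * (deriv v r + g r) + s r)]
        calc ψ₀ r ^ 2 * r ≤ (2 * (r ^ 2 * (deriv v r + g r) ^ 2) + 2 * s r ^ 2) * r := by gcongr
          _ = 2 * r ^ 2 * ((deriv v r + g r) ^ 2 * r) + 2 * s r ^ 2 * r := by ring
          _ ≤ _ := by
            gcongr
            · exact hr.2.le
            · exact hr.2.le
      · have e : ψ r = 0 := indicator_of_notMem hrp _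
        rw [e]
        have : 0 ≤ (deriv v r + g r) ^ 2 * r := by positivity
        have h4 : 0 ≤ 2 * r₀ ^ 2 * ((deriv v r + g r) ^ 2 * r) := by positivity
        have h5 : 0 ≤ 2 * M ^ 2 * r₀ := by positivity
        simp only [ne_eq, OfNat.ofNat_ne_zero, not_false_eq_true, zero_pow, zero_mul]
        linarith
    have hloc : ∀ a b, 0 < a → a ≤ b → b < r₀ → IntervalIntegrable ψ volume a b :=
      fun a b ha hab hb => (sq_integral_abs_le ha hab hb mψ iψ2).1
    set φ : ℝ → ℝ := fun r => 0 + ∫ t in p..r, ψ t with hφ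
    have hφAC : LocallyAC r₀ φ := locallyAC_primitive hp hloc
    have hφd : ∀ᵐ r ∂(volume.restrict (Ioo 0 r₀)), HasDerivAt φ (ψ r) r :=
      ae_deriv_primitive hp hloc
    have hφ0 : ∀ r ≤ p, φ r = 0 := by
      intro r hr
      simp only [hφ, zero_add]
      have h0 : ∫ t in Ioc r p, ψ t = ∫ t in Ioc r p, (0 : ℝ) :=
        setIntegral_congr_fun measurableSet_Ioc fun t ht =>
          (indicator_of_notMem (not_lt.2 ht.2) _ : ψ t = 0)
      rw [intervalIntegral.integral_symm, intervalIntegral.integral_of_le hr, h0]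
      simp
    have iψ : IntegrableOn ψ (Ioo p r₀) := by
      refine integrableOn_of_abs_le measurableSet_Ioo
        (mψ.mono_measure (Measure.restrict_mono hsub le_rfl))
        ((integrable_const (1 : ℝ)).add ((iψ2.mono_set hsub).mul_const (1 / p))) fun r hr => ?_
      have : 1 ≤ r * (1 / p) := by
        rw [mul_one_div, one_le_div hp.1]; exact hr.1.le
      have h2 : ψ r ^ 2 ≤ ψ r ^ 2 * r * (1 / p) := by
        rw [mul_assoc]; exact le_mul_of_one_le_right (sq_nonneg _) this
      simp only [Pi.add_apply]
      nlinarith [sq_nonneg (|ψ r| - 1), sq_abs (ψ r), abs_nonneg (ψ r)]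
    obtain ⟨L, hL⟩ := hφAC.exists_bound_right hp (by
      refine Integrable.congr iψ ?_
      filter_upwards [ae_restrict_of_ae_restrict_of_subset hsub hφd] with r hr
      exact hr.deriv.symm)
    have hL0 : 0 ≤ L := (abs_nonneg _).trans (hL p ⟨le_rfl, hp.2⟩)
    have hLall : ∀ r ∈ Ioo 0 r₀, |φ r| ≤ L := fun r hr => by
      rcases le_total r p with h | h
      · rw [hφ0 r h, abs_zero]; exact hL0
      · exact hL r ⟨h, hr.2⟩
    have k1 : IntegrableOn (fun r => deriv φ r ^ 2 * r) (Ioo 0 r₀) := by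
      refine Integrable.congr iψ2 ?_
      filter_upwards [hφd] with r hr
      rw [hr.deriv]
    have k0 : IntegrableOn (fun r => (φ r / r) ^ 2 * r) (Ioo 0 r₀) := by
      refine integrableOn_of_abs_le (g := fun _ => L ^ 2 / p) measurableSet_Ioo
        (((aesm_of_continuousOn (hφAC.continuousOn.div continuousOn_id
          fun _ hr => hr.1.ne')).pow 2).mul mid) (integrable_const _) fun r hr => ?_
      have hr1 := hr.1
      rw [abs_of_nonneg (by positivity)]
      rcases le_total r p with h | h
      · rw [hφ0 r h]
        have := hp.1
        simp only [zero_div, ne_eq, OfNat.ofNat_ne_zero, not_false_eq_true, zero_pow, zero_mul]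
        positivity
      · calc (φ r / r) ^ 2 * r = |φ r| ^ 2 / r := by rw [sq_abs]; field_simp
          _ ≤ L ^ 2 / p := by
            have := hp.1
            gcongr
            exact hLall r hr
    obtain ⟨w1, w2, w3⟩ := radial_weak_equation hα hgc hv hmin hφAC k1 k0
    -- integrate the second term by parts
    have hsφ : LocallyAC r₀ (fun r => s r * φ r) := hsAC.mul hφAC
    have hsφd : ∀ᵐ r ∂(volume.restrict (Ioo 0 r₀)), deriv (fun r => s r * φ r) r
        = max (v r / r) (-2 * √αs) * (φ r / r) * r + s r * ψ r := by
      filter_upwards [hφd, ae_restrict_mem measurableSet_Ioo] with r hr hrI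
      have e := ((hsd r hrI).mul hr).deriv
      have hr0 := hrI.1.ne'
      refine Eq.trans e ?_
      simp only [hm]
      field_simp
    have isψ : IntegrableOn (fun r => s r * ψ r) (Ioo 0 r₀) := by
      have h1 : IntegrableOn (fun r => M * |ψ r|) (Ioo 0 r₀) := by
        have e : IntegrableOn ψ (Ioo 0 r₀) := by
          have : ψ = (Ioi p).indicator ψ := by rw [hψ, indicator_indicator, inter_self]
          rw [this, IntegrableOn, integrable_indicator_iff measurableSet_Ioi, IntegrableOn,
            Measure.restrict_restrict measurableSet_Ioi]
          refine iψ.mono_set ?_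
          exact fun x hx => ⟨hx.1, hx.2.2⟩
        exact e.abs.const_mul M
      refine integrableOn_of_abs_le measurableSet_Ioo (msn.mul mψ) h1 fun r hr => ?_
      by_cases hrp : p < r
      · rw [abs_mul]
        gcongr
        exact hM r ⟨hrp.le, hr.2⟩
      · have e : ψ r = 0 := indicator_of_notMem hrp _
        rw [e]; simp
    have isφ : IntegrableOn (deriv fun r => s r * φ r) (Ioo 0 r₀) := by
      refine (w2.add isψ).congr ?_
      filter_upwards [hsφd] with r hr
      rw [hr]; rfl
    have vsφ := hsφ.setIntegral_deriv hr₀ (A := 0) (B := 0) isφ (by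
        refine tendsto_const_nhds.congr' ?_
        filter_upwards [Ioo_mem_nhdsGT hp.1] with r hr
        rw [hφ0 r hr.2.le, mul_zero]) (by
        refine squeeze_zero_norm' (a := fun r => |s r| * L) ?_ ?_
        · filter_upwards [Ioo_mem_nhdsLT hr₀] with r hr
          rw [Real.norm_eq_abs, abs_mul]
          exact mul_le_mul_of_nonneg_left (hLall r hr) (abs_nonneg _)
        · simpa using hsend.abs.mul_const L)
    rw [integral_congr_ae hsφd, integral_add w2 isψ, sub_zero] at vsφ
    have e1 : ∫ r in Ioo 0 r₀, (deriv v r + g r) * deriv φ r * r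
        = ∫ r in Ioo 0 r₀, (deriv v r + g r) * ψ r * r := by
      refine integral_congr_ae ?_
      filter_upwards [hφd] with r hr
      rw [hr.deriv]
    have i1 : IntegrableOn (fun r => (deriv v r + g r) * ψ r * r) (Ioo 0 r₀) := by
      refine w1.congr ?_
      filter_upwards [hφd] with r hr
      rw [hr.deriv]
    have hzero : ∫ r in Ioo 0 r₀, ψ r ^ 2 = 0 := by
      have e2 : ∀ r, ψ r ^ 2 = (deriv v r + g r) * ψ r * r - s r * ψ r := by
        intro r
        by_cases hrp : p < r
        · have e : ψ r = ψ₀ r := indicator_of_mem hrp _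
          rw [e]; simp only [hψ₀]; ring
        · have e : ψ r = 0 := indicator_of_notMem hrp _
          rw [e]; ring
      simp_rw [e2]
      rw [integral_sub i1 isψ, ← e1]
      linarith
    have iψsq : IntegrableOn (fun r => ψ r ^ 2) (Ioo 0 r₀) := by
      refine (i1.sub isψ).congr (Eventually.of_forall fun r => ?_)
      simp only [Pi.sub_apply]
      by_cases hrp : p < r
      · have e : ψ r = ψ₀ r := indicator_of_mem hrp _
        rw [e]; simp only [hψ₀]; ring
      · have e : ψ r = 0 := indicator_of_notMem hrp _
        rw [e]; ring
    have h0 := (integral_eq_zero_iff_of_nonneg (fun r => sq_nonneg (ψ r)) iψsq).1 hzero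
    filter_upwards [ae_restrict_of_ae_restrict_of_subset hsub h0,
      ae_restrict_mem measurableSet_Ioo] with r hr hrI
    have e : ψ r = ψ₀ r := indicator_of_mem (show r ∈ Ioi p from hrI.1) _
    have h2 : ψ r = 0 := by simpa using hr
    rw [e] at h2
    simp only [hψ₀] at h2
    linarith
  have hae : ∀ᵐ r ∂(volume.restrict (Ioo 0 r₀)), deriv v r = s r / r - g r := by
    refine ae_Ioo_of_forall_Icc fun a b ha hab hb => ?_
    have := hkey (a / 2) ⟨by linarith, by linarith⟩
    rw [ae_restrict_iff' measurableSet_Ioo] at this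
    filter_upwards [this] with x hx hxI
    have h1 := hx ⟨by linarith [hxI.1], by linarith [hxI.2]⟩
    have hx0 : 0 < x := ha.trans_le hxI.1
    rw [← h1]
    field_simp
    ring
  refine ⟨s, hsd, hv.locallyAC.hasDerivAt_of_ae_eq ?_ hae, hsend⟩
  exact (hsAC.continuousOn.div continuousOn_id fun _ hr => hr.1.ne').sub hgc

/-- The function `1 / r` is not integrable at the origin. -/
lemma false_of_div_le {f : ℝ → ℝ} {c δ : ℝ} (hc : 0 < c) (hδ : 0 < δ)
    (hf : IntegrableOn f (Ioo 0 δ)) (h : ∀ r ∈ Ioo 0 δ, c / r ≤ f r) : False := by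
  have h1 : IntegrableOn (fun r : ℝ => r ^ (-1 : ℝ)) (Ioo 0 δ) := by
    refine integrableOn_of_abs_le measurableSet_Ioo
      (ContinuousOn.aestronglyMeasurable ?_ measurableSet_Ioo) (hf.const_mul (1 / c)) fun r hr => ?_
    · exact continuousOn_id.rpow_const fun x hx => Or.inl hx.1.ne'
    · have h2 := h r hr
      have hr1 := hr.1
      rw [Real.rpow_neg_one, abs_of_pos (by positivity)]
      calc r⁻¹ = 1 / c * (c / r) := by field_simp
        _ ≤ _ := by gcongr
  rw [intervalIntegral.integrableOn_Ioo_rpow_iff hδ] at h1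
  exact lt_irrefl _ h1

/-- The maximum principle: a solution of the equilibrium equations with finite energy is under
radial tension, and it satisfies the boundary conditions at the origin. -/
lemma isEquilibrium_of_finite {s : ℝ → ℝ} (hr₀ : 0 < r₀) (hα : 0 < αs)
    (hg0 : ∀ r ∈ Ioo 0 r₀, 0 ≤ g r) (hgK : ∀ r ∈ Ioo 0 r₀, g r ≤ K / √r)
    (hv : RadialSpace αs r₀ g v)
    (hsd : ∀ r ∈ Ioo 0 r₀, HasDerivAt s (max (v r / r) (-2 * √αs)) r)
    (hvd : ∀ r ∈ Ioo 0 r₀, HasDerivAt v (s r / r - g r) r)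
    (hsend : Tendsto s (𝓝[<] r₀) (𝓝 0)) : IsEquilibrium αs r₀ g v s := by
  have ha := Real.sqrt_pos.2 hα
  have hsc : ContinuousOn s (Ioo 0 r₀) := fun r hr => (hsd r hr).continuousAt.continuousWithinAt
  have iss : IntegrableOn (fun r => s r ^ 2 / r) (Ioo 0 r₀) := by
    refine hv.integrable_stress.congr_fun (fun r hr => ?_) measurableSet_Ioo
    have hr1 := hr.1
    simp only [(hvd r hr).deriv]
    field_simp
    ring
  -- negative stress forces outward displacement
  have hA : ∀ r ∈ Ioo 0 r₀, s r < 0 → 0 < v r := by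
    intro r hr hneg
    by_contra hvr
    rw [not_lt] at hvr
    obtain ⟨q, hq, hsq⟩ : ∃ q ∈ Ioo r r₀, s r / 2 ≤ s q := by
      have h1 : ∀ᶠ q in 𝓝[<] r₀, s r / 2 < s q :=
        hsend.eventually (lt_mem_nhds (by linarith))
      obtain ⟨q, hq1, hq2⟩ := (h1.and (Ioo_mem_nhdsLT hr.2)).exists
      exact ⟨q, hq2, hq1.le⟩
    have hsub : Icc r q ⊆ Ioo 0 r₀ := fun x hx => ⟨hr.1.trans_le hx.1, hx.2.trans_lt hq.2⟩
    obtain ⟨c, ⟨hcI, hcs⟩, hcmin⟩ := (IsCompact.exists_isLeast (s := {t ∈ Icc r q | s r / 2 ≤ s t})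
      (isCompact_Icc.of_isClosed_subset
        ((hsc.mono hsub).preimage_isClosed_of_isClosed isClosed_Icc isClosed_Ici)
        (fun x hx => hx.1)) ⟨q, ⟨hq.1.le, le_rfl⟩, hsq⟩)
    have hlt : ∀ t ∈ Ico r c, s t < s r / 2 := fun t ht => by
      by_contra hcon
      have := hcmin ⟨⟨ht.1, ht.2.le.trans hcI.2⟩, not_lt.1 hcon⟩
      linarith [ht.2]
    have hrc : r < c := lt_of_le_of_ne hcI.1 fun h => by rw [← h] at hcs; linarith
    have hsub2 : Icc r c ⊆ Ioo 0 r₀ := (Icc_subset_Icc_right hcI.2).trans hsub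
    have hvanti : AntitoneOn v (Icc r c) := by
      refine antitoneOn_of_deriv_nonpos (convex_Icc _ _)
        (fun t ht => (hvd t (hsub2 ht)).continuousAt.continuousWithinAt) ?_ ?_
      · rw [interior_Icc]
        exact fun t ht => (hvd t (hsub2 (Ioo_subset_Icc_self ht))).differentiableAt.differentiableWithinAt
      · rw [interior_Icc]
        intro t ht
        have htI := hsub2 (Ioo_subset_Icc_self ht)
        rw [(hvd t htI).deriv]
        have h1 := hlt t ⟨ht.1.le, ht.2⟩
        have h2 := div_nonpos_of_nonpos_of_nonneg (show s t ≤ 0 by linarith) htI.1.le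
        linarith [hg0 t htI]
    have hsanti : AntitoneOn s (Icc r c) := by
      refine antitoneOn_of_deriv_nonpos (convex_Icc _ _) (hsc.mono hsub2) ?_ ?_
      · rw [interior_Icc]
        exact fun t ht => (hsd t (hsub2 (Ioo_subset_Icc_self ht))).differentiableAt.differentiableWithinAt
      · rw [interior_Icc]
        intro t ht
        have htI := hsub2 (Ioo_subset_Icc_self ht)
        rw [(hsd t htI).deriv]
        have h1 := hvanti (left_mem_Icc.2 hrc.le) (Ioo_subset_Icc_self ht) ht.1.le
        exact max_le (div_nonpos_of_nonpos_of_nonneg (h1.trans hvr) htI.1.le) (by linarith)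
    have := hsanti (left_mem_Icc.2 hrc.le) (right_mem_Icc.2 hrc.le) hrc.le
    linarith
  have hmono_of_neg : ∀ a b, 0 < a → b < r₀ → (∀ t ∈ Ioo a b, s t < 0) → MonotoneOn s (Icc a b) := by
    intro a b ha' hb hneg
    have hsub : Icc a b ⊆ Ioo 0 r₀ := fun x hx => ⟨ha'.trans_le hx.1, hx.2.trans_lt hb⟩
    refine monotoneOn_of_deriv_nonneg (convex_Icc _ _) (hsc.mono hsub) ?_ ?_
    · rw [interior_Icc]
      exact fun t ht => (hsd t (hsub (Ioo_subset_Icc_self ht))).differentiableAt.differentiableWithinAt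
    · rw [interior_Icc]
      intro t ht
      have htI := hsub (Ioo_subset_Icc_self ht)
      rw [(hsd t htI).deriv]
      exact le_max_of_le_left (div_nonneg (hA t htI (hneg t ht)).le htI.1.le)
  have hs0 : ∀ r ∈ Ioo 0 r₀, 0 ≤ s r := by
    intro r₁ hr₁
    by_contra hneg
    rw [not_le] at hneg
    have hneg' : ∀ r ∈ Ioc 0 r₁, s r < 0 := by
      intro r hr
      by_contra hcon
      rw [not_lt] at hcon
      have hsub : Icc r r₁ ⊆ Ioo 0 r₀ := fun x hx => ⟨hr.1.trans_le hx.1, hx.2.trans_lt hr₁.2⟩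
      obtain ⟨c, ⟨hcI, hcs⟩, hcmax⟩ := (IsCompact.exists_isGreatest
        (s := {t ∈ Icc r r₁ | 0 ≤ s t})
        (isCompact_Icc.of_isClosed_subset
          ((hsc.mono hsub).preimage_isClosed_of_isClosed isClosed_Icc isClosed_Ici)
          (fun x hx => hx.1)) ⟨r, ⟨le_rfl, hr.2⟩, hcon⟩)
      have h1 := hmono_of_neg c r₁ (hr.1.trans_le hcI.1) hr₁.2 fun t ht => by
        by_contra hcon2
        have := hcmax ⟨⟨hcI.1.trans ht.1.le, ht.2.le⟩, not_lt.1 hcon2⟩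
        linarith [ht.1]
      have h2 := h1 ⟨le_rfl, hcI.2⟩ ⟨hcI.2, le_rfl⟩ hcI.2
      have hcs' : 0 ≤ s c := hcs
      linarith
    refine false_of_div_le (c := s r₁ ^ 2) (by nlinarith) hr₁.1
      (iss.mono_set (Ioo_subset_Ioo_right hr₁.2.le)) fun r hr => ?_
    have h1 := hmono_of_neg r r₁ hr.1 hr₁.2 fun t ht => hneg' t ⟨hr.1.trans ht.1, ht.2.le⟩
    have h2 := h1 ⟨le_rfl, hr.2.le⟩ ⟨hr.2.le, le_rfl⟩ hr.2.le
    have hr1 := hr.1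
    gcongr ?_ / _
    nlinarith
  -- the stress tends to zero at the origin
  have hsmono : MonotoneOn (fun r => s r + 2 * √αs * r) (Ioo 0 r₀) := by
    refine monotoneOn_Ioo_of_hasDerivAt (f' := fun r => max (v r / r) (-2 * √αs) + 2 * √αs)
      (fun r hr => ((hsd r hr).add ((hasDerivAt_id r).const_mul (2 * √αs))).congr_deriv (by ring))
      fun r _ => by linarith [le_max_right (v r / r) (-2 * √αs)]
  have hszero : Tendsto s (𝓝[>] 0) (𝓝 0) := by
    rw [Metric.tendsto_nhds]
    intro ε hε
    set δ := min r₀ (ε / (4 * √αs)) with hδ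
    have hδ0 : 0 < δ := lt_min hr₀ (by positivity)
    have hδr : δ ≤ r₀ := min_le_left _ _
    obtain ⟨r₁, hr₁, hsr₁⟩ : ∃ r₁ ∈ Ioo 0 δ, s r₁ < ε / 2 := by
      by_contra! hcon
      refine false_of_div_le (c := (ε / 2) ^ 2) (by positivity) hδ0
        (iss.mono_set (Ioo_subset_Ioo_right hδr)) fun r hr => ?_
      have hr1 := hr.1
      have := hcon r hr
      gcongr
    filter_upwards [Ioo_mem_nhdsGT hr₁.1] with r hr
    have hrI : r ∈ Ioo 0 r₀ := ⟨hr.1, hr.2.trans (hr₁.2.trans_le hδr)⟩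
    have h1 := hsmono hrI ⟨hr₁.1, hr₁.2.trans_le hδr⟩ hr.2.le
    simp only at h1
    have h2 : √αs * r₁ ≤ ε / 4 := by
      have : r₁ ≤ ε / (4 * √αs) := hr₁.2.le.trans (min_le_right _ _)
      rw [le_div_iff₀ (by positivity)] at this
      linarith
    have h3 := hs0 r hrI
    rw [Real.dist_eq, sub_zero, abs_of_nonneg h3]
    nlinarith [mul_pos ha hr.1]
  -- the displacement tends to zero at the origin
  have hK : 0 ≤ K := by
    have hp : r₀ / 2 ∈ Ioo 0 r₀ := ⟨by linarith, by linarith⟩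
    have h := (hg0 _ hp).trans (hgK _ hp)
    by_contra hneg
    exact absurd h (not_le.2 (div_neg_of_neg_of_pos (not_le.1 hneg) (Real.sqrt_pos.2 hp.1)))
  have hvmono : MonotoneOn (fun r => v r + 2 * K * √r) (Ioo 0 r₀) := by
    refine monotoneOn_Ioo_of_hasDerivAt (f' := fun r => (s r / r - g r) + 2 * K * (1 / (2 * √r)))
      (fun r hr => (hvd r hr).add ((Real.hasDerivAt_sqrt hr.1.ne').const_mul (2 * K)))
      fun r hr => ?_
    have h1 := div_nonneg (hs0 r hr) hr.1.le
    have h2 := hgK r hr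
    have h3 : 2 * K * (1 / (2 * √r)) = K / √r := by
      have := Real.sqrt_pos.2 hr.1
      field_simp
    linarith
  have hvlow : ∀ r ∈ Ioo 0 r₀, 0 ≤ v r + 2 * K * √r := by
    intro r₁ hr₁
    by_contra hneg
    rw [not_le] at hneg
    set κ := -(v r₁ + 2 * K * √r₁) with hκ
    have hκ0 : 0 < κ := by linarith
    -- below `r₁` the displacement is so negative that the azimuthal reaction saturates
    set r₂ := min r₁ (κ / (2 * √αs)) with hr₂
    have hr₂0 : 0 < r₂ := lt_min hr₁.1 (by positivity)
    have hr₂r : r₂ ≤ r₁ := min_le_left _ _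
    have hanti : AntitoneOn (fun r => s r + 2 * √αs * r) (Ioo 0 r₂) := by
      have hd : ∀ r ∈ Ioo 0 r₂, HasDerivAt (fun r => s r + 2 * √αs * r) 0 r := by
        intro r hr
        have hrI : r ∈ Ioo 0 r₀ := ⟨hr.1, hr.2.trans_le (hr₂r.trans hr₁.2.le)⟩
        have h1 := hvmono hrI hr₁ (hr.2.le.trans hr₂r)
        simp only at h1
        have h2 : 0 ≤ 2 * K * √r := by positivity
        have h3 : v r / r ≤ -2 * √αs := by
          rw [div_le_iff₀ hr.1]
          have : r ≤ κ / (2 * √αs) := hr.2.le.trans (min_le_right _ _)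
          rw [le_div_iff₀ (by positivity)] at this
          linarith
        refine ((hsd r hrI).add ((hasDerivAt_id r).const_mul (2 * √αs))).congr_deriv ?_
        rw [max_eq_right h3]; ring
      refine antitoneOn_of_deriv_nonpos (convex_Ioo _ _)
        (fun r hr => (hd r hr).continuousAt.continuousWithinAt) ?_ ?_
      · rw [interior_Ioo]; exact fun r hr => (hd r hr).differentiableAt.differentiableWithinAt
      · rw [interior_Ioo]; exact fun r hr => (hd r hr).deriv.le
    have hp : r₂ / 2 ∈ Ioo 0 r₂ := ⟨by linarith, by linarith⟩
    have h1 : ∀ᶠ r in 𝓝[>] (0 : ℝ), √αs * (r₂ / 2) ≤ s r := by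
      filter_upwards [Ioo_mem_nhdsGT (show 0 < r₂ / 4 by linarith)] with r hr
      have h1 := hanti ⟨hr.1, by linarith [hr.2]⟩ hp (by linarith [hr.2])
      simp only at h1
      have h2 := hs0 (r₂ / 2) ⟨hp.1, by linarith [hp.2, hr₁.2]⟩
      nlinarith [hr.2]
    have h2 := ge_of_tendsto hszero h1
    have : 0 < √αs * (r₂ / 2) := by positivity
    linarith
  have hvzero : Tendsto v (𝓝[>] 0) (𝓝 0) := by
    have hKt : Tendsto (fun r => 2 * K * √r) (𝓝[>] 0) (𝓝 0) := by
      have h : Tendsto (fun r : ℝ => √r) (𝓝[>] 0) (𝓝 √0) :=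
        Real.continuous_sqrt.continuousAt.tendsto.mono_left nhdsWithin_le_nhds
      simpa using h.const_mul (2 * K)
    rw [Metric.tendsto_nhds]
    intro ε hε
    obtain ⟨δ', hδ', hδK⟩ := mem_nhdsGT_iff_exists_Ioo_subset.1
      (hKt.eventually (gt_mem_nhds (show (0 : ℝ) < ε / 2 by positivity)))
    have hδ'0 : (0 : ℝ) < δ' := hδ'
    set δ := min r₀ δ' with hδ
    have hδ0 : 0 < δ := lt_min hr₀ hδ'0
    have hδr : δ ≤ r₀ := min_le_left _ _
    have hδK' : ∀ r ∈ Ioo 0 δ, 2 * K * √r < ε / 2 := fun r hr =>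
      hδK ⟨hr.1, hr.2.trans_le (min_le_right _ _)⟩
    obtain ⟨r₁, hr₁, hvr₁⟩ : ∃ r₁ ∈ Ioo 0 δ, v r₁ < ε / 2 := by
      by_contra! hcon
      refine false_of_div_le (c := (ε / 2) ^ 2) (by positivity) hδ0
        (hv.integrable_Wrel.mono_set (Ioo_subset_Ioo_right hδr)) fun r hr => ?_
      have hr1 := hr.1
      have h1 := hcon r hr
      have h2 : 0 ≤ v r / r := div_nonneg (by linarith) hr1.le
      have h3 : Wrel αs (v r / r) = (v r / r) ^ 2 := by
        unfold Wrel
        rw [if_pos (by linarith)]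
      rw [h3]
      calc (ε / 2) ^ 2 / r ≤ v r ^ 2 / r := by gcongr
        _ = _ := by field_simp
    filter_upwards [Ioo_mem_nhdsGT hr₁.1] with r hr
    have hrI : r ∈ Ioo 0 r₀ := ⟨hr.1, hr.2.trans (hr₁.2.trans_le hδr)⟩
    have h1 := hvmono hrI ⟨hr₁.1, hr₁.2.trans_le hδr⟩ hr.2.le
    simp only at h1
    have h2 := hδK' r₁ hr₁
    have h3 := hδK' r ⟨hr.1, hr.2.trans hr₁.2⟩
    have h4 := hvlow r hrI
    have h5 : 0 ≤ 2 * K * √r := by positivity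
    rw [Real.dist_eq, sub_zero, abs_lt]
    constructor <;> linarith
  exact ⟨hvd, hsd, hs0, hvzero, hszero, hsend⟩

/-- Every nonnegative strain with a singularity of at most `r ^ (-1/2)` at the origin admits an
equilibrium. -/
theorem exists_isEquilibrium (hr₀ : 0 < r₀) (hα : 0 < αs) (hg0 : ∀ r ∈ Ioo 0 r₀, 0 ≤ g r)
    (hgK : ∀ r ∈ Ioo 0 r₀, g r ≤ K / √r) (hgc : ContinuousOn g (Ioo 0 r₀)) :
    ∃ v s, IsEquilibrium αs r₀ g v s := by
  obtain ⟨v, hv, hmin⟩ := exists_radial_minimizer hr₀ hα hg0 hgK hgc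
  obtain ⟨s, hsd, hvd, hsend⟩ := radial_strong_equation hr₀ hα hgc hv hmin
  exact ⟨v, s, isEquilibrium_of_finite hr₀ hα hg0 hgK hv hsd hvd hsend⟩

end

/-! ### The space of normal displacements is complete -/

section

variable {r₀ : ℝ}

/-- The square of the natural norm on normal displacements. -/
noncomputable def wNormSq (r₀ : ℝ) (w : ℝ → ℝ) : ℝ :=
  (∫ r in Ioo 0 r₀, w r ^ 2 * r) + ∫ r in Ioo 0 r₀, deriv (deriv w) r ^ 2 * r

lemma wNormSq_nonneg (w : ℝ → ℝ) : 0 ≤ wNormSq r₀ w :=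
  add_nonneg (weighted_nonneg _) (weighted_nonneg _)

/-- A uniform pointwise bound of a normal displacement by its norm. -/
lemma WSpace.exists_value_bound (hr₀ : 0 < r₀) : ∃ C > 0, ∀ w, WSpace r₀ w →
    (∀ r ∈ Ioo 0 r₀, w r ^ 2 ≤ C * wNormSq r₀ w / √r) := by
  obtain ⟨C, hC, H⟩ := LocallyAC.sq_le hr₀
  refine ⟨C * (1728 / (r₀ / 4) ^ 2 + 16 * (r₀ / 4) ^ 2 + 1), by positivity, fun w hw r hr => ?_⟩
  obtain ⟨i1, i2⟩ := hw.admissible.interpolation hw.integrable_sq hw.integrable_sq_deriv2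
    (l := r₀ / 4) (by positivity) le_rfl
  have h1 := H _ hw.admissible.locallyAC hw.integrable_sq i1 r hr
  have hA : 0 ≤ ∫ r in Ioo 0 r₀, w r ^ 2 * r := weighted_nonneg w
  have hB : 0 ≤ ∫ r in Ioo 0 r₀, deriv (deriv w) r ^ 2 * r := weighted_nonneg _
  refine h1.trans ?_
  unfold wNormSq
  gcongr ?_ / _
  rw [mul_assoc]
  gcongr
  set A := ∫ r in Ioo 0 r₀, w r ^ 2 * r
  set B := ∫ r in Ioo 0 r₀, deriv (deriv w) r ^ 2 * r
  have e1 : 0 ≤ 1728 / (r₀ / 4) ^ 2 * B := by positivity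
  have e2 : 0 ≤ 16 * (r₀ / 4) ^ 2 * A := by positivity
  calc _ ≤ A + (1728 / (r₀ / 4) ^ 2 * A + 16 * (r₀ / 4) ^ 2 * B) := by linarith
    _ ≤ _ := by
      have : (1728 / (r₀ / 4) ^ 2 + 16 * (r₀ / 4) ^ 2 + 1) * (A + B)
        = 1728 / (r₀ / 4) ^ 2 * A + 16 * (r₀ / 4) ^ 2 * B + B + 1728 / (r₀ / 4) ^ 2 * B
          + 16 * (r₀ / 4) ^ 2 * A + A := by ring
      rw [this]; linarith

/-- A pointwise estimate makes a sequence of functions converge at a point. -/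
lemma exists_tendsto_of_sq_le {x : ℕ → ℝ} {K : ℝ}
    (h : ∀ ε > 0, ∃ N, ∀ m ≥ N, ∀ n ≥ N, (x m - x n) ^ 2 ≤ K * ε) :
    ∃ a, Tendsto x atTop (𝓝 a) := by
  refine cauchySeq_tendsto_of_complete (Metric.cauchySeq_iff.2 fun ε hε => ?_)
  obtain ⟨N, hN⟩ := h (ε ^ 2 / (2 * (|K| + 1))) (by positivity)
  refine ⟨N, fun m hm n hn => ?_⟩
  rw [Real.dist_eq]
  refine abs_lt_of_sq_lt_sq ((hN m hm n hn).trans_lt ?_) hε.le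
  have h1 : K ≤ |K| + 1 := (le_abs_self K).trans (by linarith)
  calc K * (ε ^ 2 / (2 * (|K| + 1))) ≤ (|K| + 1) * (ε ^ 2 / (2 * (|K| + 1))) := by gcongr
    _ = ε ^ 2 / 2 := by field_simp
    _ < ε ^ 2 := by linarith [pow_pos hε 2]

/-- Completeness of `WSpace` in its norm. -/
lemma WSpace.exists_limit (hr₀ : 0 < r₀) {w : ℕ → ℝ → ℝ} (hw : ∀ n, WSpace r₀ (w n))
    (hC : ∀ ε > 0, ∃ N, ∀ m ≥ N, ∀ n ≥ N, wNormSq r₀ (fun r => w m r - w n r) ≤ ε) :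
    ∃ u, WSpace r₀ u ∧ ∀ ε > 0, ∃ N, ∀ n ≥ N, wNormSq r₀ (fun r => w n r - u r) ≤ ε := by
  obtain ⟨C₁, hC₁, H₁⟩ := WSpace.exists_value_bound hr₀
  obtain ⟨C₂, hC₂, H₂⟩ := WSpace.exists_slope_bound hr₀
  have b1 : ∀ m n, ∀ r ∈ Ioo 0 r₀, (w m r - w n r) ^ 2
      ≤ C₁ / √r * wNormSq r₀ (fun r => w m r - w n r) := fun m n r hr =>
    (H₁ _ ((hw m).sub (hw n)) r hr).trans_eq (by ring)
  have b2 : ∀ m n, ∀ r ∈ Ioo 0 r₀, (deriv (w m) r - deriv (w n) r) ^ 2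
      ≤ C₂ / √r * wNormSq r₀ (fun r => w m r - w n r) := fun m n r hr => by
    have := H₂ _ ((hw m).sub (hw n)) r hr
    rw [(hw m).admissible.deriv_sub (hw n).admissible hr] at this
    exact this.trans_eq (by unfold wNormSq; ring)
  have c1 : ∀ r ∈ Ioo 0 r₀, ∃ a, Tendsto (fun n => w n r) atTop (𝓝 a) := fun r hr =>
    exists_tendsto_of_sq_le (K := C₁ / √r) fun ε hε => by
      obtain ⟨N, hN⟩ := hC ε hε
      exact ⟨N, fun m hm n hn => (b1 m n r hr).trans (by
        have := hr.1
        gcongr; exact hN m hm n hn)⟩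
  have c2 : ∀ r ∈ Ioo 0 r₀, ∃ a, Tendsto (fun n => deriv (w n) r) atTop (𝓝 a) := fun r hr =>
    exists_tendsto_of_sq_le (K := C₂ / √r) fun ε hε => by
      obtain ⟨N, hN⟩ := hC ε hε
      exact ⟨N, fun m hm n hn => (b2 m n r hr).trans (by
        have := hr.1
        gcongr; exact hN m hm n hn)⟩
  choose! u hu using c1
  choose! z hz using c2
  have d1 : ∀ ε > 0, ∃ N, ∀ n ≥ N, ∀ r ∈ Ioo 0 r₀, (w n r - u r) ^ 2 ≤ C₁ / √r * ε := by
    intro ε hε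
    obtain ⟨N, hN⟩ := hC ε hε
    refine ⟨N, fun n hn r hr => le_of_tendsto (((tendsto_const_nhds (x := w n r)).sub
      (hu r hr)).pow 2) ?_⟩
    filter_upwards [eventually_ge_atTop N] with m hm
    have := hr.1
    exact (b1 n m r hr).trans (by gcongr; exact hN n hn m hm)
  have d2 : ∀ ε > 0, ∃ N, ∀ n ≥ N, ∀ r ∈ Ioo 0 r₀, (deriv (w n) r - z r) ^ 2 ≤ C₂ / √r * ε := by
    intro ε hε
    obtain ⟨N, hN⟩ := hC ε hε
    refine ⟨N, fun n hn r hr => le_of_tendsto (((tendsto_const_nhds (x := deriv (w n) r)).sub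
      (hz r hr)).pow 2) ?_⟩
    filter_upwards [eventually_ge_atTop N] with m hm
    have := hr.1
    exact (b2 n m r hr).trans (by gcongr; exact hN n hn m hm)
  -- the limit is differentiable with derivative `z`
  have hunif : TendstoLocallyUniformlyOn (fun n => deriv (w n)) z atTop (Ioo 0 r₀) := by
    rw [Metric.tendstoLocallyUniformlyOn_iff]
    intro ε hε x hx
    refine ⟨Ioo (x / 2) r₀, mem_nhdsWithin_of_mem_nhds
      (Ioo_mem_nhds (by linarith [hx.1]) hx.2), ?_⟩
    have hx2 : 0 < √(x / 2) := Real.sqrt_pos.2 (by linarith [hx.1])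
    obtain ⟨N, hN⟩ := d2 (ε ^ 2 * √(x / 2) / (2 * C₂)) (by positivity)
    filter_upwards [eventually_ge_atTop N] with n hn y hy
    rw [Real.dist_eq, abs_sub_comm]
    refine abs_lt_of_sq_lt_sq ((hN n hn y ⟨by linarith [hx.1, hy.1], hy.2⟩).trans_lt ?_) hε.le
    have : √(x / 2) ≤ √y := Real.sqrt_le_sqrt hy.1.le
    calc C₂ / √y * (ε ^ 2 * √(x / 2) / (2 * C₂))
        ≤ C₂ / √(x / 2) * (ε ^ 2 * √(x / 2) / (2 * C₂)) := by gcongr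
      _ = ε ^ 2 / 2 := by field_simp
      _ < ε ^ 2 := by linarith [pow_pos hε 2]
  have hud : ∀ r ∈ Ioo 0 r₀, HasDerivAt u (z r) r := fun r hr =>
    hasDerivAt_of_tendstoLocallyUniformlyOn isOpen_Ioo hunif
      (Eventually.of_forall fun n x hx => (hw n).admissible.hasDerivAt hx) (fun x hx => hu x hx) hr
  -- the limit of the second derivatives
  obtain ⟨f, mf, if2, hf⟩ := exists_weighted_limit (r₀ := r₀) (f := fun n => deriv (deriv (w n)))
    (fun n => aesm_deriv _ _) (fun n => (hw n).integrable_sq_deriv2) fun ε hε => by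
      obtain ⟨N, hN⟩ := hC ε hε
      refine ⟨N, fun m hm n hn => le_trans ?_ (hN m hm n hn)⟩
      have : ∫ r in Ioo 0 r₀, (deriv (deriv (w m)) r - deriv (deriv (w n)) r) ^ 2 * r
          = ∫ r in Ioo 0 r₀, deriv (deriv fun r => w m r - w n r) r ^ 2 * r := by
        refine integral_congr_ae ?_
        filter_upwards [(hw m).admissible.ae_deriv2_sub (hw n).admissible] with r hr
        rw [hr]
      rw [this]
      exact le_add_of_nonneg_left (weighted_nonneg _)
  have idiff : ∀ n, IntegrableOn (fun r => (deriv (deriv (w n)) r - f r) ^ 2 * r) (Ioo 0 r₀) :=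
    fun n => by
      have := integrableOn_sq_lin (aesm_deriv (deriv (w n)) _) mf (hw n).integrable_sq_deriv2
        if2 1 (-1)
      refine this.congr (Eventually.of_forall fun r => ?_)
      simp only
      ring
  have hfloc : ∀ a b, 0 < a → a ≤ b → b < r₀ → IntervalIntegrable f volume a b :=
    fun a b ha hab hb => (sq_integral_abs_le ha hab hb mf if2).1
  have hzint : ∀ a b, 0 < a → a ≤ b → b < r₀ → z b - z a = ∫ t in a..b, f t := by
    intro a b ha hab hb
    have haI : a ∈ Ioo 0 r₀ := ⟨ha, hab.trans_lt hb⟩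
    have hbI : b ∈ Ioo 0 r₀ := ⟨ha.trans_le hab, hb⟩
    refine tendsto_nhds_unique ((hz b hbI).sub (hz a haI)) ?_
    have hlim : Tendsto (fun n => ∫ t in a..b, (deriv (deriv (w n)) t - f t)) atTop (𝓝 0) := by
      have h1 : Tendsto (fun n => √((∫ r in Ioo 0 r₀, (deriv (deriv (w n)) r - f r) ^ 2 * r)
          * (2 * √r₀ / √a))) atTop (𝓝 0) := by
        have := (hf.mul_const (2 * √r₀ / √a)).sqrt
        simpa using this
      refine squeeze_zero_norm (fun n => ?_) h1
      rw [Real.norm_eq_abs]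
      refine (intervalIntegral.abs_integral_le_integral_abs hab).trans (Real.le_sqrt_of_sq_le ?_)
      exact (sq_integral_abs_le ha hab hb ((aesm_deriv _ _).sub mf) (idiff n)).2
    have h2 := hlim.add_const (∫ t in a..b, f t)
    rw [zero_add] at h2
    refine h2.congr fun n => ?_
    have hI := (hw n).admissible.locallyAC_deriv.intervalIntegrable_deriv haI hbI
    rw [intervalIntegral.integral_sub hI (hfloc a b ha hab hb),
      (hw n).admissible.locallyAC_deriv.integral_deriv haI hbI]
    ring
  set p := r₀ / 2 with hpd
  have hp : p ∈ Ioo 0 r₀ := ⟨by positivity, by linarith⟩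
  have hzeq : ∀ r ∈ Ioo 0 r₀, z p + ∫ t in p..r, f t = z r := by
    intro r hr
    rcases le_total p r with h | h
    · rw [← hzint p r hp.1 h hr.2]; ring
    · rw [intervalIntegral.integral_symm, ← hzint r p hr.1 h hp.2]; ring
  have hzAC : LocallyAC r₀ z := (locallyAC_primitive (c := z p) hp hfloc).of_eqOn hzeq
  have hdu : EqOn z (deriv u) (Ioo 0 r₀) := fun r hr => (hud r hr).deriv.symm
  have hddu : ∀ᵐ r ∂(volume.restrict (Ioo 0 r₀)), deriv (deriv u) r = f r := by
    filter_upwards [ae_deriv_primitive (c := z p) hp hfloc, ae_restrict_mem measurableSet_Ioo]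
      with r h1 hr
    refine (h1.congr_of_eventuallyEq ?_).deriv
    exact eventually_of_mem (Ioo_mem_nhds hr.1 hr.2) fun t ht =>
      (hdu ht).symm.trans (hzeq t ht).symm
  have hadm : AdmissibleW r₀ u :=
    ⟨fun r hr => (hud r hr).differentiableAt.differentiableWithinAt, hzAC.of_eqOn hdu⟩
  have isv := integrableOn_inv_sqrt r₀
  have mu := aesm_of_continuousOn hadm.locallyAC.continuousOn
  have mwn := fun n => aesm_of_continuousOn (hw n).admissible.locallyAC.continuousOn
  have mid : AEStronglyMeasurable (fun r : ℝ => r) (volume.restrict (Ioo 0 r₀)) :=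
    measurable_id.aestronglyMeasurable
  have key : ∀ ε > 0, ∃ N, ∀ n ≥ N, IntegrableOn (fun r => (w n r - u r) ^ 2 * r) (Ioo 0 r₀) ∧
      ∫ r in Ioo 0 r₀, (w n r - u r) ^ 2 * r
        ≤ ε * (C₁ * r₀ * ∫ r in Ioo 0 r₀, 1 / √r) := by
    intro ε hε
    obtain ⟨N, hN⟩ := d1 ε hε
    refine ⟨N, fun n hn => ?_⟩
    have hle : ∀ r ∈ Ioo 0 r₀, (w n r - u r) ^ 2 * r ≤ ε * C₁ * r₀ * (1 / √r) := by
      intro r hr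
      have hr1 := hr.1
      calc (w n r - u r) ^ 2 * r ≤ C₁ / √r * ε * r₀ := by
            gcongr
            · exact hN n hn r hr
            · exact hr.2.le
        _ = _ := by ring
    have hi : IntegrableOn (fun r => (w n r - u r) ^ 2 * r) (Ioo 0 r₀) := by
      refine integrableOn_of_abs_le measurableSet_Ioo ((((mwn n).sub mu).pow 2).mul mid)
        (isv.const_mul (ε * C₁ * r₀)) fun r hr => ?_
      rw [abs_of_nonneg (mul_nonneg (sq_nonneg _) hr.1.le)]
      exact hle r hr
    refine ⟨hi, (setIntegral_mono_on hi (isv.const_mul (ε * C₁ * r₀)) measurableSet_Ioo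
      hle).trans_eq ?_⟩
    rw [integral_const_mul]; ring
  have hu2 : IntegrableOn (fun r => u r ^ 2 * r) (Ioo 0 r₀) := by
    obtain ⟨N, hN⟩ := key 1 one_pos
    refine (integrableOn_sq_lin (mwn N) ((mwn N).sub mu) (hw N).integrable_sq
      (hN N le_rfl).1 1 (-1)).congr (Eventually.of_forall fun r => ?_)
    simp only [Pi.sub_apply]
    ring
  have hWu : WSpace r₀ u := ⟨hadm, hu2, if2.congr (by
    filter_upwards [hddu] with r hr
    rw [hr])⟩
  refine ⟨u, hWu, fun ε hε => ?_⟩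
  set M := C₁ * r₀ * ∫ r in Ioo 0 r₀, 1 / √r with hM
  have hM0 : 0 ≤ M := by
    have : 0 ≤ ∫ r in Ioo 0 r₀, 1 / √r :=
      setIntegral_nonneg measurableSet_Ioo fun r hr => by positivity
    positivity
  obtain ⟨N₁, hN₁⟩ := key (ε / (2 * (M + 1))) (by positivity)
  obtain ⟨N₂, hN₂⟩ := eventually_atTop.1 (hf.eventually (ge_mem_nhds (half_pos hε)))
  refine ⟨max N₁ N₂, fun n hn => ?_⟩
  have h1 := (hN₁ n ((le_max_left _ _).trans hn)).2
  have h2 := hN₂ n ((le_max_right _ _).trans hn)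
  have h3 : ∫ r in Ioo 0 r₀, deriv (deriv fun r => w n r - u r) r ^ 2 * r
      = ∫ r in Ioo 0 r₀, (deriv (deriv (w n)) r - f r) ^ 2 * r := by
    refine integral_congr_ae ?_
    filter_upwards [(hw n).admissible.ae_deriv2_sub hadm, hddu] with r hr hr'
    rw [hr, hr']
  have h4 : ε / (2 * (M + 1)) * M ≤ ε / 2 := by
    rw [div_mul_eq_mul_div, div_le_div_iff₀ (by positivity) two_pos]
    nlinarith
  unfold wNormSq
  rw [h3]
  linarith

end

/-! ### Minimization over the normal displacement -/

section

variable {αs r₀ R h : ℝ}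

lemma firstVar_const_mul (w s y : ℝ → ℝ) (c : ℝ) :
    firstVar αs r₀ R h w s (fun r => c * y r) = c * firstVar αs r₀ R h w s y := by
  have e1 : (deriv fun r => c * y r) = fun r => c * deriv y r :=
    funext fun r => deriv_const_mul_field c
  have e2 : (deriv fun r => c * deriv y r) = fun r => c * deriv (deriv y) r :=
    funext fun r => deriv_const_mul_field c
  unfold firstVar
  rw [e1, e2, ← integral_const_mul]
  refine integral_congr_ae (Eventually.of_forall fun r => ?_)
  simp only
  ring

lemma firstVar_self (w s u : ℝ → ℝ) : firstVar αs r₀ R h w s (fun r => u r - u r) = 0 := by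
  have := firstVar_const_mul (αs := αs) (r₀ := r₀) (R := R) (h := h) w s u 0
  simpa using this

lemma wNormSq_const_mul (y : ℝ → ℝ) (c : ℝ) :
    wNormSq r₀ (fun r => c * y r) = c ^ 2 * wNormSq r₀ y := by
  have e1 : (deriv fun r => c * y r) = fun r => c * deriv y r :=
    funext fun r => deriv_const_mul_field c
  have e2 : (deriv fun r => c * deriv y r) = fun r => c * deriv (deriv y) r :=
    funext fun r => deriv_const_mul_field c
  unfold wNormSq
  rw [e1, e2, mul_add, ← integral_const_mul, ← integral_const_mul]
  simp only [mul_pow, mul_assoc]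

namespace IsEquilibrium

variable {w v s : ℝ → ℝ}

/-- The first variation is a bounded linear functional of the normal displacement. -/
lemma exists_firstVar_bound (hr₀ : 0 < r₀) (h : ℝ) (hw : WSpace r₀ w)
    (he : IsEquilibrium αs r₀ (strain R w) v s) :
    ∃ M, ∀ y, WSpace r₀ y → firstVar αs r₀ R h w s y ^ 2 ≤ M * wNormSq r₀ y := by
  obtain ⟨C, hC, H⟩ := he.exists_bounds hr₀ hw
  obtain ⟨C₂, hC₂, H₂⟩ := WSpace.exists_slope_bound hr₀
  set a₀ := ∫ r in Ioo 0 r₀, w r ^ 2 * r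
  set c₀ := ∫ r in Ioo 0 r₀, (deriv (deriv w) r - 1 / R) ^ 2 * r
  refine ⟨3 * (C ^ 3 * C₂ * r₀ ^ 2 + (αs * (h ^ 2)⁻¹) ^ 2 * a₀ + (h ^ 2) ^ 2 * c₀),
    fun y hy => ?_⟩
  have hN := wNormSq_nonneg (r₀ := r₀) y
  set N := wNormSq r₀ y with hNd
  have hA : 0 ≤ ∫ r in Ioo 0 r₀, y r ^ 2 * r := weighted_nonneg y
  have hB : 0 ≤ ∫ r in Ioo 0 r₀, deriv (deriv y) r ^ 2 * r := weighted_nonneg _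
  have hAN : ∫ r in Ioo 0 r₀, y r ^ 2 * r ≤ N := le_add_of_nonneg_right hB
  have hBN : ∫ r in Ioo 0 r₀, deriv (deriv y) r ^ 2 * r ≤ N := le_add_of_nonneg_left hA
  have ha₀ : 0 ≤ a₀ := weighted_nonneg w
  have hc₀ : 0 ≤ c₀ := weighted_nonneg fun r => deriv (deriv w) r - 1 / R
  have ms : AEStronglyMeasurable s (volume.restrict (Ioo 0 r₀)) :=
    aesm_of_continuousOn he.continuousOn_s
  have my := aesm_of_continuousOn hy.admissible.locallyAC.continuousOn
  have mw := aesm_of_continuousOn hw.admissible.locallyAC.continuousOn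
  have hpt : ∀ r ∈ Ioo 0 r₀, |-(s r * (r / R - deriv w r) * deriv y r)| ≤ √(C ^ 3 * C₂ * N) := by
    intro r hr
    have hr1 := hr.1
    have hsr := Real.sqrt_pos.2 hr1
    obtain ⟨h1, -, -, h2⟩ := H r hr
    have h3 : deriv y r ^ 2 ≤ C₂ * N / √r := H₂ y hy r hr
    have h0 := he.s_nonneg r hr
    rw [abs_neg]
    refine Real.abs_le_sqrt ?_
    calc (s r * (r / R - deriv w r) * deriv y r) ^ 2
        = s r ^ 2 * ((r / R - deriv w r) ^ 2 * deriv y r ^ 2) := by ring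
      _ ≤ (C * √r) ^ 2 * (C / √r * (C₂ * N / √r)) := by gcongr
      _ = _ := by field_simp
  have i1 : IntegrableOn (fun r => -(s r * (r / R - deriv w r) * deriv y r)) (Ioo 0 r₀) := by
    refine integrableOn_of_abs_le measurableSet_Ioo ?_ (integrable_const (√(C ^ 3 * C₂ * N))) hpt
    have := measurable_deriv w
    exact ((ms.mul (by fun_prop : Measurable
      fun r => r / R - deriv w r).aestronglyMeasurable).mul (aesm_deriv y _)).neg
  obtain ⟨i2, e2⟩ := integrableOn_weighted_mul mw my hw.integrable_sq hy.integrable_sq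
  obtain ⟨i3, e3⟩ := integrableOn_weighted_mul
    ((aesm_deriv (deriv w) _).sub (aestronglyMeasurable_const (b := 1 / R)))
    (aesm_deriv _ _) (hw.integrable_curvature (1 / R)) hy.integrable_sq_deriv2
  simp only [Pi.sub_apply] at i3 e3
  have e1 : (∫ r in Ioo 0 r₀, -(s r * (r / R - deriv w r) * deriv y r)) ^ 2
      ≤ C ^ 3 * C₂ * r₀ ^ 2 * N := by
    have h1 : |∫ r in Ioo 0 r₀, -(s r * (r / R - deriv w r) * deriv y r)|
        ≤ √(C ^ 3 * C₂ * N) * r₀ := by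
      have := norm_setIntegral_le_of_norm_le_const (μ := volume) (s := Ioo 0 r₀)
        (f := fun r => -(s r * (r / R - deriv w r) * deriv y r)) (by simp) hpt
      simpa [Real.norm_eq_abs, Measure.real, hr₀.le] using this
    rw [← sq_abs]
    calc _ ≤ (√(C ^ 3 * C₂ * N) * r₀) ^ 2 := by gcongr
      _ = _ := by rw [mul_pow, Real.sq_sqrt (by positivity)]; ring
  have i12 : IntegrableOn (fun r => -(s r * (r / R - deriv w r) * deriv y r)
      + αs * (h ^ 2)⁻¹ * (w r * y r * r)) (Ioo 0 r₀) := i1.add (i2.const_mul _)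
  unfold firstVar
  rw [integral_add i12 (i3.const_mul _), integral_add i1 (i2.const_mul _), integral_const_mul,
    integral_const_mul]
  set a := ∫ r in Ioo 0 r₀, -(s r * (r / R - deriv w r) * deriv y r)
  set b := ∫ r in Ioo 0 r₀, w r * y r * r
  set c := ∫ r in Ioo 0 r₀, (deriv (deriv w) r - 1 / R) * deriv (deriv y) r * r
  have e2' : (αs * (h ^ 2)⁻¹ * b) ^ 2 ≤ (αs * (h ^ 2)⁻¹) ^ 2 * a₀ * N := by
    rw [mul_pow, mul_assoc]
    gcongr
    exact e2.trans (by gcongr)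
  have e3' : (h ^ 2 * c) ^ 2 ≤ (h ^ 2) ^ 2 * c₀ * N := by
    rw [mul_pow, mul_assoc]
    gcongr
    exact e3.trans (by gcongr)
  nlinarith [sq_nonneg (a - αs * (h ^ 2)⁻¹ * b), sq_nonneg (a - h ^ 2 * c),
    sq_nonneg (αs * (h ^ 2)⁻¹ * b - h ^ 2 * c)]

/-- The consequences of the second variation identity without excess strain. -/
lemma energy_ge (hr₀ : 0 < r₀) (hα : 0 < αs) (hh : 0 < h) (hw : WSpace r₀ w)
    (he : IsEquilibrium αs r₀ (strain R w) v s) {v₁ w₁ : ℝ → ℝ}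
    (hv₁ : AdmissibleV r₀ v₁) (hw₁ : AdmissibleW r₀ w₁)
    (hfin : IntegrableOn (density αs R h (fun _ => 0) v₁ w₁) (Ioo 0 r₀)) :
    (∫ r in Ioo 0 r₀, density αs R h (fun _ => 0) v w r)
      + 2 * firstVar αs r₀ R h w s (fun r => w₁ r - w r)
      + min (αs * (h ^ 2)⁻¹) (h ^ 2) * wNormSq r₀ (fun r => w₁ r - w r)
      ≤ ∫ r in Ioo 0 r₀, density αs R h (fun _ => 0) v₁ w₁ r := by
  obtain ⟨-, -, -, -, e⟩ := he.energy_identity hr₀ hα hh hw hv₁ hw₁ integrableOn_zero hfin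
  rw [e]
  have h1 : 0 ≤ ∫ r in Ioo 0 r₀, s r * deriv (fun r => w₁ r - w r) r ^ 2 :=
    setIntegral_nonneg measurableSet_Ioo fun r hr => mul_nonneg (he.s_nonneg r hr) (sq_nonneg _)
  have h2 : 0 ≤ ∫ r in Ioo 0 r₀,
      (deriv v₁ r + (1 / 2) * (r / R - deriv w₁ r) ^ 2 + 0 - s r / r) ^ 2 * r :=
    weighted_nonneg fun r => deriv v₁ r + (1 / 2) * (r / R - deriv w₁ r) ^ 2 + 0 - s r / r
  have h3 : 0 ≤ ∫ r in Ioo 0 r₀, excess αs (v₁ r / r) (v r / r) * r :=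
    setIntegral_nonneg measurableSet_Ioo fun r hr => mul_nonneg (excess_nonneg hα _ _) hr.1.le
  have hA : 0 ≤ ∫ r in Ioo 0 r₀, (w₁ r - w r) ^ 2 * r := weighted_nonneg fun r => w₁ r - w r
  have hB : 0 ≤ ∫ r in Ioo 0 r₀, deriv (deriv fun r => w₁ r - w r) r ^ 2 * r := weighted_nonneg _
  have h4 := mul_le_mul_of_nonneg_right (min_le_left (αs * (h ^ 2)⁻¹) (h ^ 2)) hA
  have h5 := mul_le_mul_of_nonneg_right (min_le_right (αs * (h ^ 2)⁻¹) (h ^ 2)) hB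
  unfold wNormSq
  simp only [mul_zero, integral_zero]
  rw [mul_add]
  linarith

end IsEquilibrium

/-- The energies obtained by minimizing over the radial displacement first. -/
def reducedEnergies (αs r₀ R h : ℝ) : Set ℝ :=
  {e | ∃ w v s, WSpace r₀ w ∧ IsEquilibrium αs r₀ (strain R w) v s ∧
    e = ∫ r in Ioo 0 r₀, density αs R h (fun _ => 0) v w r}

lemma WSpace.exists_isEquilibrium (hr₀ : 0 < r₀) (hα : 0 < αs) (R : ℝ) {w : ℝ → ℝ}
    (hw : WSpace r₀ w) : ∃ v s, IsEquilibrium αs r₀ (strain R w) v s := by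
  obtain ⟨K, hK, H⟩ := hw.exists_strain_le hr₀ R
  exact WrinkledSheet.exists_isEquilibrium hr₀ hα (fun r _ => strain_nonneg R w r) H
    (hw.admissible.continuousOn_strain R)

/-- The direct method for the reduced energy. Minimizing sequences are Cauchy by the second variation
identity at midpoints, and the energy at the limit is compared through the same identity there, so
that no lower semicontinuity of the reduced energy is needed. -/
lemma exists_reduced_minimizer (hr₀ : 0 < r₀) (hα : 0 < αs) (hh : 0 < h) (R : ℝ) :
    ∃ w v s, WSpace r₀ w ∧ IsEquilibrium αs r₀ (strain R w) v s ∧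
      ∀ e ∈ reducedEnergies αs r₀ R h,
        ∫ r in Ioo 0 r₀, density αs R h (fun _ => 0) v w r ≤ e := by
  have hbdd : BddBelow (reducedEnergies αs r₀ R h) := by
    refine ⟨0, ?_⟩
    rintro e ⟨w, v, s, -, -, rfl⟩
    exact integral_density_nonneg hα
  have hne : (reducedEnergies αs r₀ R h).Nonempty := by
    obtain ⟨v, s, he⟩ := (wSpace_zero r₀).exists_isEquilibrium hr₀ hα R
    exact ⟨_, _, v, s, wSpace_zero r₀, he, rfl⟩
  set I := sInf (reducedEnergies αs r₀ R h) with hI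
  have hseq : ∀ n : ℕ, ∃ w v s, WSpace r₀ w ∧ IsEquilibrium αs r₀ (strain R w) v s ∧
      ∫ r in Ioo 0 r₀, density αs R h (fun _ => 0) v w r < I + 1 / ((n : ℝ) + 1) := by
    intro n
    obtain ⟨e, ⟨w, v, s, hw, he, rfl⟩, hlt⟩ := exists_lt_of_csInf_lt hne
      (lt_add_of_pos_right I (show (0 : ℝ) < 1 / ((n : ℝ) + 1) by positivity))
    exact ⟨w, v, s, hw, he, hlt⟩
  choose w v s hw he hlt using hseq
  set κ := min (αs * (h ^ 2)⁻¹) (h ^ 2) with hκ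
  have hκ0 : 0 < κ := lt_min (by positivity) (by positivity)
  have hadm := fun n => (he n).admissible ((hw n).admissible.continuousOn_strain R)
  have hint := fun n => (he n).integrableOn_density hr₀ hα h (hw n) (hw n)
  have htend : Tendsto (fun n : ℕ => 1 / ((n : ℝ) + 1)) atTop (𝓝 0) :=
    tendsto_one_div_add_atTop_nhds_zero_nat
  -- compare both members of a pair with the equilibrium over their midpoint
  have hpair : ∀ m n : ℕ, κ * wNormSq r₀ (fun r => w m r - w n r)
      ≤ 2 * (1 / ((m : ℝ) + 1) + 1 / ((n : ℝ) + 1)) := by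
    intro m n
    have hmid := (hw m).lin (hw n) (1 / 2) (1 / 2)
    obtain ⟨v', s', he'⟩ := hmid.exists_isEquilibrium hr₀ hα R
    have h1 := he'.energy_ge hr₀ hα hh hmid (hadm m) (hw m).admissible (hint m)
    have h2 := he'.energy_ge hr₀ hα hh hmid (hadm n) (hw n).admissible (hint n)
    have e1 : (fun r => w m r - (1 / 2 * w m r + 1 / 2 * w n r))
        = fun r => 1 / 2 * (w m r - w n r) := by ext; ring
    have e2 : (fun r => w n r - (1 / 2 * w m r + 1 / 2 * w n r))
        = fun r => -(1 / 2) * (w m r - w n r) := by ext; ring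
    rw [e1, firstVar_const_mul, wNormSq_const_mul] at h1
    rw [e2, firstVar_const_mul, wNormSq_const_mul] at h2
    have h3 : I ≤ _ := csInf_le hbdd ⟨_, v', s', hmid, he', rfl⟩
    have h4 := hlt m
    have h5 := hlt n
    nlinarith
  obtain ⟨u, hu, hlim⟩ := WSpace.exists_limit hr₀ hw fun ε hε => by
    obtain ⟨N, hN⟩ := eventually_atTop.1 (htend.eventually
      (ge_mem_nhds (show (0 : ℝ) < κ * ε / 4 by positivity)))
    refine ⟨N, fun m hm n hn => ?_⟩
    have h1 := hN m hm
    have h2 := hN n hn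
    have h3 := hpair m n
    refine le_of_mul_le_mul_left ?_ hκ0
    linarith
  obtain ⟨v', s', he'⟩ := hu.exists_isEquilibrium hr₀ hα R
  refine ⟨u, v', s', hu, he', fun e hemem => le_trans ?_ (csInf_le hbdd hemem)⟩
  obtain ⟨M, hM⟩ := he'.exists_firstVar_bound hr₀ h hu
  have hM' : ∀ y, WSpace r₀ y → firstVar αs r₀ R h u s' y ^ 2 ≤ (|M| + 1) * wNormSq r₀ y :=
    fun y hy => (hM y hy).trans (by
      have := wNormSq_nonneg (r₀ := r₀) y
      gcongr
      linarith [le_abs_self M])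
  refine le_of_forall_pos_le_add fun ε hε => ?_
  obtain ⟨N₁, hN₁⟩ := eventually_atTop.1 (htend.eventually (ge_mem_nhds (half_pos hε)))
  obtain ⟨N₂, hN₂⟩ := hlim ((ε / 4) ^ 2 / (|M| + 1)) (by positivity)
  set n := max N₁ N₂
  have h1 := hN₁ n (le_max_left _ _)
  have h2 := hN₂ n (le_max_right _ _)
  have h3 := he'.energy_ge hr₀ hα hh hu (hadm n) (hw n).admissible (hint n)
  have h4 := hM' _ ((hw n).sub hu)
  have h5 : (|M| + 1) * wNormSq r₀ (fun r => w n r - u r) ≤ (ε / 4) ^ 2 :=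
    (mul_le_mul_of_nonneg_left h2 (by positivity)).trans_eq (by field_simp)
  have h6 := abs_le_of_sq_le_sq (h4.trans h5) (by positivity)
  have h7 : 0 ≤ κ * wNormSq r₀ (fun r => w n r - u r) :=
    mul_nonneg hκ0.le (wNormSq_nonneg _)
  have h8 := hlt n
  linarith [neg_le_of_abs_le h6]

/-- A critical point of the energy: an equilibrium, with weighted stress `s`, at which the first
variation in the normal displacement vanishes. -/
structure IsCritical (αs r₀ R h : ℝ) (w v s : ℝ → ℝ) : Prop where
  wSpace : WSpace r₀ w
  isEquilibrium : IsEquilibrium αs r₀ (strain R w) v s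
  firstVar_eq_zero : ∀ y, WSpace r₀ y → firstVar αs r₀ R h w s y = 0

/-- At a minimizer of the reduced energy the first variation vanishes: a perturbation `t y` changes
the energy by `2 t` times the first variation plus a term of order `t ^ 2`. -/
theorem exists_isCritical (hr₀ : 0 < r₀) (hα : 0 < αs) (hh : 0 < h) (R : ℝ) :
    ∃ w v s, IsCritical αs r₀ R h w v s := by
  obtain ⟨w, v, s, hw, he, hmin⟩ := exists_reduced_minimizer hr₀ hα hh R
  refine ⟨w, v, s, hw, he, fun y hy => ?_⟩
  obtain ⟨K, hK, HK⟩ := hy.exists_deriv_bound hr₀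
  obtain ⟨C, hC, H⟩ := he.exists_bounds hr₀ hw
  have hadm := he.admissible (hw.admissible.continuousOn_strain R)
  -- the energy of the displacement `w + t y`, with `v` unchanged, is quadratic in small `t`
  set M := (∫ r in Ioo 0 r₀, s r * deriv y r ^ 2) + (2 * C * K + K ^ 2) * r₀
    + αs * (h ^ 2)⁻¹ * (∫ r in Ioo 0 r₀, y r ^ 2 * r)
    + h ^ 2 * (∫ r in Ioo 0 r₀, deriv (deriv y) r ^ 2 * r) with hM
  have hkey : ∀ t : ℝ, |t| ≤ 1 → 0 ≤ 2 * t * firstVar αs r₀ R h w s y + t ^ 2 * M := by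
    intro t ht
    have hwt : WSpace r₀ (fun r => w r + t * y r) := by
      have := hw.lin hy 1 t
      simpa using this
    have hfin := he.integrableOn_density hr₀ hα h hw hwt
    obtain ⟨v', s', he'⟩ := hwt.exists_isEquilibrium hr₀ hα R
    have h1 := hmin _ ⟨_, v', s', hwt, he', rfl⟩
    have h2 := he'.energy_ge hr₀ hα hh hwt hadm hwt.admissible hfin
    rw [firstVar_self] at h2
    have h2' : 0 ≤ min (αs * (h ^ 2)⁻¹) (h ^ 2)
        * wNormSq r₀ (fun r => (w r + t * y r) - (w r + t * y r)) :=
      mul_nonneg (by positivity) (wNormSq_nonneg _)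
    obtain ⟨-, -, iρ, -, e⟩ :=
      he.energy_identity hr₀ hα hh hw hadm hwt.admissible integrableOn_zero hfin
    have hy1 : (fun r => w r + t * y r - w r) = fun r => t * y r := by ext; ring
    have e1 : (deriv fun r => t * y r) = fun r => t * deriv y r :=
      funext fun r => deriv_const_mul_field t
    have e2 : (deriv fun r => t * deriv y r) = fun r => t * deriv (deriv y) r :=
      funext fun r => deriv_const_mul_field t
    have hρ : ∫ r in Ioo 0 r₀, (deriv v r
        + (1 / 2) * (r / R - deriv (fun r => w r + t * y r) r) ^ 2 + 0 - s r / r) ^ 2 * r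
        ≤ t ^ 2 * ((2 * C * K + K ^ 2) * r₀) := by
      refine (setIntegral_mono_on iρ (integrable_const (t ^ 2 * (2 * C * K + K ^ 2)))
        measurableSet_Ioo fun r hr => ?_).trans_eq ?_
      · have hr1 := hr.1
        have hsr := Real.sqrt_pos.2 hr1
        have e3 : deriv (fun r => w r + t * y r) r = deriv w r + t * deriv y r :=
          ((hw.admissible.hasDerivAt hr).add ((hy.admissible.hasDerivAt hr).const_mul t)).deriv
        rw [e3, (he.hasDerivAt_v r hr).deriv, strain]
        have hx := (H r hr).2.2.2
        have hz := HK r hr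
        set x := r / R - deriv w r
        have e4 : r / R - (deriv w r + t * deriv y r) = x - t * deriv y r := by
          simp only [x]; ring
        rw [e4]
        set z := deriv y r
        have ht2 : t ^ 2 ≤ 1 := by rw [← sq_abs]; exact pow_le_one₀ (abs_nonneg t) ht
        have e5 : (s r / r - 1 / 2 * x ^ 2 + 1 / 2 * (x - t * z) ^ 2 + 0 - s r / r) ^ 2
            = t ^ 2 * (- x * z + t * z ^ 2 / 2) ^ 2 := by ring
        rw [e5, mul_assoc]
        refine mul_le_mul_of_nonneg_left ?_ (sq_nonneg t)
        have e6 : (- x * z + t * z ^ 2 / 2) ^ 2 ≤ 2 * (x ^ 2 * z ^ 2) + (z ^ 2) ^ 2 := by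
          nlinarith [sq_nonneg (x * z + t * z ^ 2 / 2), mul_le_mul_of_nonneg_right ht2
            (sq_nonneg (z ^ 2))]
        calc _ ≤ (2 * (x ^ 2 * z ^ 2) + (z ^ 2) ^ 2) * r := by gcongr
          _ ≤ (2 * (C / √r * (K / √r)) + (K / √r) ^ 2) * r := by gcongr
          _ = (2 * C * K + K ^ 2) * (r / (√r * √r)) := by field_simp
          _ = _ := by rw [Real.mul_self_sqrt hr1.le, div_self hr1.ne', mul_one]
      · simp [Measure.real, hr₀.le]; ring
    have hexc : ∫ r in Ioo 0 r₀, excess αs (v r / r) (v r / r) * r = 0 := by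
      simp [excess]
    rw [hy1, firstVar_const_mul, hexc, e1, e2] at e
    have hsq : ∀ r, w r + t * y r - w r = t * y r := fun r => by ring
    simp only [mul_zero, integral_zero, hsq, mul_pow] at e
    have e7 : ∫ r in Ioo 0 r₀, s r * (t ^ 2 * deriv y r ^ 2)
        = t ^ 2 * ∫ r in Ioo 0 r₀, s r * deriv y r ^ 2 := by
      rw [← integral_const_mul]; congr 1; ext; ring
    have e8 : ∫ r in Ioo 0 r₀, t ^ 2 * y r ^ 2 * r = t ^ 2 * ∫ r in Ioo 0 r₀, y r ^ 2 * r := by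
      rw [← integral_const_mul]; congr 1; ext; ring
    have e9 : ∫ r in Ioo 0 r₀, t ^ 2 * deriv (deriv y) r ^ 2 * r
        = t ^ 2 * ∫ r in Ioo 0 r₀, deriv (deriv y) r ^ 2 * r := by
      rw [← integral_const_mul]; congr 1; ext; ring
    rw [e7, e8, e9] at e
    rw [hM]
    nlinarith
  set φ := firstVar αs r₀ R h w s y
  by_contra hne
  have hφ : 0 < |φ| := abs_pos.2 hne
  set t := min 1 (|φ| / (|M| + 1)) with ht
  have ht0 : 0 < t := lt_min one_pos (by positivity)
  have ht1 : t ≤ 1 := min_le_left _ _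
  have ht2 : t * M ≤ |φ| := by
    have h1 : t ≤ |φ| / (|M| + 1) := min_le_right _ _
    rw [le_div_iff₀ (by positivity)] at h1
    nlinarith [le_abs_self M]
  rcases lt_or_gt_of_ne hne with hneg | hpos
  · have := hkey t (by rw [abs_of_pos ht0]; exact ht1)
    rw [abs_of_neg hneg] at ht2
    nlinarith
  · have := hkey (-t) (by rw [abs_neg, abs_of_pos ht0]; exact ht1)
    rw [abs_of_pos hpos] at ht2
    nlinarith

end

/-! ### Minimality and uniqueness -/

section

variable {αs r₀ R h : ℝ}

lemma LocallyAC.eqOn_of_ae_deriv_eq {f g : ℝ → ℝ} (hf : LocallyAC r₀ f) (hg : LocallyAC r₀ g)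
    (h : ∀ᵐ r ∂(volume.restrict (Ioo 0 r₀)), deriv f r = deriv g r)
    (hf0 : Tendsto f (𝓝[>] 0) (𝓝 0)) (hg0 : Tendsto g (𝓝[>] 0) (𝓝 0)) : EqOn f g (Ioo 0 r₀) := by
  intro b hb
  have key : ∀ a ∈ Ioo 0 r₀, f b - f a = g b - g a := by
    intro a ha
    rw [← hf.integral_deriv ha hb, ← hg.integral_deriv ha hb]
    refine intervalIntegral.integral_congr_ae_restrict ?_
    exact ae_restrict_of_ae_restrict_of_subset
      (uIoc_subset_uIcc.trans (uIcc_subset_Ioo' ha hb)) h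
  have h1 : Tendsto (fun a => f b - f a) (𝓝[>] 0) (𝓝 (f b)) := by
    simpa using tendsto_const_nhds.sub hf0
  have h2 : Tendsto (fun a => g b - g a) (𝓝[>] 0) (𝓝 (g b)) := by
    simpa using tendsto_const_nhds.sub hg0
  refine tendsto_nhds_unique h1 (h2.congr' ?_)
  filter_upwards [Ioo_mem_nhdsGT (hb.1.trans hb.2)] with a ha
  exact (key a ha).symm

namespace IsEquilibrium

variable {w v s : ℝ → ℝ}

/-- A competitor whose energy does not exceed that of an equilibrium coincides with it, provided
that the first variation in the direction of the competitor vanishes. -/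
lemma eqOn_of_energy_le (hr₀ : 0 < r₀) (hα : 0 < αs) (hh : 0 < h) (hw : WSpace r₀ w)
    (he : IsEquilibrium αs r₀ (strain R w) v s) {v₁ w₁ : ℝ → ℝ}
    (hv₁ : AdmissibleV r₀ v₁) (hw₁ : AdmissibleW r₀ w₁)
    (hcrit : firstVar αs r₀ R h w s (fun r => w₁ r - w r) = 0)
    (hfin : IntegrableOn (density αs R h (fun _ => 0) v₁ w₁) (Ioo 0 r₀))
    (hle : ∫ r in Ioo 0 r₀, density αs R h (fun _ => 0) v₁ w₁ r
      ≤ ∫ r in Ioo 0 r₀, density αs R h (fun _ => 0) v w r) :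
    EqOn v₁ v (Ioo 0 r₀) ∧ EqOn w₁ w (Ioo 0 r₀) := by
  have hadm := he.admissible (hw.admissible.continuousOn_strain R)
  obtain ⟨-, -, iρ, -, e⟩ := he.energy_identity hr₀ hα hh hw hv₁ hw₁ integrableOn_zero hfin
  have hw₁' := (integrableOn_terms hα hh hv₁.locallyAC hw₁ aestronglyMeasurable_const hfin).2.1
  have h1 : 0 ≤ ∫ r in Ioo 0 r₀, s r * deriv (fun r => w₁ r - w r) r ^ 2 :=
    setIntegral_nonneg measurableSet_Ioo fun r hr => mul_nonneg (he.s_nonneg r hr) (sq_nonneg _)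
  have h2 : 0 ≤ ∫ r in Ioo 0 r₀,
      (deriv v₁ r + (1 / 2) * (r / R - deriv w₁ r) ^ 2 + 0 - s r / r) ^ 2 * r :=
    weighted_nonneg fun r => deriv v₁ r + (1 / 2) * (r / R - deriv w₁ r) ^ 2 + 0 - s r / r
  have h3 : 0 ≤ ∫ r in Ioo 0 r₀, excess αs (v₁ r / r) (v r / r) * r :=
    setIntegral_nonneg measurableSet_Ioo fun r hr => mul_nonneg (excess_nonneg hα _ _) hr.1.le
  have hA : 0 ≤ ∫ r in Ioo 0 r₀, (w₁ r - w r) ^ 2 * r := weighted_nonneg fun r => w₁ r - w r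
  have hB : 0 ≤ ∫ r in Ioo 0 r₀, deriv (deriv fun r => w₁ r - w r) r ^ 2 * r := weighted_nonneg _
  simp only [mul_zero, integral_zero, hcrit] at e
  have hA' : 0 ≤ αs * (h ^ 2)⁻¹ * ∫ r in Ioo 0 r₀, (w₁ r - w r) ^ 2 * r := by positivity
  have hB' : 0 ≤ h ^ 2 * ∫ r in Ioo 0 r₀, deriv (deriv fun r => w₁ r - w r) r ^ 2 * r := by
    positivity
  have z1 : ∫ r in Ioo 0 r₀, (w₁ r - w r) ^ 2 * r = 0 := by
    have : αs * (h ^ 2)⁻¹ * ∫ r in Ioo 0 r₀, (w₁ r - w r) ^ 2 * r = 0 := by linarith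
    have hne : αs * (h ^ 2)⁻¹ ≠ 0 := by positivity
    exact (mul_eq_zero.1 this).resolve_left hne
  have z2 : ∫ r in Ioo 0 r₀, deriv (deriv fun r => w₁ r - w r) r ^ 2 * r = 0 := by
    have : h ^ 2 * ∫ r in Ioo 0 r₀, deriv (deriv fun r => w₁ r - w r) r ^ 2 * r = 0 := by linarith
    have hne : h ^ 2 ≠ 0 := by positivity
    exact (mul_eq_zero.1 this).resolve_left hne
  have z3 : ∫ r in Ioo 0 r₀,
      (deriv v₁ r + (1 / 2) * (r / R - deriv w₁ r) ^ 2 + 0 - s r / r) ^ 2 * r = 0 := by linarith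
  have hwe : EqOn w₁ w (Ioo 0 r₀) := by
    obtain ⟨C, hC, H⟩ := WSpace.exists_value_bound hr₀
    intro r hr
    have := H _ (hw₁'.sub hw) r hr
    unfold wNormSq at this
    rw [z1, z2] at this
    simp only [add_zero, mul_zero, zero_div] at this
    exact sub_eq_zero.1 (pow_eq_zero_iff two_ne_zero |>.1 (le_antisymm this (sq_nonneg _)))
  refine ⟨?_, hwe⟩
  have hder : ∀ r ∈ Ioo 0 r₀, deriv w₁ r = deriv w r := fun r hr =>
    EventuallyEq.deriv_eq (eventually_of_mem (Ioo_mem_nhds hr.1 hr.2) hwe)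
  refine hv₁.locallyAC.eqOn_of_ae_deriv_eq hadm.locallyAC ?_ hv₁.zero_at_zero hadm.zero_at_zero
  rw [setIntegral_eq_zero_iff_of_nonneg_ae ((ae_restrict_iff' measurableSet_Ioo).2
    (Eventually.of_forall fun r hr => mul_nonneg (sq_nonneg _) hr.1.le)) iρ] at z3
  filter_upwards [z3, ae_restrict_mem measurableSet_Ioo] with r h0 hr
  have h5 := pow_eq_zero_iff two_ne_zero |>.1 ((mul_eq_zero.1 h0).resolve_right hr.1.ne')
  rw [(he.hasDerivAt_v r hr).deriv, strain, ← hder r hr]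
  linarith

/-- A critical point is a minimizer. -/
lemma F_le (hr₀ : 0 < r₀) (hα : 0 < αs) (hh : 0 < h) (hw : WSpace r₀ w)
    (he : IsEquilibrium αs r₀ (strain R w) v s) {v₁ w₁ : ℝ → ℝ}
    (hv₁ : AdmissibleV r₀ v₁) (hw₁ : AdmissibleW r₀ w₁)
    (hcrit : WSpace r₀ w₁ → firstVar αs r₀ R h w s (fun r => w₁ r - w r) = 0) :
    F αs r₀ R h v w ≤ F αs r₀ R h v₁ w₁ := by
  by_cases hfin : F αs r₀ R h v₁ w₁ = ∞
  · rw [hfin]; exact le_top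
  have hi := integrableOn_density_of_ne_top hα hv₁.locallyAC hw₁ aestronglyMeasurable_const hfin
  have hw₁' := (integrableOn_terms hα hh hv₁.locallyAC hw₁ aestronglyMeasurable_const hi).2.1
  unfold F
  rw [FB_eq_ofReal hα hi, FB_eq_ofReal hα (he.integrableOn_density hr₀ hα h hw hw)]
  refine ENNReal.ofReal_le_ofReal ?_
  have h1 := he.energy_ge hr₀ hα hh hw hv₁ hw₁ hi
  rw [hcrit hw₁'] at h1
  have : 0 ≤ min (αs * (h ^ 2)⁻¹) (h ^ 2) * wNormSq r₀ (fun r => w₁ r - w r) :=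
    mul_nonneg (by positivity) (wNormSq_nonneg _)
  linarith

/-- A critical point is the only minimizer. -/
lemma eqOn_of_F_le (hr₀ : 0 < r₀) (hα : 0 < αs) (hh : 0 < h) (hw : WSpace r₀ w)
    (he : IsEquilibrium αs r₀ (strain R w) v s) {v₁ w₁ : ℝ → ℝ}
    (hv₁ : AdmissibleV r₀ v₁) (hw₁ : AdmissibleW r₀ w₁)
    (hcrit : WSpace r₀ w₁ → firstVar αs r₀ R h w s (fun r => w₁ r - w r) = 0)
    (hle : F αs r₀ R h v₁ w₁ ≤ F αs r₀ R h v w) :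
    EqOn v₁ v (Ioo 0 r₀) ∧ EqOn w₁ w (Ioo 0 r₀) := by
  have i0 := he.integrableOn_density hr₀ hα h hw hw
  have e0 : F αs r₀ R h v w = _ := FB_eq_ofReal hα i0
  have hfin : F αs r₀ R h v₁ w₁ ≠ ∞ := ne_top_of_le_ne_top (by rw [e0]; exact ENNReal.ofReal_ne_top) hle
  have hi := integrableOn_density_of_ne_top hα hv₁.locallyAC hw₁ aestronglyMeasurable_const hfin
  have hw₁' := (integrableOn_terms hα hh hv₁.locallyAC hw₁ aestronglyMeasurable_const hi).2.1
  refine he.eqOn_of_energy_le hr₀ hα hh hw hv₁ hw₁ (hcrit hw₁') hi ?_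
  have e1 : F αs r₀ R h v₁ w₁ = _ := FB_eq_ofReal hα hi
  rw [e0, e1] at hle
  exact (ENNReal.ofReal_le_ofReal_iff (integral_density_nonneg hα)).1 hle

end IsEquilibrium

end

/-! ### The minimizer of the effective functional -/

section

variable {αs r₀ R h : ℝ}

lemma hasDerivAt_ite_le {f g : ℝ → ℝ} {a d : ℝ} (hf : HasDerivAt f d a) (hg : HasDerivAt g d a)
    (h : f a = g a) : HasDerivAt (fun r => if r ≤ a then f r else g r) d a := by
  have h1 : HasDerivWithinAt (fun r => if r ≤ a then f r else g r) d (Iic a) a :=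
    hf.hasDerivWithinAt.congr (fun r hr => if_pos hr) (if_pos le_rfl)
  have h2 : HasDerivWithinAt (fun r => if r ≤ a then f r else g r) d (Ici a) a := by
    refine hg.hasDerivWithinAt.congr (fun r hr => ?_) (by rw [if_pos le_rfl, h])
    rcases eq_or_lt_of_le (show a ≤ r from hr) with h' | h'
    · subst h'; rw [if_pos le_rfl, h]
    · exact if_neg (not_le.2 h')
  have := h1.union h2
  rwa [Iic_union_Ici, hasDerivWithinAt_univ] at this

/-- Gluing two differentiable functions whose values and derivatives agree at one point. -/
lemma hasDerivAt_ite {f g f' g' : ℝ → ℝ} {a : ℝ} {r : ℝ} (hf : HasDerivAt f (f' r) r)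
    (hg : a ≤ r → HasDerivAt g (g' r) r) (h : f a = g a) (h' : f' a = g' a) :
    HasDerivAt (fun r => if r ≤ a then f r else g r) (if r ≤ a then f' r else g' r) r := by
  rcases lt_trichotomy r a with hr | rfl | hr
  · rw [if_pos hr.le]
    refine hf.congr_of_eventuallyEq ?_
    filter_upwards [Iio_mem_nhds hr] with t ht
    exact if_pos (show t < a from ht).le
  · rw [if_pos le_rfl]
    exact hasDerivAt_ite_le hf (h' ▸ hg le_rfl) h
  · rw [if_neg (not_le.2 hr)]
    refine (hg hr.le).congr_of_eventuallyEq ?_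
    filter_upwards [Ioi_mem_nhds hr] with t ht
    exact if_neg (not_le.2 ht)

/-- The weighted radial stress of the explicit minimizer `v₀`. -/
noncomputable def s₀ (αs r₀ R r : ℝ) : ℝ :=
  if r ≤ rw αs r₀ R then
    (2 * √αs * (r₀ / rw αs r₀ R - 1) + 1 / 16 * (rw αs r₀ R ^ 2 / R ^ 2)) * r
      - 1 / 16 * (r ^ 3 / R ^ 2)
  else 2 * √αs * (r₀ - r)

lemma rw_pos (hα : 0 < αs) (hr₀ : 0 < r₀) (hR : 0 < R) : 0 < rw αs r₀ R := by
  unfold rw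
  have := Real.sqrt_pos.2 hα
  positivity

lemma rw_pow_three (hα : 0 < αs) (hr₀ : 0 < r₀) (hR : 0 < R) :
    rw αs r₀ R ^ 3 = 16 * √αs * r₀ * R ^ 2 := by
  have := Real.sqrt_pos.2 hα
  unfold rw
  rw [← Real.rpow_natCast, ← Real.rpow_mul (by positivity)]
  norm_num

lemma rw_lt (hα : 0 < αs) (hr₀ : 0 < r₀) (hR : 0 < R) (hcond : αs < (2 ^ 8)⁻¹ * (r₀ / R) ^ 4) :
    rw αs r₀ R < r₀ := by
  have h1 : √αs < r₀ ^ 2 / (16 * R ^ 2) := by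
    rw [Real.sqrt_lt' (by positivity)]
    calc αs < (2 ^ 8)⁻¹ * (r₀ / R) ^ 4 := hcond
      _ = (r₀ ^ 2 / (16 * R ^ 2)) ^ 2 := by field_simp; norm_num
  rw [lt_div_iff₀ (by positivity)] at h1
  refine lt_of_pow_lt_pow_left₀ 3 hr₀.le ?_
  rw [rw_pow_three hα hr₀ hR]
  nlinarith

/-- Outside the inner radius the effective azimuthal strain is below the threshold, by an amount
that vanishes only at the inner radius. -/
lemma v₀_le_of_rw_le (hα : 0 < αs) (hr₀ : 0 < r₀) (hR : 0 < R) {r : ℝ} (hr : rw αs r₀ R < r) :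
    v₀ αs r₀ R r ≤ -2 * √αs * r - (r ^ 3 - rw αs r₀ R ^ 3) / (8 * R ^ 2) := by
  have hp := rw_pos hα hr₀ hR
  have h3 := rw_pow_three hα hr₀ hR
  unfold v₀
  rw [if_neg (not_le.2 hr)]
  set a := rw αs r₀ R
  have hra : 0 < r / a := div_pos (hp.trans hr) hp
  -- `log t ≤ t - 1 ≤ (t ^ 3 - 1) / 3`
  have h1 : Real.log (r / a) ≤ ((r / a) ^ 3 - 1) / 3 := by
    have := Real.log_le_sub_one_of_pos hra
    nlinarith [mul_nonneg (sq_nonneg (r / a - 1)) (show 0 ≤ r / a + 2 by linarith)]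
  have h2 : 2 * √αs * r₀ = a ^ 3 / (8 * R ^ 2) := by
    rw [h3]; field_simp; norm_num
  have h4 : 2 * √αs * r₀ * Real.log (r / a) ≤ (r ^ 3 - a ^ 3) / (24 * R ^ 2) := by
    rw [h2]
    calc a ^ 3 / (8 * R ^ 2) * Real.log (r / a)
        ≤ a ^ 3 / (8 * R ^ 2) * (((r / a) ^ 3 - 1) / 3) := by gcongr
      _ = _ := by field_simp; ring
  have e : 1 / 6 * ((r ^ 3 - a ^ 3) / R ^ 2) = (r ^ 3 - a ^ 3) / (8 * R ^ 2)
      + (r ^ 3 - a ^ 3) / (24 * R ^ 2) := by field_simp; ring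
  linarith

/-- Inside the inner radius the effective azimuthal strain is above the threshold. -/
lemma v₀_ge_of_le_rw (hα : 0 < αs) (hr₀ : 0 < r₀) (hR : 0 < R) {r : ℝ} (hr0 : 0 < r)
    (hr : r ≤ rw αs r₀ R) :
    -2 * √αs + 3 / 16 * ((rw αs r₀ R ^ 2 - r ^ 2) / R ^ 2) = v₀ αs r₀ R r / r := by
  have hp := rw_pos hα hr₀ hR
  have h3 := rw_pow_three hα hr₀ hR
  unfold v₀
  rw [if_pos hr]
  set a := rw αs r₀ R
  have h2 : 2 * √αs * (r₀ / a) = 1 / 8 * (a ^ 2 / R ^ 2) := by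
    field_simp
    linarith
  rw [eq_div_iff hr0.ne']
  have : r ^ 3 / R ^ 2 = r * (r ^ 2 / R ^ 2) := by ring
  rw [this, mul_sub, h2]
  ring

/-- The hypothesis on `αs` says that the inner radius is smaller than `r₀`, so that both branches of
`v₀` occur. -/
lemma isEquilibrium_v₀ (hα : 0 < αs) (hr₀ : 0 < r₀) (hR : 0 < R)
    (hcond : αs < (2 ^ 8)⁻¹ * (r₀ / R) ^ 4) :
    IsEquilibrium αs r₀ (strain R fun _ => 0) (v₀ αs r₀ R) (s₀ αs r₀ R) := by
  have hp := rw_pos hα hr₀ hR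
  have h3 := rw_pow_three hα hr₀ hR
  have hlt := rw_lt hα hr₀ hR hcond
  have hge : ∀ r, 0 < r → r ≤ rw αs r₀ R → -2 * √αs ≤ v₀ αs r₀ R r / r := fun r h0 h => by
    rw [← v₀_ge_of_le_rw hα hr₀ hR h0 h]
    have : 0 ≤ rw αs r₀ R ^ 2 - r ^ 2 := by nlinarith
    have : 0 ≤ 3 / 16 * ((rw αs r₀ R ^ 2 - r ^ 2) / R ^ 2) := by positivity
    linarith
  have hle : ∀ r, rw αs r₀ R < r → v₀ αs r₀ R r / r ≤ -2 * √αs := fun r h => by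
    rw [div_le_iff₀ (hp.trans h)]
    refine (v₀_le_of_rw_le hα hr₀ hR h).trans ?_
    have : 0 ≤ r ^ 3 - rw αs r₀ R ^ 3 := sub_nonneg.2 (pow_le_pow_left₀ hp.le h.le 3)
    have : 0 ≤ (r ^ 3 - rw αs r₀ R ^ 3) / (8 * R ^ 2) := by positivity
    linarith
  have hα' := Real.sqrt_pos.2 hα
  have hg : ∀ r, strain R (fun _ => 0) r = r ^ 2 / (2 * R ^ 2) := fun r => by
    unfold strain
    rw [deriv_const, sub_zero, div_pow]
    field_simp
  have hcub : ∀ r : ℝ, HasDerivAt (fun r => r ^ 3 / R ^ 2) (3 * r ^ 2 / R ^ 2) r := fun r => by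
    simpa using (hasDerivAt_pow 3 r).div_const (R ^ 2)
  set a := rw αs r₀ R with ha
  set k := 2 * √αs * (r₀ / a - 1) + 1 / 16 * (a ^ 2 / R ^ 2) with hk
  have hk1 : k * a - 1 / 16 * (a ^ 3 / R ^ 2) = 2 * √αs * (r₀ - a) := by
    rw [hk]; field_simp; ring
  have hk2 : 2 * √αs * r₀ = 1 / 8 * (a ^ 3 / R ^ 2) := by rw [h3]; field_simp; norm_num
  have hk3 : 0 < k := by
    have : 1 < r₀ / a := by rwa [one_lt_div hp]
    have : 0 < r₀ / a - 1 := by linarith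
    positivity
  have hcases : ∀ r, (s₀ αs r₀ R r = if r ≤ a then k * r - 1 / 16 * (r ^ 3 / R ^ 2)
      else 2 * √αs * (r₀ - r)) := fun r => rfl
  have hev : ∀ {p : ℝ → Prop}, (∀ r, 0 < r → r ≤ a → p r) → ∀ᶠ r in 𝓝[>] (0 : ℝ), p r :=
    fun hr => by
      filter_upwards [Ioo_mem_nhdsGT hp] with r h
      exact hr r h.1 h.2.le
  constructor
  · intro r hr
    have h1 : HasDerivAt (fun r => -3 / 16 * (r ^ 3 / R ^ 2) + k * r)
        (-3 / 16 * (3 * r ^ 2 / R ^ 2) + k) r :=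
      ((hcub r).const_mul (-3 / 16)).add (by simpa using (hasDerivAt_id r).const_mul k)
    have h2 : a ≤ r → HasDerivAt (fun r => -2 * √αs * r - 1 / 6 * ((r ^ 3 - a ^ 3) / R ^ 2)
        + 2 * √αs * r₀ * Real.log (r / a))
        (-2 * √αs - 1 / 6 * (3 * r ^ 2 / R ^ 2) + 2 * √αs * r₀ * r⁻¹) r := by
      intro _
      have e1 : HasDerivAt (fun r => Real.log (r / a)) r⁻¹ r := by
        refine (((hasDerivAt_id r).div_const a).log (div_pos hr.1 hp).ne').congr_deriv ?_
        have := hr.1.ne'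
        simp only [id]
        field_simp
      have e2 : HasDerivAt (fun r => (r ^ 3 - a ^ 3) / R ^ 2) (3 * r ^ 2 / R ^ 2) r := by
        simpa using ((hasDerivAt_pow 3 r).sub_const (a ^ 3)).div_const (R ^ 2)
      exact (HasDerivAt.sub (((hasDerivAt_id r).const_mul (-2 * √αs)).congr_deriv (mul_one _))
        (e2.const_mul (1 / 6))).add (e1.const_mul _)
    have h4 := hasDerivAt_ite (f' := fun r => -3 / 16 * (3 * r ^ 2 / R ^ 2) + k)
      (g' := fun r => -2 * √αs - 1 / 6 * (3 * r ^ 2 / R ^ 2) + 2 * √αs * r₀ * r⁻¹)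
      (a := a) h1 h2 ?_ ?_
    · refine h4.congr_deriv ?_
      have := hr.1.ne'
      rw [hg, hcases]
      split_ifs with hra
      · field_simp; ring
      · field_simp; ring
    · have : -3 / 16 * (a ^ 3 / R ^ 2) + k * a = -2 * √αs * a := by
        have : -3 / 16 * (a ^ 3 / R ^ 2) = - (1 / 8 * (a ^ 3 / R ^ 2))
          - 1 / 16 * (a ^ 3 / R ^ 2) := by ring
        rw [this, ← hk2]; linarith
      rw [this, div_self hp.ne']; simp
    · rw [hk]
      field_simp
      ring
  · intro r hr
    have h1 : HasDerivAt (fun r => k * r - 1 / 16 * (r ^ 3 / R ^ 2))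
        (k - 1 / 16 * (3 * r ^ 2 / R ^ 2)) r :=
      HasDerivAt.sub (by simpa using (hasDerivAt_id r).const_mul k) ((hcub r).const_mul (1 / 16))
    have h2 : a ≤ r → HasDerivAt (fun r => 2 * √αs * (r₀ - r)) (-2 * √αs) r := fun _ =>
      (((hasDerivAt_id r).const_sub r₀).const_mul (2 * √αs)).congr_deriv (by ring)
    have hka : k - 1 / 16 * (3 * a ^ 2 / R ^ 2) = -2 * √αs := by
      have : k * a = -2 * √αs * a + 3 / 16 * (a ^ 3 / R ^ 2) := by linarith
      have h5 : (k - 1 / 16 * (3 * a ^ 2 / R ^ 2)) * a = -2 * √αs * a := by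
        rw [sub_mul, this]; ring
      exact mul_right_cancel₀ hp.ne' h5
    have h4 := hasDerivAt_ite (f' := fun r => k - 1 / 16 * (3 * r ^ 2 / R ^ 2))
      (g' := fun _ => -2 * √αs) (a := a) h1 h2 hk1 hka
    refine h4.congr_deriv ?_
    split_ifs with hra
    · rw [max_eq_left (hge r hr.1 hra)]
      have : v₀ αs r₀ R r = -3 / 16 * (r ^ 3 / R ^ 2) + k * r := if_pos hra
      have := hr.1.ne'
      rw [‹v₀ αs r₀ R r = _›]
      field_simp
      ring
    · rw [max_eq_right (hle r (not_le.1 hra))]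
  · intro r hr
    rw [hcases]
    split_ifs with hra
    · have h1 : r ^ 3 ≤ r * a ^ 2 := by
        have : r ^ 2 ≤ a ^ 2 := pow_le_pow_left₀ hr.1.le hra 2
        nlinarith [hr.1]
      have h2 : 1 / 16 * (r ^ 3 / R ^ 2) ≤ 1 / 16 * (a ^ 2 / R ^ 2) * r := by
        calc 1 / 16 * (r ^ 3 / R ^ 2) ≤ 1 / 16 * (r * a ^ 2 / R ^ 2) := by gcongr
          _ = _ := by ring
      have : 1 < r₀ / a := by rwa [one_lt_div hp]
      have h3 : 0 ≤ 2 * √αs * (r₀ / a - 1) * r := by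
        have := hr.1
        have : 0 ≤ r₀ / a - 1 := by linarith
        positivity
      rw [hk, add_mul]
      linarith
    · have : 0 ≤ r₀ - r := by linarith [hr.2]
      positivity
  · have h1 : Tendsto (fun r => -3 / 16 * (r ^ 3 / R ^ 2) + k * r) (𝓝[>] 0) (𝓝 0) := by
      have : Continuous fun r : ℝ => -3 / 16 * (r ^ 3 / R ^ 2) + k * r := by fun_prop
      simpa using (this.tendsto 0).mono_left nhdsWithin_le_nhds
    exact h1.congr' (hev fun r _ h => (if_pos h).symm)
  · have h1 : Tendsto (fun r => k * r - 1 / 16 * (r ^ 3 / R ^ 2)) (𝓝[>] 0) (𝓝 0) := by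
      have : Continuous fun r : ℝ => k * r - 1 / 16 * (r ^ 3 / R ^ 2) := by fun_prop
      simpa using (this.tendsto 0).mono_left nhdsWithin_le_nhds
    exact h1.congr' (hev fun r _ h => (if_pos h).symm)
  · have h1 : Tendsto (fun r => 2 * √αs * (r₀ - r)) (𝓝[<] r₀) (𝓝 0) := by
      have : Continuous fun r : ℝ => 2 * √αs * (r₀ - r) := by fun_prop
      simpa using (this.tendsto r₀).mono_left nhdsWithin_le_nhds
    refine h1.congr' ?_
    filter_upwards [Ioo_mem_nhdsLT hlt] with r hr
    exact (if_neg (not_le.2 hr.1)).symm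

lemma integral_id_Ioo (hr₀ : 0 < r₀) : ∫ r in Ioo 0 r₀, r = r₀ ^ 2 / 2 := by
  rw [← integral_Ioc_eq_integral_Ioo, ← intervalIntegral.integral_of_le hr₀.le, integral_id]
  ring

/-- The effective functional is the full one at `w = 0`, up to the bending energy of the flat
profile. -/
lemma F_zero (hr₀ : 0 < r₀) (hα : 0 < αs) (v : ℝ → ℝ) :
    F αs r₀ R h v (fun _ => 0) = F₀ αs r₀ R v
      + ENNReal.ofReal (h ^ 2 * (1 / R) ^ 2 * (r₀ ^ 2 / 2)) := by
  have h1 : ENNReal.ofReal (h ^ 2 * (1 / R) ^ 2 * (r₀ ^ 2 / 2))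
      = ∫⁻ r in Ioo 0 r₀, ENNReal.ofReal (h ^ 2 * (1 / R) ^ 2 * r) := by
    rw [← integral_id_Ioo hr₀, ← integral_const_mul, ofReal_integral_eq_lintegral_ofReal
      ((integrableOn_id_Ioo r₀).const_mul _) ((ae_restrict_iff' measurableSet_Ioo).2
        (Eventually.of_forall fun r hr => by have := hr.1; positivity))]
  rw [h1, F, FB, F₀, ← lintegral_add_right _ (by fun_prop)]
  refine setLIntegral_congr_fun measurableSet_Ioo fun r hr => ?_
  have := hr.1
  have := Wrel_nonneg hα (v r / r)
  rw [← ENNReal.ofReal_add (by positivity) (by positivity)]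
  congr 1
  simp only [deriv_const']
  ring

lemma isMinimizerF₀_v₀ (hα : 0 < αs) (hr₀ : 0 < r₀) (hR : 0 < R)
    (hcond : αs < (2 ^ 8)⁻¹ * (r₀ / R) ^ 4) :
    IsMinimizerF₀ αs r₀ R (v₀ αs r₀ R) ∧
    (∀ v, IsMinimizerF₀ αs r₀ R v → EqOn v (v₀ αs r₀ R) (Ioo 0 r₀)) ∧
    F₀ αs r₀ R (v₀ αs r₀ R) ≠ ∞ := by
  have he := isEquilibrium_v₀ hα hr₀ hR hcond
  have hw := wSpace_zero r₀
  have hadm := he.admissible (hw.admissible.continuousOn_strain R)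
  refine ⟨⟨hadm, fun v' hv' => ?_⟩, fun v hv => ?_, ?_⟩
  · have := he.F_le hr₀ hα one_pos hw hv' hw.admissible fun _ => firstVar_self _ _ _
    rw [F_zero hr₀ hα, F_zero hr₀ hα] at this
    exact (ENNReal.add_le_add_iff_right ENNReal.ofReal_ne_top).1 this
  · refine (he.eqOn_of_F_le hr₀ hα one_pos hw hv.admissible hw.admissible
      (fun _ => firstVar_self _ _ _) ?_).1
    rw [F_zero hr₀ hα, F_zero hr₀ hα]
    gcongr
    exact hv.le _ hadm
  · have e : F αs r₀ R 1 (v₀ αs r₀ R) (fun _ => 0) = _ :=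
      FB_eq_ofReal hα (he.integrableOn_density hr₀ hα 1 hw hw)
    have h1 : F αs r₀ R 1 (v₀ αs r₀ R) (fun _ => 0) ≠ ∞ := by
      rw [e]; exact ENNReal.ofReal_ne_top
    rw [F_zero hr₀ hα] at h1
    exact (ENNReal.add_ne_top.1 h1).1

lemma toReal_F₀_v₀ (hα : 0 < αs) (hr₀ : 0 < r₀) (hR : 0 < R)
    (hcond : αs < (2 ^ 8)⁻¹ * (r₀ / R) ^ 4) (h : ℝ) :
    ∫ r in Ioo 0 r₀, density αs R h (fun _ => 0) (v₀ αs r₀ R) (fun _ => 0) r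
      = (F₀ αs r₀ R (v₀ αs r₀ R)).toReal + h ^ 2 * (1 / R) ^ 2 * (r₀ ^ 2 / 2) := by
  have he := isEquilibrium_v₀ hα hr₀ hR hcond
  have hw := wSpace_zero r₀
  have e : F αs r₀ R h (v₀ αs r₀ R) (fun _ => 0) = _ :=
    FB_eq_ofReal hα (he.integrableOn_density hr₀ hα h hw hw)
  rw [F_zero hr₀ hα] at e
  have e' := congrArg ENNReal.toReal e
  rw [ENNReal.toReal_add (isMinimizerF₀_v₀ hα hr₀ hR hcond).2.2 ENNReal.ofReal_ne_top,
    ENNReal.toReal_ofReal (by positivity),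
    ENNReal.toReal_ofReal (integral_density_nonneg hα)] at e'
  exact e'.symm

end

/-! ### Comparison of the minimizer with the effective minimizer -/

section

variable {αs r₀ R h : ℝ}

namespace IsEquilibrium

variable {v s : ℝ → ℝ}

/-- At the unwrinkled profile, the first variation is controlled by half of the quadratic energy
and an error `h ^ 2`; the term with the slope is integrated by parts. -/
lemma exists_firstVar_ge (hr₀ : 0 < r₀) (hα : 0 < αs) (hR : 0 < R)
    (he : IsEquilibrium αs r₀ (strain R fun _ => 0) v s) : ∃ C > 0, ∀ h > 0, ∀ y, WSpace r₀ y →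
      -(1 / 2 * (αs * (h ^ 2)⁻¹ * ∫ r in Ioo 0 r₀, y r ^ 2 * r))
        - 1 / 2 * (h ^ 2 * ∫ r in Ioo 0 r₀, deriv (deriv y) r ^ 2 * r) - C * h ^ 2
      ≤ 2 * firstVar αs r₀ R h (fun _ => 0) s y := by
  obtain ⟨C, hC, H⟩ := he.exists_bounds hr₀ (wSpace_zero r₀)
  obtain ⟨C₁, hC₁, H₁⟩ := WSpace.exists_value_bound hr₀
  refine ⟨8 * C ^ 2 / (αs * R ^ 2) * r₀ + 2 / R ^ 2 * r₀ ^ 2, by positivity,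
    fun h hh y hy => ?_⟩
  obtain ⟨K, hK, HK⟩ := hy.exists_deriv_bound hr₀
  set L := max K (C₁ * wNormSq r₀ y) with hL
  have hL0 : 0 < L := lt_max_of_lt_left hK
  -- `√r y` and `√r y'` are bounded
  have hbd : ∀ (x r : ℝ), r ∈ Ioo 0 r₀ → x ^ 2 ≤ L / √r → |√r * x| ≤ √(L * √r₀) := by
    intro x r hr hx
    have hsr := Real.sqrt_pos.2 hr.1
    refine Real.abs_le_sqrt ?_
    rw [sqrt_mul_sq hr.1.le]
    rw [le_div_iff₀ hsr] at hx
    calc x ^ 2 * r = x ^ 2 * √r * √r := by rw [mul_assoc, Real.mul_self_sqrt hr.1.le]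
      _ ≤ L * √r₀ := by gcongr; exact hr.2.le
  set M := √(L * √r₀) with hM
  have hy0 : ∀ r ∈ Ioo 0 r₀, |√r * y r| ≤ M := fun r hr => hbd _ r hr
    ((H₁ y hy r hr).trans (by have := hr.1; gcongr; exact le_max_right _ _))
  have hy1 : ∀ r ∈ Ioo 0 r₀, |√r * deriv y r| ≤ M := fun r hr => hbd _ r hr
    ((HK r hr).trans (by have := hr.1; gcongr; exact le_max_left _ _))
  have hM0 : 0 ≤ M := Real.sqrt_nonneg _
  have hry : ∀ (x r : ℝ), r ∈ Ioo 0 r₀ → |√r * x| ≤ M → |r * x| ≤ √r₀ * M := by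
    intro x r hr hx
    calc |r * x| = √r * |√r * x| := by
          rw [abs_mul, abs_mul, abs_of_nonneg (Real.sqrt_nonneg r), abs_of_pos hr.1, ← mul_assoc,
            Real.mul_self_sqrt hr.1.le]
      _ ≤ √r₀ * M := by gcongr; exact hr.2.le
  set m : ℝ → ℝ := fun r => max (v r / r) (-2 * √αs) with hm
  set f : ℝ → ℝ := fun r => s r * (r * y r) with hf
  have hfd : ∀ r ∈ Ioo 0 r₀,
      HasDerivAt f (m r * (r * y r) + s r * (1 * y r + r * deriv y r)) r := fun r hr =>
    (he.hasDerivAt_s r hr).mul ((hasDerivAt_id r).mul (hy.admissible.hasDerivAt hr))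
  have ms := aesm_of_continuousOn he.continuousOn_s
  have my := aesm_of_continuousOn hy.admissible.locallyAC.continuousOn
  have mm := aesm_of_continuousOn he.continuousOn_max
  have mid : AEStronglyMeasurable (fun r : ℝ => r) (volume.restrict (Ioo 0 r₀)) :=
    measurable_id.aestronglyMeasurable
  have isv := integrableOn_inv_sqrt r₀
  have iC : ∀ c : ℝ, IntegrableOn (fun _ : ℝ => c) (Ioo 0 r₀) := fun c => integrable_const c
  have i1 : IntegrableOn (fun r => m r * (r * y r)) (Ioo 0 r₀) := by
    refine integrableOn_of_abs_le measurableSet_Ioo (mm.mul (mid.mul my))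
      (isv.const_mul (C * (√r₀ * M))) fun r hr => ?_
    rw [abs_mul]
    calc |m r| * |r * y r| ≤ C / √r * (√r₀ * M) := by
          gcongr
          · exact (H r hr).2.2.1
          · exact hry _ r hr (hy0 r hr)
      _ = _ := by ring
  have hs : ∀ r ∈ Ioo 0 r₀, |s r| ≤ C * √r := fun r hr => by
    rw [abs_of_nonneg (he.s_nonneg r hr)]; exact (H r hr).1
  have i2 : IntegrableOn (fun r => s r * y r) (Ioo 0 r₀) := by
    refine integrableOn_of_abs_le measurableSet_Ioo (ms.mul my) (iC (C * M)) fun r hr => ?_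
    rw [abs_mul]
    calc |s r| * |y r| ≤ C * √r * |y r| := by gcongr; exact hs r hr
      _ = C * |√r * y r| := by rw [abs_mul, abs_of_nonneg (Real.sqrt_nonneg r)]; ring
      _ ≤ C * M := by gcongr; exact hy0 r hr
  have i3 : IntegrableOn (fun r => s r * (r * deriv y r)) (Ioo 0 r₀) := by
    refine integrableOn_of_abs_le measurableSet_Ioo (ms.mul (mid.mul (aesm_deriv y _)))
      (iC (C * √r₀ * (√r₀ * M))) fun r hr => ?_
    rw [abs_mul]
    gcongr
    · exact (hs r hr).trans (by gcongr; exact hr.2.le)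
    · exact hry _ r hr (hy1 r hr)
  have iall : IntegrableOn (fun r => m r * (r * y r) + s r * (1 * y r + r * deriv y r))
      (Ioo 0 r₀) := by
    refine (i1.add (i2.add i3)).congr (Eventually.of_forall fun r => ?_)
    simp only [Pi.add_apply]; ring
  have hfAC : LocallyAC r₀ f :=
    he.locallyAC_s.mul (LocallyAC.mul (locallyAC_of_hasDerivAt (fun r _ => hasDerivAt_id r)
      continuousOn_const) hy.admissible.locallyAC)
  have hfint : ∫ r in Ioo 0 r₀, (m r * (r * y r) + s r * (1 * y r + r * deriv y r)) = 0 := by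
    have hd : ∀ r ∈ Ioo 0 r₀, deriv f r = m r * (r * y r) + s r * (1 * y r + r * deriv y r) :=
      fun r hr => (hfd r hr).deriv
    rw [← setIntegral_congr_fun measurableSet_Ioo hd]
    have hlim : ∀ l : Filter ℝ, (∀ᶠ r in l, r ∈ Ioo 0 r₀) → Tendsto s l (𝓝 0) →
        Tendsto f l (𝓝 0) := by
      intro l hl hsl
      refine squeeze_zero_norm' (a := fun r => |s r| * (√r₀ * M)) ?_ ?_
      · filter_upwards [hl] with r hr
        rw [Real.norm_eq_abs, abs_mul]
        gcongr
        exact hry _ r hr (hy0 r hr)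
      · simpa using hsl.abs.mul_const (√r₀ * M)
    have := hfAC.setIntegral_deriv hr₀
      (iall.congr_fun (fun r hr => (hd r hr).symm) measurableSet_Ioo)
      (hlim _ (Ioo_mem_nhdsGT hr₀) he.s_zero) (hlim _ (Ioo_mem_nhdsLT hr₀) he.s_end)
    simpa using this
  have i4 : IntegrableOn (fun r => deriv (deriv y) r * r) (Ioo 0 r₀) := by
    refine integrableOn_of_abs_le measurableSet_Ioo ((aesm_deriv _ _).mul mid)
      (hy.integrable_sq_deriv2.add (integrableOn_id_Ioo r₀)) fun r hr => ?_
    rw [abs_mul, abs_of_pos hr.1]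
    simp only [Pi.add_apply]
    have := hr.1
    have : |deriv (deriv y) r| ≤ deriv (deriv y) r ^ 2 + 1 := by
      rw [← sq_abs]; nlinarith [sq_nonneg (|deriv (deriv y) r| - 1), abs_nonneg (deriv (deriv y) r)]
    nlinarith
  have hfv : firstVar αs r₀ R h (fun _ => 0) s y
      = ∫ r in Ioo 0 r₀, (-(1 / R) * (s r * (r * deriv y r))
          + -(h ^ 2 / R) * (deriv (deriv y) r * r)) := by
    unfold firstVar
    congr 1
    ext r
    simp only [deriv_const']
    ring
  have iV : IntegrableOn (fun r => -(1 / R) * (s r * (r * deriv y r))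
          + -(h ^ 2 / R) * (deriv (deriv y) r * r)) (Ioo 0 r₀) :=
    (i3.const_mul _).add (i4.const_mul _)
  have hsum : 2 * firstVar αs r₀ R h (fun _ => 0) s y
      = ∫ r in Ioo 0 r₀, (2 * (-(1 / R) * (s r * (r * deriv y r))
          + -(h ^ 2 / R) * (deriv (deriv y) r * r))
        + 2 / R * (m r * (r * y r) + s r * (1 * y r + r * deriv y r))) := by
    rw [integral_add (iV.const_mul 2) (iall.const_mul (2 / R)), integral_const_mul,
      integral_const_mul, hfint, hfv]
    ring
  have j1 := hy.integrable_sq.const_mul (-(1 / 2 * (αs * (h ^ 2)⁻¹)))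
  have j2 := hy.integrable_sq_deriv2.const_mul (-(1 / 2 * h ^ 2))
  have j3 := iC (-((8 * C ^ 2 / (αs * R ^ 2) + 2 / R ^ 2 * r₀) * h ^ 2))
  have j12 : IntegrableOn (fun r => -(1 / 2 * (αs * (h ^ 2)⁻¹)) * (y r ^ 2 * r)
      + -(1 / 2 * h ^ 2) * (deriv (deriv y) r ^ 2 * r)) (Ioo 0 r₀) := j1.add j2
  have hlow : ∫ r in Ioo 0 r₀, (-(1 / 2 * (αs * (h ^ 2)⁻¹)) * (y r ^ 2 * r)
      + -(1 / 2 * h ^ 2) * (deriv (deriv y) r ^ 2 * r)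
      + -((8 * C ^ 2 / (αs * R ^ 2) + 2 / R ^ 2 * r₀) * h ^ 2))
      = -(1 / 2 * (αs * (h ^ 2)⁻¹ * ∫ r in Ioo 0 r₀, y r ^ 2 * r))
        - 1 / 2 * (h ^ 2 * ∫ r in Ioo 0 r₀, deriv (deriv y) r ^ 2 * r)
        - (8 * C ^ 2 / (αs * R ^ 2) * r₀ + 2 / R ^ 2 * r₀ ^ 2) * h ^ 2 := by
    rw [integral_add j12 j3, integral_add j1 j2, integral_const_mul, integral_const_mul,
      setIntegral_const]
    simp only [Measure.real, Real.volume_Ioo, sub_zero, ENNReal.toReal_ofReal hr₀.le, smul_eq_mul]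
    ring
  rw [hsum, ← hlow]
  refine setIntegral_mono_on (j12.add j3) ((iV.const_mul 2).add (iall.const_mul (2 / R)))
    measurableSet_Ioo fun r hr => ?_
  have hr1 := hr.1
  have hsr := Real.sqrt_pos.2 hr1
  have hrs : √r * √r = r := Real.mul_self_sqrt hr1.le
  set Y := deriv (deriv y) r
  -- the two linear terms are absorbed by Young's inequality
  have e1 : -(2 / R * h ^ 2 * (Y * r)) ≥ -(1 / 2 * h ^ 2) * (Y ^ 2 * r) - 2 / R ^ 2 * r₀ * h ^ 2 := by
    have h1 : 2 / R * Y ≤ 1 / 2 * Y ^ 2 + 2 / R ^ 2 := by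
      have : 1 / 2 * Y ^ 2 + 2 / R ^ 2 - 2 / R * Y = 1 / 2 * (Y - 2 / R) ^ 2 := by ring
      nlinarith [sq_nonneg (Y - 2 / R)]
    have h2 : 2 / R * Y * (h ^ 2 * r) ≤ (1 / 2 * Y ^ 2 + 2 / R ^ 2) * (h ^ 2 * r) := by gcongr
    have h3 : 2 / R ^ 2 * h ^ 2 * r ≤ 2 / R ^ 2 * h ^ 2 * r₀ := by gcongr; exact hr.2.le
    linarith
  have hq : |m r * r + s r| ≤ 2 * C * √r := by
    have h1 : |m r * r| ≤ C * √r := by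
      rw [abs_mul, abs_of_pos hr1]
      calc |m r| * r ≤ C / √r * r := by gcongr; exact (H r hr).2.2.1
        _ = C / √r * (√r * √r) := by rw [hrs]
        _ = C * √r := by field_simp
    calc |m r * r + s r| ≤ |m r * r| + |s r| := abs_add_le _ _
      _ ≤ C * √r + C * √r := add_le_add h1 (hs r hr)
      _ = _ := by ring
  have hq2 : (m r * r + s r) ^ 2 ≤ 4 * C ^ 2 * r := by
    rw [← sq_abs]
    calc |m r * r + s r| ^ 2 ≤ (2 * C * √r) ^ 2 := by gcongr
      _ = _ := by rw [mul_pow, Real.sq_sqrt hr1.le]; ring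
  have e2 : 2 / R * ((m r * r + s r) * y r) ≥ -(1 / 2 * (αs * (h ^ 2)⁻¹)) * (y r ^ 2 * r)
      - 8 * C ^ 2 / (αs * R ^ 2) * h ^ 2 := by
    set q := m r * r + s r
    have h1 : -(2 / R * (q * y r)) ≤ 1 / 2 * (αs * (h ^ 2)⁻¹) * (y r ^ 2 * r)
        + 2 * h ^ 2 / (αs * R ^ 2) * (q ^ 2 / r) := by
      have : 1 / 2 * (αs * (h ^ 2)⁻¹) * (y r ^ 2 * r) + 2 * h ^ 2 / (αs * R ^ 2) * (q ^ 2 / r)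
          + 2 / R * (q * y r)
          = 1 / 2 * (αs * (h ^ 2)⁻¹ * r) * (y r + 2 * h ^ 2 / (αs * R) * (q / r)) ^ 2 := by
        field_simp
        ring
      have : 0 ≤ 1 / 2 * (αs * (h ^ 2)⁻¹ * r) * (y r + 2 * h ^ 2 / (αs * R) * (q / r)) ^ 2 := by
        positivity
      linarith
    have h2 : 2 * h ^ 2 / (αs * R ^ 2) * (q ^ 2 / r) ≤ 2 * h ^ 2 / (αs * R ^ 2) * (4 * C ^ 2) := by
      gcongr
      rw [div_le_iff₀ hr1]; exact hq2
    have h3 : 2 * h ^ 2 / (αs * R ^ 2) * (4 * C ^ 2) = 8 * C ^ 2 / (αs * R ^ 2) * h ^ 2 := by ring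
    linarith
  have e3 : 2 * (-(1 / R) * (s r * (r * deriv y r)) + -(h ^ 2 / R) * (Y * r))
        + 2 / R * (m r * (r * y r) + s r * (1 * y r + r * deriv y r))
      = 2 / R * ((m r * r + s r) * y r) - 2 / R * h ^ 2 * (Y * r) := by ring
  rw [e3]
  linarith

end IsEquilibrium

end

/-! ### Uniform bounds for the minimizers -/

section

variable {αs r₀ R h : ℝ} {w v s : ℝ → ℝ}

namespace IsCritical

lemma admissibleV (hc : IsCritical αs r₀ R h w v s) : AdmissibleV r₀ v :=
  hc.isEquilibrium.admissible (hc.wSpace.admissible.continuousOn_strain R)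

lemma integrableOn_density (hr₀ : 0 < r₀) (hα : 0 < αs) (hc : IsCritical αs r₀ R h w v s) :
    IntegrableOn (density αs R h (fun _ => 0) v w) (Ioo 0 r₀) :=
  hc.isEquilibrium.integrableOn_density hr₀ hα h hc.wSpace hc.wSpace

lemma energy_le (hr₀ : 0 < r₀) (hα : 0 < αs) (hh : 0 < h) (hc : IsCritical αs r₀ R h w v s)
    {v₁ w₁ : ℝ → ℝ} (hv₁ : AdmissibleV r₀ v₁) (hw₁ : WSpace r₀ w₁)
    (hfin : IntegrableOn (density αs R h (fun _ => 0) v₁ w₁) (Ioo 0 r₀)) :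
    ∫ r in Ioo 0 r₀, density αs R h (fun _ => 0) v w r
      ≤ ∫ r in Ioo 0 r₀, density αs R h (fun _ => 0) v₁ w₁ r := by
  have h1 := hc.isEquilibrium.energy_ge hr₀ hα hh hc.wSpace hv₁ hw₁.admissible hfin
  rw [hc.firstVar_eq_zero _ (hw₁.sub hc.wSpace)] at h1
  have : 0 ≤ min (αs * (h ^ 2)⁻¹) (h ^ 2) * wNormSq r₀ (fun r => w₁ r - w r) :=
    mul_nonneg (by positivity) (wNormSq_nonneg _)
  linarith

/-- The flat, undeformed state `v = 0`, `w = r² / (2R)` is a competitor. -/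
lemma energy_le_inv (hr₀ : 0 < r₀) (hα : 0 < αs) (hh : 0 < h) (hc : IsCritical αs r₀ R h w v s) :
    ∫ r in Ioo 0 r₀, density αs R h (fun _ => 0) v w r
      ≤ αs * (h ^ 2)⁻¹ * ∫ r in Ioo 0 r₀, (1 / R / 2 * r ^ 2) ^ 2 * r := by
  obtain ⟨hp, hp1, hp2⟩ := wSpace_parabola r₀ (1 / R)
  have hv : AdmissibleV r₀ (fun _ => 0) :=
    ⟨locallyAC_of_hasDerivAt (fun r _ => hasDerivAt_const r 0) continuousOn_const,
      tendsto_const_nhds⟩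
  have e : density αs R h (fun _ => 0) (fun _ => 0) (fun r => 1 / R / 2 * r ^ 2)
      = fun r => αs * (h ^ 2)⁻¹ * ((1 / R / 2 * r ^ 2) ^ 2 * r) := by
    ext r
    unfold density
    rw [hp1, hp2, deriv_const, zero_div, Wrel, if_pos (by
      have := Real.sqrt_nonneg αs; linarith)]
    ring
  refine (hc.energy_le hr₀ hα hh hv hp ?_).trans_eq ?_
  · rw [e]; exact hp.integrable_sq.const_mul _
  · rw [e, integral_const_mul]

/-- Bounds by the energy of the flat state; they are the relevant ones for large `h`. -/
lemma bounds_inv (hr₀ : 0 < r₀) (hα : 0 < αs) (hh : 0 < h) (hc : IsCritical αs r₀ R h w v s) :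
    (∫ r in Ioo 0 r₀, w r ^ 2 * r) ≤ (∫ r in Ioo 0 r₀, (1 / R / 2 * r ^ 2) ^ 2 * r) ∧
    (∫ r in Ioo 0 r₀, (deriv (deriv w) r - 1 / R) ^ 2 * r)
      ≤ αs * (h ^ 4)⁻¹ * ∫ r in Ioo 0 r₀, (1 / R / 2 * r ^ 2) ^ 2 * r := by
  have hE := hc.energy_le_inv hr₀ hα hh
  have hi := hc.integrableOn_density hr₀ hα
  set A := ∫ r in Ioo 0 r₀, (1 / R / 2 * r ^ 2) ^ 2 * r
  have h1 : αs * (h ^ 2)⁻¹ * (∫ r in Ioo 0 r₀, w r ^ 2 * r) ≤ αs * (h ^ 2)⁻¹ * A := by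
    refine le_trans ?_ hE
    rw [← integral_const_mul]
    refine setIntegral_mono_on (hc.wSpace.integrable_sq.const_mul _) hi measurableSet_Ioo
      fun r hr => ?_
    have := hr.1
    have := Wrel_nonneg hα (v r / r)
    unfold density
    have : 0 ≤ ((deriv v r + 1 / 2 * (r / R - deriv w r) ^ 2 + 0) ^ 2
      + h ^ 2 * (deriv (deriv w) r - 1 / R) ^ 2 + Wrel αs (v r / r)) * r := by positivity
    linarith
  have h2 : h ^ 2 * (∫ r in Ioo 0 r₀, (deriv (deriv w) r - 1 / R) ^ 2 * r)
      ≤ αs * (h ^ 2)⁻¹ * A := by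
    refine le_trans ?_ hE
    rw [← integral_const_mul]
    refine setIntegral_mono_on ((hc.wSpace.integrable_curvature _).const_mul _) hi
      measurableSet_Ioo fun r hr => ?_
    have := hr.1
    have := Wrel_nonneg hα (v r / r)
    unfold density
    have : 0 ≤ ((deriv v r + 1 / 2 * (r / R - deriv w r) ^ 2 + 0) ^ 2
      + αs * (h ^ 2)⁻¹ * w r ^ 2 + Wrel αs (v r / r)) * r := by positivity
    linarith
  refine ⟨le_of_mul_le_mul_left h1 (by positivity), le_of_mul_le_mul_left ?_ (pow_pos hh 2)⟩
  refine h2.trans_eq ?_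
  field_simp

end IsCritical

/-- The main comparison: the second variation identity at the effective minimizer, read as an upper
bound for the quadratic terms at a minimizer of the full energy. -/
lemma exists_comparison (hα : 0 < αs) (hr₀ : 0 < r₀) (hR : 0 < R)
    (hcond : αs < (2 ^ 8)⁻¹ * (r₀ / R) ^ 4) :
    ∃ C > 0, ∀ h > 0, ∀ w v s, IsCritical αs r₀ R h w v s →
      |(F₀ αs r₀ R (v₀ αs r₀ R)).toReal - ∫ r in Ioo 0 r₀, density αs R h (fun _ => 0) v w r|
        ≤ C * h ^ 2 ∧
      (∫ r in Ioo 0 r₀, w r ^ 2 * r) ≤ C * h ^ 4 ∧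
      (∫ r in Ioo 0 r₀, deriv (deriv w) r ^ 2 * r) ≤ C ∧
      IntegrableOn (fun r => (s r / r - s₀ αs r₀ R r / r) ^ 2 * r) (Ioo 0 r₀) ∧
      (∫ r in Ioo 0 r₀, (s r / r - s₀ αs r₀ R r / r) ^ 2 * r) ≤ C * h ^ 2 ∧
      IntegrableOn (fun r => excess αs (v r / r) (v₀ αs r₀ R r / r) * r) (Ioo 0 r₀) ∧
      (∫ r in Ioo 0 r₀, excess αs (v r / r) (v₀ αs r₀ R r / r) * r) ≤ C * h ^ 2 := by
  have he := isEquilibrium_v₀ hα hr₀ hR hcond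
  have hw0 := wSpace_zero r₀
  obtain ⟨C₁, hC₁, H⟩ := he.exists_firstVar_ge hr₀ hα hR
  set c := (1 / R) ^ 2 * (r₀ ^ 2 / 2) with hc
  have hc0 : 0 ≤ c := by positivity
  refine ⟨(C₁ + c) * (1 + 2 + 2 / αs), by positivity, fun h hh w v s hcrit => ?_⟩
  have hi := hcrit.integrableOn_density hr₀ hα
  have hE0 := toReal_F₀_v₀ hα hr₀ hR hcond h
  have hup := hcrit.energy_le hr₀ hα hh (he.admissible (hw0.admissible.continuousOn_strain R)) hw0
    (he.integrableOn_density hr₀ hα h hw0 hw0)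
  obtain ⟨-, -, iρ, iD, e⟩ := he.energy_identity hr₀ hα hh hw0 hcrit.admissibleV
    hcrit.wSpace.admissible integrableOn_zero hi
  have hH := H h hh w hcrit.wSpace
  have hρ : ∀ r ∈ Ioo 0 r₀, (deriv v r + 1 / 2 * (r / R - deriv w r) ^ 2 + 0
      - s₀ αs r₀ R r / r) ^ 2 * r = (s r / r - s₀ αs r₀ R r / r) ^ 2 * r := fun r hr => by
    rw [add_zero, ← hcrit.isEquilibrium.stress_eq hr, stress]
  have iρ' := iρ.congr_fun hρ measurableSet_Ioo
  rw [setIntegral_congr_fun measurableSet_Ioo hρ] at e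
  have h1 : 0 ≤ ∫ r in Ioo 0 r₀, s₀ αs r₀ R r * deriv (fun r => w r - 0) r ^ 2 :=
    setIntegral_nonneg measurableSet_Ioo fun r hr => mul_nonneg (he.s_nonneg r hr) (sq_nonneg _)
  have h2 : 0 ≤ ∫ r in Ioo 0 r₀, (s r / r - s₀ αs r₀ R r / r) ^ 2 * r :=
    weighted_nonneg fun r => s r / r - s₀ αs r₀ R r / r
  have h3 : 0 ≤ ∫ r in Ioo 0 r₀, excess αs (v r / r) (v₀ αs r₀ R r / r) * r :=
    setIntegral_nonneg measurableSet_Ioo fun r hr => mul_nonneg (excess_nonneg hα _ _) hr.1.le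
  have hA : 0 ≤ ∫ r in Ioo 0 r₀, w r ^ 2 * r := weighted_nonneg w
  have hB : 0 ≤ ∫ r in Ioo 0 r₀, deriv (deriv w) r ^ 2 * r := weighted_nonneg _
  simp only [mul_zero, integral_zero, sub_zero] at e h1
  rw [hE0] at e hup
  set E := ∫ r in Ioo 0 r₀, density αs R h (fun _ => 0) v w r
  set E₀ := (F₀ αs r₀ R (v₀ αs r₀ R)).toReal
  set X := ∫ r in Ioo 0 r₀, w r ^ 2 * r
  set Y := ∫ r in Ioo 0 r₀, deriv (deriv w) r ^ 2 * r
  set Z := ∫ r in Ioo 0 r₀, (s r / r - s₀ αs r₀ R r / r) ^ 2 * r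
  set D := ∫ r in Ioo 0 r₀, excess αs (v r / r) (v₀ αs r₀ R r / r) * r
  have hX : 0 ≤ αs * (h ^ 2)⁻¹ * X := by positivity
  have hY : 0 ≤ h ^ 2 * Y := by positivity
  have hch : h ^ 2 * (1 / R) ^ 2 * (r₀ ^ 2 / 2) = c * h ^ 2 := by rw [hc]; ring
  rw [hch] at e hup
  have hall : Z + D + 1 / 2 * (αs * (h ^ 2)⁻¹ * X) + 1 / 2 * (h ^ 2 * Y) ≤ C₁ * h ^ 2 := by linarith
  have hh2 : 0 < h ^ 2 := by positivity
  set K := C₁ + c with hK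
  have hK0 : 0 < K := by positivity
  have hKh : 0 ≤ K * h ^ 2 := by positivity
  have k0 : 0 ≤ c * h ^ 2 := by positivity
  have k1 : K * h ^ 2 ≤ K * (1 + 2 + 2 / αs) * h ^ 2 := by
    have : 0 ≤ K * (2 + 2 / αs) * h ^ 2 := by positivity
    linarith
  have k2 : C₁ * h ^ 2 ≤ K * h ^ 2 := by rw [hK]; linarith
  refine ⟨?_, ?_, ?_, iρ', by linarith, iD, by linarith⟩
  · refine le_trans ?_ k1
    rw [abs_le, hK]
    constructor <;> linarith
  · have h5 : αs * (h ^ 2)⁻¹ * X ≤ 2 * K * h ^ 2 := by linarith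
    have h6 : X = (αs * (h ^ 2)⁻¹ * X) * (h ^ 2 / αs) := by field_simp
    rw [h6]
    calc αs * (h ^ 2)⁻¹ * X * (h ^ 2 / αs) ≤ 2 * K * h ^ 2 * (h ^ 2 / αs) := by gcongr
      _ = K * (2 / αs) * h ^ 4 := by ring
      _ ≤ _ := by gcongr; linarith
  · have h5 : h ^ 2 * Y ≤ h ^ 2 * (2 * K) := by linarith
    have h6 := le_of_mul_le_mul_left h5 hh2
    have : 0 ≤ K * (2 / αs) := by positivity
    linarith

/-- Bounds for the slope of a minimizer. The pointwise ones are uniform in `h`. -/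
lemma exists_slope_estimates (hα : 0 < αs) (hr₀ : 0 < r₀) (hR : 0 < R)
    (hcond : αs < (2 ^ 8)⁻¹ * (r₀ / R) ^ 4) :
    ∃ C > 0, ∀ h > 0, ∀ w v s, IsCritical αs r₀ R h w v s →
      IntegrableOn (fun r => deriv w r ^ 2 * r) (Ioo 0 r₀) ∧
      (∫ r in Ioo 0 r₀, deriv w r ^ 2 * r) ≤ C * h ^ 2 ∧
      ∀ r ∈ Ioo 0 r₀, deriv w r ^ 2 ≤ C / √r ∧ (r / R - deriv w r) ^ 2 ≤ C / √r := by
  obtain ⟨C₁, hC₁, H⟩ := exists_comparison hα hr₀ hR hcond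
  obtain ⟨C₂, hC₂, H₂⟩ := WSpace.exists_slope_bound hr₀
  set A := ∫ r in Ioo 0 r₀, (1 / R / 2 * r ^ 2) ^ 2 * r with hA
  have hA0 : 0 ≤ A := weighted_nonneg _
  set K := C₂ * (A + C₁) with hK
  have hK0 : 0 < K := by positivity
  set C₃ := 1728 / (r₀ / 4) ^ 2 * (A + C₁) + 16 * (r₀ / 4) ^ 2 * C₁ with hC₃
  have hC₃0 : 0 < C₃ := by positivity
  refine ⟨C₃ + 2 * K + 2 * r₀ ^ 2 / R ^ 2 * √r₀, by positivity, fun h hh w v s hc => ?_⟩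
  obtain ⟨-, b1, b2, -⟩ := H h hh w v s hc
  have b3 := (hc.bounds_inv hr₀ hα hh).1
  have hX : 0 ≤ ∫ r in Ioo 0 r₀, w r ^ 2 * r := weighted_nonneg w
  have hY : 0 ≤ ∫ r in Ioo 0 r₀, deriv (deriv w) r ^ 2 * r := weighted_nonneg _
  have hint := fun (l : ℝ) => hc.wSpace.admissible.interpolation hc.wSpace.integrable_sq
    hc.wSpace.integrable_sq_deriv2 (l := l)
  refine ⟨(hint (r₀ / 4) (by positivity) le_rfl).1, ?_, fun r hr => ?_⟩
  -- interpolate at scale `h`, or at scale `r₀ / 4` if `h` is large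
  · suffices h : ∫ r in Ioo 0 r₀, deriv w r ^ 2 * r ≤ C₃ * h ^ 2 by
      refine h.trans ?_
      gcongr
      have : 0 ≤ 2 * r₀ ^ 2 / R ^ 2 * √r₀ := by positivity
      linarith
    rcases le_total h 1 with h1 | h1
    · have hl : h * (r₀ / 4) ≤ r₀ / 4 := mul_le_of_le_one_left (by positivity) h1
      refine (hint (h * (r₀ / 4)) (by positivity) hl).2.trans ?_
      calc 1728 / (h * (r₀ / 4)) ^ 2 * (∫ r in Ioo 0 r₀, w r ^ 2 * r)
            + 16 * (h * (r₀ / 4)) ^ 2 * ∫ r in Ioo 0 r₀, deriv (deriv w) r ^ 2 * r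
          ≤ 1728 / (h * (r₀ / 4)) ^ 2 * (C₁ * h ^ 4) + 16 * (h * (r₀ / 4)) ^ 2 * C₁ := by gcongr
        _ = (1728 / (r₀ / 4) ^ 2 * C₁ + 16 * (r₀ / 4) ^ 2 * C₁) * h ^ 2 := by field_simp
        _ ≤ C₃ * h ^ 2 := by rw [hC₃]; gcongr; linarith
    · refine (hint (r₀ / 4) (by positivity) le_rfl).2.trans ?_
      calc 1728 / (r₀ / 4) ^ 2 * (∫ r in Ioo 0 r₀, w r ^ 2 * r)
            + 16 * (r₀ / 4) ^ 2 * ∫ r in Ioo 0 r₀, deriv (deriv w) r ^ 2 * r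
          ≤ 1728 / (r₀ / 4) ^ 2 * (A + C₁) + 16 * (r₀ / 4) ^ 2 * C₁ := by
            gcongr
            linarith
        _ = C₃ * 1 := by rw [hC₃, mul_one]
        _ ≤ C₃ * h ^ 2 := by gcongr; exact one_le_pow₀ h1
  · have hr1 := hr.1
    have hsr := Real.sqrt_pos.2 hr1
    have h1 : deriv w r ^ 2 ≤ K / √r := by
      refine (H₂ w hc.wSpace r hr).trans ?_
      rw [hK]
      gcongr
    have h2 : (r / R) ^ 2 ≤ r₀ ^ 2 / R ^ 2 * √r₀ / √r := by
      rw [le_div_iff₀ hsr, div_pow]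
      gcongr
      · exact hr.2.le
      · exact hr.2.le
    have h0 : 0 ≤ 2 * r₀ ^ 2 / R ^ 2 * √r₀ := by positivity
    constructor
    · refine h1.trans ?_
      gcongr
      linarith
    · have h3 : (r / R - deriv w r) ^ 2 ≤ 2 * (r / R) ^ 2 + 2 * deriv w r ^ 2 := by
        nlinarith [sq_nonneg (r / R + deriv w r)]
      calc (r / R - deriv w r) ^ 2 ≤ 2 * (r₀ ^ 2 / R ^ 2 * √r₀ / √r) + 2 * (K / √r) := by linarith
        _ = (2 * K + 2 * r₀ ^ 2 / R ^ 2 * √r₀) / √r := by ring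
        _ ≤ _ := by gcongr; linarith

/-- Pointwise bounds for the radial displacement and the stress, uniform in `h`. -/
lemma exists_uniform_bounds (hα : 0 < αs) (hr₀ : 0 < r₀) (hR : 0 < R)
    (hcond : αs < (2 ^ 8)⁻¹ * (r₀ / R) ^ 4) :
    ∃ C > 0, ∀ h > 0, ∀ w v s, IsCritical αs r₀ R h w v s → ∀ r ∈ Ioo 0 r₀,
      s r ≤ C * √r ∧ |v r| ≤ C * √r ∧ (r / R - deriv w r) ^ 2 ≤ C / √r := by
  obtain ⟨K, hK, H⟩ := exists_slope_estimates hα hr₀ hR hcond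
  have hα' := Real.sqrt_nonneg αs
  refine ⟨4 * K + 10 * √αs * √r₀, by positivity, fun h hh w v s hc r hr => ?_⟩
  obtain ⟨-, -, H'⟩ := H h hh w v s hc
  have he := hc.isEquilibrium
  have hg : ∀ r ∈ Ioo 0 r₀, strain R w r ≤ K / √r := fun r hr => by
    have := (H' r hr).2
    unfold strain
    nlinarith [sq_nonneg (r / R - deriv w r)]
  refine ⟨?_, ?_, ?_⟩
  · refine (he.s_le_sqrt (fun r _ => strain_nonneg R w r) hg hr).trans ?_
    gcongr; norm_num
  · refine (he.abs_v_le (fun r _ => strain_nonneg R w r) hg hr).trans ?_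
    gcongr; norm_num
  · refine (H' r hr).2.trans ?_
    gcongr
    have : 0 ≤ √αs * √r₀ := by positivity
    nlinarith

end

/-! ### Convergence of the radial displacement -/

section

variable {αs r₀ R h : ℝ} {w v s : ℝ → ℝ}

/-- Lower bound for the excess at a base point strictly above the threshold: it is quadratic, or
linear once the other point lies below the threshold. -/
lemma sq_le_excess_or {a b δ : ℝ} (hα : 0 < αs) (hδ : 0 < δ) (hb : -2 * √αs + δ ≤ b) :
    (a - b) ^ 2 ≤ excess αs a b ∨ δ * |a - b| ≤ excess αs a b := by
  have h1 := Real.sqrt_pos.2 hα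
  unfold excess
  rw [Wrel_eq_max_sq hα, Wrel_eq_max_sq hα, max_eq_left (show -2 * √αs ≤ b by linarith)]
  rcases le_total a (-2 * √αs) with h | h
  · right
    rw [max_eq_right h, abs_of_nonpos (by linarith)]
    have e : (-2 * √αs) ^ 2 - 4 * √αs * (a - -2 * √αs) - (b ^ 2 - 4 * √αs * (b - b))
        - 2 * b * (a - b) = (b + 2 * √αs) * (b - 2 * √αs - 2 * a) := by ring
    nlinarith [mul_nonneg (show 0 ≤ b + 2 * √αs - δ by linarith)
      (show 0 ≤ b - 2 * √αs - 2 * a by linarith), mul_nonneg hδ.le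
      (show 0 ≤ -2 * √αs - a by linarith)]
  · left
    rw [max_eq_left h]
    exact le_of_eq (by ring)

/-- Oscillation of a function whose derivative is the sum of a square integrable function and of
the product of a square integrable function with one of size `r ^ (-1/4)`. -/
lemma LocallyAC.sq_sub_le_of_deriv_eq {d f z g : ℝ → ℝ} {K : ℝ} (hd : LocallyAC r₀ d)
    (hfm : AEStronglyMeasurable f (volume.restrict (Ioo 0 r₀)))
    (hf : IntegrableOn (fun r => f r ^ 2 * r) (Ioo 0 r₀))
    (hzm : AEStronglyMeasurable z (volume.restrict (Ioo 0 r₀)))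
    (hz : IntegrableOn (fun r => z r ^ 2 * r) (Ioo 0 r₀))
    (hgm : AEStronglyMeasurable g (volume.restrict (Ioo 0 r₀)))
    (hg : ∀ r ∈ Ioo 0 r₀, g r ^ 2 ≤ K / √r)
    (h : ∀ᵐ r ∂(volume.restrict (Ioo 0 r₀)), deriv d r = f r + z r * g r) {a b : ℝ}
    (ha : a ∈ Ioo 0 r₀) (hb : b ∈ Ioo 0 r₀) :
    (d b - d a) ^ 2 ≤ (4 * √r₀ * (∫ r in Ioo 0 r₀, f r ^ 2 * r)
      + 4 * K * ∫ r in Ioo 0 r₀, z r ^ 2 * r) / √(min a b) := by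
  wlog hab : a ≤ b generalizing a b
  · have := this hb ha (le_of_not_ge hab)
    rw [min_comm a b]
    calc (d b - d a) ^ 2 = (d a - d b) ^ 2 := by ring
      _ ≤ _ := this
  rw [min_eq_left hab]
  obtain ⟨i1, e1⟩ := sq_integral_abs_le ha.1 hab hb.2 hfm hf
  obtain ⟨i2, e2⟩ := sq_integral_abs_mul_le ha.1 hab hb.2 hzm hz hgm hg
  have hle : |d b - d a| ≤ (∫ t in a..b, |f t|) + ∫ t in a..b, |z t * g t| := by
    rw [← hd.integral_deriv ha hb, ← intervalIntegral.integral_add i1.abs i2.abs]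
    refine (intervalIntegral.abs_integral_le_integral_abs hab).trans ?_
    refine intervalIntegral.integral_mono_ae_restrict hab (hd.intervalIntegrable_deriv ha hb).abs
      (i1.abs.add i2.abs) ?_
    filter_upwards [ae_restrict_of_ae_restrict_of_subset (by
      rw [← uIcc_of_le hab]; exact uIcc_subset_Ioo' ha hb) h] with t ht
    rw [ht]
    exact abs_add_le _ _
  have h0 : 0 ≤ ∫ t in a..b, |f t| := intervalIntegral.integral_nonneg hab fun _ _ => abs_nonneg _
  have h0' : 0 ≤ ∫ t in a..b, |z t * g t| :=
    intervalIntegral.integral_nonneg hab fun _ _ => abs_nonneg _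
  rw [← sq_abs]
  calc |d b - d a| ^ 2 ≤ ((∫ t in a..b, |f t|) + ∫ t in a..b, |z t * g t|) ^ 2 := by gcongr
    _ ≤ 2 * (∫ t in a..b, |f t|) ^ 2 + 2 * (∫ t in a..b, |z t * g t|) ^ 2 := add_sq_le.trans_eq (by ring)
    _ ≤ 2 * ((∫ r in Ioo 0 r₀, f r ^ 2 * r) * (2 * √r₀ / √a))
        + 2 * ((∫ r in Ioo 0 r₀, z r ^ 2 * r) * (2 * K / √a)) := by gcongr
    _ = _ := by ring

lemma intervalIntegral_le_setIntegral {f : ℝ → ℝ} {a b : ℝ} (ha : 0 < a) (hab : a ≤ b) (hb : b < r₀)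
    (hf : IntegrableOn f (Ioo 0 r₀)) (h0 : ∀ r ∈ Ioo 0 r₀, 0 ≤ f r) :
    IntervalIntegrable f volume a b ∧ ∫ t in a..b, f t ≤ ∫ t in Ioo 0 r₀, f t := by
  have hsub : Ioc a b ⊆ Ioo 0 r₀ := fun t ht => ⟨ha.trans ht.1, ht.2.trans_lt hb⟩
  refine ⟨(intervalIntegrable_iff_integrableOn_Ioc_of_le hab).2 (hf.mono_set hsub), ?_⟩
  rw [intervalIntegral.integral_of_le hab]
  exact setIntegral_mono_set hf ((ae_restrict_iff' measurableSet_Ioo).2 (Eventually.of_forall h0))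
    hsub.eventuallyLE

/-- The difference of the displacements has derivative `(σ - σ₀) + w' (r / R - w' / 2)`, where both
`σ - σ₀` and `w'` are of size `h` in mean square. -/
lemma exists_oscillation_bound (hα : 0 < αs) (hr₀ : 0 < r₀) (hR : 0 < R)
    (hcond : αs < (2 ^ 8)⁻¹ * (r₀ / R) ^ 4) :
    ∃ C > 0, ∀ h > 0, ∀ w v s, IsCritical αs r₀ R h w v s → ∀ p ∈ Ioo 0 r₀, ∀ q ∈ Ioo 0 r₀,
      ((v q - v₀ αs r₀ R q) - (v p - v₀ αs r₀ R p)) ^ 2 ≤ C * h ^ 2 / √(min p q) := by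
  obtain ⟨C₁, hC₁, H₁⟩ := exists_comparison hα hr₀ hR hcond
  obtain ⟨C₂, hC₂, H₂⟩ := exists_slope_estimates hα hr₀ hR hcond
  have he₀ := isEquilibrium_v₀ hα hr₀ hR hcond
  set K := C₂ + r₀ ^ 2 / R ^ 2 * √r₀ with hK
  have hK0 : 0 < K := by positivity
  refine ⟨4 * √r₀ * C₁ + 4 * K * C₂, by positivity, fun h hh w v s hc p hp q hq => ?_⟩
  obtain ⟨-, -, -, iρ, bρ, -, -⟩ := H₁ h hh w v s hc
  obtain ⟨iz, bz, hx⟩ := H₂ h hh w v s hc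
  have he := hc.isEquilibrium
  have hv := hc.admissibleV
  have hv₀ := he₀.admissible ((wSpace_zero r₀).admissible.continuousOn_strain R)
  set d : ℝ → ℝ := fun r => v r - v₀ αs r₀ R r with hd
  have hder : ∀ᵐ r ∂(volume.restrict (Ioo 0 r₀)), deriv d r
      = (s r / r - s₀ αs r₀ R r / r) + deriv w r * (r / R - 1 / 2 * deriv w r) := by
    filter_upwards [ae_restrict_mem measurableSet_Ioo] with r hr
    have h2 := ((he.hasDerivAt_v r hr).sub (he₀.hasDerivAt_v r hr)).deriv
    rw [show deriv d r = _ from h2, strain, strain, deriv_const]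
    ring
  have hgK : ∀ r ∈ Ioo 0 r₀, (r / R - 1 / 2 * deriv w r) ^ 2 ≤ K / √r := by
    intro r hr
    have hsr := Real.sqrt_pos.2 hr.1
    have e1 := (hx r hr).2
    have hr1 := hr.1
    have e2 : (r / R) ^ 2 ≤ r₀ ^ 2 / R ^ 2 * √r₀ / √r := by
      rw [le_div_iff₀ hsr, div_pow]
      gcongr
      · exact hr.2.le
      · exact hr.2.le
    have e3 : (r / R - 1 / 2 * deriv w r) ^ 2 ≤ (r / R) ^ 2 + (r / R - deriv w r) ^ 2 := by
      nlinarith [sq_nonneg (deriv w r), sq_nonneg (r / R), sq_nonneg (2 * (r / R) - deriv w r)]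
    calc _ ≤ r₀ ^ 2 / R ^ 2 * √r₀ / √r + C₂ / √r := by linarith
      _ = _ := by rw [hK]; ring
  have hgm : AEStronglyMeasurable (fun r => r / R - 1 / 2 * deriv w r)
      (volume.restrict (Ioo 0 r₀)) := by
    have := measurable_deriv w
    exact (by fun_prop : Measurable fun r => r / R - 1 / 2 * deriv w r).aestronglyMeasurable
  have hfm : AEStronglyMeasurable (fun r => s r / r - s₀ αs r₀ R r / r)
      (volume.restrict (Ioo 0 r₀)) :=
    aesm_of_continuousOn ((he.continuousOn_s.div continuousOn_id fun _ hr => hr.1.ne').sub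
      (he₀.continuousOn_s.div continuousOn_id fun _ hr => hr.1.ne'))
  refine ((hv.locallyAC.sub hv₀.locallyAC).sq_sub_le_of_deriv_eq hfm iρ
    (aesm_deriv w _) iz hgm hgK hder hp hq).trans ?_
  have : (4 * √r₀ * C₁ + 4 * K * C₂) * h ^ 2
    = 4 * √r₀ * (C₁ * h ^ 2) + 4 * K * (C₂ * h ^ 2) := by ring
  rw [this]
  gcongr

/-- There is a point, at a distance from the origin independent of `h`, where the displacement is
close to the effective one: below the inner radius the excess controls the distance. -/
lemma exists_close_point (hα : 0 < αs) (hr₀ : 0 < r₀) (hR : 0 < R)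
    (hcond : αs < (2 ^ 8)⁻¹ * (r₀ / R) ^ 4) :
    ∃ C > 0, ∀ h > 0, h ≤ 1 → ∀ w v s, IsCritical αs r₀ R h w v s →
      ∃ p ∈ Ioo (rw αs r₀ R / 4) (rw αs r₀ R / 2), (v p - v₀ αs r₀ R p) ^ 2 ≤ C * h ^ 2 := by
  obtain ⟨C₁, hC₁, H₁⟩ := exists_comparison hα hr₀ hR hcond
  have hapos := rw_pos hα hr₀ hR
  have halt := rw_lt hα hr₀ hR hcond
  have hge := fun r => v₀_ge_of_le_rw (r := r) hα hr₀ hR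
  set a := rw αs r₀ R
  -- on `(a / 4, a / 2)` the effective azimuthal strain is above the threshold by `δ`
  set δ := 9 / 64 * (a ^ 2 / R ^ 2) with hδ
  have hδ0 : 0 < δ := by positivity
  set A := 16 * C₁ / a ^ 2 with hA
  have hA0 : 0 < A := by positivity
  refine ⟨r₀ ^ 2 * (A + A ^ 2 / δ ^ 2), by positivity, fun h hh h1 w v s hc => ?_⟩
  obtain ⟨-, -, -, -, -, iD, bD⟩ := H₁ h hh w v s hc
  obtain ⟨ii, bi⟩ := intervalIntegral_le_setIntegral (a := a / 4) (b := a / 2) (by linarith)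
    (by linarith) (by linarith) iD fun r hr => mul_nonneg (excess_nonneg hα _ _) hr.1.le
  obtain ⟨p, hp, hpi⟩ := exists_mul_le_integral (by linarith) ii
  refine ⟨p, hp, ?_⟩
  have hp0 : 0 < p := lt_trans (by linarith) hp.1
  have hpr : p < r₀ := by linarith [hp.2]
  have hD := excess_nonneg hα (v p / p) (v₀ αs r₀ R p / p)
  have e1 : excess αs (v p / p) (v₀ αs r₀ R p / p) ≤ A * h ^ 2 := by
    have : excess αs (v p / p) (v₀ αs r₀ R p / p) * (a / 4) * (a / 4) ≤ C₁ * h ^ 2 := by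
      calc _ ≤ excess αs (v p / p) (v₀ αs r₀ R p / p) * p * (a / 2 - a / 4) := by
            have : a / 2 - a / 4 = a / 4 := by ring
            rw [this]; gcongr; exact hp.1.le
        _ ≤ C₁ * h ^ 2 := hpi.trans (bi.trans bD)
    rw [hA, div_mul_eq_mul_div, le_div_iff₀ (by positivity)]
    nlinarith
  have hb : -2 * √αs + δ ≤ v₀ αs r₀ R p / p := by
    rw [← hge p hp0 (by linarith [hp.2])]
    gcongr
    have e2 : p ^ 2 ≤ (a / 2) ^ 2 := pow_le_pow_left₀ hp0.le hp.2.le 2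
    have e3 : δ = 3 / 16 * ((a ^ 2 - (a / 2) ^ 2) / R ^ 2) := by rw [hδ]; ring
    rw [e3]
    gcongr
  set y := v p / p - v₀ αs r₀ R p / p with hy
  have hdy : v p - v₀ αs r₀ R p = p * y := by
    rw [hy]; field_simp
  have hy2 : y ^ 2 ≤ (A + A ^ 2 / δ ^ 2) * h ^ 2 := by
    have n1 : 0 ≤ A * h ^ 2 := by positivity
    have n2 : 0 ≤ A ^ 2 / δ ^ 2 * h ^ 2 := by positivity
    rcases sq_le_excess_or (a := v p / p) hα hδ0 hb with h2 | h2
    · linarith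
    · have h3 : |y| ≤ A / δ * h := by
        rw [div_mul_eq_mul_div, le_div_iff₀ hδ0]
        have : A * h ^ 2 ≤ A * h := by
          gcongr; rw [pow_two]; exact mul_le_of_le_one_left hh.le h1
        linarith
      have h4 : y ^ 2 ≤ (A / δ * h) ^ 2 := by rw [← sq_abs]; gcongr
      have h5 : (A / δ * h) ^ 2 = A ^ 2 / δ ^ 2 * h ^ 2 := by ring
      linarith
  rw [hdy, mul_pow]
  calc p ^ 2 * y ^ 2 ≤ r₀ ^ 2 * ((A + A ^ 2 / δ ^ 2) * h ^ 2) := by gcongr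
    _ = _ := by ring

/-- The radial displacement converges to the effective one with rate `h`, pointwise. -/
lemma exists_displacement_bound (hα : 0 < αs) (hr₀ : 0 < r₀) (hR : 0 < R)
    (hcond : αs < (2 ^ 8)⁻¹ * (r₀ / R) ^ 4) :
    ∃ C > 0, ∀ h > 0, ∀ w v s, IsCritical αs r₀ R h w v s → ∀ r ∈ Ioo 0 r₀,
      (v r - v₀ αs r₀ R r) ^ 2 ≤ C * h ^ 2 / √r := by
  obtain ⟨C₅, hC₅, H₅⟩ := exists_close_point hα hr₀ hR hcond
  obtain ⟨C₆, hC₆, H₆⟩ := exists_oscillation_bound hα hr₀ hR hcond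
  obtain ⟨C₃, hC₃, H₃⟩ := exists_uniform_bounds hα hr₀ hR hcond
  have he₀ := isEquilibrium_v₀ hα hr₀ hR hcond
  obtain ⟨C₄, hC₄, H₄⟩ := he₀.exists_bounds hr₀ (wSpace_zero r₀)
  have hapos := rw_pos hα hr₀ hR
  have halt := rw_lt hα hr₀ hR hcond
  set a := rw αs r₀ R
  set C₇ := 2 * C₅ * √r₀ + 2 * C₆ * (1 + √r₀ / √(a / 4)) with hC₇
  have hC₇0 : 0 < C₇ := by positivity
  refine ⟨C₇ + 2 * (C₃ ^ 2 + C₄ ^ 2) * (r₀ * √r₀), by positivity, fun h hh w v s hc r hr => ?_⟩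
  have hr1 := hr.1
  have hsr := Real.sqrt_pos.2 hr1
  have hsr₀ : √r ≤ √r₀ := Real.sqrt_le_sqrt hr.2.le
  -- for `1 ≤ h` the uniform bounds suffice
  rcases le_total 1 h with h1 | h1
  · have e1 : (v r - v₀ αs r₀ R r) ^ 2 ≤ 2 * (C₃ ^ 2 + C₄ ^ 2) * r := by
      have b1 := (H₃ h hh w v s hc r hr).2.1
      have b2 := (H₄ r hr).2.1
      have b3 : v r ^ 2 ≤ C₃ ^ 2 * r := by
        rw [← sq_abs, ← Real.sq_sqrt hr1.le, ← mul_pow]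
        rw [Real.sq_sqrt hr1.le]; gcongr
      have b4 : v₀ αs r₀ R r ^ 2 ≤ C₄ ^ 2 * r := by
        rw [← sq_abs, ← Real.sq_sqrt hr1.le, ← mul_pow]
        rw [Real.sq_sqrt hr1.le]; gcongr
      nlinarith [sq_nonneg (v r + v₀ αs r₀ R r)]
    refine e1.trans ?_
    rw [le_div_iff₀ hsr]
    calc 2 * (C₃ ^ 2 + C₄ ^ 2) * r * √r ≤ 2 * (C₃ ^ 2 + C₄ ^ 2) * r₀ * √r₀ * 1 := by
          rw [mul_one]; gcongr; exact hr.2.le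
      _ ≤ 2 * (C₃ ^ 2 + C₄ ^ 2) * r₀ * √r₀ * h ^ 2 := by gcongr; exact one_le_pow₀ h1
      _ ≤ _ := by
        have : 0 ≤ C₇ * h ^ 2 := by positivity
        linarith
  obtain ⟨p, hp, hdp⟩ := H₅ h hh h1 w v s hc
  have ho := H₆ h hh w v s hc
  set d : ℝ → ℝ := fun r => v r - v₀ αs r₀ R r with hd
  have hpI : p ∈ Ioo 0 r₀ := ⟨by linarith [hp.1], by linarith [hp.2]⟩
  replace ho : (d r - d p) ^ 2 ≤ C₆ * h ^ 2 / √(min p r) := ho p hpI r hr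
  replace hdp : d p ^ 2 ≤ C₅ * h ^ 2 := hdp
  have hmin : 1 / √(min p r) ≤ (1 + √r₀ / √(a / 4)) / √r := by
    have ha4 : 0 < √(a / 4) := Real.sqrt_pos.2 (by linarith)
    rcases le_total r p with h2 | h2
    · rw [min_eq_right h2]
      gcongr
      have : 0 ≤ √r₀ / √(a / 4) := by positivity
      linarith
    · rw [min_eq_left h2]
      have h3 : √(a / 4) ≤ √p := Real.sqrt_le_sqrt hp.1.le
      calc 1 / √p ≤ 1 / √(a / 4) := by gcongr
        _ = √r / √(a / 4) / √r := by field_simp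
        _ ≤ _ := by
          gcongr
          have : √r / √(a / 4) ≤ √r₀ / √(a / 4) := by gcongr
          linarith
  have h3 : (d r - d p) ^ 2 ≤ C₆ * h ^ 2 * ((1 + √r₀ / √(a / 4)) / √r) := by
    refine ho.trans ?_
    rw [← mul_one_div]
    gcongr
  have h4 : C₅ * h ^ 2 ≤ C₅ * √r₀ * h ^ 2 / √r := by
    rw [le_div_iff₀ hsr]
    calc C₅ * h ^ 2 * √r ≤ C₅ * h ^ 2 * √r₀ := by gcongr
      _ = _ := by ring
  have h5 : d r ^ 2 ≤ 2 * d p ^ 2 + 2 * (d r - d p) ^ 2 := by nlinarith [sq_nonneg (d r - 2 * d p)]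
  calc d r ^ 2 ≤ 2 * (C₅ * √r₀ * h ^ 2 / √r)
        + 2 * (C₆ * h ^ 2 * ((1 + √r₀ / √(a / 4)) / √r)) := by linarith
    _ = C₇ * h ^ 2 / √r := by rw [hC₇]; ring
    _ ≤ _ := by
      gcongr
      have : 0 ≤ 2 * (C₃ ^ 2 + C₄ ^ 2) * (r₀ * √r₀) := by positivity
      linarith

lemma exists_integral_displacement_bound (hα : 0 < αs) (hr₀ : 0 < r₀) (hR : 0 < R)
    (hcond : αs < (2 ^ 8)⁻¹ * (r₀ / R) ^ 4) :
    ∃ C > 0, ∀ h > 0, ∀ w v s, IsCritical αs r₀ R h w v s →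
      IntegrableOn (fun r => (v r - v₀ αs r₀ R r) ^ 2 * r) (Ioo 0 r₀) ∧
      ∫ r in Ioo 0 r₀, (v r - v₀ αs r₀ R r) ^ 2 * r ≤ C * h ^ 2 := by
  obtain ⟨C, hC, H⟩ := exists_displacement_bound hα hr₀ hR hcond
  have he₀ := isEquilibrium_v₀ hα hr₀ hR hcond
  refine ⟨C * √r₀ * r₀, by positivity, fun h hh w v s hc => ?_⟩
  have hle : ∀ r ∈ Ioo 0 r₀, (v r - v₀ αs r₀ R r) ^ 2 * r ≤ C * h ^ 2 * √r₀ := by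
    intro r hr
    have hr1 := hr.1
    have hsr := Real.sqrt_pos.2 hr1
    calc (v r - v₀ αs r₀ R r) ^ 2 * r ≤ C * h ^ 2 / √r * r := by
          gcongr; exact H h hh w v s hc r hr
      _ = C * h ^ 2 / √r * (√r * √r) := by rw [Real.mul_self_sqrt hr1.le]
      _ = C * h ^ 2 * √r := by field_simp
      _ ≤ _ := by gcongr; exact hr.2.le
  have hi : IntegrableOn (fun r => (v r - v₀ αs r₀ R r) ^ 2 * r) (Ioo 0 r₀) := by
    refine integrableOn_of_abs_le (g := fun _ => C * h ^ 2 * √r₀) measurableSet_Ioo ?_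
      (integrable_const _) fun r hr => ?_
    · exact ((aesm_of_continuousOn
        (hc.isEquilibrium.continuousOn_v.sub he₀.continuousOn_v)).pow 2).mul
        measurable_id.aestronglyMeasurable
    · rw [abs_of_nonneg (mul_nonneg (sq_nonneg _) hr.1.le)]
      exact hle r hr
  refine ⟨hi, (setIntegral_mono_on hi (integrable_const _) measurableSet_Ioo hle).trans_eq ?_⟩
  rw [setIntegral_const]
  simp only [Measure.real, Real.volume_Ioo, sub_zero, ENNReal.toReal_ofReal hr₀.le, smul_eq_mul]
  ring

/-- For small `h` the sheet is in the wrinkled regime beyond `(2 rw + r₀) / 3`, where the stress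
equation can be integrated. -/
lemma exists_stress_formula (hα : 0 < αs) (hr₀ : 0 < r₀) (hR : 0 < R)
    (hcond : αs < (2 ^ 8)⁻¹ * (r₀ / R) ^ 4) :
    ∃ hbar > 0, ∀ h > 0, h < hbar → ∀ w v s, IsCritical αs r₀ R h w v s →
      ∀ r ∈ Ioo ((2 * rw αs r₀ R + r₀) / 3) r₀, s r = 2 * √αs * (r₀ - r) := by
  obtain ⟨C, hC, H⟩ := exists_displacement_bound hα hr₀ hR hcond
  have hapos := rw_pos hα hr₀ hR
  have halt := rw_lt hα hr₀ hR hcond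
  have hle := fun r => v₀_le_of_rw_le (r := r) hα hr₀ hR
  set a := rw αs r₀ R with ha
  set b := (2 * a + r₀) / 3 with hb
  have hab : a < b := by rw [hb]; linarith
  have hbr : b < r₀ := by rw [hb]; linarith
  have hb0 : 0 < b := hapos.trans hab
  set δ := (b ^ 3 - a ^ 3) / (8 * R ^ 2) with hδ
  have hδ0 : 0 < δ := by
    have : a ^ 3 < b ^ 3 := pow_lt_pow_left₀ hab hapos.le (by norm_num)
    have : 0 < b ^ 3 - a ^ 3 := by linarith
    positivity
  have hsb : 0 < √b := Real.sqrt_pos.2 hb0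
  refine ⟨√(δ ^ 2 * √b / C), by positivity, fun h hh hlt w v s hc => ?_⟩
  have he := hc.isEquilibrium
  have hh2 : C * h ^ 2 / √b < δ ^ 2 := by
    have : h ^ 2 < δ ^ 2 * √b / C := (Real.lt_sqrt hh.le).1 hlt
    rw [lt_div_iff₀ hC] at this
    rw [div_lt_iff₀ hsb]
    linarith
  have hv : ∀ r ∈ Ioo b r₀, v r / r ≤ -2 * √αs := by
    intro r hr
    have hr0 : 0 < r := hb0.trans hr.1
    have e1 := H h hh w v s hc r ⟨hr0, hr.2⟩
    have e2 : C * h ^ 2 / √r ≤ C * h ^ 2 / √b := by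
      have := Real.sqrt_le_sqrt hr.1.le
      gcongr
    have e3 := abs_lt_of_sq_lt_sq ((e1.trans e2).trans_lt hh2) hδ0.le
    have e4 := hle r (hab.trans hr.1)
    have e5 : δ ≤ (r ^ 3 - a ^ 3) / (8 * R ^ 2) := by
      rw [hδ]
      have := hr.1.le
      gcongr
    rw [div_le_iff₀ hr0]
    have := (abs_lt.1 e3).2
    linarith
  have hder : ∀ r ∈ Ioo b r₀, HasDerivAt s (-2 * √αs) r := fun r hr => by
    have := he.hasDerivAt_s r ⟨hb0.trans hr.1, hr.2⟩
    rwa [max_eq_right (hv r hr)] at this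
  intro r hr
  have hconst : ∀ t ∈ Ioo b r₀, s t + 2 * √αs * t = s r + 2 * √αs * r := by
    intro t ht
    refine (convex_Ioo b r₀).is_const_of_fderivWithin_eq_zero (𝕜 := ℝ)
      (f := fun t => s t + 2 * √αs * t) ?_ ?_ ht hr
    · exact fun x hx => ((hder x hx).add
        ((hasDerivAt_id x).const_mul (2 * √αs))).differentiableAt.differentiableWithinAt
    · intro x hx
      have h1 : HasDerivAt (fun t => s t + 2 * √αs * t) 0 x :=
        ((hder x hx).add ((hasDerivAt_id x).const_mul (2 * √αs))).congr_deriv (by ring)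
      rw [fderivWithin_of_isOpen isOpen_Ioo hx]
      have := h1.hasFDerivAt.fderiv
      rw [this]; ext; simp
  have h1 : Tendsto (fun t => s t + 2 * √αs * t) (𝓝[<] r₀) (𝓝 (0 + 2 * √αs * r₀)) :=
    he.s_end.add ((Continuous.tendsto (by fun_prop) r₀).mono_left nhdsWithin_le_nhds)
  have h2 : Tendsto (fun t => s t + 2 * √αs * t) (𝓝[<] r₀) (𝓝 (s r + 2 * √αs * r)) := by
    refine tendsto_const_nhds.congr' ?_
    filter_upwards [Ioo_mem_nhdsLT hbr] with t ht
    exact (hconst t ht).symm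
  have h3 := tendsto_nhds_unique h1 h2
  linarith

end

/-! ### Thick sheets -/

section

variable {αs r₀ R h : ℝ} {w v s : ℝ → ℝ}

lemma abs_le_of_Wrel_le {η c : ℝ} (hα : 0 < αs) (hc : 0 ≤ c) (h : Wrel αs η ≤ c ^ 2) :
    |η| ≤ c + c ^ 2 / (2 * √αs) := by
  have h1 := Real.sqrt_pos.2 hα
  have hs : √αs ^ 2 = αs := Real.sq_sqrt hα.le
  have h2 : 0 ≤ c ^ 2 / (2 * √αs) := by positivity
  unfold Wrel at h
  split_ifs at h with hη
  · have := abs_le_of_sq_le_sq h hc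
    linarith
  · have h3 : 2 * √αs * |η| ≤ c ^ 2 := by
      rw [abs_of_nonpos (by linarith)]
      nlinarith
    have h4 : |η| ≤ c ^ 2 / (2 * √αs) := by
      rw [le_div_iff₀ (by positivity)]; linarith
    linarith

/-- The membrane energy of a minimizer tends to zero for large `h`. -/
lemma IsCritical.membrane_bounds (hr₀ : 0 < r₀) (hα : 0 < αs) (hh : 0 < h)
    (hc : IsCritical αs r₀ R h w v s) :
    IntegrableOn (fun r => (s r / r) ^ 2 * r) (Ioo 0 r₀) ∧
    (∫ r in Ioo 0 r₀, (s r / r) ^ 2 * r)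
      ≤ αs * (h ^ 2)⁻¹ * (∫ r in Ioo 0 r₀, (1 / R / 2 * r ^ 2) ^ 2 * r) ∧
    IntegrableOn (fun r => Wrel αs (v r / r) * r) (Ioo 0 r₀) ∧
    (∫ r in Ioo 0 r₀, Wrel αs (v r / r) * r)
      ≤ αs * (h ^ 2)⁻¹ * ∫ r in Ioo 0 r₀, (1 / R / 2 * r ^ 2) ^ 2 * r := by
  have hE := hc.energy_le_inv hr₀ hα hh
  have hi := hc.integrableOn_density hr₀ hα
  obtain ⟨i1, -, i4⟩ := integrableOn_terms hα hh hc.admissibleV.locallyAC hc.wSpace.admissible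
    aestronglyMeasurable_const hi
  have hσ : ∀ r ∈ Ioo 0 r₀, (deriv v r + 1 / 2 * (r / R - deriv w r) ^ 2 + 0) ^ 2 * r
      = (s r / r) ^ 2 * r := fun r hr => by
    rw [add_zero, ← hc.isEquilibrium.stress_eq hr, stress]
  have i1' := i1.congr_fun hσ measurableSet_Ioo
  refine ⟨i1', ?_, i4, ?_⟩
  · refine le_trans (setIntegral_mono_on i1' hi measurableSet_Ioo fun r hr => ?_) hE
    have := hr.1
    have := Wrel_nonneg hα (v r / r)
    rw [← hσ r hr]
    unfold density
    have : 0 ≤ (αs * (h ^ 2)⁻¹ * w r ^ 2 + h ^ 2 * (deriv (deriv w) r - 1 / R) ^ 2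
      + Wrel αs (v r / r)) * r := by positivity
    linarith
  · refine le_trans (setIntegral_mono_on i4 hi measurableSet_Ioo fun r hr => ?_) hE
    have := hr.1
    unfold density
    have : 0 ≤ ((deriv v r + 1 / 2 * (r / R - deriv w r) ^ 2 + 0) ^ 2
      + αs * (h ^ 2)⁻¹ * w r ^ 2 + h ^ 2 * (deriv (deriv w) r - 1 / R) ^ 2) * r := by positivity
    linarith

/-- For large `h` there is an interior point at which the slope of the deformed sheet is small: the
membrane energy bounds `σ` and `v`, hence also the integral of the strain. -/
lemma exists_flat_point (hα : 0 < αs) (hr₀ : 0 < r₀) (R : ℝ) :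
    ∃ L ≥ 0, ∀ h ≥ 1, ∀ w v s, IsCritical αs r₀ R h w v s → ∃ t ∈ Ioo (r₀ / 8) (5 * r₀ / 8),
      (t / R - deriv w t) ^ 2 ≤ L / (2 * h) := by
  have hα' := Real.sqrt_pos.2 hα
  set A := αs * ∫ r in Ioo 0 r₀, (1 / R / 2 * r ^ 2) ^ 2 * r with hA
  have hA0 : 0 ≤ A := mul_nonneg hα.le (weighted_nonneg _)
  -- bound for `|v|` at the points selected below
  set c := √(A * (64 / r₀ ^ 2)) with hcdef
  have hc0 : 0 ≤ c := Real.sqrt_nonneg _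
  set V := r₀ * (c + c ^ 2 / (2 * √αs)) with hV
  have hV0 : 0 ≤ V := by positivity
  set S := √(A * (2 * √r₀ / √(r₀ / 8))) with hS
  have hS0 : 0 ≤ S := Real.sqrt_nonneg _
  set L := 16 / r₀ * (S + 2 * V) with hL
  refine ⟨L, by positivity, fun h h1 w v s hc => ?_⟩
  have hh : 0 < h := by linarith
  have he := hc.isEquilibrium
  obtain ⟨iσ, bσ, iW, bW⟩ := hc.membrane_bounds hr₀ hα hh
  have hAh : αs * (h ^ 2)⁻¹ * (∫ r in Ioo 0 r₀, (1 / R / 2 * r ^ 2) ^ 2 * r) = A * (h ^ 2)⁻¹ := by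
    rw [hA]; ring
  rw [hAh] at bσ bW
  have hpoint : ∀ a b : ℝ, 0 < a → b < r₀ → b - a = r₀ / 8 → r₀ / 8 ≤ a →
      ∃ p ∈ Ioo a b, |v p| ≤ V / h := by
    intro a b ha hb hab ha8
    obtain ⟨ii, bi⟩ := intervalIntegral_le_setIntegral ha (by linarith) hb iW
      fun r hr => mul_nonneg (Wrel_nonneg hα _) hr.1.le
    obtain ⟨p, hp, hpi⟩ := exists_mul_le_integral (by linarith) ii
    refine ⟨p, hp, ?_⟩
    have hp0 : 0 < p := ha.trans hp.1
    have hW := Wrel_nonneg hα (v p / p)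
    have e1 : Wrel αs (v p / p) ≤ (c / h) ^ 2 := by
      have e2 : Wrel αs (v p / p) * (r₀ / 8) * (r₀ / 8) ≤ A * (h ^ 2)⁻¹ := by
        calc _ ≤ Wrel αs (v p / p) * p * (b - a) := by
              rw [hab]; gcongr; linarith [hp.1]
          _ ≤ _ := hpi.trans (bi.trans bW)
      rw [div_pow, hcdef, Real.sq_sqrt (by positivity)]
      calc Wrel αs (v p / p) = Wrel αs (v p / p) * (r₀ / 8) * (r₀ / 8) * (64 / r₀ ^ 2) := by
            field_simp; norm_num
        _ ≤ A * (h ^ 2)⁻¹ * (64 / r₀ ^ 2) := by gcongr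
        _ = _ := by ring
    have e3 := abs_le_of_Wrel_le hα (by positivity) e1
    have e4 : (c / h) ^ 2 / (2 * √αs) ≤ c ^ 2 / (2 * √αs) / h := by
      have e5 : (c / h) ^ 2 / (2 * √αs) = c ^ 2 / (2 * √αs) / h ^ 2 := by ring
      rw [e5]
      exact div_le_div_of_nonneg_left (by positivity) hh (le_self_pow₀ h1 two_ne_zero)
    calc |v p| = p * |v p / p| := by rw [abs_div, abs_of_pos hp0]; field_simp
      _ ≤ r₀ * (c / h + c ^ 2 / (2 * √αs) / h) := by
        gcongr
        · linarith [hp.2]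
        · linarith
      _ = V / h := by rw [hV]; ring
  obtain ⟨p, hp, hvp⟩ := hpoint (r₀ / 8) (r₀ / 4) (by linarith) (by linarith) (by ring) le_rfl
  obtain ⟨q, hq, hvq⟩ := hpoint (r₀ / 2) (5 * r₀ / 8) (by linarith) (by linarith) (by ring)
    (by linarith)
  have hp0 : 0 < p := by linarith [hp.1]
  have hpq : p < q := by linarith [hp.2, hq.1]
  have hqr : q < r₀ := by linarith [hq.2]
  have hpI : p ∈ Ioo 0 r₀ := ⟨hp0, by linarith⟩
  have hqI : q ∈ Ioo 0 r₀ := ⟨by linarith, hqr⟩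
  -- integrating `v' = σ - strain` between the two points
  have hsub : uIcc p q ⊆ Ioo 0 r₀ := uIcc_subset_Ioo' hpI hqI
  have ig : IntervalIntegrable (strain R w) volume p q :=
    ((hc.wSpace.admissible.continuousOn_strain R).mono hsub).intervalIntegrable
  have iσc : ContinuousOn (fun r => s r / r) (Ioo 0 r₀) :=
    he.continuousOn_s.div continuousOn_id fun _ hr => hr.1.ne'
  have iσ' : IntervalIntegrable (fun r => s r / r) volume p q :=
    (iσc.mono hsub).intervalIntegrable
  have hFTC : ∫ t in p..q, (s t / t - strain R w t) = v q - v p :=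
    intervalIntegral.integral_eq_sub_of_hasDerivAt (fun t ht => he.hasDerivAt_v t (hsub ht))
      (iσ'.sub ig)
  rw [intervalIntegral.integral_sub iσ' ig] at hFTC
  have hσS : ∫ t in p..q, s t / t ≤ S / h := by
    have e1 := (sq_integral_abs_le hp0 hpq.le hqr (aesm_of_continuousOn iσc) iσ).2
    have e2 : ∫ t in p..q, s t / t ≤ ∫ t in p..q, |s t / t| :=
      intervalIntegral.integral_mono_on hpq.le iσ' iσ'.abs fun t _ => le_abs_self _
    refine e2.trans (abs_le_of_sq_le_sq' (e1.trans ?_) (by positivity)).2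
    rw [div_pow, hS, Real.sq_sqrt (by positivity), div_eq_mul_inv _ (h ^ 2)]
    have : √(r₀ / 8) ≤ √p := Real.sqrt_le_sqrt hp.1.le
    have h8 : 0 < √(r₀ / 8) := Real.sqrt_pos.2 (by linarith)
    calc (∫ r in Ioo 0 r₀, (s r / r) ^ 2 * r) * (2 * √r₀ / √p)
        ≤ A * (h ^ 2)⁻¹ * (2 * √r₀ / √(r₀ / 8)) := by gcongr
      _ = _ := by ring
  obtain ⟨t₀, ht₀, hxt⟩ := exists_mul_le_integral hpq ig
  refine ⟨t₀, ⟨by linarith [hp.1, ht₀.1], by linarith [hq.2, ht₀.2]⟩, ?_⟩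
  have e1 : strain R w t₀ * (q - p) ≤ (S + 2 * V) / h := by
    have := abs_le.1 hvp
    have := abs_le.1 hvq
    have e : (S + 2 * V) / h = S / h + V / h + V / h := by ring
    rw [e]
    linarith
  have e2 : strain R w t₀ * (r₀ / 4) ≤ (S + 2 * V) / h := by
    refine le_trans ?_ e1
    have := strain_nonneg R w t₀
    gcongr
    linarith [hp.2, hq.1]
  unfold strain at e2
  have e3 : L / (2 * h) = 8 / r₀ * ((S + 2 * V) / h) := by rw [hL]; field_simp; ring
  rw [e3]
  calc (t₀ / R - deriv w t₀) ^ 2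
      = 8 / r₀ * (1 / 2 * (t₀ / R - deriv w t₀) ^ 2 * (r₀ / 4)) := by field_simp; ring
    _ ≤ _ := by gcongr

/-- For large `h` the sheet is almost flat: the slope of the deformed sheet tends to zero. -/
lemma exists_flatness_bound (hα : 0 < αs) (hr₀ : 0 < r₀) (R : ℝ) :
    ∃ C > 0, ∀ h ≥ 1, ∀ w v s, IsCritical αs r₀ R h w v s → ∀ r ∈ Ioo 0 r₀,
      (r / R - deriv w r) ^ 2 ≤ C / h + C * (h ^ 4)⁻¹ / √r := by
  obtain ⟨L, hL0, HL⟩ := exists_flat_point hα hr₀ R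
  set A := αs * ∫ r in Ioo 0 r₀, (1 / R / 2 * r ^ 2) ^ 2 * r with hA
  have hA0 : 0 ≤ A := mul_nonneg hα.le (weighted_nonneg _)
  set T := 4 * √r₀ * A * (1 + √r₀ / √(r₀ / 8)) with hT
  have hT0 : 0 ≤ T := by positivity
  refine ⟨L + T + 1, by positivity, fun h h1 w v s hc r hr => ?_⟩
  have hh : 0 < h := by linarith
  obtain ⟨t₀, ht₀, hx0⟩ := HL h h1 w v s hc
  have ht₀I : t₀ ∈ Ioo 0 r₀ := ⟨by linarith [ht₀.1], by linarith [ht₀.2]⟩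
  obtain ⟨hpar, hpar1, hpar2⟩ := wSpace_parabola r₀ (1 / R)
  have hω := hpar.sub hc.wSpace
  have hωd : ∀ t ∈ Ioo 0 r₀, deriv (fun r => 1 / R / 2 * r ^ 2 - w r) t = t / R - deriv w t :=
    fun t ht => by rw [hpar.admissible.deriv_sub hc.wSpace.admissible ht, hpar1]; ring
  have hosc := hω.admissible.locallyAC_deriv.sq_sub_le ht₀I hr hω.integrable_sq_deriv2
  rw [hωd r hr, hωd t₀ ht₀I] at hosc
  have hω2 : ∫ r in Ioo 0 r₀, deriv (deriv fun r => 1 / R / 2 * r ^ 2 - w r) r ^ 2 * r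
      ≤ A * (h ^ 4)⁻¹ := by
    have e1 : ∫ r in Ioo 0 r₀, deriv (deriv fun r => 1 / R / 2 * r ^ 2 - w r) r ^ 2 * r
        = ∫ r in Ioo 0 r₀, (deriv (deriv w) r - 1 / R) ^ 2 * r := by
      refine integral_congr_ae ?_
      filter_upwards [hpar.admissible.ae_deriv2_sub hc.wSpace.admissible] with r hr
      rw [hr, hpar2]; ring
    rw [e1]
    refine (hc.bounds_inv hr₀ hα hh).2.trans_eq ?_
    rw [hA]; ring
  have hr1 := hr.1
  have hsr := Real.sqrt_pos.2 hr1
  have hmin : 1 / √(min t₀ r) ≤ (1 + √r₀ / √(r₀ / 8)) / √r := by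
    have h8 : 0 < √(r₀ / 8) := Real.sqrt_pos.2 (by linarith)
    rcases le_total r t₀ with h2 | h2
    · rw [min_eq_right h2]
      gcongr
      have : 0 ≤ √r₀ / √(r₀ / 8) := by positivity
      linarith
    · rw [min_eq_left h2]
      have h3 : √(r₀ / 8) ≤ √t₀ := Real.sqrt_le_sqrt ht₀.1.le
      calc 1 / √t₀ ≤ 1 / √(r₀ / 8) := by gcongr
        _ = √r / √(r₀ / 8) / √r := by field_simp
        _ ≤ _ := by
          gcongr
          have : √r / √(r₀ / 8) ≤ √r₀ / √(r₀ / 8) := by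
            gcongr; exact hr.2.le
          linarith
  have hosc' : ((r / R - deriv w r) - (t₀ / R - deriv w t₀)) ^ 2 ≤ T * (h ^ 4)⁻¹ / √r / 2 := by
    refine hosc.trans ?_
    rw [← mul_one_div (2 * √r₀)]
    calc _ ≤ A * (h ^ 4)⁻¹ * (2 * √r₀ * ((1 + √r₀ / √(r₀ / 8)) / √r)) := by gcongr
      _ = _ := by rw [hT]; ring
  set x := r / R - deriv w r
  set x₀ := t₀ / R - deriv w t₀
  have hfin : x ^ 2 ≤ L / h + T * (h ^ 4)⁻¹ / √r := by
    have e1 : x ^ 2 ≤ 2 * x₀ ^ 2 + 2 * (x - x₀) ^ 2 := by nlinarith [sq_nonneg (x - 2 * x₀)]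
    have e2 : L / h = 2 * (L / (2 * h)) := by field_simp
    linarith
  refine hfin.trans ?_
  gcongr <;> linarith

/-- For large `h`, the threshold for wrinkling is not reached beyond the distance `1 / h`. -/
lemma exists_unwrinkled (hα : 0 < αs) (hr₀ : 0 < r₀) (R : ℝ) :
    ∃ H ≥ 1, ∀ h ≥ H, ∀ w v s, IsCritical αs r₀ R h w v s → ∀ r ∈ Ioo 0 r₀, 1 / h ≤ r →
      -2 * √αs ≤ v r / r := by
  obtain ⟨C, hC, H⟩ := exists_flatness_bound hα hr₀ R
  have hα' := Real.sqrt_pos.2 hα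
  refine ⟨1 + C / √αs, by have : 0 < C / √αs := by positivity
                          linarith, fun h hh w v s hc r hr hrh => ?_⟩
  have hCα : 0 < C / √αs := by positivity
  have h1 : 1 ≤ h := by linarith
  have hh0 : 0 < h := by linarith
  have he := hc.isEquilibrium
  set a := C / h with ha
  set b := C * (h ^ 4)⁻¹ with hb
  have hd : ∀ r ∈ Ioo 0 r₀, HasDerivAt (fun r => v r + (a / 2 * r + b * √r))
      ((s r / r - strain R w r) + (a / 2 * 1 + b * (1 / (2 * √r)))) r := fun r hr =>
    (he.hasDerivAt_v r hr).add (((hasDerivAt_id r).const_mul (a / 2)).add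
      ((Real.hasDerivAt_sqrt hr.1.ne').const_mul b))
  have hm := monotoneOn_Ioo_of_hasDerivAt hd fun r hr => by
    have e1 := H h h1 w v s hc r hr
    have e2 : 0 ≤ s r / r := div_nonneg (he.s_nonneg r hr) hr.1.le
    have e3 : b * (1 / (2 * √r)) = b / √r / 2 := by ring
    rw [e3]
    unfold strain
    linarith
  have hlim : Tendsto (fun r => v r + (a / 2 * r + b * √r)) (𝓝[>] 0) (𝓝 0) := by
    have e1 : Tendsto (fun r : ℝ => a / 2 * r + b * √r) (𝓝[>] 0) (𝓝 (a / 2 * 0 + b * √0)) :=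
      (Continuous.tendsto (by fun_prop) 0).mono_left nhdsWithin_le_nhds
    simpa using he.v_zero.add e1
  have hv := MonotoneOn.ge_of_tendsto_zero hm hlim hr
  have hr1 := hr.1
  have hsr := Real.sqrt_pos.2 hr1
  -- `√r ≤ h r` since `1 / h ≤ r` and `1 ≤ h`
  have hs : √r ≤ h * r := by
    have e1 : 1 ≤ h * r := by rw [div_le_iff₀ hh0] at hrh; linarith
    refine Real.sqrt_le_iff.2 ⟨by positivity, ?_⟩
    have e2 : r ≤ h * r := le_mul_of_one_le_left hr1.le h1
    nlinarith
  have hbs : b * √r ≤ C / h * r := by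
    calc b * √r ≤ b * (h * r) := by gcongr
      _ = C * (h ^ 3)⁻¹ * r := by rw [hb]; field_simp
      _ ≤ C / h * r := by
        rw [div_eq_mul_inv]
        gcongr
        exact le_self_pow₀ h1 (by norm_num)
  have hCh : C / h ≤ √αs := by
    rw [div_le_iff₀ hh0, mul_comm, ← div_le_iff₀ hα']
    linarith
  rw [le_div_iff₀ hr1]
  have e5 : C / h * r ≤ √αs * r := by gcongr
  rw [ha] at hv
  have : 0 ≤ √αs * r := by positivity
  linarith

end

/-! ### Stability of the minimizer -/

section

variable {αs r₀ R h e : ℝ} {w v s : ℝ → ℝ}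

/-- A competitor that is above an equilibrium by much on the whole interval `(κ r², r)` would have
large excess: nonnegativity of the stress forces the azimuthal strain of the equilibrium to be above
the threshold on a large part of this interval. -/
lemma exists_start (hr₀ : 0 < r₀) (hα : 0 < αs) {C : ℝ} (hC : 0 < C) : ∃ κ > 0, ∃ M > 0,
    ∀ g v s, IsEquilibrium αs r₀ g v s → (∀ r ∈ Ioo 0 r₀, s r ≤ C * √r ∧ |v r| ≤ C * √r) →
    ∀ v₁, ContinuousOn v₁ (Ioo 0 r₀) → ∀ e > 0,
    IntegrableOn (fun r => excess αs (v₁ r / r) (v r / r) * r) (Ioo 0 r₀) →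
    (∫ r in Ioo 0 r₀, excess αs (v₁ r / r) (v r / r) * r) ≤ e → ∀ r ∈ Ioo 0 r₀,
      ∃ p ∈ Ioo (κ * r ^ 2) r, max (v₁ p - v p) 0 ^ 2 ≤ M * e / r := by
  have hα' := Real.sqrt_pos.2 hα
  -- the first bound on `κ` makes `s (κ r²) ≤ √αs r / 2`, the second one `κ r² ≤ r / 2`
  set κ := min (αs / (4 * C ^ 2)) (1 / (2 * r₀)) with hκ
  have hκ0 : 0 < κ := lt_min (by positivity) (by positivity)
  set C₂ := C * √r₀ + 2 * √αs * r₀ with hC₂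
  have hC₂0 : 0 < C₂ := by positivity
  refine ⟨κ, hκ0, (2 * C₂ + 2) / √αs, by positivity,
    fun g v s he hb v₁ hv₁ e he0 iD bD r hr => ?_⟩
  have hr1 := hr.1
  set p₀ := κ * r ^ 2 with hp₀
  have hp₀0 : 0 < p₀ := by positivity
  have hp₀r : p₀ ≤ r / 2 := by
    have h1 : κ ≤ 1 / (2 * r₀) := min_le_right _ _
    calc κ * r ^ 2 ≤ 1 / (2 * r₀) * r ^ 2 := by gcongr
      _ = r / r₀ * (r / 2) := by field_simp
      _ ≤ 1 * (r / 2) := by gcongr; exact (div_le_one hr₀).2 hr.2.le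
      _ = r / 2 := one_mul _
  have hp₀lt : p₀ < r := by linarith
  have hp₀I : p₀ ∈ Ioo 0 r₀ := ⟨hp₀0, hp₀lt.trans hr.2⟩
  have hsub : uIcc p₀ r ⊆ Ioo 0 r₀ := uIcc_subset_Ioo' hp₀I hr
  set m : ℝ → ℝ := fun t => max (v t / t) (-2 * √αs) with hm
  set n : ℝ → ℝ := fun t => m t + 2 * √αs with hn
  set d₂ : ℝ → ℝ := fun t => max (v₁ t - v t) 0 ^ 2 with hd₂
  set l := (2 * C₂ + 2) / √αs * e / r with hl
  have hnc : ContinuousOn n (Ioo 0 r₀) := he.continuousOn_max.add continuousOn_const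
  have hdc : ContinuousOn d₂ (Ioo 0 r₀) :=
    (ContinuousOn.sup (hv₁.sub he.continuousOn_v) continuousOn_const).pow 2
  have hn0 : ∀ t, 0 ≤ n t := fun t => by
    have : -2 * √αs ≤ m t := le_max_right _ _
    simp only [hn]; linarith
  -- the integral of `n` is bounded below, since `n = s' + 2 √αs` and `0 ≤ s r`
  have imn : IntervalIntegrable m volume p₀ r := (he.continuousOn_max.mono hsub).intervalIntegrable
  have hnint : √αs / 2 * r ≤ ∫ t in p₀..r, n t := by
    have e1 : ∫ t in p₀..r, m t = s r - s p₀ :=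
      intervalIntegral.integral_eq_sub_of_hasDerivAt (fun t ht => he.hasDerivAt_s t (hsub ht)) imn
    have e2 : ∫ t in p₀..r, n t = s r - s p₀ + (r - p₀) * (2 * √αs) := by
      simp only [hn]
      rw [intervalIntegral.integral_add imn (by simp), e1]
      simp
      ring
    have e3 : s p₀ ≤ √αs / 2 * r := by
      refine (hb p₀ hp₀I).1.trans ?_
      have e4 : √p₀ ≤ √αs / (2 * C) * r := by
        refine Real.sqrt_le_iff.2 ⟨by positivity, ?_⟩
        rw [mul_pow, div_pow, Real.sq_sqrt hα.le, hp₀]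
        gcongr
        exact (min_le_left _ _).trans_eq (by ring)
      calc C * √p₀ ≤ C * (√αs / (2 * C) * r) := by gcongr
        _ = √αs / 2 * r := by field_simp
    have e5 := he.s_nonneg r hr
    rw [e2]
    nlinarith
  -- on the set where `n` is positive, the excess controls the positive part
  have hpt : ∀ t ∈ Ioo 0 r₀, n t * d₂ t ≤ C₂ * (excess αs (v₁ t / t) (v t / t) * t) := by
    intro t ht
    have ht1 := ht.1
    have hD := excess_nonneg hα (v₁ t / t) (v t / t)
    rcases le_total (v t / t) (-2 * √αs) with h1 | h1
    · have : n t = 0 := by simp only [hn, hm]; rw [max_eq_right h1]; ring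
      rw [this, zero_mul]; positivity
    rcases le_total (v₁ t) (v t) with h2 | h2
    · have : d₂ t = 0 := by simp only [hd₂]; rw [max_eq_right (by linarith)]; ring
      rw [this, mul_zero]; positivity
    · have e1 : excess αs (v₁ t / t) (v t / t) = (v₁ t / t - v t / t) ^ 2 :=
        excess_eq_sq hα h1 (by gcongr)
      have e2 : n t = v t / t + 2 * √αs := by simp only [hn, hm]; rw [max_eq_left h1]
      have e3 : d₂ t = (v₁ t - v t) ^ 2 := by simp only [hd₂]; rw [max_eq_left (by linarith)]
      rw [e1, e2, e3]
      have e4 : (v t / t + 2 * √αs) * (v₁ t - v t) ^ 2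
          = (v t + 2 * √αs * t) * ((v₁ t / t - v t / t) ^ 2 * t) := by field_simp
      rw [e4, hC₂]
      gcongr
      · refine (le_abs_self _).trans ((hb t ht).2.trans ?_)
        gcongr
        exact ht.2.le
      · exact ht.2.le
  have ind : IntervalIntegrable (fun t => n t * d₂ t) volume p₀ r :=
    ((hnc.mul hdc).mono hsub).intervalIntegrable
  have inn : IntervalIntegrable n volume p₀ r := (hnc.mono hsub).intervalIntegrable
  have hnd : ∫ t in p₀..r, n t * d₂ t ≤ C₂ * e := by
    obtain ⟨ii, bi⟩ := intervalIntegral_le_setIntegral hp₀0 hp₀lt.le hr.2 (iD.const_mul C₂)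
      fun t ht => mul_nonneg hC₂0.le (mul_nonneg (excess_nonneg hα _ _) ht.1.le)
    refine (intervalIntegral.integral_mono_on hp₀lt.le ind ii fun t ht =>
      hpt t (hsub (by rwa [uIcc_of_le hp₀lt.le]))).trans (bi.trans ?_)
    rw [integral_const_mul]
    gcongr
  obtain ⟨p, hp, hpi⟩ := exists_mul_le_integral hp₀lt (ind.sub (inn.mul_const l))
  refine ⟨p, hp, ?_⟩
  have hneg : ∫ t in p₀..r, (n t * d₂ t - n t * l) < 0 := by
    rw [intervalIntegral.integral_sub ind (inn.mul_const l), intervalIntegral.integral_mul_const]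
    have hl0 : 0 ≤ l := by positivity
    have e1 : √αs / 2 * r * l ≤ (∫ t in p₀..r, n t) * l := by gcongr
    have e2 : √αs / 2 * r * l = (C₂ + 1) * e := by rw [hl]; field_simp
    nlinarith
  have h3 : n p * (d₂ p - l) < 0 := by
    have h4 : (n p * d₂ p - n p * l) * (r - p₀) < 0 := hpi.trans_lt hneg
    have h5 : 0 < r - p₀ := by linarith
    nlinarith
  by_contra! h6
  have h7 : 0 ≤ n p * (d₂ p - l) := mul_nonneg (hn0 p) (by simp only [hd₂]; linarith)
  linarith

/-- Integration of a one-sided differential inequality from `p` to `r`. -/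
lemma max_zero_le_add_integral {d f k : ℝ → ℝ} (hd : LocallyAC r₀ d)
    (hk : ContinuousOn k (Ioo 0 r₀))
    (hder : ∀ᵐ r ∂(volume.restrict (Ioo 0 r₀)), deriv d r ≤ f r + k r) {p r : ℝ}
    (hp : p ∈ Ioo 0 r₀) (hr : r ∈ Ioo 0 r₀) (hpr : p ≤ r) (hf : IntervalIntegrable f volume p r) :
    max (d r) 0 ≤ max (d p) 0 + (∫ t in p..r, |f t|) + ∫ t in p..r, |k t| := by
  have hsub := uIcc_subset_Ioo' hp hr
  have ik : IntervalIntegrable k volume p r := (hk.mono hsub).intervalIntegrable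
  have h1 : d r - d p ≤ (∫ t in p..r, |f t|) + ∫ t in p..r, |k t| := by
    rw [← hd.integral_deriv hp hr, ← intervalIntegral.integral_add hf.abs ik.abs]
    refine intervalIntegral.integral_mono_ae_restrict hpr (hd.intervalIntegrable_deriv hp hr)
      (hf.abs.add ik.abs) ?_
    filter_upwards [ae_restrict_of_ae_restrict_of_subset (by rwa [uIcc_of_le hpr] at hsub) hder]
      with t ht
    exact ht.trans (add_le_add (le_abs_self _) (le_abs_self _))
  have h2 : 0 ≤ ∫ t in p..r, |f t| := intervalIntegral.integral_nonneg hpr fun _ _ => abs_nonneg _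
  have h3 : 0 ≤ ∫ t in p..r, |k t| := intervalIntegral.integral_nonneg hpr fun _ _ => abs_nonneg _
  have h4 := le_max_left (d p) 0
  have h5 := le_max_right (d p) 0
  exact max_le (by linarith) (by linarith)

/-- The bounds for the difference of a competitor `(v₁, w + y)` and a minimizer `(v, w)` when the
energies differ by at most `e`. Here `ρ` is the difference of the stresses, with the excess strain
of the competitor included. -/
structure EnergyGap (αs r₀ R h e : ℝ) (w v v₁ y ρ : ℝ → ℝ) : Prop where
  locallyAC : LocallyAC r₀ (fun r => v₁ r - v r)
  continuousOn : ContinuousOn v₁ (Ioo 0 r₀)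
  wSpace : WSpace r₀ y
  aesm : AEStronglyMeasurable ρ (volume.restrict (Ioo 0 r₀))
  integrable : IntegrableOn (fun r => ρ r ^ 2 * r) (Ioo 0 r₀)
  residual_le : ∫ r in Ioo 0 r₀, ρ r ^ 2 * r ≤ e
  deriv_le : ∀ᵐ r ∂(volume.restrict (Ioo 0 r₀)),
    deriv (fun r => v₁ r - v r) r ≤ ρ r + deriv y r * (r / R - deriv w r)
  integrable_excess : IntegrableOn (fun r => excess αs (v₁ r / r) (v r / r) * r) (Ioo 0 r₀)
  excess_le : ∫ r in Ioo 0 r₀, excess αs (v₁ r / r) (v r / r) * r ≤ e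
  sq_le : αs * (h ^ 2)⁻¹ * (∫ r in Ioo 0 r₀, y r ^ 2 * r) ≤ e
  sq_deriv2_le : h ^ 2 * (∫ r in Ioo 0 r₀, deriv (deriv y) r ^ 2 * r) ≤ e

namespace EnergyGap

variable {v₁ y ρ : ℝ → ℝ}

lemma mono {e' : ℝ} (hG : EnergyGap αs r₀ R h e w v v₁ y ρ) (he : e ≤ e') :
    EnergyGap αs r₀ R h e' w v v₁ y ρ :=
  { hG with
    residual_le := hG.residual_le.trans he
    excess_le := hG.excess_le.trans he
    sq_le := hG.sq_le.trans he
    sq_deriv2_le := hG.sq_deriv2_le.trans he }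

lemma sq_le' (hα : 0 < αs) (hh : 0 < h) (hG : EnergyGap αs r₀ R h e w v v₁ y ρ) :
    ∫ r in Ioo 0 r₀, y r ^ 2 * r ≤ h ^ 2 / αs * e := by
  calc ∫ r in Ioo 0 r₀, y r ^ 2 * r
      = h ^ 2 / αs * (αs * (h ^ 2)⁻¹ * ∫ r in Ioo 0 r₀, y r ^ 2 * r) := by field_simp
    _ ≤ _ := by gcongr; exact hG.sq_le

lemma sq_deriv2_le' (hh : 0 < h) (hG : EnergyGap αs r₀ R h e w v v₁ y ρ) :
    ∫ r in Ioo 0 r₀, deriv (deriv y) r ^ 2 * r ≤ 1 / h ^ 2 * e := by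
  calc ∫ r in Ioo 0 r₀, deriv (deriv y) r ^ 2 * r
      = 1 / h ^ 2 * (h ^ 2 * ∫ r in Ioo 0 r₀, deriv (deriv y) r ^ 2 * r) := by field_simp
    _ ≤ _ := by gcongr; exact hG.sq_deriv2_le

/-- For bounded `h`, interpolation controls the slope of the perturbation. -/
lemma exists_slope_le (hα : 0 < αs) (hr₀ : 0 < r₀) {H : ℝ} (hH : 1 ≤ H) :
    ∃ C > 0, ∀ h > 0, h ≤ H → ∀ R e w v v₁ y ρ, 0 ≤ e → EnergyGap αs r₀ R h e w v v₁ y ρ →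
      IntegrableOn (fun r => deriv y r ^ 2 * r) (Ioo 0 r₀) ∧
      ∫ r in Ioo 0 r₀, deriv y r ^ 2 * r ≤ C * e := by
  have hH0 : 0 < H := by linarith
  set l₀ := r₀ / 4 / H with hl₀
  have hl₀0 : 0 < l₀ := by positivity
  refine ⟨1728 / l₀ ^ 2 / αs + 16 * l₀ ^ 2, by positivity,
    fun h hh hhH R e w v v₁ y ρ he hG => ?_⟩
  have hl : h * l₀ ≤ r₀ / 4 := by
    rw [hl₀, mul_div_assoc', div_le_iff₀ hH0]
    have : 0 < r₀ / 4 := by positivity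
    nlinarith
  obtain ⟨i1, b1⟩ := hG.wSpace.admissible.interpolation hG.wSpace.integrable_sq
    hG.wSpace.integrable_sq_deriv2 (l := h * l₀) (by positivity) hl
  refine ⟨i1, b1.trans ?_⟩
  have := hG.sq_le' hα hh
  have := hG.sq_deriv2_le' hh
  calc _ ≤ 1728 / (h * l₀) ^ 2 * (h ^ 2 / αs * e) + 16 * (h * l₀) ^ 2 * (1 / h ^ 2 * e) := by
        gcongr
    _ = _ := by field_simp

/-- For large `h` only a weaker pointwise control of the slope of the perturbation holds. -/
lemma exists_slope_sq_le (hα : 0 < αs) (hr₀ : 0 < r₀) :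
    ∃ C > 0, ∀ h ≥ 1, ∀ R e w v v₁ y ρ, 0 ≤ e → EnergyGap αs r₀ R h e w v v₁ y ρ →
      ∀ r ∈ Ioo 0 r₀, deriv y r ^ 2 ≤ C * h ^ 2 * e / √r := by
  obtain ⟨C, hC, H⟩ := WSpace.exists_slope_bound hr₀
  refine ⟨C * (1 / αs + 1), by positivity, fun h h1 R e w v v₁ y ρ he hG r hr => ?_⟩
  have hh : 0 < h := by linarith
  have b1 := hG.sq_le' hα hh
  have b2 := hG.sq_deriv2_le' hh
  refine (H y hG.wSpace r hr).trans ?_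
  have h2 : 1 / h ^ 2 ≤ h ^ 2 := by
    have := one_le_pow₀ h1 (n := 2)
    rw [div_le_iff₀ (by positivity)]
    nlinarith
  gcongr ?_ / _
  rw [mul_assoc, mul_assoc]
  gcongr
  calc _ ≤ h ^ 2 / αs * e + h ^ 2 * e := by
        refine add_le_add b1 (b2.trans ?_)
        gcongr
    _ = _ := by ring

end EnergyGap

lemma integral_inv_sqrt_le {p r : ℝ} (hp : 0 < p) (hpr : p ≤ r) :
    IntervalIntegrable (fun t => 1 / √t) volume p r ∧ ∫ t in p..r, 1 / √t ≤ 2 * √r := by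
  have hpos : ∀ t ∈ uIcc p r, 0 < t := fun t ht => by
    rw [uIcc_of_le hpr] at ht; exact hp.trans_le ht.1
  have hi : IntervalIntegrable (fun t => 1 / √t) volume p r :=
    ContinuousOn.intervalIntegrable (continuousOn_const.div Real.continuous_sqrt.continuousOn
      fun t ht => (Real.sqrt_pos.2 (hpos t ht)).ne')
  refine ⟨hi, ?_⟩
  have := intervalIntegral.integral_eq_sub_of_hasDerivAt (f := fun t => 2 * √t)
    (f' := fun t => 1 / √t) (fun t ht => ((Real.hasDerivAt_sqrt (hpos t ht).ne').const_mul
      2).congr_deriv (by field_simp)) hi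
  rw [this]
  linarith [Real.sqrt_nonneg p]

/-- The pointwise form of stability. Integrate `(v₁ - v)' ≤ ρ + y' (r / R - w')` from a point `p`
provided by `exists_start`. For bounded `h` the slope `y'` is controlled in mean square. For large
`h` its control is lost by a factor `h`, which a small interval `r ≤ 1 / h` compensates; beyond, the
azimuthal strain of the minimizer is above the threshold and the excess itself is a square. -/
lemma exists_stability_bound (hα : 0 < αs) (hr₀ : 0 < r₀) (hR : 0 < R)
    (hcond : αs < (2 ^ 8)⁻¹ * (r₀ / R) ^ 4) :
    ∃ M > 0, ∀ h > 0, ∀ w v s, IsCritical αs r₀ R h w v s → ∀ v₁ y ρ, ∀ e > 0,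
      EnergyGap αs r₀ R h e w v v₁ y ρ → ∀ r ∈ Ioo 0 r₀,
        max (v₁ r - v r) 0 ^ 2 * r ≤ M * (e + excess αs (v₁ r / r) (v r / r) * r) := by
  obtain ⟨C, hC, HC⟩ := exists_uniform_bounds hα hr₀ hR hcond
  obtain ⟨κ, hκ, M₁, hM₁, HS⟩ := exists_start hr₀ hα hC
  obtain ⟨H, hH1, HH⟩ := exists_unwrinkled hα hr₀ R
  obtain ⟨C₁, hC₁, H₁⟩ := EnergyGap.exists_slope_le hα hr₀ hH1
  obtain ⟨C₂, hC₂, H₂⟩ := EnergyGap.exists_slope_sq_le hα hr₀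
  have hsκ := Real.sqrt_pos.2 hκ
  refine ⟨3 * (M₁ + 2 * √r₀ / √κ + 2 * C * C₁ / √κ + 4 * (C₂ * C)) + r₀ ^ 2, by positivity,
    fun h hh w v s hc v₁ y ρ e he hG r hr => ?_⟩
  have hr1 := hr.1
  have hD : 0 ≤ excess αs (v₁ r / r) (v r / r) * r := mul_nonneg (excess_nonneg hα _ _) hr1.le
  -- either bound the integral of the product of the slopes, or use the excess at `r`
  suffices hmain : (∃ K ≥ 0, K ≤ 2 * C * C₁ / √κ + 4 * (C₂ * C) ∧ ∀ p ∈ Ioo (κ * r ^ 2) r,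
      (∫ t in p..r, |deriv y t * (t / R - deriv w t)|) ^ 2 * r ≤ K * e) ∨
      (-2 * √αs ≤ v r / r) by
    rcases hmain with ⟨K, hK0, hK, hI⟩ | hv
    · obtain ⟨p, hp, hdp⟩ := HS _ v s hc.isEquilibrium (fun r hr =>
        ⟨(HC h hh w v s hc r hr).1, (HC h hh w v s hc r hr).2.1⟩) v₁ hG.continuousOn e he
        hG.integrable_excess hG.excess_le r hr
      have hp0 : 0 < p := lt_trans (by positivity) hp.1
      have hpI : p ∈ Ioo 0 r₀ := ⟨hp0, hp.2.trans hr.2⟩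
      obtain ⟨i1, b1⟩ := sq_integral_abs_le hp0 hp.2.le hr.2 hG.aesm hG.integrable
      have hkc : ContinuousOn (fun t => deriv y t * (t / R - deriv w t)) (Ioo 0 r₀) :=
        hG.wSpace.admissible.continuousOn_deriv.mul
          ((continuousOn_id.div_const R).sub hc.wSpace.admissible.continuousOn_deriv)
      have h1 := max_zero_le_add_integral hG.locallyAC hkc hG.deriv_le hpI hr hp.2.le i1
      have h2 := hI p hp
      set a := max (v₁ p - v p) 0
      set b := ∫ t in p..r, |ρ t|
      set c := ∫ t in p..r, |deriv y t * (t / R - deriv w t)|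
      have h3 : max (v₁ r - v r) 0 ^ 2 ≤ 3 * (a ^ 2 + b ^ 2 + c ^ 2) := by
        have : max (v₁ r - v r) 0 ^ 2 ≤ (a + b + c) ^ 2 :=
          pow_le_pow_left₀ (le_max_right _ _) h1 2
        nlinarith [sq_nonneg (a - b), sq_nonneg (a - c), sq_nonneg (b - c)]
      have ha : a ^ 2 * r ≤ M₁ * e := by rwa [le_div_iff₀ hr1] at hdp
      have hb : b ^ 2 * r ≤ 2 * √r₀ / √κ * e := by
        have hsp : √κ * r ≤ √p := by
          refine Real.le_sqrt_of_sq_le ?_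
          rw [mul_pow, Real.sq_sqrt hκ.le]
          exact hp.1.le
        calc b ^ 2 * r ≤ (∫ r in Ioo 0 r₀, ρ r ^ 2 * r) * (2 * √r₀ / √p) * r := by gcongr
          _ ≤ e * (2 * √r₀ / (√κ * r)) * r := by gcongr; exact hG.residual_le
          _ = _ := by field_simp
      have hfin : max (v₁ r - v r) 0 ^ 2 * r ≤ 3 * (M₁ + 2 * √r₀ / √κ + K) * e := by
        calc _ ≤ 3 * (a ^ 2 + b ^ 2 + c ^ 2) * r := by gcongr
          _ = 3 * (a ^ 2 * r + b ^ 2 * r + c ^ 2 * r) := by ring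
          _ ≤ 3 * (M₁ * e + 2 * √r₀ / √κ * e + K * e) := by gcongr
          _ = _ := by ring
      have hKe := mul_le_mul_of_nonneg_right hK he.le
      have h5 : 0 ≤ r₀ ^ 2 * e := by positivity
      have h6 : 0 ≤ (3 * (M₁ + 2 * √r₀ / √κ + 2 * C * C₁ / √κ + 4 * (C₂ * C)) + r₀ ^ 2)
        * (excess αs (v₁ r / r) (v r / r) * r) := mul_nonneg (by positivity) hD
      rw [mul_add]
      linarith
    · have h4 : max (v₁ r - v r) 0 ^ 2 * r ≤ r₀ ^ 2 * (excess αs (v₁ r / r) (v r / r) * r) := by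
        rcases le_total (v₁ r) (v r) with h2 | h2
        · rw [max_eq_right (by linarith)]
          have : 0 ≤ r₀ ^ 2 * (excess αs (v₁ r / r) (v r / r) * r) := by positivity
          linarith
        · rw [max_eq_left (by linarith), excess_eq_sq hα hv (by gcongr)]
          have : (v₁ r - v r) ^ 2 * r = r ^ 2 * ((v₁ r / r - v r / r) ^ 2 * r) := by field_simp
          rw [this]
          gcongr
          exact hr.2.le
      have h5 : 0 ≤ 3 * (M₁ + 2 * √r₀ / √κ + 2 * C * C₁ / √κ + 4 * (C₂ * C))
        * (e + excess αs (v₁ r / r) (v r / r) * r) := by positivity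
      have h6 : 0 ≤ r₀ ^ 2 * e := by positivity
      linarith
  rcases le_total h H with hhH | hhH
  · left
    refine ⟨2 * C * C₁ / √κ, by positivity, le_add_of_nonneg_right (by positivity),
      fun p hp => ?_⟩
    have hp0 : 0 < p := lt_trans (by positivity) hp.1
    obtain ⟨iz, bz⟩ := H₁ h hh hhH R e w v v₁ y ρ he.le hG
    have hgm : AEStronglyMeasurable (fun r => r / R - deriv w r) (volume.restrict (Ioo 0 r₀)) := by
      have := measurable_deriv w
      exact (by fun_prop : Measurable fun r => r / R - deriv w r).aestronglyMeasurable
    have h1 := (sq_integral_abs_mul_le hp0 hp.2.le hr.2 (aesm_deriv y _) iz hgm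
      fun t ht => (HC h hh w v s hc t ht).2.2).2
    have hsp : √κ * r ≤ √p := by
      refine Real.le_sqrt_of_sq_le ?_
      rw [mul_pow, Real.sq_sqrt hκ.le]
      exact hp.1.le
    calc _ ≤ (∫ r in Ioo 0 r₀, deriv y r ^ 2 * r) * (2 * C / √p) * r := by gcongr
      _ ≤ C₁ * e * (2 * C / (√κ * r)) * r := by gcongr
      _ = _ := by field_simp
  · rcases le_total r (1 / h) with hrh | hrh
    · left
      have hh1 : 1 ≤ h := hH1.trans hhH
      refine ⟨4 * (C₂ * C), by positivity, le_add_of_nonneg_left (by positivity), fun p hp => ?_⟩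
      have hp0 : 0 < p := lt_trans (by positivity) hp.1
      obtain ⟨i1, b1⟩ := integral_inv_sqrt_le hp0 hp.2.le
      have hle : ∫ t in p..r, |deriv y t * (t / R - deriv w t)|
          ≤ √(C₂ * C * e) * h * (2 * √r) := by
        have hsub : uIcc p r ⊆ Ioo 0 r₀ := uIcc_subset_Ioo' ⟨hp0, hp.2.trans hr.2⟩ hr
        have hkc : ContinuousOn (fun t => deriv y t * (t / R - deriv w t)) (Ioo 0 r₀) :=
          hG.wSpace.admissible.continuousOn_deriv.mul
            ((continuousOn_id.div_const R).sub hc.wSpace.admissible.continuousOn_deriv)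
        calc _ ≤ ∫ t in p..r, √(C₂ * C * e) * h * (1 / √t) := by
              refine intervalIntegral.integral_mono_on hp.2.le
                (hkc.mono hsub).intervalIntegrable.abs (i1.const_mul _) fun t ht => ?_
              have ht' := hsub (by rwa [uIcc_of_le hp.2.le])
              have hst := Real.sqrt_pos.2 ht'.1
              have e1 := H₂ h hh1 R e w v v₁ y ρ he.le hG t ht'
              have e2 := (HC h hh w v s hc t ht').2.2
              refine abs_le_of_sq_le_sq ?_ (by positivity)
              rw [mul_pow]
              calc _ ≤ C₂ * h ^ 2 * e / √t * (C / √t) := by gcongr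
                _ = C₂ * C * e * h ^ 2 * (1 / √t) ^ 2 := by field_simp
                _ = _ := by
                  rw [mul_pow, mul_pow, Real.sq_sqrt (by positivity)]
          _ ≤ _ := by
            rw [intervalIntegral.integral_const_mul]
            gcongr
      have hnn : 0 ≤ ∫ t in p..r, |deriv y t * (t / R - deriv w t)| :=
        intervalIntegral.integral_nonneg hp.2.le fun _ _ => abs_nonneg _
      have hhr : h * r ≤ 1 := by rwa [le_div_iff₀ hh, mul_comm] at hrh
      calc _ ≤ (√(C₂ * C * e) * h * (2 * √r)) ^ 2 * r := by gcongr
        _ = 4 * (C₂ * C) * e * (h * r) ^ 2 := by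
          rw [mul_pow, mul_pow, mul_pow, Real.sq_sqrt (by positivity), Real.sq_sqrt hr1.le]
          ring
        _ ≤ 4 * (C₂ * C) * e * 1 := by
          gcongr
          exact pow_le_one₀ (by positivity) hhr
        _ = _ := mul_one _
    · exact Or.inr (HH h hhH w v s hc r hr hrh)

end

/-! ### Energy gap and stability -/

section

variable {αs r₀ R h : ℝ} {w v s : ℝ → ℝ}

namespace IsCritical

/-- The second variation identity at a minimizer, for a competitor with excess strain `B`. -/
lemma energyGap (hr₀ : 0 < r₀) (hα : 0 < αs) (hh : 0 < h) (hc : IsCritical αs r₀ R h w v s)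
    {B v₁ w₁ : ℝ → ℝ} (hB : IntegrableOn B (Ioo 0 r₀))
    (hB0 : ∀ᵐ r ∂(volume.restrict (Ioo 0 r₀)), 0 ≤ B r) (hv₁ : AdmissibleV r₀ v₁)
    (hw₁ : AdmissibleW r₀ w₁) (hfin : IntegrableOn (density αs R h B v₁ w₁) (Ioo 0 r₀)) {e : ℝ}
    (he : e = (∫ r in Ioo 0 r₀, density αs R h B v₁ w₁ r)
      - ∫ r in Ioo 0 r₀, density αs R h (fun _ => 0) v w r) :
    0 ≤ e ∧ IntegrableOn (fun r => s r * B r) (Ioo 0 r₀) ∧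
    2 * (∫ r in Ioo 0 r₀, s r * B r) ≤ e ∧
    EnergyGap αs r₀ R h e w v v₁ (fun r => w₁ r - w r)
      (fun r => deriv v₁ r + (1 / 2) * (r / R - deriv w₁ r) ^ 2 + B r - s r / r) := by
  have hE := hc.isEquilibrium
  have hV := hc.admissibleV
  have hw₁' := (integrableOn_terms hα hh hv₁.locallyAC hw₁ hB.aestronglyMeasurable hfin).2.1
  have hy := hw₁'.sub hc.wSpace
  obtain ⟨iB, iz, iρ, iD, hid⟩ := hE.energy_identity hr₀ hα hh hc.wSpace hv₁ hw₁ hB hfin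
  rw [hc.firstVar_eq_zero _ hy] at hid
  have h1 : 0 ≤ ∫ r in Ioo 0 r₀, s r * B r := by
    refine setIntegral_nonneg_of_ae_restrict ?_
    filter_upwards [hB0, ae_restrict_mem measurableSet_Ioo] with r h1 h2
    exact mul_nonneg (hE.s_nonneg r h2) h1
  have h2 : 0 ≤ ∫ r in Ioo 0 r₀, s r * deriv (fun r => w₁ r - w r) r ^ 2 :=
    setIntegral_nonneg measurableSet_Ioo fun r hr => mul_nonneg (hE.s_nonneg r hr) (sq_nonneg _)
  have h3 : 0 ≤ ∫ r in Ioo 0 r₀,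
      (deriv v₁ r + (1 / 2) * (r / R - deriv w₁ r) ^ 2 + B r - s r / r) ^ 2 * r :=
    weighted_nonneg fun r => deriv v₁ r + (1 / 2) * (r / R - deriv w₁ r) ^ 2 + B r - s r / r
  have h4 : 0 ≤ ∫ r in Ioo 0 r₀, excess αs (v₁ r / r) (v r / r) * r :=
    setIntegral_nonneg measurableSet_Ioo fun r hr => mul_nonneg (excess_nonneg hα _ _) hr.1.le
  have hX : 0 ≤ ∫ r in Ioo 0 r₀, (w₁ r - w r) ^ 2 * r := weighted_nonneg fun r => w₁ r - w r
  have hY : 0 ≤ ∫ r in Ioo 0 r₀, deriv (deriv fun r => w₁ r - w r) r ^ 2 * r := weighted_nonneg _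
  have h5 : 0 ≤ αs * (h ^ 2)⁻¹ * ∫ r in Ioo 0 r₀, (w₁ r - w r) ^ 2 * r := by positivity
  have h6 : 0 ≤ h ^ 2 * ∫ r in Ioo 0 r₀, deriv (deriv fun r => w₁ r - w r) r ^ 2 * r := by
    positivity
  refine ⟨by linarith, iB, by linarith, ⟨hv₁.locallyAC.sub hV.locallyAC, hv₁.locallyAC.continuousOn,
    hy, ?_, iρ, by linarith, ?_, iD, by linarith, by linarith, by linarith⟩⟩
  · exact (aesm_strain R v₁ w₁ hB.aestronglyMeasurable).sub
      (aesm_of_continuousOn (hE.continuousOn_s.div continuousOn_id fun _ hr => hr.1.ne'))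
  · filter_upwards [hv₁.locallyAC.ae_differentiableAt, hB0, ae_restrict_mem measurableSet_Ioo]
      with r d₁ b0 hr
    have e1 : deriv (fun r => v₁ r - v r) r = deriv v₁ r - (s r / r - strain R w r) :=
      (d₁.hasDerivAt.sub (hE.hasDerivAt_v r hr)).deriv
    rw [e1, hw₁.deriv_sub hc.wSpace.admissible hr, strain]
    nlinarith [sq_nonneg (deriv w₁ r - deriv w r)]

end IsCritical

/-- Stability in integrated form: the excess strain enters the second variation identity with the
factor `2 s`, and the positive part of the displacement is bounded pointwise. -/
lemma exists_stability (hα : 0 < αs) (hr₀ : 0 < r₀) (hR : 0 < R)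
    (hcond : αs < (2 ^ 8)⁻¹ * (r₀ / R) ^ 4) :
    ∃ C > 0, ∀ h > 0, ∀ w v s, IsCritical αs r₀ R h w v s → ∀ B v₁ w₁ : ℝ → ℝ,
      IntegrableOn B (Ioo 0 r₀) → (∀ᵐ r ∂(volume.restrict (Ioo 0 r₀)), 0 ≤ B r) →
      AdmissibleV r₀ v₁ → AdmissibleW r₀ w₁ →
      IntegrableOn (density αs R h B v₁ w₁) (Ioo 0 r₀) → ∀ e : ℝ,
      e = (∫ r in Ioo 0 r₀, density αs R h B v₁ w₁ r)
        - (∫ r in Ioo 0 r₀, density αs R h (fun _ => 0) v w r) →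
      IntegrableOn (fun r => (2 * stress R v w r * B r + max (v₁ r - v r) 0 ^ 2) * r)
        (Ioo 0 r₀) ∧
      ∫ r in Ioo 0 r₀, (2 * stress R v w r * B r + max (v₁ r - v r) 0 ^ 2) * r ≤ C * e := by
  obtain ⟨M, hM, HM⟩ := exists_stability_bound hα hr₀ hR hcond
  refine ⟨1 + M * r₀ + M, by positivity, fun h hh w v s hc B v₁ w₁ hB hB0 hv₁ hw₁ hfin e he => ?_⟩
  obtain ⟨he0, iB, bB, hG⟩ := hc.energyGap hr₀ hα hh hB hB0 hv₁ hw₁ hfin he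
  have hE := hc.isEquilibrium
  -- the pointwise bound needs a positive energy gap; pass to the limit
  have hpt : ∀ r ∈ Ioo 0 r₀, max (v₁ r - v r) 0 ^ 2 * r
      ≤ M * e + M * (excess αs (v₁ r / r) (v r / r) * r) := by
    intro r hr
    refine le_of_forall_pos_le_add fun ε hε => ?_
    have h1 := HM h hh w v s hc v₁ _ _ (e + ε / M) (by positivity)
      (hG.mono (by have : 0 < ε / M := by positivity
                   linarith)) r hr
    have h2 : M * (e + ε / M + excess αs (v₁ r / r) (v r / r) * r)
        = M * e + M * (excess αs (v₁ r / r) (v r / r) * r) + ε := by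
      field_simp; ring
    linarith
  have ib : IntegrableOn (fun r => M * e + M * (excess αs (v₁ r / r) (v r / r) * r)) (Ioo 0 r₀) :=
    (integrable_const (M * e)).add (hG.integrable_excess.const_mul M)
  have id2 : IntegrableOn (fun r => max (v₁ r - v r) 0 ^ 2 * r) (Ioo 0 r₀) := by
    refine integrableOn_of_abs_le measurableSet_Ioo ?_ ib fun r hr => ?_
    · exact aesm_of_continuousOn (((ContinuousOn.sup (hG.continuousOn.sub hE.continuousOn_v)
        continuousOn_const).pow 2).mul continuousOn_id)
    · rw [abs_of_nonneg (mul_nonneg (sq_nonneg _) hr.1.le)]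
      exact hpt r hr
  have hd2 : ∫ r in Ioo 0 r₀, max (v₁ r - v r) 0 ^ 2 * r ≤ (M * r₀ + M) * e := by
    refine (setIntegral_mono_on id2 ib measurableSet_Ioo hpt).trans ?_
    rw [integral_add (integrable_const (M * e)) (hG.integrable_excess.const_mul M),
      setIntegral_const, integral_const_mul]
    simp only [Measure.real, Real.volume_Ioo, sub_zero, ENNReal.toReal_ofReal hr₀.le, smul_eq_mul]
    have := mul_le_mul_of_nonneg_left hG.excess_le hM.le
    linarith
  have heq : ∀ r ∈ Ioo 0 r₀, 2 * (s r * B r) + max (v₁ r - v r) 0 ^ 2 * r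
      = (2 * stress R v w r * B r + max (v₁ r - v r) 0 ^ 2) * r := fun r hr => by
    rw [hE.stress_eq hr]
    have := hr.1.ne'
    field_simp
  have isum : IntegrableOn (fun r => 2 * (s r * B r) + max (v₁ r - v r) 0 ^ 2 * r) (Ioo 0 r₀) :=
    (iB.const_mul 2).add id2
  refine ⟨isum.congr_fun heq measurableSet_Ioo, ?_⟩
  rw [← setIntegral_congr_fun measurableSet_Ioo heq, integral_add (iB.const_mul 2) id2,
    integral_const_mul]
  linarith

lemma lintegral_le_of_integral_le {f : ℝ → ℝ} {c : ℝ} (hf : IntegrableOn f (Ioo 0 r₀))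
    (h0 : ∀ r ∈ Ioo 0 r₀, 0 ≤ f r) (h : ∫ r in Ioo 0 r₀, f r ≤ c) :
    ∫⁻ r in Ioo 0 r₀, ENNReal.ofReal (f r) ≤ ENNReal.ofReal c := by
  rw [← ofReal_integral_eq_lintegral_ofReal hf
    ((ae_restrict_iff' measurableSet_Ioo).2 (Eventually.of_forall h0))]
  exact ENNReal.ofReal_le_ofReal h

end

end WrinkledSheet

theorem proposition2 (αs r₀ R : ℝ) (hαs : 0 < αs) (hr₀ : 0 < r₀) (hR : 0 < R)
    (hcond : αs < (2 ^ 8)⁻¹ * (r₀ / R) ^ 4) :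
    -- the explicit function is the unique minimizer of the effective functional, of finite energy
    WrinkledSheet.IsMinimizerF₀ αs r₀ R (WrinkledSheet.v₀ αs r₀ R) ∧
    (∀ v, WrinkledSheet.IsMinimizerF₀ αs r₀ R v →
      EqOn v (WrinkledSheet.v₀ αs r₀ R) (Ioo 0 r₀)) ∧
    WrinkledSheet.F₀ αs r₀ R (WrinkledSheet.v₀ αs r₀ R) ≠ ∞ ∧
    ∃ C > 0, ∃ hbar > 0, ∀ h : ℝ, 0 < h →
      ∃ vh wh : ℝ → ℝ,
        -- existence and uniqueness of the minimizer
        WrinkledSheet.IsMinimizerF αs r₀ R h vh wh ∧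
        (∀ v w, WrinkledSheet.IsMinimizerF αs r₀ R h v w →
          EqOn v vh (Ioo 0 r₀) ∧ EqOn w wh (Ioo 0 r₀)) ∧
        -- comparison of the minimum values
        WrinkledSheet.F αs r₀ R h vh wh ≠ ∞ ∧
        |(WrinkledSheet.F₀ αs r₀ R (WrinkledSheet.v₀ αs r₀ R)).toReal
          - (WrinkledSheet.F αs r₀ R h vh wh).toReal| ≤ C * h ^ 2 ∧
        -- bounds on the minimizer
        (∫⁻ r in Ioo 0 r₀, ENNReal.ofReal (wh r ^ 2 * r)) ≤ ENNReal.ofReal (C * h ^ 4) ∧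
        (∫⁻ r in Ioo 0 r₀, ENNReal.ofReal (deriv wh r ^ 2 * r)) ≤ ENNReal.ofReal (C * h ^ 2) ∧
        (∫⁻ r in Ioo 0 r₀, ENNReal.ofReal (|vh r - WrinkledSheet.v₀ αs r₀ R r| ^ 2 * r))
          ≤ ENNReal.ofReal (C * h ^ 2) ∧
        -- explicit formula for the stress near the outer boundary
        (h < hbar → ∀ r ∈ Ioo ((2 * WrinkledSheet.rw αs r₀ R + r₀) / 3) r₀,
          WrinkledSheet.stress R vh wh r = 2 * √αs * (r₀ / r - 1)) ∧
        -- stability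
        (∀ B v w : ℝ → ℝ, IntegrableOn B (Ioo 0 r₀) →
          (∀ᵐ r ∂(volume.restrict (Ioo 0 r₀)), 0 ≤ B r) →
          WrinkledSheet.AdmissibleV r₀ v → WrinkledSheet.AdmissibleW r₀ w →
          ∀ e : ℝ,
            WrinkledSheet.FB αs r₀ R h B v w ≠ ∞ →
            e = (WrinkledSheet.FB αs r₀ R h B v w).toReal
              - (WrinkledSheet.F αs r₀ R h vh wh).toReal →
            e ≤ 1 →
            IntegrableOn (fun r =>
              (2 * WrinkledSheet.stress R vh wh r * B r + (max (v r - vh r) 0) ^ 2) * r)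
              (Ioo 0 r₀) ∧
            ∫ r in Ioo 0 r₀,
              (2 * WrinkledSheet.stress R vh wh r * B r + (max (v r - vh r) 0) ^ 2) * r
                ≤ C * e) := by
  obtain ⟨m1, m2, m3⟩ := WrinkledSheet.isMinimizerF₀_v₀ hαs hr₀ hR hcond
  obtain ⟨C₁, hC₁, H₁⟩ := WrinkledSheet.exists_comparison hαs hr₀ hR hcond
  obtain ⟨C₂, hC₂, H₂⟩ := WrinkledSheet.exists_slope_estimates hαs hr₀ hR hcond
  obtain ⟨C₃, hC₃, H₃⟩ := WrinkledSheet.exists_integral_displacement_bound hαs hr₀ hR hcond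
  obtain ⟨C₄, hC₄, H₄⟩ := WrinkledSheet.exists_stability hαs hr₀ hR hcond
  obtain ⟨hbar, hbar0, H₅⟩ := WrinkledSheet.exists_stress_formula hαs hr₀ hR hcond
  refine ⟨m1, m2, m3, C₁ + C₂ + C₃ + C₄, by positivity, hbar, hbar0, fun h hh => ?_⟩
  obtain ⟨w, v, s, hc⟩ := WrinkledSheet.exists_isCritical hr₀ hαs hh R
  have hi := hc.integrableOn_density hr₀ hαs
  have hE : WrinkledSheet.F αs r₀ R h v w
      = ENNReal.ofReal (∫ r in Ioo 0 r₀, WrinkledSheet.density αs R h (fun _ => 0) v w r) :=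
    WrinkledSheet.FB_eq_ofReal hαs hi
  have hE' : (WrinkledSheet.F αs r₀ R h v w).toReal
      = ∫ r in Ioo 0 r₀, WrinkledSheet.density αs R h (fun _ => 0) v w r :=
    WrinkledSheet.FB_toReal hαs hi
  have hcrit : ∀ w₁, WrinkledSheet.WSpace r₀ w₁ →
      WrinkledSheet.firstVar αs r₀ R h w s (fun r => w₁ r - w r) = 0 := fun w₁ hw₁ =>
    hc.firstVar_eq_zero _ (hw₁.sub hc.wSpace)
  obtain ⟨a1, a2, -⟩ := H₁ h hh w v s hc
  obtain ⟨b1, b2, -⟩ := H₂ h hh w v s hc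
  obtain ⟨c1, c2⟩ := H₃ h hh w v s hc
  refine ⟨v, w, ⟨hc.admissibleV, hc.wSpace.admissible, fun v' w' hv' hw' =>
    hc.isEquilibrium.F_le hr₀ hαs hh hc.wSpace hv' hw' (hcrit w')⟩, fun v' w' hm => ?_, ?_, ?_, ?_,
    ?_, ?_, fun hlt r hr => ?_, fun B v₁ w₁ hB hB0 hv₁ hw₁ e hfin he _ => ?_⟩
  · exact hc.isEquilibrium.eqOn_of_F_le hr₀ hαs hh hc.wSpace hm.admissibleV hm.admissibleW
      (hcrit w') (hm.le _ _ hc.admissibleV hc.wSpace.admissible)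
  · rw [hE]; exact ENNReal.ofReal_ne_top
  · rw [hE']
    refine a1.trans ?_
    gcongr
    linarith
  · refine WrinkledSheet.lintegral_le_of_integral_le hc.wSpace.integrable_sq
      (fun r hr => mul_nonneg (sq_nonneg _) hr.1.le) (a2.trans ?_)
    gcongr
    linarith
  · refine WrinkledSheet.lintegral_le_of_integral_le b1
      (fun r hr => mul_nonneg (sq_nonneg _) hr.1.le) (b2.trans ?_)
    gcongr
    linarith
  · simp only [sq_abs]
    refine WrinkledSheet.lintegral_le_of_integral_le c1
      (fun r hr => mul_nonneg (sq_nonneg _) hr.1.le) (c2.trans ?_)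
    gcongr
    linarith
  · have hr0 : 0 < r := by
      have := WrinkledSheet.rw_pos hαs hr₀ hR
      linarith [hr.1]
    rw [hc.isEquilibrium.stress_eq ⟨hr0, hr.2⟩, H₅ h hh hlt w v s hc r hr]
    field_simp
  · have hi₁ := WrinkledSheet.integrableOn_density_of_ne_top hαs hv₁.locallyAC hw₁
      hB.aestronglyMeasurable hfin
    rw [hE', WrinkledSheet.FB_toReal hαs hi₁] at he
    obtain ⟨i1, i2⟩ := H₄ h hh w v s hc B v₁ w₁ hB hB0 hv₁ hw₁ hi₁ e he
    have he0 := (hc.energyGap hr₀ hαs hh hB hB0 hv₁ hw₁ hi₁ he).1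
    refine ⟨i1, i2.trans ?_⟩
    gcongr
    linarith
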